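/- A digraph is a finite nonempty vertex set $V$ with a set of arcs $(x,y)$, $x\neq y$. Its underlying graph joins $x$ and $y$ whenever $(x,y)$ or $(y,x)$ is an arc. For a strongly connected digraph $\Gamma$ let $\partial(x,y)$ be the length of a shortest directed path from $x$ to $y$, let $\tilde\partial(x,y)=(\partial(x,y),\partial(y,x))$, and for each value $\tilde i$ of $\tilde\partial$ let $\Gamma_{\tilde i}=\{(x,y)\in V\times V : \tilde\partial(x,y)=\tilde i\}$. The digraph $\Gamma$ is weakly distance-regular if it is strongly connected and the relations $\Gamma_{\tilde i}$ form a non-symmetric association scheme on $V$, that is, not all $\Gamma_{\tilde i}$ are symmetric, and for all $\tilde i,\tilde j,\tilde l$ the number $p_{\tilde i,\tilde j}^{\tilde l}$ of vertices $z$ with $(x,z)\in\Gamma_{\tilde i}$ and $(z,y)\in\Gamma_{\tilde j}$ is the same for all $(x,y)\in\Gamma_{\tilde l}$. It is commutative if $p_{\tilde i,\tilde j}^{\tilde l}=p_{\tilde j,\tilde i}^{\tilde l}$ for all $\tilde i,\tilde j,\tilde l$. For $e\ge 2$ and $n\ge 2e$, the Johnson graph $J(n,e)$ has the $e$-subsets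 of an $n$-set as vertices, two being adjacent when they meet in $e-1$ elements. For $e\geq 1$, the folded Johnson graph $\bar J(2e,e)$ has as vertices the partitions of a $2e$-set into two $e$-sets, two distinct partitions being adjacent when their common refinement consists of four sets of sizes $1,e-1,1,e-1$. The Cayley digraph $\mathrm{Cay}(\mathbb Z_6,S)$ has vertex set $\mathbb Z_6$ and arcs $(x,y)$ with $y-x\in S$. **Theorem.** Let $\Gamma$ be a commutative weakly distance-regular digraph. Then the underlying graph of $\Gamma$ is isomorphic to a Johnson graph $J(n,e)$ with $e\ge2$ and $n\ge 2e$, or to a folded Johnson graph $\bar J(2e,e)$ of diameter at least $2$, if and only if $\Gamma$ is isomorphic to $\mathrm{Cay}(\mathbb Z_6,\{1,2\})$ or to $\mathrm{Cay}(\mathbb Z_6,\{1,4\})$. In particular, the underlying graph of $\Gamma$ is never isomorphic to a folded Johnson graph of diameter at least $2$. -/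

import Mathlib

/-!
Digraphs are Mathlib's `Digraph V`; as that type allows loops, a digraph in the sense used
here is a `Digraph V` on a finite nonempty type `V` with `Loopless Γ`.
-/

namespace WDRD

variable {V : Type*}

/-- No arc joins a vertex to itself. -/
def Loopless (Γ : Digraph V) : Prop :=
  ∀ x, ¬ Γ.Adj x x

/-- There is a path `(x = w₀, w₁, …, w_r = y)` of length `r` (only `w 0, …, w r` matter). -/
def HasPath (Γ : Digraph V) (r : ℕ) (x y : V) : Prop :=
  ∃ w : ℕ → V, w 0 = x ∧ w r = y ∧ ∀ t < r, Γ.Adj (w t) (w (t + 1))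

/-- Any vertex can be reached from any vertex by a path. -/
def StronglyConnected (Γ : Digraph V) : Prop :=
  ∀ x y, ∃ r, HasPath Γ r x y

/-- The length of a shortest path from `x` to `y`. It is only used for strongly connected
digraphs, where the set of lengths is nonempty. -/
noncomputable def dist (Γ : Digraph V) (x y : V) : ℕ :=
  sInf {r | HasPath Γ r x y}

/-- The two-way distance `(∂(x, y), ∂(y, x))`. -/
noncomputable def twoWayDist (Γ : Digraph V) (x y : V) : ℕ × ℕ :=
  (dist Γ x y, dist Γ y x)

/-- The two-way distance set. -/
def twoWayDistSet (Γ : Digraph V) : Set (ℕ × ℕ) :=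
  {i | ∃ x y, twoWayDist Γ x y = i}

/-- The relation `Γ_i`, for `i` in the two-way distance set. -/
def distRel (Γ : Digraph V) (i : twoWayDistSet Γ) (x y : V) : Prop :=
  twoWayDist Γ x y = i

/-- The number of `z` with `(x, z) ∈ R i` and `(z, y) ∈ R j`. -/
noncomputable def interCount {X I : Type*} (R : I → X → X → Prop) (i j : I) (x y : X) : ℕ :=
  {z | R i x z ∧ R j z y}.ncard

/-- The relations `R i` form an association scheme on `X` (which is finite in all uses). -/
structure IsAssociationScheme {X I : Type*} (R : I → X → X → Prop) : Prop where
  nonempty : ∀ i, ∃ x y, R i x y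
  diagonal : ∃ i₀, ∀ x y, R i₀ x y ↔ x = y
  partition : ∀ x y, ∃! i, R i x y
  transpose : ∀ i, ∃ j, ∀ x y, R j x y ↔ R i y x
  intersection : ∀ i j l, ∃ p : ℕ, ∀ x y, R l x y → interCount R i j x y = p

/-- All relations are symmetric. -/
def IsSymmetricScheme {X I : Type*} (R : I → X → X → Prop) : Prop :=
  ∀ i x y, R i x y → R i y x

/-- `p_{i,j}^l = p_{j,i}^l` for all `i, j, l`. -/
def IsCommutativeScheme {X I : Type*} (R : I → X → X → Prop) : Prop :=
  ∀ i j l x y, R l x y → interCount R i j x y = interCount R j i x y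

/-- Strongly connected, and the two-way distance relations form a non-symmetric association
scheme. -/
structure IsWeaklyDistanceRegular (Γ : Digraph V) : Prop where
  stronglyConnected : StronglyConnected Γ
  scheme : IsAssociationScheme (distRel Γ)
  nonsymmetric : ¬ IsSymmetricScheme (distRel Γ)

/-- The attached scheme is commutative. -/
structure IsCommutativeWeaklyDistanceRegular (Γ : Digraph V) : Prop extends
    IsWeaklyDistanceRegular Γ where
  commutative : IsCommutativeScheme (distRel Γ)

/-- The Johnson graph `J(n, e)`: two `e`-subsets of an `n`-set are adjacent when they meet in
`e - 1` points. -/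
def johnsonGraph (n e : ℕ) : SimpleGraph {s : Finset (Fin n) // s.card = e} where
  Adj x y := (x.1 ∩ y.1).card + 1 = e
  symm := ⟨fun x y h => by rwa [Finset.inter_comm]⟩
  loopless := ⟨fun x h => by
    have hx := x.2
    rw [Finset.inter_self] at h
    omega⟩

/-- The partitions of a `2e`-set into two `e`-sets. -/
abbrev HalfPartition (e : ℕ) : Type :=
  {P : Finset (Finset (Fin (2 * e))) // ∃ x : Finset (Fin (2 * e)), x.card = e ∧ P = {x, xᶜ}}

/-- The folded Johnson graph of `J(2e, e)`: two distinct partitions are adjacent when their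
common refinement `{x ∩ y, x \ y, xᶜ ∩ yᶜ, y \ x}` has blocks of sizes `1, e - 1, 1, e - 1`. -/
def foldedJohnsonGraph (e : ℕ) : SimpleGraph (HalfPartition e) where
  Adj P Q := P ≠ Q ∧ ∃ x ∈ P.1, ∃ y ∈ Q.1,
    (x ∩ y).card = 1 ∧ (x \ y).card + 1 = e ∧ (xᶜ ∩ yᶜ).card = 1 ∧ (y \ x).card + 1 = e
  symm := ⟨by
    rintro P Q ⟨hne, x, hx, y, hy, h1, h2, h3, h4⟩
    exact ⟨hne.symm, y, hy, x, hx, by rwa [Finset.inter_comm], h4,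
      by rwa [Finset.inter_comm], h2⟩⟩
  loopless := ⟨fun _ h => h.1 rfl⟩

/-- The Cayley digraph `Cay(G, S)` of an additive group: `(x, y)` is an arc when
`y - x ∈ S`. -/
def cayleyDigraph {G : Type*} [AddGroup G] (S : Set G) : Digraph G where
  Adj x y := y - x ∈ S

/-- Isomorphism of digraphs. -/
def DigraphIso {W : Type*} (Γ : Digraph V) (Δ : Digraph W) : Prop :=
  Nonempty (Γ.Adj ≃r Δ.Adj)

/-- The underlying graph of `Γ` is, up to isomorphism, a Johnson graph `J(n, e)` with
`e ≥ 2` and `n ≥ 2e`. -/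
def HasJohnsonUnderlyingGraph (Γ : Digraph V) : Prop :=
  ∃ n e : ℕ, 2 ≤ e ∧ 2 * e ≤ n ∧ Nonempty (Γ.toSimpleGraphInclusive ≃g johnsonGraph n e)

/-- The underlying graph of `Γ` is, up to isomorphism, a folded Johnson graph of diameter at
least two. -/
def HasFoldedJohnsonUnderlyingGraph (Γ : Digraph V) : Prop :=
  ∃ e : ℕ, 1 ≤ e ∧ 2 ≤ (foldedJohnsonGraph e).diam ∧
    Nonempty (Γ.toSimpleGraphInclusive ≃g foldedJohnsonGraph e)

end WDRD

/-! The functions of the two-way distance are closed under matrix multiplication and, by hypothesis,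
commute. In particular the adjacency matrix `A` of the underlying graph commutes with the matrices
attached to a non-symmetric edge label `i₀`: the 0-1 support `P` of `i₀` and its reverse, and the
skew sign matrix `S`. These are pulled back to the `e`-subsets of an `n`-set along a map that is a
local isomorphism from `J(n, e)`: a bijection on vertices for a Johnson graph, identification of
complements for a folded one. The exchanges `x - a + b` at a set `x` form an array with rows `a` and
columns `b`.

Three consequences are used. Counting over the common neighbours of an edge shows that row sum plus
column sum is again a function of the label (`Labelling.exists_rowAt_add_colAt`). At two sets at
distance two, commutativity with `A` balances the four common neighbours (`HasQuad`). Finally, when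
all line sums of `φ` vanish and `φ` is `ε`-symmetric, commutativity with `A`, tested on the vectors
`sideSign p q`, says that `u ↦ φ(u ∪ q, u ∪ p)` is an eigenfunction of the exchange graph on `(e -
1)`-subsets of the other `n - 2` points (`Labelling.isEigen`). Taking differences raises its
eigenvalue by one while the valency drops. So a symmetric `φ` vanishes when `e = 2` or `n ≥ 7`, and
for `e ≥ 3` a skew sign-valued `φ` is governed by the membership of a single point in `u`, which
forces `n = 2e`.

For `n > 2e` the line sums vanish after centring, so `P` is constant on edges, and `e ≥ 3` is
impossible. For `e = 2` the eigenvalue equation for `S ^ 2` partitions configurations into blocks of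
four points and a positivity estimate finishes (`PairModel.false_of_five_le`). For `n = 2e ≥ 8`, `P`
depends only on the exchanged pair and is constant, a star or the complement of a star; each is
excluded by vanishing or parity. Folded graphs with `e ≥ 5` look the same up to distance three. The
folded graph of `J(8, 4)` lacks the distance-two identity; there the problem reduces to a tournament
on five points. For `J(6, 3)` the signs produce an impossible orientation of triples on six points.
Only the octahedron `J(4, 2)` remains, where `S` is an orientation invariant under the antipodal map
with balanced degrees, and this leaves the two Cayley digraphs. -/

namespace WDRD

/-! ### The commutative algebra of functions of the two-way distance -/

section Scheme

variable {V : Type*} {Γ : Digraph V}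

theorem twoWayDist_swap (Γ : Digraph V) (v w : V) :
    twoWayDist Γ w v = (twoWayDist Γ v w).swap := rfl

theorem hasPath_zero {x y : V} : HasPath Γ 0 x y ↔ x = y := by
  constructor
  · rintro ⟨w, h0, h1, -⟩
    rw [← h0, ← h1]
  · rintro rfl
    exact ⟨fun _ => x, rfl, rfl, by simp⟩

theorem hasPath_one {x y : V} : HasPath Γ 1 x y ↔ Γ.Adj x y := by
  constructor
  · rintro ⟨w, h0, h1, h⟩
    have := h 0 one_pos
    rwa [h0, zero_add, h1] at this
  · intro h
    refine ⟨fun t => if t = 0 then x else y, by simp, by simp, ?_⟩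
    intro t ht
    have : t = 0 := by omega
    subst this
    simpa using h

theorem HasPath.cons {r : ℕ} {x y z : V} (h : Γ.Adj x y) (hp : HasPath Γ r y z) :
    HasPath Γ (r + 1) x z := by
  obtain ⟨w, h0, h1, hw⟩ := hp
  refine ⟨fun t => if t = 0 then x else w (t - 1), by simp, by simpa using h1, ?_⟩
  intro t ht
  rcases Nat.eq_zero_or_pos t with rfl | hpos
  · simpa [h0] using h
  · have h2 := hw (t - 1) (by omega)
    have h3 : t - 1 + 1 = t := by omega
    rw [h3] at h2
    simpa [hpos.ne'] using h2

theorem hasPath_reverse (hs : ∀ x y, Γ.Adj x y → Γ.Adj y x) {r : ℕ} {x y : V}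
    (h : HasPath Γ r x y) : HasPath Γ r y x := by
  obtain ⟨w, h0, h1, hw⟩ := h
  refine ⟨fun t => w (r - t), by simpa using h1, by simpa using h0, ?_⟩
  intro t ht
  have h2 := hs _ _ (hw (r - t - 1) (by omega))
  have h3 : r - t - 1 + 1 = r - t := by omega
  rw [h3] at h2
  have h4 : r - t - 1 = r - (t + 1) := by omega
  rwa [h4] at h2

theorem dist_hasPath (hc : StronglyConnected Γ) (x y : V) : HasPath Γ (dist Γ x y) x y :=
  Nat.sInf_mem (hc x y)

theorem dist_le {r : ℕ} {x y : V} (h : HasPath Γ r x y) : dist Γ x y ≤ r :=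
  Nat.sInf_le h

theorem dist_eq_zero_iff (hc : StronglyConnected Γ) {x y : V} : dist Γ x y = 0 ↔ x = y := by
  constructor
  · intro h
    have := dist_hasPath hc x y
    rwa [h, hasPath_zero] at this
  · rintro rfl
    exact Nat.le_zero.mp (dist_le (hasPath_zero.mpr rfl))

theorem dist_eq_one_iff (hl : Loopless Γ) (hc : StronglyConnected Γ) {x y : V} :
    dist Γ x y = 1 ↔ Γ.Adj x y := by
  constructor
  · intro h
    have := dist_hasPath hc x y
    rwa [h, hasPath_one] at this
  · intro h
    have h1 : dist Γ x y ≤ 1 := dist_le (hasPath_one.mpr h)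
    have h2 : dist Γ x y ≠ 0 := by
      intro h0
      rw [dist_eq_zero_iff hc] at h0
      subst h0
      exact hl _ h
    omega

theorem dist_eq_two (hl : Loopless Γ) (hc : StronglyConnected Γ) {x y z : V}
    (hxz : Γ.Adj x z) (hzy : Γ.Adj z y) (hne : x ≠ y) (hn : ¬ Γ.Adj x y) : dist Γ x y = 2 := by
  have h1 : dist Γ x y ≤ 2 := dist_le ((hasPath_one.mpr hzy).cons hxz)
  have h2 : dist Γ x y ≠ 0 := fun h => hne ((dist_eq_zero_iff hc).mp h)
  have h3 : dist Γ x y ≠ 1 := fun h => hn ((dist_eq_one_iff hl hc).mp h)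
  omega

/-- The two-way distances of adjacent vertices of the underlying graph. -/
def IsEdgeLabel (i : ℕ × ℕ) : Prop := i.1 = 1 ∨ i.2 = 1

instance (i : ℕ × ℕ) : Decidable (IsEdgeLabel i) := inferInstanceAs (Decidable (_ ∨ _))

theorem isEdgeLabel_swap (i : ℕ × ℕ) : IsEdgeLabel i.swap ↔ IsEdgeLabel i := by
  simp [IsEdgeLabel, or_comm]

theorem isEdgeLabel_iff (hl : Loopless Γ) (hc : StronglyConnected Γ) {x y : V} :
    IsEdgeLabel (twoWayDist Γ x y) ↔ Γ.toSimpleGraphInclusive.Adj x y := by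
  simp only [IsEdgeLabel, twoWayDist, dist_eq_one_iff hl hc, Digraph.toSimpleGraphInclusive,
    SimpleGraph.fromRel_adj]
  constructor
  · intro h
    refine ⟨?_, h⟩
    rintro rfl
    rcases h with h | h <;> exact hl _ h
  · exact fun h => h.2

/-- A non-symmetric weakly distance-regular digraph has an arc that is not reversed. -/
theorem exists_nonsymmetric_arc (h : IsWeaklyDistanceRegular Γ) :
    ∃ x y, Γ.Adj x y ∧ ¬ Γ.Adj y x := by
  by_contra! hs
  refine h.nonsymmetric fun i x y hxy => ?_
  have key : ∀ a b : V, dist Γ a b = dist Γ b a := by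
    intro a b
    unfold dist
    congr 1
    ext r
    exact ⟨hasPath_reverse hs, hasPath_reverse hs⟩
  unfold distRel at *
  rw [← hxy, twoWayDist, twoWayDist, key x y]

variable [Fintype V]

open Classical in
theorem card_filter_eq (h : IsWeaklyDistanceRegular Γ) (i j : ℕ × ℕ) {v w v' w' : V}
    (hh : twoWayDist Γ v w = twoWayDist Γ v' w') :
    (Finset.univ.filter fun z => twoWayDist Γ v z = i ∧ twoWayDist Γ z w = j).card =
      (Finset.univ.filter fun z => twoWayDist Γ v' z = i ∧ twoWayDist Γ z w' = j).card := by
  by_cases hi : i ∈ twoWayDistSet Γ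
  · by_cases hj : j ∈ twoWayDistSet Γ
    · obtain ⟨p, hp⟩ := h.scheme.intersection ⟨i, hi⟩ ⟨j, hj⟩ ⟨twoWayDist Γ v w, v, w, rfl⟩
      have h1 := hp v w rfl
      have h2 := hp v' w' hh.symm
      simp only [interCount, distRel, Set.ncard_eq_toFinset_card', Set.toFinset_ofPred] at h1 h2
      rw [h1, h2]
    · rw [Finset.filter_false_of_mem, Finset.filter_false_of_mem] <;>
        exact fun z _ hz => hj ⟨_, _, hz.2⟩
  · rw [Finset.filter_false_of_mem, Finset.filter_false_of_mem] <;>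
      exact fun z _ hz => hi ⟨_, _, hz.1⟩

open Classical in
theorem card_filter_comm (h : IsCommutativeWeaklyDistanceRegular Γ) (i j : ℕ × ℕ) (v w : V) :
    (Finset.univ.filter fun z => twoWayDist Γ v z = i ∧ twoWayDist Γ z w = j).card =
      (Finset.univ.filter fun z => twoWayDist Γ v z = j ∧ twoWayDist Γ z w = i).card := by
  by_cases hi : i ∈ twoWayDistSet Γ
  · by_cases hj : j ∈ twoWayDistSet Γ
    · have h1 := h.commutative ⟨i, hi⟩ ⟨j, hj⟩ ⟨twoWayDist Γ v w, v, w, rfl⟩ v w rfl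
      simpa only [interCount, distRel, Set.ncard_eq_toFinset_card', Set.toFinset_ofPred] using h1
    · rw [Finset.filter_false_of_mem, Finset.filter_false_of_mem] <;>
        intro z _ hz
      exacts [hj ⟨_, _, hz.1⟩, hj ⟨_, _, hz.2⟩]
  · rw [Finset.filter_false_of_mem, Finset.filter_false_of_mem] <;>
      intro z _ hz
    exacts [hi ⟨_, _, hz.2⟩, hi ⟨_, _, hz.1⟩]

-- Grouping the terms by their two labels turns a weighted convolution into a combination of
-- intersection numbers, so regularity and commutativity pass from relations to arbitrary weights.
open Classical in
theorem sum_eq_sum_card (f g : ℕ × ℕ → ℚ) (v w : V) :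
    ∑ z, f (twoWayDist Γ v z) * g (twoWayDist Γ z w) =
      ∑ i ∈ Finset.univ.image (fun p : V × V => twoWayDist Γ p.1 p.2),
        ∑ j ∈ Finset.univ.image (fun p : V × V => twoWayDist Γ p.1 p.2),
          ((Finset.univ.filter fun z => twoWayDist Γ v z = i ∧ twoWayDist Γ z w = j).card : ℚ) *
            (f i * g j) := by
  rw [← Finset.sum_product',
    ← Finset.sum_fiberwise_of_maps_to (g := fun z => (twoWayDist Γ v z, twoWayDist Γ z w))
      (t := Finset.univ.image (fun p : V × V => twoWayDist Γ p.1 p.2) ×ˢ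
        Finset.univ.image (fun p : V × V => twoWayDist Γ p.1 p.2))]
  · refine Finset.sum_congr rfl ?_
    rintro ⟨i, j⟩ -
    rw [Finset.sum_congr rfl (g := fun _ => f i * g j)]
    · rw [Finset.sum_const, nsmul_eq_mul]
      simp only [Prod.mk.injEq]
    · intro z hz
      simp only [Finset.mem_filter, Finset.mem_univ, true_and, Prod.mk.injEq] at hz
      rw [hz.1, hz.2]
  · intro z _
    simp only [Finset.mem_product, Finset.mem_image, Finset.mem_univ, true_and]
    exact ⟨⟨(v, z), rfl⟩, ⟨(z, w), rfl⟩⟩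

/-- Functions of the two-way distance are closed under convolution. -/
theorem exists_conv (h : IsWeaklyDistanceRegular Γ) (f g : ℕ × ℕ → ℚ) :
    ∃ k : ℕ × ℕ → ℚ, ∀ v w,
      ∑ z, f (twoWayDist Γ v z) * g (twoWayDist Γ z w) = k (twoWayDist Γ v w) := by
  classical
  -- The value at a label is read off at any pair that carries it; the value 0 at labels that do not
  -- occur is a dummy.
  refine ⟨fun i => if hi : ∃ p : V × V, twoWayDist Γ p.1 p.2 = i then
    ∑ z, f (twoWayDist Γ hi.choose.1 z) * g (twoWayDist Γ z hi.choose.2) else 0, fun v w => ?_⟩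
  have hi : ∃ p : V × V, twoWayDist Γ p.1 p.2 = twoWayDist Γ v w := ⟨(v, w), rfl⟩
  beta_reduce
  rw [dif_pos hi, sum_eq_sum_card, sum_eq_sum_card]
  refine Finset.sum_congr rfl fun i _ => Finset.sum_congr rfl fun j _ => ?_
  rw [card_filter_eq h i j hi.choose_spec.symm]

theorem conv_comm (h : IsCommutativeWeaklyDistanceRegular Γ) (f g : ℕ × ℕ → ℚ) (v w : V) :
    ∑ z, f (twoWayDist Γ v z) * g (twoWayDist Γ z w) =
      ∑ z, g (twoWayDist Γ v z) * f (twoWayDist Γ z w) := by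
  classical
  rw [sum_eq_sum_card, sum_eq_sum_card, Finset.sum_comm]
  refine Finset.sum_congr rfl fun i _ => Finset.sum_congr rfl fun j _ => ?_
  rw [card_filter_comm h j i, mul_comm (f j)]

/-- Row sums of functions of the two-way distance are constant. -/
theorem exists_rowSum (h : IsWeaklyDistanceRegular Γ) (f : ℕ × ℕ → ℚ) :
    ∃ k : ℚ, ∀ v, ∑ z, f (twoWayDist Γ v z) = k := by
  obtain ⟨k, hk⟩ := exists_conv h f 1
  -- A row sum is a diagonal entry of the convolution with the constant function 1, and the diagonal
  -- carries the label `(0, 0)`.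
  refine ⟨k (0, 0), fun v => ?_⟩
  have := hk v v
  simp only [Pi.one_apply, mul_one] at this
  rw [this]
  congr 1
  have h0 : dist Γ v v = 0 := (dist_eq_zero_iff h.stronglyConnected).mpr rfl
  simp [twoWayDist, h0]

/-- Over all ordered pairs a skew function cancels against its reverse; the row sums being equal,
each of them is zero. -/
theorem rowSum_eq_zero (h : IsWeaklyDistanceRegular Γ) (f : ℕ × ℕ → ℚ)
    (hf : ∀ i, f i.swap = - f i) (v : V) : ∑ z, f (twoWayDist Γ v z) = 0 := by
  obtain ⟨k, hk⟩ := exists_rowSum h f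
  have h1 : ∑ v, ∑ z, f (twoWayDist Γ v z) = - ∑ v, ∑ z, f (twoWayDist Γ v z) := by
    conv_lhs => rw [Finset.sum_comm]
    rw [← Finset.sum_neg_distrib]
    refine Finset.sum_congr rfl fun a _ => ?_
    rw [← Finset.sum_neg_distrib]
    refine Finset.sum_congr rfl fun b _ => ?_
    rw [twoWayDist_swap, hf]
  simp only [hk, Finset.sum_const, nsmul_eq_mul, Finset.card_univ] at h1
  have : (Fintype.card V : ℚ) ≠ 0 := by
    have : 0 < Fintype.card V := Fintype.card_pos_iff.mpr ⟨v⟩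
    positivity
  rw [hk]
  have h2 : (Fintype.card V : ℚ) * k = 0 := by linarith
  exact (mul_eq_zero.mp h2).resolve_left this

end Scheme

end WDRD

namespace WDRD

/-! ### Eigenfunctions of exchange graphs, dictators and stars -/

section Exchange

variable {α : Type*} [DecidableEq α]

/-- A property of the `k`-subsets of `G` that is stable under exchanging one point holds for
all of them as soon as it holds for one. -/
theorem exchange_induction {G : Finset α} {k : ℕ} {p : Finset α → Prop}
    (hstep : ∀ v r r', v ⊆ G → r ∈ G → r' ∈ G → r ∉ v → r' ∉ v → r ≠ r' → v.card + 1 = k →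
      p (insert r v) → p (insert r' v))
    {u u' : Finset α} (hu : u ⊆ G) (hu' : u' ⊆ G) (hk : u.card = k) (hk' : u'.card = k)
    (h : p u) : p u' := by
  -- Each exchange of a point of `u \ u'` for one of `u' \ u` lowers the number of missing points by
  -- one.
  induction hm : (u' \ u).card generalizing u with
  | zero =>
    have h1 : u' ⊆ u := by
      rw [Finset.card_eq_zero, Finset.sdiff_eq_empty_iff_subset] at hm
      exact hm
    rwa [Finset.eq_of_subset_of_card_le h1 (by omega)]
  | succ m ih =>
    have h1 : (u \ u').card = (u' \ u).card := Finset.card_sdiff_comm (by omega)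
    obtain ⟨r', hr'⟩ : (u' \ u).Nonempty := Finset.card_pos.mp (by omega)
    obtain ⟨r, hr⟩ : (u \ u').Nonempty := Finset.card_pos.mp (by omega)
    rw [Finset.mem_sdiff] at hr hr'
    have hne : r ≠ r' := fun h => hr.2 (h ▸ hr'.1)
    have hc : (u.erase r).card + 1 = k := by rw [Finset.card_erase_add_one hr.1, hk]
    have hr'' : r' ∉ u.erase r := fun h => hr'.2 (Finset.mem_of_mem_erase h)
    refine ih (u := insert r' (u.erase r)) ?_ ?_ ?_ ?_
    · exact Finset.insert_subset (hu' hr'.1) ((Finset.erase_subset _ _).trans hu)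
    · rw [Finset.card_insert_of_notMem hr'', hc]
    · refine hstep (u.erase r) r r' ((Finset.erase_subset _ _).trans hu) (hu hr.1) (hu' hr'.1)
        (Finset.notMem_erase _ _) hr'' hne hc ?_
      rwa [Finset.insert_erase hr.1]
    · have : u' \ insert r' (u.erase r) = (u' \ u).erase r' := by
        ext z
        simp only [Finset.mem_sdiff, Finset.mem_insert, Finset.mem_erase]
        constructor
        · rintro ⟨h1, h2⟩
          refine ⟨fun h => h2 (Or.inl h), h1, fun hz => h2 (Or.inr ⟨?_, hz⟩)⟩
          rintro rfl
          exact hr.2 h1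
        · rintro ⟨h1, h2, h3⟩
          exact ⟨h2, fun h => h.elim h1 fun h => h3 h.2⟩
      rw [this, Finset.card_erase_of_mem (Finset.mem_sdiff.mpr hr'), hm]
      rfl

theorem eq_of_exchange {G : Finset α} {k : ℕ} {f : Finset α → ℚ}
    (hstep : ∀ v r r', v ⊆ G → r ∈ G → r' ∈ G → r ∉ v → r' ∉ v → r ≠ r' → v.card + 1 = k →
      f (insert r v) = f (insert r' v))
    {u u' : Finset α} (hu : u ⊆ G) (hu' : u' ⊆ G) (hk : u.card = k) (hk' : u'.card = k) :
    f u = f u' := by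
  refine exchange_induction (p := fun z => f u = f z) ?_ hu hu' hk hk' rfl
  intro v r r' h1 h2 h3 h4 h5 h6 h7 h
  rw [h, hstep v r r' h1 h2 h3 h4 h5 h6 h7]

/-- The sum of `σ` over the sets obtained from `u` by exchanging a point for a point of `G`. -/
def exchangeSum (G : Finset α) (σ : Finset α → ℚ) (u : Finset α) : ℚ :=
  ∑ a ∈ u, ∑ b ∈ G \ u, σ (insert b (u.erase a))

/-- `σ` is an eigenfunction of the exchange graph on the `k`-subsets of `G`. -/
def IsEigen (G : Finset α) (k : ℕ) (c : ℚ) (σ : Finset α → ℚ) : Prop :=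
  ∀ u, u ⊆ G → u.card = k → exchangeSum G σ u = c * σ u

theorem insert_erase_insert_ne {a r : α} {v : Finset α} (h : a ≠ r) :
    (insert r v).erase a = insert r (v.erase a) :=
  Finset.erase_insert_of_ne h.symm

/-- The neighbours of `v ∪ {r}` are sorted by what happens to `r` and `r'`: neither moves, `r'`
enters and `r` stays, `r` leaves for a third point, or `r` leaves for `r'`. The second and third
groups are common to `v ∪ {r}` and `v ∪ {r'}`, so only the first and the last survive in a
difference; the last accounts for the shift of the eigenvalue. -/
theorem exchangeSum_insert {G : Finset α} {σ : Finset α → ℚ} {v : Finset α} {r r' : α}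
    (hr' : r' ∈ G) (hne : r ≠ r') (hv : v ⊆ (G.erase r).erase r') :
    exchangeSum G σ (insert r v) =
      exchangeSum ((G.erase r).erase r') (fun z => σ (insert r z)) v +
        ∑ a ∈ v, σ (insert r' (insert r (v.erase a))) +
        ∑ b ∈ ((G.erase r).erase r') \ v, σ (insert b v) + σ (insert r' v) := by
  have hrv : r ∉ v := fun h => by simpa using hv h
  have hr'v : r' ∉ v := fun h => by simpa using hv h
  have hG : G \ insert r v = insert r' (((G.erase r).erase r') \ v) := by
    ext z
    simp only [Finset.mem_sdiff, Finset.mem_insert, Finset.mem_erase]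
    constructor
    · rintro ⟨h1, h2⟩
      by_cases hz : z = r'
      · exact Or.inl hz
      · exact Or.inr ⟨⟨hz, fun h => h2 (Or.inl h), h1⟩, fun h => h2 (Or.inr h)⟩
    · rintro (rfl | ⟨⟨h1, h2, h3⟩, h4⟩)
      · exact ⟨hr', fun h => h.elim (fun h => hne h.symm) hr'v⟩
      · exact ⟨h3, fun h => h.elim h2 h4⟩
  have hn : r' ∉ ((G.erase r).erase r') \ v := by simp
  unfold exchangeSum
  rw [Finset.sum_insert hrv, hG, Finset.sum_insert hn, Finset.erase_insert hrv]
  have : ∀ a ∈ v, ∑ b ∈ insert r' (((G.erase r).erase r') \ v),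
      σ (insert b ((insert r v).erase a)) =
      ∑ b ∈ ((G.erase r).erase r') \ v, σ (insert r (insert b (v.erase a))) +
        σ (insert r' (insert r (v.erase a))) := by
    intro a ha
    have har : a ≠ r := fun h => hrv (h ▸ ha)
    rw [Finset.sum_insert hn, insert_erase_insert_ne har, add_comm]
    congr 1
    refine Finset.sum_congr rfl fun b _ => ?_
    rw [Finset.insert_comm]
  rw [Finset.sum_congr rfl this, Finset.sum_add_distrib]
  ring

/-- The difference operator raises the eigenvalue by one. -/
theorem IsEigen.diff {G : Finset α} {k : ℕ} {c : ℚ} {σ : Finset α → ℚ}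
    (h : IsEigen G (k + 1) c σ) {r r' : α} (hr : r ∈ G) (hr' : r' ∈ G) (hne : r ≠ r') :
    IsEigen ((G.erase r).erase r') k (c + 1) (fun v => σ (insert r v) - σ (insert r' v)) := by
  intro v hv hk
  have hrv : r ∉ v := fun h => by simpa using hv h
  have hr'v : r' ∉ v := fun h => by simpa using hv h
  have hvG : v ⊆ G := hv.trans ((Finset.erase_subset _ _).trans (Finset.erase_subset _ _))
  have h1 := h (insert r v) (Finset.insert_subset hr hvG)
    (by rw [Finset.card_insert_of_notMem hrv, hk])
  have h2 := h (insert r' v) (Finset.insert_subset hr' hvG)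
    (by rw [Finset.card_insert_of_notMem hr'v, hk])
  have hcomm : (G.erase r).erase r' = (G.erase r').erase r := Finset.erase_right_comm
  rw [exchangeSum_insert hr' hne hv] at h1
  rw [exchangeSum_insert hr hne.symm (hcomm ▸ hv), ← hcomm] at h2
  have h3 : ∑ a ∈ v, σ (insert r' (insert r (v.erase a))) =
      ∑ a ∈ v, σ (insert r (insert r' (v.erase a))) :=
    Finset.sum_congr rfl fun a _ => by rw [Finset.insert_comm]
  have h4 : exchangeSum ((G.erase r).erase r') (fun v => σ (insert r v) - σ (insert r' v)) v =
      exchangeSum ((G.erase r).erase r') (fun v => σ (insert r v)) v -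
      exchangeSum ((G.erase r).erase r') (fun v => σ (insert r' v)) v := by
    simp only [exchangeSum, Finset.sum_sub_distrib]
  rw [h4]
  linarith

theorem exchangeSum_const {G : Finset α} {k : ℕ} {σ : Finset α → ℚ} {u : Finset α} {c : ℚ}
    (hu : u ⊆ G) (hk : u.card = k) (hσ : ∀ z, z ⊆ G → z.card = k → σ z = c) :
    exchangeSum G σ u = k * ((G.card : ℚ) - k) * c := by
  unfold exchangeSum
  rw [Finset.sum_congr rfl fun a ha => Finset.sum_congr rfl fun b hb => hσ _ ?_ ?_]
  · simp only [Finset.sum_const, nsmul_eq_mul, hk, Finset.card_sdiff_of_subset hu]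
    rw [Nat.cast_sub (by rw [← hk]; exact Finset.card_le_card hu)]
    ring
  · exact Finset.insert_subset (Finset.mem_sdiff.mp hb).1 ((Finset.erase_subset _ _).trans hu)
  · rw [Finset.card_insert_of_notMem, Finset.card_erase_add_one ha, hk]
    exact fun h => (Finset.mem_sdiff.mp hb).2 (Finset.mem_of_mem_erase h)

theorem exchange_mem {G : Finset α} {k : ℕ} {u : Finset α} (hu : u ⊆ G) (hk : u.card = k)
    {a b : α} (ha : a ∈ u) (hb : b ∈ G \ u) :
    insert b (u.erase a) ⊆ G ∧ (insert b (u.erase a)).card = k := by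
  refine ⟨Finset.insert_subset (Finset.mem_sdiff.mp hb).1 ((Finset.erase_subset _ _).trans hu),
    ?_⟩
  rw [Finset.card_insert_of_notMem, Finset.card_erase_add_one ha, hk]
  exact fun h => (Finset.mem_sdiff.mp hb).2 (Finset.mem_of_mem_erase h)

/-- An eigenvalue above the valency only has the zero eigenfunction. -/
theorem IsEigen.eq_zero {G : Finset α} {k : ℕ} {c : ℚ} {σ : Finset α → ℚ}
    (h : IsEigen G k c σ) (hc : k * ((G.card : ℚ) - k) < c) {u : Finset α} (hu : u ⊆ G)
    (hk : u.card = k) : σ u = 0 := by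
  -- At a set where `|σ|` is largest the eigenvalue equation bounds `c * |σ m|` by the valency times
  -- `|σ m|`.
  obtain ⟨m, hm, hmax⟩ := Finset.exists_max_image (G.powersetCard k) (fun z => |σ z|)
    ⟨u, Finset.mem_powersetCard.mpr ⟨hu, hk⟩⟩
  obtain ⟨hmG, hmk⟩ := Finset.mem_powersetCard.mp hm
  have h1 : |exchangeSum G σ m| ≤ exchangeSum G (fun _ => |σ m|) m := by
    refine (Finset.abs_sum_le_sum_abs _ _).trans (Finset.sum_le_sum fun a ha => ?_)
    refine (Finset.abs_sum_le_sum_abs _ _).trans (Finset.sum_le_sum fun b hb => ?_)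
    exact hmax _ (Finset.mem_powersetCard.mpr (exchange_mem hmG hmk ha hb))
  rw [exchangeSum_const (c := |σ m|) hmG hmk (fun _ _ _ => rfl), h m hmG hmk, abs_mul] at h1
  have h2 : c * |σ m| ≤ |c| * |σ m| :=
    mul_le_mul_of_nonneg_right (le_abs_self c) (abs_nonneg _)
  have h3 : |σ m| ≤ 0 := by
    by_contra! h4
    have := (mul_lt_mul_iff_left₀ h4).mpr hc
    linarith
  have h4 := hmax u (Finset.mem_powersetCard.mpr ⟨hu, hk⟩)
  exact abs_nonpos_iff.mp (h4.trans h3)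

/-- Eigenfunctions for the valency are constant. -/
theorem IsEigen.const {G : Finset α} {k : ℕ} {c : ℚ} {σ : Finset α → ℚ}
    (h : IsEigen G k c σ) (hc : k * ((G.card : ℚ) - k) = c) {u u' : Finset α} (hu : u ⊆ G)
    (hk : u.card = k) (hu' : u' ⊆ G) (hk' : u'.card = k) : σ u = σ u' := by
  obtain ⟨m, hm, hmax⟩ := Finset.exists_max_image (G.powersetCard k) σ
    ⟨u, Finset.mem_powersetCard.mpr ⟨hu, hk⟩⟩
  obtain ⟨hmG, hmk⟩ := Finset.mem_powersetCard.mp hm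
  -- Maximum principle: where the maximum is attained, the mean over the neighbours equals it, so
  -- all neighbours attain it, and exchanges connect the `k`-subsets.
  have key : ∀ z, z ⊆ G → z.card = k → σ z = σ m := by
    intro z hz hzk
    refine exchange_induction (p := fun z => σ z = σ m) ?_ hmG hz hmk hzk rfl
    intro v r r' hv hr hr' hrv hr'v hne hvk h1
    set y := insert r v with hy
    have hyG : y ⊆ G := Finset.insert_subset hr hv
    have hyk : y.card = k := by rw [hy, Finset.card_insert_of_notMem hrv, hvk]
    have hle : ∀ a ∈ y, ∀ b ∈ G \ y, σ (insert b (y.erase a)) ≤ σ m := fun a ha b hb =>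
      hmax _ (Finset.mem_powersetCard.mpr (exchange_mem hyG hyk ha hb))
    have h2 : exchangeSum G σ y = exchangeSum G (fun _ => σ m) y := by
      rw [h y hyG hyk, exchangeSum_const (c := σ m) hyG hyk (fun _ _ _ => rfl), hc, h1]
    have h3 : r' ∈ G \ y := by
      rw [Finset.mem_sdiff, hy, Finset.mem_insert]
      exact ⟨hr', fun h => h.elim (fun h => hne h.symm) hr'v⟩
    have h4 := (Finset.sum_eq_sum_iff_of_le
      (fun a ha => Finset.sum_le_sum fun b hb => hle a ha b hb)).mp h2 r (by simp [hy])
    have h5 := (Finset.sum_eq_sum_iff_of_le (fun b hb => hle r (by simp [hy]) b hb)).mp h4 r' h3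
    rwa [hy, Finset.erase_insert hrv] at h5
  rw [key u hu hk, key u' hu' hk']

/-- A sign function on `k`-subsets whose differences only depend on the exchanged points is
constant or determined by one point. -/
theorem exists_dictator {G : Finset α} {k : ℕ} {σ : Finset α → ℚ}
    (hσ : ∀ u, u ⊆ G → u.card = k + 2 → σ u = 1 ∨ σ u = -1) (hG : k + 4 ≤ G.card)
    (hd : ∀ r ∈ G, ∀ r' ∈ G, r ≠ r' → ∀ v v', v ⊆ (G.erase r).erase r' →
      v' ⊆ (G.erase r).erase r' → v.card = k + 1 → v'.card = k + 1 →
      σ (insert r v) - σ (insert r' v) = σ (insert r v') - σ (insert r' v')) :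
    (∃ c, ∀ u, u ⊆ G → u.card = k + 2 → σ u = c) ∨
    ∃ d ∈ G, ∃ ε : ℚ, (ε = 1 ∨ ε = -1) ∧
      ∀ u, u ⊆ G → u.card = k + 2 → σ u = if d ∈ u then ε else -ε := by
  by_cases hconst : ∀ v r r', v ⊆ G → r ∈ G → r' ∈ G → r ∉ v → r' ∉ v → r ≠ r' →
      v.card + 1 = k + 2 → σ (insert r v) = σ (insert r' v)
  · left
    obtain ⟨u, hu, huk⟩ := Finset.exists_subset_card_eq (show k + 2 ≤ G.card by omega)
    exact ⟨σ u, fun z hz hzk => eq_of_exchange hconst hz hu hzk huk⟩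
  right
  have sub : ∀ {v r r'}, v ⊆ G → r ∉ v → r' ∉ v → v ⊆ (G.erase r).erase r' := by
    intro v r r' h1 h2 h3 z hz
    simp only [Finset.mem_erase]
    exact ⟨fun h => h3 (h ▸ hz), fun h => h2 (h ▸ hz), h1 hz⟩
  have ins : ∀ {v r}, v ⊆ G → r ∈ G → r ∉ v → v.card = k + 1 →
      σ (insert r v) = 1 ∨ σ (insert r v) = -1 := by
    intro v r h1 h2 h3 h4
    exact hσ _ (Finset.insert_subset h2 h1) (by rw [Finset.card_insert_of_notMem h3, h4])
  push Not at hconst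
  -- A nonzero difference of two signs is `±2` and determines both of them. As the difference does
  -- not depend on `v`, both values are forced for every `v`.
  obtain ⟨r₀, r₁, hr₀, hr₁, hne, h01⟩ : ∃ r₀ r₁, r₀ ∈ G ∧ r₁ ∈ G ∧ r₀ ≠ r₁ ∧
      ∀ v, v ⊆ G → r₀ ∉ v → r₁ ∉ v → v.card = k + 1 →
        σ (insert r₀ v) = 1 ∧ σ (insert r₁ v) = -1 := by
    obtain ⟨v, r, r', hv, hr, hr', hrv, hr'v, hne, hvk, hσne⟩ := hconst
    have hvk : v.card = k + 1 := by omega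
    have key : ∀ r r', r ∈ G → r' ∈ G → r ∉ v → r' ∉ v → r ≠ r' → σ (insert r v) = 1 →
        σ (insert r' v) = -1 → ∀ v', v' ⊆ G → r ∉ v' → r' ∉ v' → v'.card = k + 1 →
        σ (insert r v') = 1 ∧ σ (insert r' v') = -1 := by
      intro r r' hr hr' hrv hr'v hne h1 h2 v' hv' h3 h4 h5
      have h6 := hd r hr r' hr' hne v v' (sub hv hrv hr'v) (sub hv' h3 h4) hvk h5
      rw [h1, h2] at h6
      rcases ins hv' hr h3 h5 with h7 | h7 <;> rcases ins hv' hr' h4 h5 with h8 | h8 <;>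
        first | exact ⟨h7, h8⟩ | (rw [h7, h8] at h6; norm_num at h6)
    rcases ins hv hr hrv hvk with h1 | h1 <;> rcases ins hv hr' hr'v hvk with h2 | h2
    · exact absurd (h1.trans h2.symm) hσne
    · exact ⟨r, r', hr, hr', hne, key r r' hr hr' hrv hr'v hne h1 h2⟩
    · exact ⟨r', r, hr', hr, hne.symm, key r' r hr' hr hr'v hrv hne.symm h2 h1⟩
    · exact absurd (h1.trans h2.symm) hσne
  have hcard : k + 2 ≤ ((G.erase r₀).erase r₁).card := by
    rw [Finset.card_erase_of_mem (by simp [hne.symm, hr₁]), Finset.card_erase_of_mem hr₀]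
    omega
  obtain ⟨y, hy, hyk⟩ := Finset.exists_subset_card_eq hcard
  have hyG : y ⊆ G := hy.trans ((Finset.erase_subset _ _).trans (Finset.erase_subset _ _))
  have hy0 : r₀ ∉ y := fun h => by simpa using hy h
  have hy1 : r₁ ∉ y := fun h => by simpa using hy h
  -- Exchanging `r` for `r'` changes nothing here: the difference may be computed after replacing a
  -- point of `v` by `r₀`, and then both values are 1.
  have disj : ∀ u, u ⊆ G → r₀ ∉ u → r₁ ∉ u → u.card = k + 2 → σ u = σ y := by
    intro u hu h0 h1 huk
    refine eq_of_exchange (G := (G.erase r₀).erase r₁) (k := k + 2) ?_ (sub hu h0 h1) hy huk hyk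
    intro v r r' hv hr hr' hrv hr'v hrr hvk
    simp only [Finset.mem_erase] at hr hr'
    have hvG : v ⊆ G := hv.trans ((Finset.erase_subset _ _).trans (Finset.erase_subset _ _))
    have hv0 : r₀ ∉ v := fun h => by simpa using hv h
    have hv1 : r₁ ∉ v := fun h => by simpa using hv h
    obtain ⟨t, ht⟩ : v.Nonempty := Finset.card_pos.mp (by omega)
    have hvt : (v.erase t).card = k := by rw [Finset.card_erase_of_mem ht]; omega
    have h2 : insert r₀ (v.erase t) ⊆ G :=
      Finset.insert_subset hr₀ ((Finset.erase_subset _ _).trans hvG)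
    have h3 : (insert r₀ (v.erase t)).card = k + 1 := by
      rw [Finset.card_insert_of_notMem (fun h => hv0 (Finset.mem_of_mem_erase h)), hvt]
    have mem : ∀ s, s ≠ r₀ → s ∉ v → s ∉ insert r₀ (v.erase t) := by
      intro s h1 h2 h
      rw [Finset.mem_insert] at h
      exact h.elim h1 fun h => h2 (Finset.mem_of_mem_erase h)
    have h4 := hd r hr.2.2 r' hr'.2.2 hrr v (insert r₀ (v.erase t)) (sub hvG hrv hr'v)
      (sub h2 (mem r hr.2.1 hrv) (mem r' hr'.2.1 hr'v)) (by omega) h3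
    have one : ∀ s, s ∈ G → s ≠ r₀ → s ≠ r₁ → s ∉ v →
        σ (insert s (insert r₀ (v.erase t))) = 1 := by
      intro s hs h0 h1 hsv
      rw [Finset.insert_comm]
      refine (h01 _ ?_ ?_ ?_ ?_).1
      · exact Finset.insert_subset hs ((Finset.erase_subset _ _).trans hvG)
      · simp only [Finset.mem_insert, Finset.mem_erase, not_or]
        exact ⟨h0.symm, fun h => hv0 h.2⟩
      · simp only [Finset.mem_insert, Finset.mem_erase, not_or]
        exact ⟨h1.symm, fun h => hv1 h.2⟩
      · rw [Finset.card_insert_of_notMem (fun h => hsv (Finset.mem_of_mem_erase h)), hvt]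
    rw [one r hr.2.2 hr.2.1 hr.1 hrv, one r' hr'.2.2 hr'.2.1 hr'.1 hr'v] at h4
    linarith
  have zeroOnly : ∀ u, u ⊆ G → r₀ ∈ u → r₁ ∉ u → u.card = k + 2 → σ u = 1 := by
    intro u hu h0 h1 huk
    have := (h01 (u.erase r₀) ((Finset.erase_subset _ _).trans hu) (Finset.notMem_erase _ _)
      (fun h => h1 (Finset.mem_of_mem_erase h))
      (by rw [Finset.card_erase_of_mem h0, huk]; rfl)).1
    rwa [Finset.insert_erase h0] at this
  have oneOnly : ∀ u, u ⊆ G → r₁ ∈ u → r₀ ∉ u → u.card = k + 2 → σ u = -1 := by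
    intro u hu h1 h0 huk
    have := (h01 (u.erase r₁) ((Finset.erase_subset _ _).trans hu)
      (fun h => h0 (Finset.mem_of_mem_erase h)) (Finset.notMem_erase _ _)
      (by rw [Finset.card_erase_of_mem h1, huk]; rfl)).2
    rwa [Finset.insert_erase h1] at this
  -- a set with both points has the value opposite to one with neither
  have both : ∀ u, u ⊆ G → r₀ ∈ u → r₁ ∈ u → u.card = k + 2 → σ u = -σ y := by
    intro u hu h0 h1 huk
    have hv : (u.erase r₀).card = k + 1 := by rw [Finset.card_erase_of_mem h0, huk]; rfl
    have : ∃ s ∈ y, s ∉ u.erase r₀ := by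
      by_contra! h
      have := Finset.card_le_card h
      omega
    obtain ⟨s, hsy, hsu⟩ := this
    have hs0 : s ≠ r₀ := fun h => hy0 (h ▸ hsy)
    have hs1 : s ≠ r₁ := fun h => hy1 (h ▸ hsy)
    have hsu' : s ∉ u := fun h => hsu (Finset.mem_erase.mpr ⟨hs0, h⟩)
    have hys : (y.erase s).card = k + 1 := by rw [Finset.card_erase_of_mem hsy, hyk]; rfl
    have h2 := hd r₀ hr₀ s (hyG hsy) hs0.symm (u.erase r₀) (y.erase s)
      (sub ((Finset.erase_subset _ _).trans hu) (Finset.notMem_erase _ _) hsu)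
      (sub ((Finset.erase_subset _ _).trans hyG) (fun h => hy0 (Finset.mem_of_mem_erase h))
        (Finset.notMem_erase _ _)) hv hys
    rw [Finset.insert_erase h0, Finset.insert_erase hsy] at h2
    rw [oneOnly (insert s (u.erase r₀))
        (Finset.insert_subset (hyG hsy) ((Finset.erase_subset _ _).trans hu))
        (by simp [hne.symm, h1]) (by simp [hs0.symm])
        (by rw [Finset.card_insert_of_notMem hsu, hv]),
      zeroOnly (insert r₀ (y.erase s))
        (Finset.insert_subset hr₀ ((Finset.erase_subset _ _).trans hyG)) (by simp)
        (by simp [hne.symm, hy1])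
        (by rw [Finset.card_insert_of_notMem (fun h => hy0 (Finset.mem_of_mem_erase h)), hys])]
      at h2
    linarith
  -- The value on sets avoiding both points decides which of the two is the dictator: `r₁` if it is
  -- 1, `r₀` if it is -1.
  rcases hσ y hyG hyk with h | h
  · refine ⟨r₁, hr₁, -1, Or.inr rfl, fun u hu huk => ?_⟩
    by_cases h0 : r₀ ∈ u <;> by_cases h1 : r₁ ∈ u <;> simp only [h1, if_true, if_false, neg_neg]
    · rw [both u hu h0 h1 huk, h]
    · exact zeroOnly u hu h0 h1 huk
    · exact oneOnly u hu h1 h0 huk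
    · rw [disj u hu h0 h1 huk, h]
  · refine ⟨r₀, hr₀, 1, Or.inl rfl, fun u hu huk => ?_⟩
    by_cases h0 : r₀ ∈ u <;> by_cases h1 : r₁ ∈ u <;> simp only [h0, if_true, if_false]
    · rw [both u hu h0 h1 huk, h]; norm_num
    · exact zeroOnly u hu h0 h1 huk
    · exact oneOnly u hu h1 h0 huk
    · rw [disj u hu h0 h1 huk, h]

/-- A symmetric `0`-`1` function on pairs with the four-term exchange property is constant, a
star, or the complement of a star. -/
theorem star_of_four_term [Fintype α] (hcard : 5 ≤ Fintype.card α) {π : α → α → ℚ}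
    (h01 : ∀ a b, a ≠ b → π a b = 0 ∨ π a b = 1) (hsymm : ∀ a b, π a b = π b a)
    (h4 : ∀ a a' b b', a ≠ a' → b ≠ b' → a ≠ b → a ≠ b' → a' ≠ b → a' ≠ b' →
      π a b + π a' b' = π a b' + π a' b) :
    (∃ κ, ∀ a b, a ≠ b → π a b = κ) ∨
      ∃ c, (∀ a b, a ≠ b → π a b = if a = c ∨ b = c then 1 else 0) ∨
        (∀ a b, a ≠ b → π a b = if a = c ∨ b = c then 0 else 1) := by
  by_cases hv : ∃ c b d, b ≠ c ∧ d ≠ c ∧ π c b = 1 ∧ π c d = 0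
  · right
    obtain ⟨c, b, d, hbc, hdc, h1, h0⟩ := hv
    have hbd : b ≠ d := by rintro rfl; rw [h1] at h0; norm_num at h0
    -- The exchange identity for `c, x` and `b, d` reads `1 + π d x = π b x`, which leaves only one
    -- choice of 0-1 values.
    have hx : ∀ x, x ≠ b → x ≠ c → x ≠ d → π d x = 0 ∧ π b x = 1 := by
      intro x hxb hxc hxd
      have h2 := h4 c x b d hxc.symm hbd hbc.symm hdc.symm hxb hxd
      rw [h1, h0, hsymm x d, hsymm x b] at h2
      rcases h01 d x hxd.symm with h5 | h5 <;> rcases h01 b x hxb.symm with h6 | h6 <;>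
        rw [h5, h6] at h2 <;> norm_num at h2 <;> exact ⟨h5, h6⟩
    have hS : 1 < ({b, c, d} : Finset α)ᶜ.card := by
      rw [Finset.card_compl]
      have := Finset.card_le_three (a := b) (b := c) (c := d)
      omega
    obtain ⟨x₀, hx₀, y₀, hy₀, hxy₀⟩ := Finset.one_lt_card.mp hS
    simp only [Finset.mem_compl, Finset.mem_insert, Finset.mem_singleton, not_or] at hx₀ hy₀
    have hcx : ∀ x, x ≠ b → x ≠ c → x ≠ d → ∀ y, y ≠ b → y ≠ c → y ≠ d → x ≠ y →
        π c x = π c y ∧ π x y = π c x := by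
      intro x hxb hxc hxd y hyb hyc hyd hxy
      have h2 := h4 c b x y hbc.symm hxy hxc.symm hyc.symm hxb.symm hyb.symm
      rw [(hx x hxb hxc hxd).2, (hx y hyb hyc hyd).2] at h2
      have h3 := h4 c y x d hyc.symm hxd hxc.symm hdc.symm hxy.symm hyd
      rw [h0, hsymm y d, (hx y hyb hyc hyd).1, hsymm y x] at h3
      exact ⟨by linarith, by linarith⟩
    have hκ : ∀ x, x ≠ b → x ≠ c → x ≠ d → π c x = π c x₀ := by
      intro x hxb hxc hxd
      by_cases h : x = x₀
      · rw [h]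
      · exact (hcx x hxb hxc hxd x₀ hx₀.1 hx₀.2.1 hx₀.2.2 h).1
    have hκ' : ∀ x, x ≠ b → x ≠ c → x ≠ d → ∀ y, y ≠ b → y ≠ c → y ≠ d → x ≠ y →
        π x y = π c x₀ := by
      intro x hxb hxc hxd y hyb hyc hyd hxy
      rw [(hcx x hxb hxc hxd y hyb hyc hyd hxy).2, hκ x hxb hxc hxd]
    have hbd' : π b d = 1 - π c x₀ := by
      have h2 := h4 b x₀ d y₀ (Ne.symm hx₀.1) (Ne.symm hy₀.2.2) hbd (Ne.symm hy₀.1) hx₀.2.2 hxy₀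
      rw [hκ' x₀ hx₀.1 hx₀.2.1 hx₀.2.2 y₀ hy₀.1 hy₀.2.1 hy₀.2.2 hxy₀,
        (hx y₀ hy₀.1 hy₀.2.1 hy₀.2.2).2, hsymm x₀ d, (hx x₀ hx₀.1 hx₀.2.1 hx₀.2.2).1] at h2
      linarith
    -- Everything is now expressed by the one value `π c x₀`. The value 0 gives the star at `b`, the
    -- value 1 the complement of the star at `d`.
    have main : ∀ x y, x ≠ y → (π x y =
        if x = b ∨ y = b then (if x = d ∨ y = d then 1 - π c x₀ else 1) else
          (if x = d ∨ y = d then 0 else π c x₀)) := by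
      intro x y hxy
      by_cases hxb : x = b
      · subst hxb
        by_cases hyd : y = d
        · subst hyd; simp [hbd']
        · by_cases hyc : y = c
          · subst hyc; simp [hyd, hbd, hsymm x y, h1]
          · simp [hyd, hbd, (hx y hxy.symm hyc hyd).2]
      by_cases hyb : y = b
      · subst hyb
        by_cases hxd : x = d
        · subst hxd; simp [hsymm x y, hbd']
        · by_cases hxc : x = c
          · subst hxc; simp [hxd, hbd, h1]
          · simp [hxd, hbd, hsymm x y, (hx x hxy hxc hxd).2]
      by_cases hxd : x = d
      · subst hxd
        by_cases hyc : y = c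
        · subst hyc; simp [hxb, hyb, hsymm x y, h0]
        · simp [hxb, hyb, (hx y hyb hyc hxy.symm).1]
      by_cases hyd : y = d
      · subst hyd
        by_cases hxc : x = c
        · subst hxc; simp [hxb, hyb, h0]
        · simp [hxb, hyb, hsymm x y, (hx x hxb hxc hxy).1]
      by_cases hxc : x = c
      · subst hxc; simp [hxb, hyb, hxd, hyd, hκ y hyb hxy.symm hyd]
      by_cases hyc : y = c
      · subst hyc; simp [hxb, hyb, hxd, hyd, hsymm x y, hκ x hxb hxy hxd]
      simp [hxb, hyb, hxd, hyd, hκ' x hxb hxc hxd y hyb hyc hyd hxy]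
    rcases h01 c x₀ (Ne.symm hx₀.2.1) with hk | hk
    · refine ⟨b, Or.inl fun x y hxy => ?_⟩
      rw [main x y hxy, hk]
      split_ifs <;> norm_num
    · refine ⟨d, Or.inr fun x y hxy => ?_⟩
      rw [main x y hxy, hk]
      split_ifs <;> norm_num
  · left
    push Not at hv
    have hc : ∀ c b d, b ≠ c → d ≠ c → π c b = π c d := by
      intro c b d hb hd
      rcases h01 c b hb.symm with h1 | h1 <;> rcases h01 c d hd.symm with h2 | h2
      · rw [h1, h2]
      · exact absurd h1 (hv c d b hd hb h2)
      · exact absurd h2 (hv c b d hb hd h1)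
      · rw [h1, h2]
    obtain ⟨a₀, b₀, hab⟩ := Fintype.exists_pair_of_one_lt_card (show 1 < Fintype.card α by omega)
    refine ⟨π a₀ b₀, fun a b h => ?_⟩
    by_cases ha : a = a₀
    · subst ha
      exact hc a b b₀ h.symm hab.symm
    · rw [hc a b a₀ h.symm (Ne.symm ha), hsymm a a₀]
      exact hc a₀ a b₀ ha hab.symm

end Exchange

end WDRD

namespace WDRD

/-! ### Pulling the scheme back to the `e`-subsets -/

section Labelling

variable {n : ℕ}

/-- `±1` according to whether `p` and `q` are on the same side of `x`. -/
def sideSign (p q : Fin n) (x : Finset (Fin n)) : ℚ := if p ∈ x ↔ q ∈ x then 1 else -1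

/-- The sum over the sets obtained from `x` by exchanging one point. -/
def nbrSum (x : Finset (Fin n)) (f : Finset (Fin n) → ℚ) : ℚ :=
  ∑ a ∈ x, ∑ b ∈ xᶜ, f (insert b (x.erase a))

/-- The sum over the common neighbours of `u ∪ {q}` and `u ∪ {p}`. -/
def triSum (D : Finset (Fin n) → Finset (Fin n) → ℕ × ℕ) (φ χ : ℕ × ℕ → ℚ)
    (u : Finset (Fin n)) (q p : Fin n) : ℚ :=
  ∑ r ∈ (insert q (insert p u))ᶜ,
      φ (D (insert q u) (insert r u)) * χ (D (insert r u) (insert p u)) +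
    ∑ a ∈ u, φ (D (insert q u) ((insert q (insert p u)).erase a)) *
      χ (D ((insert q (insert p u)).erase a) (insert p u))

/-- A labelling of the pairs of `e`-sets with the regularity that a commutative scheme with
underlying graph locally like `J(n, e)` induces. -/
structure Labelling (n e : ℕ) (D : Finset (Fin n) → Finset (Fin n) → ℕ × ℕ) : Prop where
  swap : ∀ x y, D y x = (D x y).swap
  total : ∀ φ : ℕ × ℕ → ℚ, ∃ k, ∀ x, x.card = e → nbrSum x (fun y => φ (D x y)) = k
  total_skew : ∀ φ : ℕ × ℕ → ℚ, (∀ i, φ i.swap = -φ i) → ∀ x, x.card = e →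
    nbrSum x (fun y => φ (D x y)) = 0
  triangle : ∀ φ χ, ∃ g : ℕ × ℕ → ℚ, ∀ u q p, u.card + 1 = e → q ∉ u → p ∉ u → q ≠ p →
    triSum D φ χ u q p = g (D (insert q u) (insert p u))
  triangle_comm : ∀ φ χ u q p, u.card + 1 = e → q ∉ u → p ∉ u → q ≠ p →
    triSum D φ χ u q p = triSum D χ φ u q p
  comm : ∀ (φ : ℕ × ℕ → ℚ) p q x, x.card = e →
    nbrSum x (fun y => φ (D x y) * nbrSum y (sideSign p q)) =
      nbrSum x (fun y => nbrSum y (fun z => φ (D y z) * sideSign p q z))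

/-- The sums over the four common neighbours of two sets at distance two agree. -/
def HasQuad (n e : ℕ) (D : Finset (Fin n) → Finset (Fin n) → ℕ × ℕ) : Prop :=
  ∀ (φ : ℕ × ℕ → ℚ) (w : Finset (Fin n)) (a a' b b' : Fin n), w.card + 2 = e →
    a ∉ w → a' ∉ w → b ∉ w → b' ∉ w → a ≠ a' → b ≠ b' → a ≠ b → a ≠ b' → a' ≠ b → a' ≠ b' →
    φ (D (insert a (insert a' w)) (insert a (insert b w))) +
      φ (D (insert a (insert a' w)) (insert a (insert b' w))) +
      φ (D (insert a (insert a' w)) (insert a' (insert b w))) +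
      φ (D (insert a (insert a' w)) (insert a' (insert b' w))) =
    φ (D (insert a (insert b w)) (insert b (insert b' w))) +
      φ (D (insert a (insert b' w)) (insert b (insert b' w))) +
      φ (D (insert a' (insert b w)) (insert b (insert b' w))) +
      φ (D (insert a' (insert b' w)) (insert b (insert b' w)))

/-- `π` maps the `e`-sets onto the vertices of `A` and is a local isomorphism from `J(n, e)`. -/
structure Cover {V : Type*} (A : SimpleGraph V) (n e d : ℕ) (π : Finset (Fin n) → V) :
    Prop where
  adj : ∀ x a b, x.card = e → a ∈ x → b ∉ x → A.Adj (π x) (π (insert b (x.erase a)))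
  lift : ∀ x v, x.card = e → A.Adj (π x) v → ∃ a ∈ x, ∃ b ∉ x, π (insert b (x.erase a)) = v
  inj : ∀ (x : Finset (Fin n)) a b a' b', x.card = e → a ∈ x → b ∉ x → a' ∈ x → b' ∉ x →
    π (insert b (x.erase a)) = π (insert b' (x.erase a')) → a = a' ∧ b = b'
  near : ∀ x y, x.card = e → y.card = e → e ≤ (x ∩ y).card + d → A.Adj (π x) (π y) →
    (x ∩ y).card + 1 = e
  side : ∀ p q, ∃ g : V → ℚ, ∀ x, x.card = e → g (π x) = sideSign p q x
  surj : ∀ v, ∃ x, x.card = e ∧ π x = v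

theorem card_exchange {x : Finset (Fin n)} {a b : Fin n} (ha : a ∈ x) (hb : b ∉ x) :
    (insert b (x.erase a)).card = x.card := by
  rw [Finset.card_insert_of_notMem (fun h => hb (Finset.mem_of_mem_erase h)),
    Finset.card_erase_add_one ha]

theorem nbrSum_congr {x : Finset (Fin n)} {f g : Finset (Fin n) → ℚ}
    (h : ∀ a ∈ x, ∀ b ∉ x, f (insert b (x.erase a)) = g (insert b (x.erase a))) :
    nbrSum x f = nbrSum x g :=
  Finset.sum_congr rfl fun a ha => Finset.sum_congr rfl fun b hb =>
    h a ha b (Finset.mem_compl.mp hb)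

variable {V : Type*} {Γ : Digraph V} {e d : ℕ} {π : Finset (Fin n) → V}

/-- Restriction of a function of the two-way distance to the edges. -/
def onEdge (φ : ℕ × ℕ → ℚ) (i : ℕ × ℕ) : ℚ := if IsEdgeLabel i then φ i else 0

theorem Cover.onEdge_adj (hl : Loopless Γ) (hs : StronglyConnected Γ)
    {φ : ℕ × ℕ → ℚ} {v w : V} (h : Γ.toSimpleGraphInclusive.Adj v w) :
    onEdge φ (twoWayDist Γ v w) = φ (twoWayDist Γ v w) :=
  if_pos ((isEdgeLabel_iff hl hs).mpr h)

theorem Cover.onEdge_not_adj (hl : Loopless Γ) (hs : StronglyConnected Γ)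
    {φ : ℕ × ℕ → ℚ} {v w : V} (h : ¬ Γ.toSimpleGraphInclusive.Adj v w) :
    onEdge φ (twoWayDist Γ v w) = 0 :=
  if_neg fun h' => h ((isEdgeLabel_iff hl hs).mp h')

/-- Adjacency within a clique `{u ∪ {q}}`. -/
theorem Cover.adj_insert (hc : Cover Γ.toSimpleGraphInclusive n e d π) {u : Finset (Fin n)}
    {q p : Fin n} (hu : u.card + 1 = e) (hq : q ∉ u) (hp : p ∉ u) (hne : q ≠ p) :
    Γ.toSimpleGraphInclusive.Adj (π (insert q u)) (π (insert p u)) := by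
  have := hc.adj (insert q u) q p (by rw [Finset.card_insert_of_notMem hq, hu]) (by simp)
    (by simp [hne.symm, hp])
  rwa [Finset.erase_insert hq] at this

/-- Adjacency within a clique `{w \ {a}}`. -/
theorem Cover.adj_erase (hc : Cover Γ.toSimpleGraphInclusive n e d π) {w : Finset (Fin n)}
    {a b : Fin n} (hw : w.card = e + 1) (ha : a ∈ w) (hb : b ∈ w) (hne : a ≠ b) :
    Γ.toSimpleGraphInclusive.Adj (π (w.erase a)) (π (w.erase b)) := by
  have := hc.adj (w.erase a) b a (by rw [Finset.card_erase_of_mem ha, hw]; rfl)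
    (by simp [hne.symm, hb]) (by simp)
  rwa [Finset.erase_right_comm, Finset.insert_erase (by simp [hne, ha])] at this

variable [Fintype V]

/-- The exchanges of `x` reach each neighbour of `π x` exactly once. The weight `H` is arbitrary so
that iterated neighbour sums can be lifted one step at a time. -/
theorem Cover.sum_nbr (hl : Loopless Γ) (hs : StronglyConnected Γ)
    (hc : Cover Γ.toSimpleGraphInclusive n e d π)
    (φ : ℕ × ℕ → ℚ) (H : V → ℚ) {x : Finset (Fin n)} (hx : x.card = e) :
    ∑ v, onEdge φ (twoWayDist Γ (π x) v) * H v =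
      nbrSum x (fun y => φ (twoWayDist Γ (π x) (π y)) * H (π y)) := by
  classical
  unfold nbrSum
  rw [← Finset.sum_product', ← Finset.sum_filter_of_ne
    (p := fun v => Γ.toSimpleGraphInclusive.Adj (π x) v)]
  · symm
    refine Finset.sum_nbij (fun p => π (insert p.2 (x.erase p.1))) ?_ ?_ ?_ ?_
    · rintro ⟨a, b⟩ hp
      simp only [Finset.mem_product, Finset.mem_compl] at hp
      simpa using hc.adj x a b hx hp.1 hp.2
    · rintro ⟨a, b⟩ hp ⟨a', b'⟩ hp' heq
      simp only [Finset.coe_product, Set.mem_prod, Finset.mem_coe, Finset.mem_compl] at hp hp'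
      have := hc.inj x a b a' b' hx hp.1 hp.2 hp'.1 hp'.2 heq
      rw [this.1, this.2]
    · intro v hv
      simp only [Finset.coe_filter, Finset.mem_univ, true_and, Set.mem_ofPred_eq] at hv
      obtain ⟨a, ha, b, hb, h⟩ := hc.lift x v hx hv
      exact ⟨(a, b), by simp [ha, hb], h⟩
    · rintro ⟨a, b⟩ hp
      simp only [Finset.mem_product, Finset.mem_compl] at hp
      rw [onEdge, if_pos ((isEdgeLabel_iff hl hs).mpr (hc.adj x a b hx hp.1 hp.2))]
  · intro v _ hv
    by_contra h
    rw [onEdge, if_neg (fun h' => h ((isEdgeLabel_iff hl hs).mp h')), zero_mul] at hv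
    exact hv rfl

/-- An exchange of `u ∪ {q}` that neither removes `q` nor brings in `p` meets `u ∪ {p}` in `e - 2`
points only. Since `d ≥ 2`, the condition `near` excludes that such sets become adjacent under `π`,
so the common neighbours are those seen in `J(n, e)`. -/
theorem Cover.sum_triangle (hl : Loopless Γ) (hs : StronglyConnected Γ)
    (hc : Cover Γ.toSimpleGraphInclusive n e d π) (hd : 2 ≤ d) (φ χ : ℕ × ℕ → ℚ)
    {u : Finset (Fin n)} {q p : Fin n} (hu : u.card + 1 = e) (hq : q ∉ u) (hp : p ∉ u)
    (hne : q ≠ p) :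
    ∑ v, onEdge φ (twoWayDist Γ (π (insert q u)) v) *
        onEdge χ (twoWayDist Γ v (π (insert p u))) =
      triSum (fun x y => twoWayDist Γ (π x) (π y)) φ χ u q p := by
  have hx : (insert q u).card = e := by rw [Finset.card_insert_of_notMem hq, hu]
  have hy : (insert p u).card = e := by rw [Finset.card_insert_of_notMem hp, hu]
  have hw : (insert q (insert p u)).card = e + 1 := by
    rw [Finset.card_insert_of_notMem (by simp [hne, hq]), hy]
  rw [hc.sum_nbr hl hs φ (fun v => onEdge χ (twoWayDist Γ v (π (insert p u)))) hx]
  have hxc : (insert q u)ᶜ = insert p (insert q (insert p u))ᶜ := by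
    ext z
    simp only [Finset.mem_compl, Finset.mem_insert]
    constructor
    · intro h
      by_cases hz : z = p
      · exact Or.inl hz
      · right; tauto
    · rintro (rfl | h)
      · exact fun h => h.elim (fun h => hne h.symm) hp
      · tauto
  simp only [nbrSum, triSum]
  rw [Finset.sum_insert hq, Finset.erase_insert hq, hxc, Finset.sum_insert (by simp)]
  congr 1
  · rw [onEdge_not_adj hl hs (fun h => h.ne rfl), mul_zero, zero_add]
    refine Finset.sum_congr rfl fun r hr => ?_
    simp only [Finset.mem_compl, Finset.mem_insert, not_or] at hr
    rw [onEdge_adj hl hs (hc.adj_insert hu hr.2.2 hp hr.2.1)]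
  · refine Finset.sum_congr rfl fun a ha => ?_
    have haq : a ≠ q := fun h => hq (h ▸ ha)
    have hap : a ≠ p := fun h => hp (h ▸ ha)
    rw [Finset.sum_insert (by simp)]
    have hz : insert p ((insert q u).erase a) = (insert q (insert p u)).erase a := by
      rw [← Finset.erase_insert_of_ne hap.symm, Finset.insert_comm]
    have hadj : Γ.toSimpleGraphInclusive.Adj (π ((insert q (insert p u)).erase a))
        (π (insert p u)) := by
      have := hc.adj_erase (a := a) (b := q) hw (by simp [ha]) (by simp) haq
      rwa [Finset.erase_insert (by simp [hne, hq])] at this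
    rw [hz, onEdge_adj hl hs hadj]
    convert add_zero _ using 2
    refine Finset.sum_eq_zero fun r hr => ?_
    simp only [Finset.mem_compl, Finset.mem_insert, not_or] at hr
    rw [onEdge_not_adj hl hs, mul_zero]
    intro hadj
    have hint : insert r ((insert q u).erase a) ∩ insert p u = u.erase a := by
      ext z
      simp only [Finset.mem_inter, Finset.mem_insert, Finset.mem_erase]
      constructor
      · rintro ⟨rfl | ⟨h1, rfl | h2⟩, rfl | h3⟩
        · exact absurd rfl hr.2.1
        · exact absurd h3 hr.2.2
        · exact absurd rfl hne
        · exact absurd h3 hq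
        · exact ⟨h1, h2⟩
        · exact ⟨h1, h2⟩
      · rintro ⟨h1, h2⟩
        exact ⟨Or.inr ⟨h1, Or.inr h2⟩, Or.inr h2⟩
    have hcard : (u.erase a).card + 1 = u.card := Finset.card_erase_add_one ha
    have := hc.near _ _ (by
      rw [card_exchange (by simp [ha]) (by simp [hr.1, hr.2.2]), hx]) hy
      (by rw [hint]; omega) hadj
    rw [hint] at this
    omega

/-- A cover of the underlying graph of a commutative weakly distance-regular digraph pulls
the two-way distance back to a labelling. -/
theorem Cover.labelling (hl : Loopless Γ) (h : IsCommutativeWeaklyDistanceRegular Γ)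
    (hc : Cover Γ.toSimpleGraphInclusive n e d π) (hd : 2 ≤ d) :
    Labelling n e (fun x y => twoWayDist Γ (π x) (π y)) where
  swap x y := rfl
  total φ := by
    obtain ⟨k, hk⟩ := exists_rowSum h.toIsWeaklyDistanceRegular (onEdge φ)
    refine ⟨k, fun x hx => ?_⟩
    have := hc.sum_nbr hl h.stronglyConnected φ 1 hx
    simp only [Pi.one_apply, mul_one] at this
    rw [← this, hk]
  total_skew φ hφ x hx := by
    have := hc.sum_nbr hl h.stronglyConnected φ 1 hx
    simp only [Pi.one_apply, mul_one] at this
    rw [← this]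
    refine rowSum_eq_zero h.toIsWeaklyDistanceRegular _ (fun i => ?_) _
    simp only [onEdge, isEdgeLabel_swap, hφ]
    split_ifs <;> simp
  triangle φ χ := by
    obtain ⟨g, hg⟩ := exists_conv h.toIsWeaklyDistanceRegular (onEdge φ) (onEdge χ)
    refine ⟨g, fun u q p hu hq hp hne => ?_⟩
    rw [← hc.sum_triangle hl h.stronglyConnected hd φ χ hu hq hp hne, hg]
  triangle_comm φ χ u q p hu hq hp hne := by
    rw [← hc.sum_triangle hl h.stronglyConnected hd φ χ hu hq hp hne,
      ← hc.sum_triangle hl h.stronglyConnected hd χ φ hu hq hp hne, conv_comm h]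
  comm φ p q x hx := by
    -- `sideSign p q` descends to the vertices, so the commutation of `φ` with the adjacency matrix
    -- can be evaluated on this vector.
    obtain ⟨g, hg⟩ := hc.side p q
    have key : ∀ (φ χ : ℕ × ℕ → ℚ),
        nbrSum x (fun y => φ (twoWayDist Γ (π x) (π y)) *
          nbrSum y (fun z => χ (twoWayDist Γ (π y) (π z)) * sideSign p q z)) =
        ∑ w, (∑ v, onEdge φ (twoWayDist Γ (π x) v) * onEdge χ (twoWayDist Γ v w)) * g w := by
      intro φ χ
      simp only [Finset.sum_mul]
      rw [Finset.sum_comm]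
      simp only [mul_assoc, ← Finset.mul_sum]
      rw [hc.sum_nbr hl h.stronglyConnected φ
        (fun v => ∑ w, onEdge χ (twoWayDist Γ v w) * g w) hx]
      refine nbrSum_congr fun a ha b hb => ?_
      have hy := (card_exchange ha hb).trans hx
      rw [hc.sum_nbr hl h.stronglyConnected χ g hy]
      congr 1
      refine nbrSum_congr fun a' ha' b' hb' => ?_
      rw [hg _ ((card_exchange ha' hb').trans hy)]
    have h1 := key φ 1
    have h2 := key 1 φ
    simp only [Pi.one_apply, one_mul] at h1 h2
    rw [h1, h2]
    simp only [conv_comm h (onEdge φ)]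

theorem sum_sum_eq_of_support {α : Type*} [DecidableEq α] {s t : Finset α} {K : α → α → ℚ}
    {a a' b b' : α} (ha : a ∈ s) (ha' : a' ∈ s) (hb : b ∈ t) (hb' : b' ∈ t) (haa : a ≠ a')
    (hbb : b ≠ b') (h : ∀ c ∈ s, ∀ r ∈ t, ¬ ((c = a ∨ c = a') ∧ (r = b ∨ r = b')) → K c r = 0) :
    ∑ c ∈ s, ∑ r ∈ t, K c r = K a b + K a b' + K a' b + K a' b' := by
  have h1 : ({a, a'} : Finset α) ⊆ s := by
    intro z hz
    rcases Finset.mem_insert.mp hz with rfl | hz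
    · exact ha
    · rwa [Finset.mem_singleton.mp hz]
  have h2 : ({b, b'} : Finset α) ⊆ t := by
    intro z hz
    rcases Finset.mem_insert.mp hz with rfl | hz
    · exact hb
    · rwa [Finset.mem_singleton.mp hz]
  rw [← Finset.sum_subset h1, Finset.sum_pair haa, ← Finset.sum_subset h2,
    ← Finset.sum_subset h2, Finset.sum_pair hbb, Finset.sum_pair hbb, add_assoc, add_assoc,
    add_assoc]
  · intro r hr hr'
    exact h a' ha' r hr fun h => hr' (by simpa using h.2)
  · intro r hr hr'
    exact h a ha r hr fun h => hr' (by simpa using h.2)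
  · intro c hc hc'
    exact Finset.sum_eq_zero fun r hr => h c hc r hr fun h => hc' (by simpa using h.1)

/-- This is commutativity of `φ` with the adjacency matrix at a pair at distance two: the only paths
of length two run through the four intermediate sets. A neighbour of `x` can be at distance three
from `y`, whence `d ≥ 3`. -/
theorem Cover.hasQuad (hl : Loopless Γ) (h : IsCommutativeWeaklyDistanceRegular Γ)
    (hc : Cover Γ.toSimpleGraphInclusive n e d π) (hd : 3 ≤ d) :
    HasQuad n e (fun x y => twoWayDist Γ (π x) (π y)) := by
  intro φ w a a' b b' hw ha ha' hb hb' haa hbb hab hab' ha'b ha'b'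
  set x := insert a (insert a' w) with hx
  set y := insert b (insert b' w) with hy
  have hxe : x.card = e := by
    rw [hx, Finset.card_insert_of_notMem (by simp [haa, ha]), Finset.card_insert_of_notMem ha',
      ← hw]
  have hye : y.card = e := by
    rw [hy, Finset.card_insert_of_notMem (by simp [hbb, hb]), Finset.card_insert_of_notMem hb',
      ← hw]
  have hs := h.stronglyConnected
  have hay : a ∉ y := by simp [hy, hab, hab', ha]
  have ha'y : a' ∉ y := by simp [hy, ha'b, ha'b', ha']
  have e1 : x.erase a = insert a' w := Finset.erase_insert (by simp [haa, ha])
  have e2 : x.erase a' = insert a w := by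
    rw [hx, Finset.insert_comm]
    exact Finset.erase_insert (by simp [haa.symm, ha'])
  have adj : ∀ c s t, c ∉ w → s ∉ w → t ∉ w → c ≠ s → c ≠ t → s ≠ t →
      Γ.toSimpleGraphInclusive.Adj (π (insert c (insert s w))) (π (insert s (insert t w))) := by
    intro c s t hcw hsw htw hcs hct hst
    rw [Finset.insert_comm s t]
    refine hc.adj_insert ?_ (by simp [hcs, hcw]) (by simp [hst.symm, htw]) hct
    rw [Finset.card_insert_of_notMem hsw]
    omega
  have key : ∀ φ χ : ℕ × ℕ → ℚ,
      ∑ v, onEdge φ (twoWayDist Γ (π x) v) * onEdge χ (twoWayDist Γ v (π y)) =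
      φ (twoWayDist Γ (π x) (π (insert a' (insert b w)))) *
          χ (twoWayDist Γ (π (insert a' (insert b w))) (π y)) +
        φ (twoWayDist Γ (π x) (π (insert a' (insert b' w)))) *
          χ (twoWayDist Γ (π (insert a' (insert b' w))) (π y)) +
        φ (twoWayDist Γ (π x) (π (insert a (insert b w)))) *
          χ (twoWayDist Γ (π (insert a (insert b w))) (π y)) +
        φ (twoWayDist Γ (π x) (π (insert a (insert b' w)))) *
          χ (twoWayDist Γ (π (insert a (insert b' w))) (π y)) := by
    intro φ χ
    rw [hc.sum_nbr hl hs φ (fun v => onEdge χ (twoWayDist Γ v (π y))) hxe]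
    simp only [nbrSum]
    rw [sum_sum_eq_of_support (a := a) (a' := a') (b := b) (b' := b') (by simp [hx])
      (by simp [hx]) (by simp [hx, hab.symm, ha'b.symm, hb])
      (by simp [hx, hab'.symm, ha'b'.symm, hb']) haa hbb]
    · have hy' : y = insert b' (insert b w) := by rw [hy, Finset.insert_comm]
      rw [e1, e2, Finset.insert_comm b a', Finset.insert_comm b' a', Finset.insert_comm b a,
        Finset.insert_comm b' a]
      have A1 := adj a b b' ha hb hb' hab hab' hbb
      have A2 := adj a b' b ha hb' hb hab' hab hbb.symm
      have A3 := adj a' b b' ha' hb hb' ha'b ha'b' hbb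
      have A4 := adj a' b' b ha' hb' hb ha'b' ha'b hbb.symm
      rw [← hy] at A1 A3
      rw [← hy'] at A2 A4
      rw [onEdge_adj hl hs A1, onEdge_adj hl hs A2, onEdge_adj hl hs A3, onEdge_adj hl hs A4]
    · intro c hcx r hr hnot
      rw [Finset.mem_compl] at hr
      rw [onEdge_not_adj hl hs, mul_zero]
      intro hadj
      have hsub : w.erase c ⊆ insert r (x.erase c) ∩ y := by
        intro z hz
        rw [Finset.mem_erase] at hz
        simp only [hx, hy, Finset.mem_inter, Finset.mem_insert, Finset.mem_erase]
        exact ⟨Or.inr ⟨hz.1, Or.inr (Or.inr hz.2)⟩, Or.inr (Or.inr hz.2)⟩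
      have h1 := Finset.card_le_card hsub
      have h2 : w.card - 1 ≤ (w.erase c).card := Finset.pred_card_le_card_erase
      have h3 := hc.near _ _ ((card_exchange hcx hr).trans hxe) hye (by omega) hadj
      have hrw : r ∉ w := fun h => hr (by simp [hx, h])
      have hmem : ∀ z, z ∈ insert r (x.erase c) ∩ y → z = r ∨ z ≠ c ∧ z ∈ w := by
        intro z hz
        rw [Finset.mem_inter, Finset.mem_insert, Finset.mem_erase, hx, Finset.mem_insert,
          Finset.mem_insert] at hz
        rcases hz with ⟨h | ⟨hzc, rfl | rfl | h⟩, h'⟩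
        · exact Or.inl h
        · exact absurd h' hay
        · exact absurd h' ha'y
        · exact Or.inr ⟨hzc, h⟩
      -- Any exchange other than the four leaves at most `w.card = e - 2` points in common with `y`,
      -- too few for adjacency.
      by_cases hr' : r = b ∨ r = b'
      · have hcw : c ∈ w := by
          rw [hx, Finset.mem_insert, Finset.mem_insert] at hcx
          rcases hcx with h | h | h
          · exact absurd ⟨Or.inl h, hr'⟩ hnot
          · exact absurd ⟨Or.inr h, hr'⟩ hnot
          · exact h
        have hsup : insert r (x.erase c) ∩ y ⊆ insert r (w.erase c) := fun z hz => by
          simpa using hmem z hz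
        have h4 := (Finset.card_le_card hsup).trans (Finset.card_insert_le _ _)
        rw [Finset.card_erase_add_one hcw] at h4
        omega
      · have hsup : insert r (x.erase c) ∩ y ⊆ w := by
          intro z hz
          rcases hmem z hz with rfl | h
          · have h' := (Finset.mem_inter.mp hz).2
            rw [hy, Finset.mem_insert, Finset.mem_insert] at h'
            rcases h' with h' | h' | h'
            · exact absurd (Or.inl h') hr'
            · exact absurd (Or.inr h') hr'
            · exact h'
          · exact h.2
        have h4 := Finset.card_le_card hsup
        omega
  have h1 := key φ 1
  have h2 := key 1 φ
  rw [conv_comm h, h2] at h1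
  simp only [Pi.one_apply, one_mul, mul_one] at h1
  linarith

end Labelling

end WDRD

namespace WDRD

/-! ### Line sums of the exchange array and the eigenvalue equation -/

section Lines

variable {n : ℕ}

/-- The sum of `f x` over the sets obtained by exchanging `a ∈ x`. -/
def rowAt (f : Finset (Fin n) → Finset (Fin n) → ℚ) (x : Finset (Fin n)) (a : Fin n) : ℚ :=
  ∑ b ∈ xᶜ, f x (insert b (x.erase a))

/-- The sum of `f x` over the sets obtained by bringing in `b ∉ x`. -/
def colAt (f : Finset (Fin n) → Finset (Fin n) → ℚ) (x : Finset (Fin n)) (b : Fin n) : ℚ :=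
  ∑ a ∈ x, f x (insert b (x.erase a))

/-- All row and column sums vanish. -/
def ZeroLines (e : ℕ) (f : Finset (Fin n) → Finset (Fin n) → ℚ) : Prop :=
  ∀ x, x.card = e → (∀ a ∈ x, rowAt f x a = 0) ∧ ∀ b ∉ x, colAt f x b = 0

theorem nbrSum_eq_sum_rowAt (f : Finset (Fin n) → Finset (Fin n) → ℚ) (x : Finset (Fin n)) :
    nbrSum x (f x) = ∑ a ∈ x, rowAt f x a := rfl

theorem nbrSum_eq_sum_colAt (f : Finset (Fin n) → Finset (Fin n) → ℚ) (x : Finset (Fin n)) :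
    nbrSum x (f x) = ∑ b ∈ xᶜ, colAt f x b := Finset.sum_comm

theorem triSum_swap {D : Finset (Fin n) → Finset (Fin n) → ℕ × ℕ}
    (hD : ∀ x y, D y x = (D x y).swap) (φ χ : ℕ × ℕ → ℚ) (u : Finset (Fin n)) (q p : Fin n) :
    triSum D φ χ u q p = triSum D (fun i => χ i.swap) (fun i => φ i.swap) u p q := by
  unfold triSum
  rw [Finset.insert_comm p q]
  congr 1
  · refine Finset.sum_congr rfl fun r _ => ?_
    beta_reduce
    rw [mul_comm, ← hD, ← hD]
  · refine Finset.sum_congr rfl fun r _ => ?_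
    beta_reduce
    rw [mul_comm, ← hD, ← hD]

/-- The common neighbours of `x` and `x - a + b` are the other entries of row `a` and of column `b`.
The entry at `(a, b)` lies on both lines, hence the coefficient 2. -/
theorem triSum_one {D : Finset (Fin n) → Finset (Fin n) → ℕ × ℕ} (φ : ℕ × ℕ → ℚ)
    {x : Finset (Fin n)} {a b : Fin n} (ha : a ∈ x) (hb : b ∉ x) :
    triSum D φ 1 (x.erase a) a b =
      rowAt (fun x y => φ (D x y)) x a + colAt (fun x y => φ (D x y)) x b -
        2 * φ (D x (insert b (x.erase a))) := by
  have hc : (insert a (insert b (x.erase a)))ᶜ = xᶜ.erase b := by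
    rw [Finset.insert_comm, Finset.insert_erase ha, Finset.compl_insert]
  simp only [triSum, rowAt, colAt, Pi.one_apply, mul_one]
  rw [Finset.insert_erase ha, hc, ← Finset.add_sum_erase _ _ (Finset.mem_compl.mpr hb),
    ← Finset.add_sum_erase _ _ ha]
  have : ∀ c ∈ x.erase a, φ (D x ((insert a (insert b (x.erase a))).erase c)) =
      φ (D x (insert b (x.erase c))) := by
    intro c hc
    rw [Finset.mem_erase] at hc
    have hbc : b ≠ c := fun h => hb (h ▸ hc.2)
    rw [Finset.insert_comm, Finset.insert_erase ha, Finset.erase_insert_of_ne hbc]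
  rw [Finset.sum_congr rfl this]
  ring

variable {e : ℕ} {D : Finset (Fin n) → Finset (Fin n) → ℕ × ℕ}

/-- Row sum plus column sum is again a function of the label. -/
theorem Labelling.exists_rowAt_add_colAt (hL : Labelling n e D) {φ : ℕ × ℕ → ℚ} {ε : ℚ}
    (hε : ε * ε = 1) (hφ : ∀ i, φ i.swap = ε * φ i) :
    ∃ ψ : ℕ × ℕ → ℚ, (∀ i, ψ i.swap = ε * ψ i) ∧ ∀ x a b, x.card = e → a ∈ x → b ∉ x →
      ψ (D x (insert b (x.erase a))) =
        rowAt (fun x y => φ (D x y)) x a + colAt (fun x y => φ (D x y)) x b := by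
  obtain ⟨g, hg⟩ := hL.triangle φ 1
  -- `g + 2φ` already gives the sum of the two lines. Averaging with `ε` times the reversed function
  -- imposes `ε`-symmetry on all labels, including those of non-edges.
  refine ⟨fun i => ((g i + 2 * φ i) + ε * (g i.swap + 2 * φ i.swap)) / 2, ?_, ?_⟩
  · intro i
    simp only [Prod.swap_swap]
    linear_combination (-(1 / 2) * (g i.swap + 2 * φ i.swap)) * hε
  · intro x a b hx ha hb
    have hab : a ≠ b := fun h => hb (h ▸ ha)
    have hu : (x.erase a).card + 1 = e := by rw [Finset.card_erase_add_one ha, hx]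
    have hbu : b ∉ x.erase a := fun h => hb (Finset.mem_of_mem_erase h)
    set y := insert b (x.erase a) with hy
    have hyb : y.erase b = x.erase a := Finset.erase_insert hbu
    have hay : a ∉ y := by simp [hy, hab]
    have hyx : insert a (y.erase b) = x := by rw [hyb, Finset.insert_erase ha]
    have h1 := hg (x.erase a) a b hu (Finset.notMem_erase _ _) hbu hab
    rw [triSum_one φ ha hb, Finset.insert_erase ha, ← hy] at h1
    have h2 := hg (x.erase a) b a hu hbu (Finset.notMem_erase _ _) hab.symm
    have h3 := triSum_one (D := D) φ (x := y) (a := b) (b := a) (by simp [hy]) hay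
    rw [hyx, hyb] at h3
    rw [h3, Finset.insert_erase ha, ← hy] at h2
    -- Commutativity relates the line sums seen from `x` to those seen from `y`; without it the
    -- averaging above could change the value.
    have h4 := hL.triangle_comm φ 1 (x.erase a) a b hu (Finset.notMem_erase _ _) hbu hab
    rw [triSum_swap hL.swap 1 φ] at h4
    have h5 : triSum D (fun i => φ i.swap) (fun i => (1 : ℕ × ℕ → ℚ) i.swap) (x.erase a) b a =
        ε * triSum D φ 1 (x.erase a) b a := by
      simp only [triSum, hφ, Pi.one_apply, mul_one, mul_add, Finset.mul_sum]
    rw [h5, triSum_one φ ha hb, h3, ← hy] at h4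
    simp only [← hL.swap]
    have h6 : φ (D y x) = ε * φ (D x y) := by rw [hL.swap, hφ]
    linear_combination (-1 / 2) * h1 - (ε / 2) * h2 - (1 / 2) * h4 + ε * h6 + φ (D x y) * hε

/-- Each moved point contributes a factor, -1 exactly when it is `p` or `q`. Separating the leaving
from the entering point makes sums over the whole array factor. -/
theorem sideSign_exchange {p q : Fin n} (hpq : p ≠ q) {x : Finset (Fin n)} {a b : Fin n}
    (ha : a ∈ x) (hb : b ∉ x) :
    sideSign p q (insert b (x.erase a)) = sideSign p q x *
      (1 - 2 * ((if a = p then 1 else 0) + if a = q then 1 else 0)) *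
      (1 - 2 * ((if b = p then 1 else 0) + if b = q then 1 else 0)) := by
  have hab : a ≠ b := fun h => hb (h ▸ ha)
  have mem : ∀ r, r ∈ insert b (x.erase a) ↔ r = b ∨ r ≠ a ∧ r ∈ x := by simp
  simp only [sideSign, mem]
  by_cases hap : a = p
  · subst hap
    have h1 : a ≠ q := hpq
    by_cases hbq : b = q
    · subst hbq; simp [ha, hb, hab, hab.symm]; norm_num
    · by_cases hq : q ∈ x <;> simp [ha, hab, hab.symm, hbq, Ne.symm hbq, h1, h1.symm, hq] <;>
        norm_num
  by_cases haq : a = q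
  · subst haq
    by_cases hbp : b = p
    · subst hbp; simp [ha, hb, hab, hab.symm]; norm_num
    · by_cases hp : p ∈ x <;>
        simp [ha, hab, hab.symm, hbp, Ne.symm hbp, hap, Ne.symm hap, hp] <;> norm_num
  by_cases hbp : b = p
  · subst hbp
    by_cases hq : q ∈ x <;>
      simp [hb, hab, hab.symm, hpq, hpq.symm, haq, Ne.symm haq, hq] <;> norm_num
  by_cases hbq : b = q
  · subst hbq
    by_cases hp : p ∈ x <;>
      simp [hb, hab, hab.symm, hpq, hpq.symm, hap, Ne.symm hap, hp] <;> norm_num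
  simp [hap, haq, hbp, hbq, Ne.symm hap, Ne.symm haq, Ne.symm hbp, Ne.symm hbq]

theorem sum_side {p q : Fin n} (x : Finset (Fin n)) :
    ∑ a ∈ x, (1 - 2 * ((if a = p then (1 : ℚ) else 0) + if a = q then 1 else 0)) =
      x.card - 2 * ((if p ∈ x then 1 else 0) + if q ∈ x then 1 else 0) := by
  rw [Finset.sum_sub_distrib, ← Finset.mul_sum, Finset.sum_add_distrib]
  simp

theorem nbrSum_sideSign {p q : Fin n} (hpq : p ≠ q) (x : Finset (Fin n)) :
    nbrSum x (sideSign p q) = sideSign p q x *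
      (x.card - 2 * ((if p ∈ x then 1 else 0) + if q ∈ x then 1 else 0)) *
      (((n : ℚ) - x.card) - 2 * ((if p ∈ x then 0 else 1) + if q ∈ x then 0 else 1)) := by
  have h1 : nbrSum x (sideSign p q) = ∑ a ∈ x, ∑ b ∈ xᶜ, sideSign p q x *
      (1 - 2 * ((if a = p then 1 else 0) + if a = q then 1 else 0)) *
      (1 - 2 * ((if b = p then 1 else 0) + if b = q then 1 else 0)) :=
    Finset.sum_congr rfl fun a ha => Finset.sum_congr rfl fun b hb =>
      sideSign_exchange hpq ha (Finset.mem_compl.mp hb)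
  rw [h1]
  simp only [← Finset.mul_sum, ← Finset.sum_mul]
  rw [sum_side, sum_side, Finset.card_compl, Fintype.card_fin,
    Nat.cast_sub (by simpa using Finset.card_le_univ x)]
  simp

/-- Vanishing line sums kill every weight that depends on the row alone or on the column alone, so
only the corner coefficient `E` is seen. -/
theorem sum_mul_side {s t : Finset (Fin n)} {M : Fin n → Fin n → ℚ}
    (hr : ∀ a ∈ s, ∑ b ∈ t, M a b = 0) (hc : ∀ b ∈ t, ∑ a ∈ s, M a b = 0) (A B C E : ℚ)
    {p q : Fin n} (hq : q ∈ s) (hp : p ∈ t) :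
    ∑ a ∈ s, ∑ b ∈ t, M a b * (A + (if a = q then B else 0) + (if b = p then C else 0) +
      if a = q then if b = p then E else 0 else 0) = E * M q p := by
  have h : ∀ a ∈ s, ∑ b ∈ t, M a b * (A + (if a = q then B else 0) + (if b = p then C else 0) +
      if a = q then if b = p then E else 0 else 0) =
      M a p * C + if a = q then M a p * E else 0 := by
    intro a ha
    have h1 : ∀ b ∈ t, M a b * (A + (if a = q then B else 0) + (if b = p then C else 0) +
        if a = q then if b = p then E else 0 else 0) =
        M a b * (A + if a = q then B else 0) +
          if b = p then M a b * C + (if a = q then M a b * E else 0) else 0 := by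
      intro b _
      split_ifs <;> ring
    rw [Finset.sum_congr rfl h1, Finset.sum_add_distrib, ← Finset.sum_mul, hr a ha, zero_mul,
      zero_add, Finset.sum_ite_eq' t p, if_pos hp]
  rw [Finset.sum_congr rfl h, Finset.sum_add_distrib, ← Finset.sum_mul, hc p hp, zero_mul,
    zero_add, Finset.sum_ite_eq' s q, if_pos hq, mul_comm]

theorem sideSign_comm (p q : Fin n) (x : Finset (Fin n)) : sideSign p q x = sideSign q p x := by
  simp only [sideSign, iff_comm]

/-- The weighted neighbour sum of `sideSign` for zero row and column sums. -/
theorem nbrSum_mul_sideSign {f : Finset (Fin n) → Finset (Fin n) → ℚ} (hf : ZeroLines e f)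
    {p q : Fin n} (hpq : p ≠ q) {x : Finset (Fin n)} (hx : x.card = e) :
    nbrSum x (fun z => f x z * sideSign p q z) = -4 *
      ((if q ∈ x ∧ p ∉ x then f x (insert p (x.erase q)) else 0) +
        if p ∈ x ∧ q ∉ x then f x (insert q (x.erase p)) else 0) := by
  have hz := hf x hx
  have main : ∀ p q : Fin n, p ≠ q → q ∈ x → p ∉ x →
      nbrSum x (fun z => f x z * sideSign p q z) = -4 * f x (insert p (x.erase q)) := by
    intro p q hpq hq hp
    have := sum_mul_side (s := x) (t := xᶜ) (M := fun a b => f x (insert b (x.erase a)))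
      (fun a ha => hz.1 a ha) (fun b hb => hz.2 b (Finset.mem_compl.mp hb)) (-1) 2 2 (-4)
      hq (Finset.mem_compl.mpr hp)
    rw [← this]
    refine Finset.sum_congr rfl fun a ha => Finset.sum_congr rfl fun b hb => ?_
    rw [Finset.mem_compl] at hb
    have h1 : a ≠ p := fun h => hp (h ▸ ha)
    have h2 : b ≠ q := fun h => hb (h ▸ hq)
    beta_reduce
    rw [sideSign_exchange hpq ha hb]
    have h3 : sideSign p q x = -1 := by simp [sideSign, hp, hq]
    rw [h3]
    by_cases h4 : a = q <;> by_cases h5 : b = p <;> simp [h1, h2, h4, h5, hpq, hpq.symm] <;> norm_num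
  have both : sideSign p q x = 1 → nbrSum x (fun z => f x z * sideSign p q z) =
      ∑ a ∈ x, ∑ b ∈ xᶜ, f x (insert b (x.erase a)) *
      ((1 - 2 * ((if a = p then 1 else 0) + if a = q then 1 else 0)) *
      (1 - 2 * ((if b = p then 1 else 0) + if b = q then 1 else 0))) := by
    intro h
    refine Finset.sum_congr rfl fun a ha => Finset.sum_congr rfl fun b hb => ?_
    beta_reduce
    rw [sideSign_exchange hpq ha (Finset.mem_compl.mp hb), h, one_mul]
  by_cases hq : q ∈ x <;> by_cases hp : p ∈ x
  · rw [both (by simp [sideSign, hp, hq])]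
    simp only [hq, hp, not_true, and_false, if_false, add_zero, mul_zero]
    refine Finset.sum_eq_zero fun a ha => ?_
    have : ∀ b ∈ xᶜ, f x (insert b (x.erase a)) *
      ((1 - 2 * ((if a = p then 1 else 0) + if a = q then 1 else 0)) *
      (1 - 2 * ((if b = p then 1 else 0) + if b = q then 1 else 0))) =
      f x (insert b (x.erase a)) *
        (1 - 2 * ((if a = p then 1 else 0) + if a = q then 1 else 0)) := by
      intro b hb
      rw [Finset.mem_compl] at hb
      have h1 : b ≠ p := fun h => hb (h ▸ hp)
      have h2 : b ≠ q := fun h => hb (h ▸ hq)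
      simp [h1, h2]
    rw [Finset.sum_congr rfl this, ← Finset.sum_mul]
    have := hz.1 a ha
    unfold rowAt at this
    rw [this, zero_mul]
  · rw [main p q hpq hq hp]
    simp [hq, hp]
  · have := main q p hpq.symm hp hq
    simp only [sideSign_comm q p] at this
    rw [this]
    simp [hq, hp]
  · rw [both (by simp [sideSign, hp, hq])]
    simp only [hq, hp, false_and, if_false, add_zero, mul_zero]
    rw [Finset.sum_comm]
    refine Finset.sum_eq_zero fun b hb => ?_
    have : ∀ a ∈ x, f x (insert b (x.erase a)) *
      ((1 - 2 * ((if a = p then 1 else 0) + if a = q then 1 else 0)) *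
      (1 - 2 * ((if b = p then 1 else 0) + if b = q then 1 else 0))) =
      f x (insert b (x.erase a)) *
        (1 - 2 * ((if b = p then 1 else 0) + if b = q then 1 else 0)) := by
      intro a ha
      have h1 : a ≠ p := fun h => hp (h ▸ ha)
      have h2 : a ≠ q := fun h => hq (h ▸ ha)
      simp [h1, h2]
    rw [Finset.sum_congr rfl this, ← Finset.sum_mul]
    have := hz.2 b (Finset.mem_compl.mp hb)
    unfold colAt at this
    rw [this, zero_mul]

/-- For zero row and column sums, the values on the exchanges of `q` and `p` form an
eigenfunction. -/
theorem Labelling.isEigen (hL : Labelling n e D) {φ : ℕ × ℕ → ℚ} {ε : ℚ}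
    (hφ : ∀ i, φ i.swap = ε * φ i) (hz : ZeroLines e (fun x y => φ (D x y))) {q p : Fin n}
    (hpq : p ≠ q) {k : ℕ} (hk : k + 1 = e) :
    IsEigen ((Finset.univ.erase p).erase q) k ((e : ℚ) * (n - e) - 2 * n + 2 - ε)
      (fun u => φ (D (insert q u) (insert p u))) := by
  intro u hu huk
  have hqu : q ∉ u := fun h => by simpa using hu h
  have hpu : p ∉ u := fun h => by simpa using hu h
  set x := insert q u with hx
  have hxe : x.card = e := by rw [hx, Finset.card_insert_of_notMem hqu, huk, hk]
  have hqx : q ∈ x := by simp [hx]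
  have hpx : p ∉ x := by simp [hx, hpq, hpu]
  have hxq : x.erase q = u := Finset.erase_insert hqu
  -- The eigenvalue equation is the commutation relation at `x = u ∪ {q}`, with each side evaluated
  -- explicitly.
  have hc := hL.comm φ p q x hxe
  have hlhs : nbrSum x (fun y => φ (D x y) * nbrSum y (sideSign p q)) =
      -4 * ((e : ℚ) * (n - e) - 2 * n + 2) * φ (D x (insert p u)) := by
    -- The weight is the value of `nbrSum y (sideSign p q)`: the first constant is its value when
    -- `q` stays and `p` stays out, the next two are the changes when `q` leaves or `p` enters. Only
    -- the mixed coefficient, the last one, contributes.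
    have := sum_mul_side (s := x) (t := xᶜ) (M := fun a b => φ (D x (insert b (x.erase a))))
      (fun a ha => (hz x hxe).1 a ha) (fun b hb => (hz x hxe).2 b (Finset.mem_compl.mp hb))
      (-((e : ℚ) - 2) * (n - e - 2)) (e * (n - e - 4) + (e - 2) * (n - e - 2))
      ((e - 4) * (n - e) + (e - 2) * (n - e - 2)) (-4 * ((e : ℚ) * (n - e) - 2 * n + 2))
      hqx (Finset.mem_compl.mpr hpx)
    simp only [hxq] at this
    rw [← this]
    refine Finset.sum_congr rfl fun a ha => Finset.sum_congr rfl fun b hb => ?_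
    rw [Finset.mem_compl] at hb
    have hab : a ≠ b := fun h => hb (h ▸ ha)
    have h1 : p ≠ a := fun h => hpx (h ▸ ha)
    have h2 : q ≠ b := fun h => hb (h ▸ hqx)
    beta_reduce
    rw [nbrSum_sideSign hpq, card_exchange ha hb, hxe]
    congr 1
    simp only [sideSign, Finset.mem_insert, Finset.mem_erase, h1, h2, hpx, hqx, ne_eq,
      not_false_eq_true, and_false, or_false, false_or, and_true]
    by_cases h4 : a = q <;> by_cases h5 : b = p <;>
      simp [h4, h5, eq_comm (a := q), eq_comm (a := p)] <;> ring
  have hxc : xᶜ = insert p (((Finset.univ.erase p).erase q) \ u) := by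
    ext z
    simp only [Finset.mem_compl, hx, Finset.mem_insert, Finset.mem_sdiff, Finset.mem_erase,
      Finset.mem_univ, and_true]
    constructor
    · intro h
      by_cases hz : z = p
      · exact Or.inl hz
      · right; tauto
    · rintro (rfl | h)
      · exact fun h => h.elim hpq hpu
      · tauto
  have hrhs : nbrSum x (fun y => nbrSum y (fun z => φ (D y z) * sideSign p q z)) =
      -4 * (ε * φ (D x (insert p u)) + exchangeSum ((Finset.univ.erase p).erase q)
        (fun u => φ (D (insert q u) (insert p u))) u) := by
    -- Only neighbours of `x` that separate `p` from `q` contribute. These are `u ∪ {p}`, which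
    -- gives the term with `ε`, and the exchanges inside `u`, which give the exchange sum.
    have step : nbrSum x (fun y => nbrSum y (fun z => φ (D y z) * sideSign p q z)) =
        ∑ a ∈ x, ∑ b ∈ xᶜ, -4 *
      ((if q ∈ insert b (x.erase a) ∧ p ∉ insert b (x.erase a) then
          φ (D (insert b (x.erase a)) (insert p ((insert b (x.erase a)).erase q))) else 0) +
        if p ∈ insert b (x.erase a) ∧ q ∉ insert b (x.erase a) then
          φ (D (insert b (x.erase a)) (insert q ((insert b (x.erase a)).erase p))) else 0) :=
      Finset.sum_congr rfl fun a ha => Finset.sum_congr rfl fun b hb =>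
        nbrSum_mul_sideSign hz hpq ((card_exchange ha (Finset.mem_compl.mp hb)).trans hxe)
    rw [step]
    simp only [← Finset.mul_sum]
    congr 1
    have hpn : p ∉ ((Finset.univ.erase p).erase q) \ u := by simp
    rw [hxc, hx, Finset.sum_insert hqu, Finset.erase_insert hqu, Finset.sum_insert hpn]
    have h0 : ∀ b ∈ ((Finset.univ.erase p).erase q) \ u,
        ((if q ∈ insert b u ∧ p ∉ insert b u then
          φ (D (insert b u) (insert p ((insert b u).erase q))) else 0) +
        if p ∈ insert b u ∧ q ∉ insert b u then
          φ (D (insert b u) (insert q ((insert b u).erase p))) else 0) = 0 := by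
      intro b hb
      simp only [Finset.mem_sdiff, Finset.mem_erase, Finset.mem_univ, and_true] at hb
      simp [Ne.symm hb.1.1, Ne.symm hb.1.2, hqu, hpu]
    have h1 : (if q ∈ insert p u ∧ p ∉ insert p u then
          φ (D (insert p u) (insert p ((insert p u).erase q))) else 0) +
        (if p ∈ insert p u ∧ q ∉ insert p u then
          φ (D (insert p u) (insert q ((insert p u).erase p))) else 0) =
        ε * φ (D (insert q u) (insert p u)) := by
      rw [if_neg (by simp), if_pos (by simp [hpq.symm, hqu]), zero_add,
        Finset.erase_insert hpu, hL.swap, hφ]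
    rw [Finset.sum_eq_zero h0, h1, add_zero]
    congr 1
    refine Finset.sum_congr rfl fun a ha => ?_
    have haq : a ≠ q := fun h => hqu (h ▸ ha)
    have hap : a ≠ p := fun h => hpu (h ▸ ha)
    rw [Finset.sum_insert hpn, if_neg (by simp), if_neg (by simp [haq.symm]), add_zero, zero_add]
    refine Finset.sum_congr rfl fun b hb => ?_
    simp only [Finset.mem_sdiff, Finset.mem_erase, Finset.mem_univ, and_true] at hb
    rw [if_pos (by simp [haq.symm, Ne.symm hb.1.2, hpq, hpu]),
      if_neg (by simp [hpq, hpu, Ne.symm hb.1.2]), add_zero,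
      insert_erase_insert_ne haq, Finset.insert_comm b q, Finset.erase_insert]
    simp [Ne.symm hb.1.1, hqu]
  rw [hlhs, hrhs] at hc
  linear_combination (1 / 4) * hc

end Lines

end WDRD

namespace WDRD

/-! ### Small eigenvalues: vanishing, constant differences, dictators -/

section Eigen

variable {α : Type*} [DecidableEq α]

theorem card_erase_erase {G : Finset α} {r r' : α} (hr : r ∈ G) (hr' : r' ∈ G) (hne : r ≠ r')
    {m : ℕ} (hG : G.card = m + 2) : ((G.erase r).erase r').card = m := by
  rw [Finset.card_erase_of_mem (by simp [hne.symm, hr']), Finset.card_erase_of_mem hr, hG]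
  rfl

theorem subset_erase_erase {G v : Finset α} {r r' : α} (h1 : v ⊆ G) (h2 : r ∉ v)
    (h3 : r' ∉ v) : v ⊆ (G.erase r).erase r' := by
  intro z hz
  simp only [Finset.mem_erase]
  exact ⟨fun h => h3 (h ▸ hz), fun h => h2 (h ▸ hz), h1 hz⟩

/-- A second difference has eigenvalue `kj - 1`, above the valency `(k - 1)(j - 1)` of its exchange
graph once `k + j ≥ 3`, so it vanishes. A first difference is then constant; a nonzero constant
would need eigenvalue `kj`, not `kj - 2`. Hence `σ` is constant, and `kj - 3 ≠ (k + 1)(j + 1)` makes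
it zero. For `k = 0` first differences live on the empty set and are trivially constant. -/
theorem IsEigen.eq_zero_of_low {G : Finset α} {k j : ℕ} {σ : Finset α → ℚ}
    (hG : G.card = k + j + 2) (h : IsEigen G (k + 1) ((k : ℚ) * j - 3) σ)
    (hkj : k = 0 ∨ 3 ≤ k + j) {u : Finset α} (hu : u ⊆ G) (huk : u.card = k + 1) : σ u = 0 := by
  have hτ : ∀ r ∈ G, ∀ r' ∈ G, r ≠ r' → ∀ v v', v ⊆ (G.erase r).erase r' →
      v' ⊆ (G.erase r).erase r' → v.card = k → v'.card = k →
      σ (insert r v) - σ (insert r' v) = σ (insert r v') - σ (insert r' v') := by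
    intro r hr r' hr' hne v v' hv hv' hvk hvk'
    rcases Nat.eq_zero_or_pos k with hk | hk
    · rw [hk, Finset.card_eq_zero] at hvk hvk'
      rw [hvk, hvk']
    · obtain ⟨l, rfl⟩ : ∃ l, k = l + 1 := ⟨k - 1, by omega⟩
      have hG' : ((G.erase r).erase r').card = l + j - 1 + 2 := by
        rw [card_erase_erase hr hr' hne (m := l + 1 + j) (by omega)]
        omega
      refine eq_of_exchange (f := fun v => σ (insert r v) - σ (insert r' v)) ?_ hv hv' hvk hvk'
      intro w s s' hw hs hs' hsw hs'w hss hwk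
      have h2 := (h.diff hr hr' hne).diff hs hs' hss
      have h3 := h2.eq_zero (u := w) ?_ (subset_erase_erase hw hsw hs'w) (by omega)
      · linarith
      · rw [card_erase_erase hs hs' hss (m := l + j - 1) hG', Nat.cast_sub (by omega)]
        push_cast
        have : (3 : ℚ) ≤ l + 1 + j := by exact_mod_cast (by omega : 3 ≤ l + 1 + j)
        nlinarith
  have hconst : ∀ v r r', v ⊆ G → r ∈ G → r' ∈ G → r ∉ v → r' ∉ v → r ≠ r' →
      v.card + 1 = k + 1 → σ (insert r v) = σ (insert r' v) := by
    intro v r r' hv hr hr' hrv hr'v hne hvk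
    have hvk : v.card = k := by omega
    have hv' := subset_erase_erase hv hrv hr'v
    have h1 := h.diff hr hr' hne v hv' hvk
    rw [exchangeSum_const hv' hvk (fun z hz hzk => hτ r hr r' hr' hne z v hz hv' hzk hvk),
      card_erase_erase hr hr' hne hG] at h1
    push_cast at h1
    linarith
  have h1 := h u hu huk
  rw [exchangeSum_const hu huk (fun z hz hzk => eq_of_exchange hconst hz hu hzk huk), hG] at h1
  push_cast at h1
  have h2 : ((k : ℚ) + j + 4) * σ u = 0 := by linarith
  have h3 : ((k : ℚ) + j + 4) ≠ 0 := by positivity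
  exact (mul_eq_zero.mp h2).resolve_left h3

/-- One difference raises the eigenvalue exactly to the valency `kj` of the smaller exchange graph,
where eigenfunctions are constant. -/
theorem IsEigen.diff_const {G : Finset α} {k j : ℕ} {σ : Finset α → ℚ}
    (hG : G.card = k + j + 2) (h : IsEigen G (k + 1) ((k : ℚ) * j - 1) σ) {r r' : α} (hr : r ∈ G)
    (hr' : r' ∈ G) (hne : r ≠ r') {v v' : Finset α} (hv : v ⊆ (G.erase r).erase r')
    (hv' : v' ⊆ (G.erase r).erase r') (hvk : v.card = k) (hvk' : v'.card = k) :
    σ (insert r v) - σ (insert r' v) = σ (insert r v') - σ (insert r' v') := by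
  refine (h.diff hr hr' hne).const ?_ hv hvk hv' hvk'
  rw [card_erase_erase hr hr' hne hG]
  push_cast
  ring

/-- The number of sets obtained by exchanging a point. -/
theorem exchangeSum_dictator {G : Finset α} {k j : ℕ} {σ : Finset α → ℚ}
    (hG : G.card = k + j + 2) {d : α} {ε : ℚ}
    (hσ : ∀ u, u ⊆ G → u.card = k + 1 → σ u = if d ∈ u then ε else -ε) {u : Finset α}
    (hu : u ⊆ G) (huk : u.card = k + 1) (hdu : d ∈ u) :
    exchangeSum G σ u = ((k : ℚ) - 1) * (j + 1) * ε := by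
  have hc : ((G \ u).card : ℚ) = j + 1 := by
    rw [Finset.card_sdiff_of_subset hu, hG, huk, Nat.cast_sub (by omega)]
    push_cast
    ring
  have h1 : ∀ a ∈ u, ∑ b ∈ G \ u, σ (insert b (u.erase a)) =
      (j + 1) * (ε - if a = d then 2 * ε else 0) := by
    intro a ha
    rw [← hc, ← nsmul_eq_mul, ← Finset.sum_const]
    refine Finset.sum_congr rfl fun b hb => ?_
    obtain ⟨h1, h2⟩ := exchange_mem hu huk ha hb
    have hdb : d ≠ b := fun h => (Finset.mem_sdiff.mp hb).2 (h ▸ hdu)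
    rw [hσ _ h1 h2]
    by_cases had : a = d
    · subst had; simp [hdb]; ring
    · simp [hdb, had, Ne.symm had, hdu]
  unfold exchangeSum
  rw [Finset.sum_congr rfl h1, ← Finset.mul_sum, Finset.sum_sub_distrib, Finset.sum_const,
    Finset.sum_ite_eq' u d, if_pos hdu, huk]
  push_cast [nsmul_eq_mul]
  ring

end Eigen

/-! ### Consequences for symmetric and for skew functions of the label -/

section Vanishing

variable {n e : ℕ} {D : Finset (Fin n) → Finset (Fin n) → ℕ × ℕ}

theorem card_univ_erase_erase {q p : Fin n} (hpq : p ≠ q) {k j : ℕ} (hn : n = k + j + 4) :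
    ((Finset.univ.erase p).erase q : Finset (Fin n)).card = k + j + 2 :=
  card_erase_erase (Finset.mem_univ _) (Finset.mem_univ _) hpq (by simp [hn])

/-- In the parameters `e = k + 2`, `n = k + j + 4` the eigenvalue `e(n - e) - 2n + 2 - ε` becomes
`kj - 2 - ε`, the shape suited to the comparison with valencies. -/
theorem Labelling.isEigen_symm (hL : Labelling n e D) {φ : ℕ × ℕ → ℚ}
    (hφ : ∀ i, φ i.swap = φ i) (hz : ZeroLines e (fun x y => φ (D x y))) {q p : Fin n}
    (hpq : p ≠ q) {k j : ℕ} (hk : e = k + 2) (hn : n = k + j + 4) :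
    IsEigen ((Finset.univ.erase p).erase q) (k + 1) ((k : ℚ) * j - 3)
      (fun u => φ (D (insert q u) (insert p u))) := by
  have := hL.isEigen (ε := 1) (by simpa using hφ) hz hpq (k := k + 1) hk.symm
  convert this using 1
  rw [hk, hn]
  push_cast
  ring

theorem Labelling.isEigen_skew (hL : Labelling n e D) {φ : ℕ × ℕ → ℚ}
    (hφ : ∀ i, φ i.swap = -φ i) (hz : ZeroLines e (fun x y => φ (D x y))) {q p : Fin n}
    (hpq : p ≠ q) {k j : ℕ} (hk : e = k + 2) (hn : n = k + j + 4) :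
    IsEigen ((Finset.univ.erase p).erase q) (k + 1) ((k : ℚ) * j - 1)
      (fun u => φ (D (insert q u) (insert p u))) := by
  have := hL.isEigen (ε := -1) (by simpa using hφ) hz hpq (k := k + 1) hk.symm
  convert this using 1
  rw [hk, hn]
  push_cast
  ring

/-- A symmetric function of the label with zero row and column sums vanishes on edges. -/
theorem Labelling.eq_zero_of_symm (hL : Labelling n e D) {φ : ℕ × ℕ → ℚ}
    (hφ : ∀ i, φ i.swap = φ i) (hz : ZeroLines e (fun x y => φ (D x y))) (he : 2 ≤ e)
    (hn : 2 * e ≤ n) (h7 : e = 2 ∨ 7 ≤ n) {x : Finset (Fin n)} {a b : Fin n} (hx : x.card = e)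
    (ha : a ∈ x) (hb : b ∉ x) : φ (D x (insert b (x.erase a))) = 0 := by
  obtain ⟨k, rfl⟩ : ∃ k, e = k + 2 := ⟨e - 2, by omega⟩
  obtain ⟨j, rfl⟩ : ∃ j, n = k + j + 4 := ⟨n - k - 4, by omega⟩
  have hba : b ≠ a := fun h => hb (h ▸ ha)
  have h1 := (hL.isEigen_symm hφ hz hba rfl rfl).eq_zero_of_low (j := j)
    (card_univ_erase_erase hba rfl) (by omega) (u := x.erase a)
    (subset_erase_erase (Finset.subset_univ _) (fun h => hb (Finset.mem_of_mem_erase h))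
      (Finset.notMem_erase _ _)) (by rw [Finset.card_erase_of_mem ha, hx]; rfl)
  beta_reduce at h1
  rwa [Finset.insert_erase ha] at h1

/-- A sign-valued skew function of the label with zero row and column sums forces `n = 2e`,
and is then determined by single points. -/
theorem Labelling.exists_dictator (hL : Labelling n e D) {φ : ℕ × ℕ → ℚ}
    (hφ : ∀ i, φ i.swap = -φ i) (hz : ZeroLines e (fun x y => φ (D x y))) (he : 3 ≤ e)
    (hn : 2 * e ≤ n)
    (hs : ∀ x a b, x.card = e → a ∈ x → b ∉ x → φ (D x (insert b (x.erase a))) = 1 ∨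
      φ (D x (insert b (x.erase a))) = -1) {q p : Fin n} (hqp : q ≠ p) :
    n = 2 * e ∧ ∃ d, d ≠ q ∧ d ≠ p ∧ ∃ ε : ℚ, (ε = 1 ∨ ε = -1) ∧
      ∀ u, u.card + 1 = e → q ∉ u → p ∉ u →
        φ (D (insert q u) (insert p u)) = if d ∈ u then ε else -ε := by
  obtain ⟨k, rfl⟩ : ∃ k, e = k + 1 + 2 := ⟨e - 3, by omega⟩
  obtain ⟨j, rfl⟩ : ∃ j, n = (k + 1) + j + 4 := ⟨n - k - 5, by omega⟩
  set G : Finset (Fin (k + 1 + j + 4)) := (Finset.univ.erase p).erase q with hG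
  have hcard : G.card = (k + 1) + j + 2 := card_univ_erase_erase hqp.symm rfl
  have heig := hL.isEigen_skew hφ hz hqp.symm rfl rfl
  rw [← hG] at heig
  have hσ : ∀ u, u ⊆ G → u.card = k + 2 →
      φ (D (insert q u) (insert p u)) = 1 ∨ φ (D (insert q u) (insert p u)) = -1 := by
    intro u hu huk
    have hqu : q ∉ u := fun h => by simpa [hG] using hu h
    have hpu : p ∉ u := fun h => by simpa [hG] using hu h
    have := hs (insert q u) q p (by rw [Finset.card_insert_of_notMem hqu, huk]) (by simp)
      (by simp [hqp.symm, hpu])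
    rwa [Finset.erase_insert hqu] at this
  have hsub : ∀ u, q ∉ u → p ∉ u → u ⊆ G := fun u h1 h2 =>
    subset_erase_erase (Finset.subset_univ _) h2 h1
  rcases WDRD.exists_dictator hσ (by omega) (fun r hr r' hr' hne v v' hv hv' hvk hvk' =>
    heig.diff_const hcard hr hr' hne hv hv' hvk hvk') with ⟨c, hc⟩ | ⟨d, hd, ε, hε, h⟩
  -- A nonzero constant has the valency `(k + 2)(j + 1)` as its eigenvalue, which exceeds `(k + 1)j
  -- - 1`.
  · exfalso
    obtain ⟨u, hu, huk⟩ := Finset.exists_subset_card_eq (show k + 2 ≤ G.card by omega)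
    have h1 := heig u hu huk
    beta_reduce at h1
    rw [exchangeSum_const hu huk hc, hcard, hc u hu huk] at h1
    have h2 : c ≠ 0 := by
      have := hσ u hu huk
      rw [hc u hu huk] at this
      rcases this with h | h <;> rw [h] <;> norm_num
    have h3 := mul_right_cancel₀ h2 h1
    push_cast at h3
    have : (0 : ℚ) ≤ k := by positivity
    have : (0 : ℚ) ≤ j := by positivity
    linarith
  · have hε0 : ε ≠ 0 := by rcases hε with h | h <;> rw [h] <;> norm_num
    constructor
    -- At a set containing `d` the eigenvalue equation reads `k(j + 1) = (k + 1)j - 1`, so `j = k +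
    -- 1`.
    · obtain ⟨v, hv, hvk⟩ := Finset.exists_subset_card_eq
        (show k + 1 ≤ (G.erase d).card by rw [Finset.card_erase_of_mem hd]; omega)
      have hdv : d ∉ v := fun h => by simpa using hv h
      have hu : insert d v ⊆ G := Finset.insert_subset hd (hv.trans (Finset.erase_subset _ _))
      have huk : (insert d v).card = k + 1 + 1 := by rw [Finset.card_insert_of_notMem hdv, hvk]
      have h1 := heig _ hu huk
      beta_reduce at h1
      rw [exchangeSum_dictator hcard h hu huk (by simp), h _ hu huk, if_pos (by simp)] at h1
      have h2 := mul_right_cancel₀ hε0 h1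
      push_cast at h2
      have h3 : (j : ℚ) = k + 1 := by linarith
      have h4 : j = k + 1 := by exact_mod_cast h3
      omega
    · refine ⟨d, ?_, ?_, ε, hε, fun u huk hqu hpu => h u (hsub u hqu hpu) (by omega)⟩
      · rintro rfl; simp [hG] at hd
      · rintro rfl; simp [hG] at hd

end Vanishing

/-! ### Vanishing line sums for `n > 2e` -/

section Large

variable {n e : ℕ} {D : Finset (Fin n) → Finset (Fin n) → ℕ × ℕ}

/-- Iterating the operation "row plus column" multiplies row sums by `n - e` and column sums by `e`,
up to the total. For `n ≠ 2e` the two kinds of lines can therefore be separated; for `n = 2e` all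
lines are scaled by the same factor `e`. -/
theorem rowAt_of_eq_add {f g : Finset (Fin n) → Finset (Fin n) → ℚ} {x : Finset (Fin n)}
    (h : ∀ a ∈ x, ∀ b ∉ x, g x (insert b (x.erase a)) = rowAt f x a + colAt f x b)
    {a : Fin n} (ha : a ∈ x) :
    rowAt g x a = ((n : ℚ) - x.card) * rowAt f x a + nbrSum x (f x) := by
  rw [nbrSum_eq_sum_colAt]
  conv_lhs => unfold rowAt
  rw [Finset.sum_congr rfl fun b hb => h a ha b (Finset.mem_compl.mp hb),
    Finset.sum_add_distrib, Finset.sum_const, Finset.card_compl, Fintype.card_fin, nsmul_eq_mul,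
    Nat.cast_sub (by simpa using Finset.card_le_univ x)]

theorem colAt_of_eq_add {f g : Finset (Fin n) → Finset (Fin n) → ℚ} {x : Finset (Fin n)}
    (h : ∀ a ∈ x, ∀ b ∉ x, g x (insert b (x.erase a)) = rowAt f x a + colAt f x b)
    {b : Fin n} (hb : b ∉ x) :
    colAt g x b = x.card * colAt f x b + nbrSum x (f x) := by
  rw [nbrSum_eq_sum_rowAt]
  conv_lhs => unfold colAt
  rw [Finset.sum_congr rfl fun a ha => h a ha b hb,
    Finset.sum_add_distrib, Finset.sum_const, nsmul_eq_mul, add_comm]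

/-- For `n ≠ 2e`, row sums and column sums are separately functions of the label. -/
theorem Labelling.exists_rowAt (hL : Labelling n e D) (hne : n ≠ 2 * e) {φ : ℕ × ℕ → ℚ} {ε : ℚ}
    (hε : ε * ε = 1) (hφ : ∀ i, φ i.swap = ε * φ i)
    (hk : ∀ x, x.card = e → nbrSum x (fun y => φ (D x y)) = 0) :
    (∃ ρ : ℕ × ℕ → ℚ, (∀ i, ρ i.swap = ε * ρ i) ∧ ∀ x a b, x.card = e → a ∈ x → b ∉ x →
      ρ (D x (insert b (x.erase a))) = rowAt (fun x y => φ (D x y)) x a) ∧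
    ∃ ρ : ℕ × ℕ → ℚ, (∀ i, ρ i.swap = ε * ρ i) ∧ ∀ x a b, x.card = e → a ∈ x → b ∉ x →
      ρ (D x (insert b (x.erase a))) = colAt (fun x y => φ (D x y)) x b := by
  obtain ⟨ψ, hψ, h1⟩ := hL.exists_rowAt_add_colAt hε hφ
  obtain ⟨ξ, hξ, h2⟩ := hL.exists_rowAt_add_colAt hε hψ
  have h3 : ∀ x a b, x.card = e → a ∈ x → b ∉ x → ξ (D x (insert b (x.erase a))) =
      ((n : ℚ) - e) * rowAt (fun x y => φ (D x y)) x a +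
        e * colAt (fun x y => φ (D x y)) x b := by
    intro x a b hx ha hb
    rw [h2 x a b hx ha hb,
      rowAt_of_eq_add (f := fun x y => φ (D x y)) (fun a ha b hb => h1 x a b hx ha hb) ha,
      colAt_of_eq_add (f := fun x y => φ (D x y)) (fun a ha b hb => h1 x a b hx ha hb) hb,
      hk x hx, hx]
    ring
  have h0 : (n : ℚ) - 2 * e ≠ 0 := by
    rw [sub_ne_zero]
    exact_mod_cast hne
  constructor
  -- With total zero, `ψ` is `R + C` and `ξ` is `(n - e)R + eC`; the two equations are solved for
  -- `R` here and for `C` below.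
  · refine ⟨fun i => (ξ i - e * ψ i) / (n - 2 * e), fun i => ?_, fun x a b hx ha hb => ?_⟩
    · beta_reduce
      rw [hξ, hψ]
      ring
    · beta_reduce
      rw [h3 x a b hx ha hb, h1 x a b hx ha hb]
      rw [div_eq_iff h0]
      ring
  · refine ⟨fun i => ((n - e) * ψ i - ξ i) / (n - 2 * e), fun i => ?_, fun x a b hx ha hb => ?_⟩
    · beta_reduce
      rw [hξ, hψ]
      ring
    · beta_reduce
      rw [h3 x a b hx ha hb, h1 x a b hx ha hb]
      rw [div_eq_iff h0]
      ring

theorem exists_third {α : Type*} [DecidableEq α] {s : Finset α} (h : 3 ≤ s.card) (a b : α) :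
    ∃ c ∈ s, c ≠ a ∧ c ≠ b := by
  by_contra! hc
  have : s ⊆ {a, b} := by
    intro z hz
    rw [Finset.mem_insert, Finset.mem_singleton]
    by_cases hza : z = a
    · exact Or.inl hza
    · exact Or.inr (hc z hz hza)
  have := (Finset.card_le_card this).trans Finset.card_le_two
  omega

/-- A function on at least three points whose values at any two agree up to `ε`. -/
theorem eps_symm {α : Type*} [DecidableEq α] {s : Finset α} (hs : 3 ≤ s.card) {ε : ℚ}
    (hε : ε = 1 ∨ ε = -1) {f : α → ℚ} (h : ∀ a ∈ s, ∀ b ∈ s, a ≠ b → f b = ε * f a) :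
    (∀ a ∈ s, ∀ b ∈ s, f a = f b) ∧ (ε = -1 → ∀ a ∈ s, f a = 0) := by
  rcases hε with rfl | rfl
  · refine ⟨fun a ha b hb => ?_, fun h => by norm_num at h⟩
    by_cases hab : a = b
    · rw [hab]
    · rw [h a ha b hb hab, one_mul]
  · have : ∀ a ∈ s, f a = 0 := by
      intro a ha
      obtain ⟨b, hb, hba, -⟩ := exists_third hs a a
      obtain ⟨c, hc, hca, hcb⟩ := exists_third hs a b
      have h1 := h a ha b hb hba.symm
      have h2 := h b hb c hc hcb.symm
      have h3 := h c hc a ha hca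
      linarith
    exact ⟨fun a ha b hb => by rw [this a ha, this b hb], fun _ => this⟩

/-- For `n > 2e`, a function of the label with zero total has zero row and column sums. -/
theorem Labelling.zeroLines (hL : Labelling n e D) (hQ : HasQuad n e D) (he : 2 ≤ e)
    (hn : 2 * e < n) {φ : ℕ × ℕ → ℚ} {ε : ℚ} (hε : ε = 1 ∨ ε = -1)
    (hφ : ∀ i, φ i.swap = ε * φ i)
    (hk : ∀ x, x.card = e → nbrSum x (fun y => φ (D x y)) = 0) :
    ZeroLines e (fun x y => φ (D x y)) := by
  have hε2 : ε * ε = 1 := by rcases hε with rfl | rfl <;> norm_num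
  obtain ⟨⟨ρ, hρ, hR⟩, ⟨γ, hγ, hC⟩⟩ := hL.exists_rowAt (by omega) hε2 hφ hk
  -- row sums depend on the intersection only
  have hrow : ∀ u q p, u.card + 1 = e → q ∉ u → p ∉ u →
      rowAt (fun x y => φ (D x y)) (insert q u) q = rowAt (fun x y => φ (D x y)) (insert p u) p ∧
      (q ≠ p → ρ (D (insert q u) (insert p u)) =
        rowAt (fun x y => φ (D x y)) (insert q u) q) ∧
      (ε = -1 → rowAt (fun x y => φ (D x y)) (insert q u) q = 0) := by
    intro u q p hu hq hp
    have hρu : ∀ q p, q ∉ u → p ∉ u → q ≠ p → ρ (D (insert q u) (insert p u)) =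
        rowAt (fun x y => φ (D x y)) (insert q u) q := by
      intro q p hq hp hne
      have := hR (insert q u) q p (by rw [Finset.card_insert_of_notMem hq, hu]) (by simp)
        (by simp [hne.symm, hp])
      rwa [Finset.erase_insert hq] at this
    have h3 : 3 ≤ uᶜ.card := by rw [Finset.card_compl, Fintype.card_fin]; omega
    obtain ⟨h4, h5⟩ := eps_symm (s := uᶜ) h3 hε
      (f := fun q => rowAt (fun x y => φ (D x y)) (insert q u) q) (by
        intro a ha b hb hab
        rw [Finset.mem_compl] at ha hb
        rw [← hρu a b ha hb hab, ← hρu b a hb ha hab.symm, hL.swap, hρ])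
    exact ⟨h4 q (by simpa using hq) p (by simpa using hp), hρu q p hq hp,
      fun h => h5 h q (by simpa using hq)⟩
  have hcol : ∀ (w : Finset (Fin n)) q p, w.card = e + 1 → q ∈ w → p ∈ w →
      colAt (fun x y => φ (D x y)) (w.erase q) q = colAt (fun x y => φ (D x y)) (w.erase p) p ∧
      (q ≠ p → γ (D (w.erase q) (w.erase p)) =
        colAt (fun x y => φ (D x y)) (w.erase q) q) ∧
      (ε = -1 → colAt (fun x y => φ (D x y)) (w.erase q) q = 0) := by
    intro w q p hw hq hp
    have hγw : ∀ q p, q ∈ w → p ∈ w → q ≠ p → γ (D (w.erase q) (w.erase p)) =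
        colAt (fun x y => φ (D x y)) (w.erase q) q := by
      intro q p hq hp hne
      have := hC (w.erase q) p q (by rw [Finset.card_erase_of_mem hq, hw]; rfl)
        (by simp [hne.symm, hp]) (by simp)
      rwa [Finset.erase_right_comm, Finset.insert_erase (by simp [hne, hq])] at this
    obtain ⟨h4, h5⟩ := eps_symm (s := w) (by omega) hε
      (f := fun q => colAt (fun x y => φ (D x y)) (w.erase q) q) (by
        intro a ha b hb hab
        rw [← hγw a b ha hb hab, ← hγw b a hb ha hab.symm, hL.swap, hγ])
    exact ⟨h4 q hq p hp, hγw q p hq hp, fun h => h5 h q hq⟩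
  -- In the skew case the comparison of three sets of one clique has already made all line sums
  -- zero.
  rcases hε with rfl | rfl
  swap
  · intro x hx
    constructor
    · intro a ha
      have := (hrow (x.erase a) a a (by rw [Finset.card_erase_add_one ha, hx]) (by simp)
        (by simp)).2.2 rfl
      rwa [Finset.insert_erase ha] at this
    · intro b hb
      have := (hcol (insert b x) b b (by rw [Finset.card_insert_of_notMem hb, hx]) (by simp)
        (by simp)).2.2 rfl
      rwa [Finset.erase_insert hb] at this
  -- symmetric case: `g u` is the common row sum, `h w` the common column sum
  have four : ∀ (w : Finset (Fin n)) a a' b b', w.card + 2 = e → a ∉ w → a' ∉ w → b ∉ w →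
      b' ∉ w → a ≠ a' → b ≠ b' → a ≠ b → a ≠ b' → a' ≠ b → a' ≠ b' →
      rowAt (fun x y => φ (D x y)) (insert a' (insert a w)) a' +
        rowAt (fun x y => φ (D x y)) (insert a (insert a' w)) a =
      rowAt (fun x y => φ (D x y)) (insert b' (insert b w)) b' +
        rowAt (fun x y => φ (D x y)) (insert b (insert b' w)) b := by
    intro w a a' b b' hw ha ha' hb hb' haa hbb hab hab' ha'b ha'b'
    have h1 := hQ ρ w a a' b b' hw ha ha' hb hb' haa hbb hab hab' ha'b ha'b'
    have key : ∀ s t r, s ∉ w → t ∉ w → r ∉ w → s ≠ t → s ≠ r → t ≠ r →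
        ρ (D (insert t (insert s w)) (insert s (insert r w))) =
          rowAt (fun x y => φ (D x y)) (insert t (insert s w)) t := by
      intro s t r hs ht hr hst hsr htr
      rw [Finset.insert_comm s r]
      exact (hrow (insert s w) t r (by rw [Finset.card_insert_of_notMem hs, ← hw])
        (by simp [hst.symm, ht]) (by simp [hsr.symm, hr])).2.1 htr
    have key' : ∀ s t r, s ∉ w → t ∉ w → r ∉ w → s ≠ t → s ≠ r → t ≠ r →
        ρ (D (insert t (insert s w)) (insert s (insert r w))) =
          rowAt (fun x y => φ (D x y)) (insert r (insert s w)) r := by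
      intro s t r hs ht hr hst hsr htr
      rw [key s t r hs ht hr hst hsr htr]
      exact (hrow (insert s w) t r (by rw [Finset.card_insert_of_notMem hs, ← hw])
        (by simp [hst.symm, ht]) (by simp [hsr.symm, hr])).1
    rw [Finset.insert_comm a a', key a a' b ha ha' hb haa hab ha'b,
      key a a' b' ha ha' hb' haa hab' ha'b', Finset.insert_comm a' a,
      key a' a b ha' ha hb haa.symm ha'b hab, key a' a b' ha' ha hb' haa.symm ha'b' hab',
      key' b a b' hb ha hb' hab.symm hbb hab', key' b a' b' hb ha' hb' ha'b.symm hbb ha'b',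
      Finset.insert_comm b b', key' b' a b hb' ha hb hab'.symm hbb.symm hab,
      key' b' a' b hb' ha' hb ha'b'.symm hbb.symm ha'b] at h1
    rw [Finset.insert_comm a' a]
    linarith
  have fourCol : ∀ (w : Finset (Fin n)) a a' b b', w.card + 2 = e → a ∉ w → a' ∉ w → b ∉ w →
      b' ∉ w → a ≠ a' → b ≠ b' → a ≠ b → a ≠ b' → a' ≠ b → a' ≠ b' →
      colAt (fun x y => φ (D x y)) (insert a (insert a' w)) b =
        colAt (fun x y => φ (D x y)) (insert a (insert a' w)) b' := by
    intro w a a' b b' hw ha ha' hb hb' haa hbb hab hab' ha'b ha'b'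
    have key : ∀ s t r, s ∉ w → t ∉ w → r ∉ w → s ≠ t → s ≠ r → t ≠ r →
        γ (D (insert s (insert t w)) (insert s (insert r w))) =
          colAt (fun x y => φ (D x y)) (insert s (insert t w)) r ∧
        colAt (fun x y => φ (D x y)) (insert s (insert t w)) r =
          colAt (fun x y => φ (D x y)) (insert s (insert r w)) t := by
      intro s t r hs ht hr hst hsr htr
      have h1 : (insert r (insert s (insert t w))).erase r = insert s (insert t w) :=
        Finset.erase_insert (by simp [hsr.symm, htr.symm, hr])
      have h2 : (insert r (insert s (insert t w))).erase t = insert s (insert r w) := by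
        rw [Finset.insert_comm s t, Finset.insert_comm r t, Finset.insert_comm r s]
        exact Finset.erase_insert (by simp [hst.symm, htr, ht])
      have h3 := hcol (insert r (insert s (insert t w))) r t
        (by rw [Finset.card_insert_of_notMem (by simp [hsr.symm, htr.symm, hr]),
          Finset.card_insert_of_notMem (by simp [hst, hs]), Finset.card_insert_of_notMem ht, ← hw])
        (by simp) (by simp)
      rw [h1, h2] at h3
      exact ⟨h3.2.1 htr.symm, h3.1⟩
    have quad : ∀ a a' b b', a ∉ w → a' ∉ w → b ∉ w → b' ∉ w → a ≠ a' → b ≠ b' → a ≠ b →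
        a ≠ b' → a' ≠ b → a' ≠ b' →
        colAt (fun x y => φ (D x y)) (insert a (insert a' w)) b +
          colAt (fun x y => φ (D x y)) (insert a (insert a' w)) b' =
        colAt (fun x y => φ (D x y)) (insert b (insert b' w)) a +
          colAt (fun x y => φ (D x y)) (insert b (insert b' w)) a' := by
      intro a a' b b' ha ha' hb hb' haa hbb hab hab' ha'b ha'b'
      have h1 := hQ γ w a a' b b' hw ha ha' hb hb' haa hbb hab hab' ha'b ha'b'
      rw [(key a a' b ha ha' hb haa hab ha'b).1, (key a a' b' ha ha' hb' haa hab' ha'b').1,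
        Finset.insert_comm a a', (key a' a b ha' ha hb haa.symm ha'b hab).1,
        (key a' a b' ha' ha hb' haa.symm ha'b' hab').1,
        Finset.insert_comm a b, Finset.insert_comm a' b, Finset.insert_comm a b',
        Finset.insert_comm a' b',
        (key b a b' hb ha hb' hab.symm hbb hab').1, (key b a' b' hb ha' hb' ha'b.symm hbb ha'b').1,
        (key b a b' hb ha hb' hab.symm hbb hab').2, (key b a' b' hb ha' hb' ha'b.symm hbb ha'b').2,
        Finset.insert_comm b b', (key b' a b hb' ha hb hab'.symm hbb.symm hab).1,
        (key b' a' b hb' ha' hb ha'b'.symm hbb.symm ha'b).1,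
        (key b' a b hb' ha hb hab'.symm hbb.symm hab).2,
        (key b' a' b hb' ha' hb ha'b'.symm hbb.symm ha'b).2] at h1
      rw [Finset.insert_comm a a', Finset.insert_comm b b']
      linarith
    -- The column sum depends only on the union of `x` and the entering point. The three splittings
    -- of four points into two pairs relate the values at `w` plus three of them, and together make
    -- all four values equal.
    have h1 := quad a a' b b' ha ha' hb hb' haa hbb hab hab' ha'b ha'b'
    have h2 := quad a b a' b' ha hb ha' hb' hab ha'b' haa hab' ha'b.symm hbb
    have h3 := quad a b' a' b ha hb' ha' hb hab' ha'b haa hab ha'b'.symm hbb.symm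
    -- express all values through the four triples
    have e1 := (key a a' b ha ha' hb haa hab ha'b).2
    have e2 := (key a a' b' ha ha' hb' haa hab' ha'b').2
    have e3 := (key a b b' ha hb hb' hab hab' hbb).2
    have e4 := (key b a b' hb ha hb' hab.symm hbb hab').2
    have e5 := (key b a' b' hb ha' hb' ha'b.symm hbb ha'b').2
    have e6 := (key a' a b ha' ha hb haa.symm ha'b hab).2
    have e7 := (key a' a b' ha' ha hb' haa.symm ha'b' hab').2
    have e8 := (key a' b b' ha' hb hb' ha'b ha'b' hbb).2
    rw [Finset.insert_comm a' a] at e6 e7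
    rw [Finset.insert_comm b a] at e4
    rw [Finset.insert_comm b a'] at e5
    linarith
  -- Two auxiliary points outside the set give two instances of the four-point relation, one with
  -- `b` and `b'` interchanged; in their sum the auxiliary terms cancel.
  have rowEq : ∀ (w : Finset (Fin n)) a a', w.card + 2 = e → a ∉ w → a' ∉ w → a ≠ a' →
      rowAt (fun x y => φ (D x y)) (insert a (insert a' w)) a =
        rowAt (fun x y => φ (D x y)) (insert a (insert a' w)) a' := by
    intro w a a' hw ha ha' haa
    have hc : 1 < (insert a (insert a' w))ᶜ.card := by
      rw [Finset.card_compl, Fintype.card_fin,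
        Finset.card_insert_of_notMem (by simp [haa, ha]), Finset.card_insert_of_notMem ha']
      omega
    obtain ⟨b, hb, b', hb', hbb⟩ := Finset.one_lt_card.mp hc
    simp only [Finset.mem_compl, Finset.mem_insert, not_or] at hb hb'
    have sw : ∀ s t r, s ∉ w → t ∉ w → r ∉ w → s ≠ t → s ≠ r →
        rowAt (fun x y => φ (D x y)) (insert t (insert s w)) t =
          rowAt (fun x y => φ (D x y)) (insert r (insert s w)) r := by
      intro s t r hs ht hr hst hsr
      exact (hrow (insert s w) t r (by rw [Finset.card_insert_of_notMem hs, ← hw])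
        (by simp [hst.symm, ht]) (by simp [hsr.symm, hr])).1
    have h1 := four w a b a' b' hw ha hb.2.2 ha' hb'.2.2 (Ne.symm hb.1) (Ne.symm hb'.2.1) haa
      (Ne.symm hb'.1) hb.2.1 hbb
    have h2 := four w a b' a' b hw ha hb'.2.2 ha' hb.2.2 (Ne.symm hb'.1) (Ne.symm hb.2.1) haa
      (Ne.symm hb.1) hb'.2.1 hbb.symm
    have s1 := sw a b a' ha hb.2.2 ha' (Ne.symm hb.1) haa
    have s2 := sw a b' a' ha hb'.2.2 ha' (Ne.symm hb'.1) haa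
    have s3 := sw a' b a ha' hb.2.2 ha (Ne.symm hb.2.1) haa.symm
    have s4 := sw a' b' a ha' hb'.2.2 ha (Ne.symm hb'.2.1) haa.symm
    have s5 := sw b a a' hb.2.2 ha ha' hb.1 hb.2.1
    have s6 := sw b' a a' hb'.2.2 ha ha' hb'.1 hb'.2.1
    rw [Finset.insert_comm a' a] at s1 s2
    linarith
  intro x hx
  constructor
  · intro a ha
    have hall : ∀ a' ∈ x, rowAt (fun x y => φ (D x y)) x a' =
        rowAt (fun x y => φ (D x y)) x a := by
      intro a' ha'
      by_cases haa : a' = a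
      · rw [haa]
      · have ha'' : a ∈ x.erase a' := by simp [ha, Ne.symm haa]
        have := rowEq ((x.erase a').erase a) a' a
          (by rw [Finset.card_erase_of_mem ha'', Finset.card_erase_of_mem ha', hx]; omega)
          (by simp) (by simp) haa
        rwa [Finset.insert_erase ha'', Finset.insert_erase ha'] at this
    have h1 := hk x hx
    rw [nbrSum_eq_sum_rowAt (fun x y => φ (D x y)), Finset.sum_congr rfl hall, Finset.sum_const,
      hx, nsmul_eq_mul] at h1
    have h2 : (e : ℚ) ≠ 0 := by
      have : e ≠ 0 := by omega
      exact_mod_cast this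
    exact (mul_eq_zero.mp h1).resolve_left h2
  · intro b hb
    have hall : ∀ b' ∈ xᶜ, colAt (fun x y => φ (D x y)) x b' =
        colAt (fun x y => φ (D x y)) x b := by
      intro b' hb'
      rw [Finset.mem_compl] at hb'
      by_cases hbb : b' = b
      · rw [hbb]
      · obtain ⟨a, ha, a', ha', haa⟩ := Finset.one_lt_card.mp (show 1 < x.card by omega)
        have ha'' : a' ∈ x.erase a := by simp [ha', Ne.symm haa]
        have := fourCol ((x.erase a).erase a') a a' b' b
          (by rw [Finset.card_erase_of_mem ha'', Finset.card_erase_of_mem ha, hx]; omega)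
          (by simp) (by simp) (by simp [hb']) (by simp [hb]) haa hbb
          (fun h => hb' (h ▸ ha)) (fun h => hb (h ▸ ha)) (fun h => hb' (h ▸ ha'))
          (fun h => hb (h ▸ ha'))
        rwa [Finset.insert_erase ha'', Finset.insert_erase ha] at this
    have h1 := hk x hx
    rw [nbrSum_eq_sum_colAt (fun x y => φ (D x y)), Finset.sum_congr rfl hall, Finset.sum_const,
      Finset.card_compl, hx, Fintype.card_fin, nsmul_eq_mul] at h1
    have h2 : ((n - e : ℕ) : ℚ) ≠ 0 := by
      have : n - e ≠ 0 := by omega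
      exact_mod_cast this
    exact (mul_eq_zero.mp h1).resolve_left h2

end Large

end WDRD

namespace WDRD

/-! ### The sign and the support of a label -/

section ArcSign

/-- The sign function of a label and its reverse. -/
def arcSign (i₀ i : ℕ × ℕ) : ℚ := (if i = i₀ then 1 else 0) - if i = i₀.swap then 1 else 0

/-- The indicator of a label and its reverse. -/
def arcSupp (i₀ i : ℕ × ℕ) : ℚ := if i = i₀ ∨ i = i₀.swap then 1 else 0

theorem swap_eq_iff (i j : ℕ × ℕ) : i.swap = j ↔ i = j.swap := by
  constructor
  · rintro rfl; simp
  · rintro rfl; simp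

theorem arcSign_swap (i₀ i : ℕ × ℕ) : arcSign i₀ i.swap = -arcSign i₀ i := by
  simp only [arcSign, swap_eq_iff, Prod.swap_swap]
  ring

theorem arcSupp_swap (i₀ i : ℕ × ℕ) : arcSupp i₀ i.swap = arcSupp i₀ i := by
  simp only [arcSupp, swap_eq_iff, Prod.swap_swap, or_comm]

theorem arcSupp_eq (i₀ i : ℕ × ℕ) : arcSupp i₀ i = 0 ∨ arcSupp i₀ i = 1 := by
  unfold arcSupp
  split_ifs <;> simp

theorem arcSign_of_supp {i₀ i : ℕ × ℕ} (h₀ : i₀.swap ≠ i₀) (h : arcSupp i₀ i = 1) :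
    arcSign i₀ i = 1 ∨ arcSign i₀ i = -1 := by
  have h1 : i = i₀ ∨ i = i₀.swap := by
    by_contra hn
    simp [arcSupp, hn] at h
  rcases h1 with rfl | rfl
  · left; simp [arcSign, h₀.symm]
  · right; simp [arcSign, h₀]

theorem arcSign_of_not_supp {i₀ i : ℕ × ℕ} (h : arcSupp i₀ i = 0) : arcSign i₀ i = 0 := by
  have h1 : ¬(i = i₀ ∨ i = i₀.swap) := by
    intro hn
    simp [arcSupp, hn] at h
  rw [not_or] at h1
  simp [arcSign, h1.1, h1.2]

theorem arcSign_mul_self {i₀ i : ℕ × ℕ} (h₀ : i₀.swap ≠ i₀) :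
    arcSign i₀ i * arcSign i₀ i = arcSupp i₀ i := by
  rcases arcSupp_eq i₀ i with h | h
  · rw [h, arcSign_of_not_supp h, zero_mul]
  · rw [h]
    rcases arcSign_of_supp h₀ h with h | h <;> rw [h] <;> norm_num

theorem skew_of_supp {i₀ i : ℕ × ℕ} (h₀ : i₀.swap ≠ i₀) {ψ : ℕ × ℕ → ℚ}
    (hψ : ∀ i, ψ i.swap = -ψ i) (h : arcSupp i₀ i = 1) : ψ i = ψ i₀ * arcSign i₀ i := by
  have h1 : i = i₀ ∨ i = i₀.swap := by
    by_contra hn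
    simp [arcSupp, hn] at h
  rcases h1 with rfl | rfl
  · simp [arcSign, h₀.symm]
  · simp [arcSign, h₀, hψ]

end ArcSign

/-! ### Excluding `J(n, e)` for `n > 2e` and `e ≥ 3` -/

section Regular

variable {n e : ℕ} {D : Finset (Fin n) → Finset (Fin n) → ℕ × ℕ}

theorem nbrSum_const {x : Finset (Fin n)} (hx : x.card = e) (c : ℚ) :
    nbrSum x (fun _ => c) = e * ((n : ℚ) - e) * c := by
  unfold nbrSum
  simp only [Finset.sum_const, Finset.card_compl, Fintype.card_fin, hx, nsmul_eq_mul]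
  rw [Nat.cast_sub (by rw [← hx]; simpa using Finset.card_le_univ x)]
  ring

/-- Subtracting its mean makes the total of a function of the label zero. -/
theorem Labelling.exists_centered (hL : Labelling n e D) (φ : ℕ × ℕ → ℚ) :
    ∃ k, ∀ x, x.card = e →
      nbrSum x (fun y => (e * ((n : ℚ) - e)) * φ (D x y) - k) = 0 := by
  obtain ⟨k, hk⟩ := hL.total φ
  refine ⟨k, fun x hx => ?_⟩
  have h1 := nbrSum_const (n := n) hx k
  have h2 := hk x hx
  unfold nbrSum at *
  simp only [Finset.sum_sub_distrib, ← Finset.mul_sum]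
  rw [h2]
  linarith

/-- There is an edge with label `i₀`. -/
def HasLabel (e : ℕ) (D : Finset (Fin n) → Finset (Fin n) → ℕ × ℕ) (i₀ : ℕ × ℕ) : Prop :=
  ∃ x a b, x.card = e ∧ a ∈ x ∧ b ∉ x ∧ D x (insert b (x.erase a)) = i₀

theorem arcSupp_self (i₀ : ℕ × ℕ) : arcSupp i₀ i₀ = 1 := by simp [arcSupp]

/-- If a label and its reverse have constant multiplicity, they are the only edge labels. -/
theorem arcSupp_eq_one_of_const {i₀ : ℕ × ℕ} (hi : HasLabel e D i₀) {c : ℚ}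
    (h : ∀ x a b, x.card = e → a ∈ x → b ∉ x → arcSupp i₀ (D x (insert b (x.erase a))) = c)
    {x : Finset (Fin n)} {a b : Fin n} (hx : x.card = e) (ha : a ∈ x) (hb : b ∉ x) :
    arcSupp i₀ (D x (insert b (x.erase a))) = 1 := by
  obtain ⟨x', a', b', hx', ha', hb', h'⟩ := hi
  rw [h x a b hx ha hb, ← h x' a' b' hx' ha' hb', h', arcSupp_self]

/-- The centred support is symmetric with zero line sums, so it vanishes on edges; the support is
thus constant there, and it is not zero because the label occurs. -/
theorem Labelling.arcSupp_eq_one (hL : Labelling n e D) (hQ : HasQuad n e D) (he : 2 ≤ e)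
    (hn : 2 * e < n) {i₀ : ℕ × ℕ} (hi : HasLabel e D i₀) {x : Finset (Fin n)} {a b : Fin n}
    (hx : x.card = e) (ha : a ∈ x) (hb : b ∉ x) :
    arcSupp i₀ (D x (insert b (x.erase a))) = 1 := by
  obtain ⟨k, hk⟩ := hL.exists_centered (arcSupp i₀)
  have hφ : ∀ i : ℕ × ℕ, (e * ((n : ℚ) - e)) * arcSupp i₀ i.swap - k =
      (e * ((n : ℚ) - e)) * arcSupp i₀ i - k := fun i => by rw [arcSupp_swap]
  have hz := hL.zeroLines hQ he hn (φ := fun i => (e * ((n : ℚ) - e)) * arcSupp i₀ i - k)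
    (Or.inl rfl) (by simpa using hφ) hk
  have h0 : (e * ((n : ℚ) - e)) ≠ 0 := by
    have h1 : (e : ℚ) ≠ 0 := by
      have : e ≠ 0 := by omega
      exact_mod_cast this
    have h2 : (n : ℚ) - e ≠ 0 := by
      rw [sub_ne_zero]
      have : n ≠ e := by omega
      exact_mod_cast this
    exact mul_ne_zero h1 h2
  refine arcSupp_eq_one_of_const hi (c := k / (e * ((n : ℚ) - e))) ?_ hx ha hb
  intro x a b hx ha hb
  have := hL.eq_zero_of_symm (φ := fun i => (e * ((n : ℚ) - e)) * arcSupp i₀ i - k) hφ hz he (by omega) (by omega) hx ha hb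
  rw [eq_div_iff h0]
  linarith

/-- The sign is now `±1` on every edge, skew, with zero line sums, and then a dictator exists only
for `n = 2e`. -/
theorem Labelling.false_of_lt (hL : Labelling n e D) (hQ : HasQuad n e D) (he : 3 ≤ e)
    (hn : 2 * e < n) {i₀ : ℕ × ℕ} (hi : HasLabel e D i₀) (h₀ : i₀.swap ≠ i₀) : False := by
  have h1 : ZeroLines e (fun x y => arcSign i₀ (D x y)) :=
    hL.zeroLines hQ (by omega) hn (φ := arcSign i₀) (Or.inr rfl)
      (fun i => by rw [arcSign_swap]; ring) (hL.total_skew _ (arcSign_swap i₀))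
  have h2 := hL.exists_dictator (arcSign_swap i₀) h1 he (by omega)
    (fun x a b hx ha hb => arcSign_of_supp h₀
      (hL.arcSupp_eq_one hQ (by omega) hn hi hx ha hb))
    (q := ⟨0, by omega⟩) (p := ⟨1, by omega⟩) (by simp)
  omega

end Regular

/-! ### Signs that depend on one exchanged point only -/

section Pure

variable {n e : ℕ} {D : Finset (Fin n) → Finset (Fin n) → ℕ × ℕ}

/-- At `x`, the value of `f` on an exchange only depends on the point that leaves. -/
def RowsOnly (f : Finset (Fin n) → Finset (Fin n) → ℚ) (x : Finset (Fin n)) : Prop :=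
  ∀ a ∈ x, ∀ b ∉ x, ∀ b' ∉ x, f x (insert b (x.erase a)) = f x (insert b' (x.erase a))

/-- At `x`, the value of `f` on an exchange only depends on the point that enters. -/
def ColsOnly (f : Finset (Fin n) → Finset (Fin n) → ℚ) (x : Finset (Fin n)) : Prop :=
  ∀ b ∉ x, ∀ a ∈ x, ∀ a' ∈ x, f x (insert b (x.erase a)) = f x (insert b (x.erase a'))

/-- The four-term exchange property at `x`. -/
def FourTerm (f : Finset (Fin n) → Finset (Fin n) → ℚ) (x : Finset (Fin n)) : Prop :=
  ∀ a ∈ x, ∀ a' ∈ x, ∀ b ∉ x, ∀ b' ∉ x,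
    f x (insert b (x.erase a)) + f x (insert b' (x.erase a')) =
      f x (insert b' (x.erase a)) + f x (insert b (x.erase a'))

/-- If one row takes two different values in columns `b₀` and `b₁`, every row has the same
difference there. As only two values are available, all rows agree in column `b₀`, and the four-term
identity carries the agreement to every column. -/
theorem FourTerm.rowsOnly_or_colsOnly {f : Finset (Fin n) → Finset (Fin n) → ℚ}
    {x : Finset (Fin n)} (h : FourTerm f x) {c d : ℚ}
    (h2 : ∀ a ∈ x, ∀ b ∉ x, f x (insert b (x.erase a)) = c ∨ f x (insert b (x.erase a)) = d) :
    RowsOnly f x ∨ ColsOnly f x := by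
  by_cases hr : RowsOnly f x
  · exact Or.inl hr
  right
  unfold RowsOnly at hr
  push Not at hr
  obtain ⟨a₀, ha₀, b₀, hb₀, b₁, hb₁, hne⟩ := hr
  have key : ∀ a ∈ x, f x (insert b₀ (x.erase a)) = f x (insert b₀ (x.erase a₀)) := by
    intro a ha
    have h1 := h a ha a₀ ha₀ b₀ hb₀ b₁ hb₁
    rcases h2 a ha b₀ hb₀ with h3 | h3 <;> rcases h2 a ha b₁ hb₁ with h4 | h4 <;>
      rcases h2 a₀ ha₀ b₀ hb₀ with h5 | h5 <;> rcases h2 a₀ ha₀ b₁ hb₁ with h6 | h6 <;>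
      rw [h3, h4, h5, h6] at h1 <;> rw [h5, h6] at hne <;> rw [h3, h5] <;>
      first
      | exact absurd rfl hne
      | exact absurd (by linarith) hne
  have key' : ∀ a ∈ x, ∀ b ∉ x, f x (insert b (x.erase a)) = f x (insert b (x.erase a₀)) := by
    intro a ha b hb
    have h1 := h a ha a₀ ha₀ b₀ hb₀ b hb
    rw [key a ha] at h1
    linarith
  intro b hb a ha a' ha'
  rw [key' a ha b hb, key' a' ha' b hb]

theorem exists_pair_eq {α : Type*} [DecidableEq α] {s : Finset α} (hs : 3 ≤ s.card) {f : α → ℚ}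
    (hf : ∀ a ∈ s, f a = 1 ∨ f a = -1) : ∃ a ∈ s, ∃ a' ∈ s, a ≠ a' ∧ f a = f a' := by
  obtain ⟨a, ha⟩ : s.Nonempty := Finset.card_pos.mp (by omega)
  obtain ⟨b, hb, hba, -⟩ := exists_third hs a a
  obtain ⟨c, hc, hca, hcb⟩ := exists_third hs a b
  by_cases h1 : f a = f b
  · exact ⟨a, ha, b, hb, hba.symm, h1⟩
  by_cases h2 : f a = f c
  · exact ⟨a, ha, c, hc, hca.symm, h2⟩
  refine ⟨b, hb, c, hc, hcb.symm, ?_⟩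
  rcases hf a ha with ha' | ha' <;> rcases hf b hb with hb' | hb' <;>
    rcases hf c hc with hc' | hc' <;> rw [ha', hb'] at h1 <;> rw [ha', hc'] at h2 <;>
    rw [hb', hc'] <;> first | exact absurd rfl h1 | exact absurd rfl h2

theorem exists_good {α : Type*} [DecidableEq α] {s : Finset α} (hs : 3 ≤ s.card) {p q : α → Prop}
    (hp : ∀ b ∈ s, ∀ b' ∈ s, b ≠ b' → ¬(p b ∧ p b'))
    (hq : ∀ b ∈ s, ∀ b' ∈ s, b ≠ b' → ¬(q b ∧ q b')) : ∃ b ∈ s, ¬p b ∧ ¬q b := by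
  have one : ∀ p : α → Prop, (∀ b ∈ s, ∀ b' ∈ s, b ≠ b' → ¬(p b ∧ p b')) →
      ∃ c, ∀ b ∈ s, b ≠ c → ¬p b := by
    intro p hp
    by_cases h : ∃ c ∈ s, p c
    · obtain ⟨c, hc, hpc⟩ := h
      exact ⟨c, fun b hb hbc hpb => hp b hb c hc hbc ⟨hpb, hpc⟩⟩
    · push Not at h
      obtain ⟨c, hc⟩ : s.Nonempty := Finset.card_pos.mp (by omega)
      exact ⟨c, fun b hb _ => h b hb⟩
  obtain ⟨c, hc⟩ := one p hp
  obtain ⟨d, hd⟩ := one q hq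
  obtain ⟨b, hb, h1, h2⟩ := exists_third hs c d
  exact ⟨b, hb, hc b hb h1, hd b hb h2⟩

/-- A skew sign function of the label is not, at every set, a function of the leaving point
only or of the entering point only. -/
theorem Labelling.false_of_pure (hL : Labelling n e D) (he : 3 ≤ e) (hn : e + 3 ≤ n)
    {φ : ℕ × ℕ → ℚ} (hφ : ∀ i, φ i.swap = -φ i)
    (hs : ∀ x a b, x.card = e → a ∈ x → b ∉ x → φ (D x (insert b (x.erase a))) = 1 ∨
      φ (D x (insert b (x.erase a))) = -1)
    (hp : ∀ x, x.card = e → RowsOnly (fun x y => φ (D x y)) x ∨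
      ColsOnly (fun x y => φ (D x y)) x) : False := by
  have hsw : ∀ x y, φ (D y x) = -φ (D x y) := fun x y => by rw [hL.swap, hφ]
  have hne : ∀ x a b, x.card = e → a ∈ x → b ∉ x → φ (D x (insert b (x.erase a))) ≠ 0 := by
    intro x a b hx ha hb h
    rcases hs x a b hx ha hb with h1 | h1 <;> rw [h1] at h <;> norm_num at h
  obtain ⟨x, hx⟩ : ∃ x : Finset (Fin n), x.card = e := by
    obtain ⟨x, -, hx⟩ := Finset.exists_subset_card_eq
      (show e ≤ (Finset.univ : Finset (Fin n)).card by simp; omega)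
    exact ⟨x, hx⟩
  have hxc : 3 ≤ xᶜ.card := by rw [Finset.card_compl, Fintype.card_fin]; omega
  obtain ⟨a₀, ha₀⟩ : x.Nonempty := Finset.card_pos.mp (by omega)
  obtain ⟨b₀, hb₀⟩ : xᶜ.Nonempty := Finset.card_pos.mp (by omega)
  rw [Finset.mem_compl] at hb₀
  rcases hp x hx with hr | hc
  · -- neighbours through a common row are not both rows-only
    have hbad : ∀ a ∈ x, ∀ b ∈ xᶜ, ∀ b' ∈ xᶜ, b ≠ b' →
        ¬(RowsOnly (fun x y => φ (D x y)) (insert b (x.erase a)) ∧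
          RowsOnly (fun x y => φ (D x y)) (insert b' (x.erase a))) := by
      rintro a ha b hb b' hb' hbb ⟨h1, h2⟩
      rw [Finset.mem_compl] at hb hb'
      have hab : a ≠ b := fun h => hb (h ▸ ha)
      have hab' : a ≠ b' := fun h => hb' (h ▸ ha)
      have h3 := h1 b (by simp) a (by simp [hab]) b' (by simp [hbb.symm, hb'])
      have h4 := h2 b' (by simp) a (by simp [hab']) b (by simp [hbb, hb])
      rw [Finset.erase_insert (by simp [hb]), Finset.insert_erase ha] at h3
      rw [Finset.erase_insert (by simp [hb']), Finset.insert_erase ha] at h4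
      have h5 := hr a ha b hb b' hb'
      have h6 := hne x a b hx ha hb
      beta_reduce at h3 h4 h5
      rw [hsw x] at h3 h4
      rw [hsw (insert b (x.erase a)) (insert b' (x.erase a)), ← h3] at h4
      exact h6 (by linarith)
    -- Two rows with equal sign have a column `b` in which both neighbours `y`, `y'` of `x` are
    -- columns-only. On the triangle `x, y, y'` this gives `φ(y, x) = φ(y, y')` and `φ(y', x) =
    -- φ(y', y)`, incompatible with `φ(x, y) = φ(x, y')` for a skew sign.
    obtain ⟨a, ha, a', ha', haa, heq⟩ := exists_pair_eq (s := x) (by omega)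
      (f := fun a => φ (D x (insert b₀ (x.erase a)))) (fun a ha => hs x a b₀ hx ha hb₀)
    obtain ⟨b, hb, h1, h2⟩ := exists_good hxc (hbad a ha) (hbad a' ha')
    rw [Finset.mem_compl] at hb
    have hab : a ≠ b := fun h => hb (h ▸ ha)
    have ha'b : a' ≠ b := fun h => hb (h ▸ ha')
    have c1 := (hp _ ((card_exchange ha hb).trans hx)).resolve_left h1
    have c2 := (hp _ ((card_exchange ha' hb).trans hx)).resolve_left h2
    have e1 : insert a ((insert b (x.erase a)).erase b) = x := by
      rw [Finset.erase_insert (by simp [hb]), Finset.insert_erase ha]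
    have e2 : insert a' ((insert b (x.erase a')).erase b) = x := by
      rw [Finset.erase_insert (by simp [hb]), Finset.insert_erase ha']
    have e3 : insert a ((insert b (x.erase a)).erase a') = insert b (x.erase a') := by
      rw [insert_erase_insert_ne ha'b, Finset.insert_comm, Finset.erase_right_comm,
        Finset.insert_erase (by simp [haa, ha])]
    have e4 : insert a' ((insert b (x.erase a')).erase a) = insert b (x.erase a) := by
      rw [insert_erase_insert_ne hab, Finset.insert_comm, Finset.erase_right_comm,
        Finset.insert_erase (by simp [haa.symm, ha'])]
    have h3 := c1 a (by simp [hab]) b (by simp) a' (by simp [haa.symm, ha'])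
    have h4 := c2 a' (by simp [ha'b]) b (by simp) a (by simp [haa, ha])
    rw [e1, e3] at h3
    rw [e2, e4] at h4
    beta_reduce at h3 h4 heq
    have h5 := hr a ha b hb b₀ hb₀
    have h6 := hr a' ha' b hb b₀ hb₀
    beta_reduce at h5 h6
    rw [hsw x] at h3 h4
    rw [hsw (insert b (x.erase a)) (insert b (x.erase a')), ← h3] at h4
    exact hne x a b hx ha hb (by linarith)
  · have hbad : ∀ b ∉ x, ∀ a ∈ x, ∀ a' ∈ x, a ≠ a' →
        ¬(ColsOnly (fun x y => φ (D x y)) (insert b (x.erase a)) ∧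
          ColsOnly (fun x y => φ (D x y)) (insert b (x.erase a'))) := by
      rintro b hb a ha a' ha' haa ⟨h1, h2⟩
      have hab : a ≠ b := fun h => hb (h ▸ ha)
      have ha'b : a' ≠ b := fun h => hb (h ▸ ha')
      have h3 := h1 a (by simp [hab]) b (by simp) a' (by simp [haa.symm, ha'])
      have h4 := h2 a' (by simp [ha'b]) b (by simp) a (by simp [haa, ha])
      have e1 : insert a ((insert b (x.erase a)).erase b) = x := by
        rw [Finset.erase_insert (by simp [hb]), Finset.insert_erase ha]
      have e2 : insert a' ((insert b (x.erase a')).erase b) = x := by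
        rw [Finset.erase_insert (by simp [hb]), Finset.insert_erase ha']
      have e3 : insert a ((insert b (x.erase a)).erase a') = insert b (x.erase a') := by
        rw [insert_erase_insert_ne ha'b, Finset.insert_comm, Finset.erase_right_comm,
          Finset.insert_erase (by simp [haa, ha])]
      have e4 : insert a' ((insert b (x.erase a')).erase a) = insert b (x.erase a) := by
        rw [insert_erase_insert_ne hab, Finset.insert_comm, Finset.erase_right_comm,
          Finset.insert_erase (by simp [haa.symm, ha'])]
      rw [e1, e3] at h3
      rw [e2, e4] at h4
      have h5 := hc b hb a ha a' ha'
      beta_reduce at h3 h4 h5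
      rw [hsw x] at h3 h4
      rw [hsw (insert b (x.erase a)) (insert b (x.erase a')), ← h3] at h4
      exact hne x a b hx ha hb (by linarith)
    obtain ⟨b, hb, b', hb', hbb, heq⟩ := exists_pair_eq (s := xᶜ) hxc
      (f := fun b => φ (D x (insert b (x.erase a₀))))
      (fun b hb => hs x a₀ b hx ha₀ (Finset.mem_compl.mp hb))
    rw [Finset.mem_compl] at hb hb'
    obtain ⟨a, ha, h1, h2⟩ := exists_good (by omega) (hbad b hb) (hbad b' hb')
    have hab : a ≠ b := fun h => hb (h ▸ ha)
    have hab' : a ≠ b' := fun h => hb' (h ▸ ha)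
    have c1 := (hp _ ((card_exchange ha hb).trans hx)).resolve_right h1
    have c2 := (hp _ ((card_exchange ha hb').trans hx)).resolve_right h2
    have h3 := c1 b (by simp) a (by simp [hab]) b' (by simp [hbb.symm, hb'])
    have h4 := c2 b' (by simp) a (by simp [hab']) b (by simp [hbb, hb])
    rw [Finset.erase_insert (by simp [hb]), Finset.insert_erase ha] at h3
    rw [Finset.erase_insert (by simp [hb']), Finset.insert_erase ha] at h4
    have h5 := hc b hb a ha a₀ ha₀
    have h6 := hc b' hb' a ha a₀ ha₀
    beta_reduce at h3 h4 h5 h6 heq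
    rw [hsw x] at h3 h4
    rw [hsw (insert b (x.erase a)) (insert b' (x.erase a)), ← h3] at h4
    exact hne x a b hx ha hb (by linarith)

end Pure

end WDRD

namespace WDRD

/-! ### Parity and sums over subsets -/

section Parity

variable {α : Type*}

theorem even_card_of_sum_eq_zero {s : Finset α} {f : α → ℚ}
    (hf : ∀ a ∈ s, f a = 1 ∨ f a = -1) (h : ∑ a ∈ s, f a = 0) : Even s.card := by
  have h1 : ∀ a ∈ s, f a = 2 * (if f a = 1 then 1 else 0) - 1 := by
    intro a ha
    rcases hf a ha with h | h <;> rw [h] <;> norm_num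
  rw [Finset.sum_congr rfl h1, Finset.sum_sub_distrib, ← Finset.mul_sum, Finset.sum_boole,
    Finset.sum_const, nsmul_eq_mul, mul_one, sub_eq_zero] at h
  refine ⟨(s.filter fun a => f a = 1).card, ?_⟩
  have h2 : 2 * (s.filter fun a => f a = 1).card = s.card := by exact_mod_cast h
  omega

theorem even_card_of_involution {s : Finset α} {d : α → α} (h1 : ∀ a ∈ s, d a ∈ s)
    (h2 : ∀ a ∈ s, d a ≠ a) (h3 : ∀ a ∈ s, d (d a) = a) : Even s.card := by
  have h : ∑ _a ∈ s, (1 : ZMod 2) = 0 :=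
    Finset.sum_involution (fun a _ => d a) (fun a _ => by decide) (fun a ha _ => h2 a ha)
      (fun a ha => h1 a ha) (fun a ha => h3 a ha)
  rw [Finset.sum_const, nsmul_eq_mul, mul_one] at h
  exact (ZMod.natCast_eq_zero_iff_even).mp h

variable [DecidableEq α]

/-- A function summing to zero over all `k + 1`-subsets vanishes. -/
theorem eq_zero_of_sum_subsets {T : Finset α} {k : ℕ} (hT : k + 2 ≤ T.card) {h : α → ℚ}
    (hs : ∀ y, y ⊆ T → y.card = k + 1 → ∑ q ∈ y, h q = 0) {c : α} (hc : c ∈ T) : h c = 0 := by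
  have hconst : ∀ c' ∈ T, h c' = h c := by
    intro c' hc'
    by_cases hcc : c' = c
    · rw [hcc]
    have h1 : k ≤ ((T.erase c).erase c').card := by
      rw [Finset.card_erase_of_mem (by simp [hcc, hc']), Finset.card_erase_of_mem hc]
      omega
    obtain ⟨v, hv, hvk⟩ := Finset.exists_subset_card_eq h1
    have hvT : v ⊆ T := hv.trans ((Finset.erase_subset _ _).trans (Finset.erase_subset _ _))
    have hcv : c ∉ v := fun h => by simpa using hv h
    have hcv' : c' ∉ v := fun h => by simpa using hv h
    have h2 := hs (insert c v) (Finset.insert_subset hc hvT)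
      (by rw [Finset.card_insert_of_notMem hcv, hvk])
    have h3 := hs (insert c' v) (Finset.insert_subset hc' hvT)
      (by rw [Finset.card_insert_of_notMem hcv', hvk])
    rw [Finset.sum_insert hcv] at h2
    rw [Finset.sum_insert hcv'] at h3
    linarith
  obtain ⟨y, hy, hyk⟩ := Finset.exists_subset_card_eq (show k + 1 ≤ T.card by omega)
  have h1 := hs y hy hyk
  rw [Finset.sum_congr rfl fun q hq => hconst q (hy hq), Finset.sum_const, hyk,
    nsmul_eq_mul] at h1
  refine (mul_eq_zero.mp h1).resolve_left ?_
  positivity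

theorem sum_pairs_insert {y : Finset α} {a : α} (ha : a ∉ y) (t : α → α → ℚ) :
    ∑ q ∈ insert a y, ∑ r ∈ (insert a y).erase q, t q r =
      ∑ q ∈ y, ∑ r ∈ y.erase q, t q r + ∑ q ∈ y, (t q a + t a q) := by
  rw [Finset.sum_insert ha, Finset.erase_insert ha, Finset.sum_add_distrib]
  have : ∀ q ∈ y, ∑ r ∈ (insert a y).erase q, t q r = t q a + ∑ r ∈ y.erase q, t q r := by
    intro q hq
    rw [insert_erase_insert_ne (show q ≠ a from fun h => ha (h ▸ hq)), Finset.sum_insert]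
    exact fun h => ha (Finset.mem_of_mem_erase h)
  rw [Finset.sum_congr rfl this, Finset.sum_add_distrib]
  ring

/-- If the sums of `t` over the ordered pairs in `k + 2`-subsets vanish, `t` is skew. -/
theorem skew_of_sum_pairs {S : Finset α} {k : ℕ} (hS : k + 4 ≤ S.card) {t : α → α → ℚ}
    (h : ∀ x, x ⊆ S → x.card = k + 2 → ∑ q ∈ x, ∑ r ∈ x.erase q, t q r = 0) {q r : α}
    (hq : q ∈ S) (hr : r ∈ S) (hqr : q ≠ r) : t q r + t r q = 0 := by
  have step : ∀ c ∈ S, ∀ a ∈ S, ∀ b ∈ S, c ≠ a → c ≠ b → a ≠ b →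
      t c a + t a c = t c b + t b c := by
    intro c hc a ha b hb hca hcb hab
    have hT : k + 2 ≤ ((S.erase a).erase b).card := by
      rw [Finset.card_erase_of_mem (by simp [hab.symm, hb]), Finset.card_erase_of_mem ha]
      omega
    -- Subtracting the pair sums of `y ∪ {a}` and `y ∪ {b}` cancels the pairs inside `y` and leaves
    -- a sum of a one-point function over `y`.
    have := eq_zero_of_sum_subsets hT (h := fun q => (t q a + t a q) - (t q b + t b q))
      (c := c) (fun y hy hyk => by
        have hyS : y ⊆ S := hy.trans ((Finset.erase_subset _ _).trans (Finset.erase_subset _ _))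
        have hay : a ∉ y := fun h => by simpa using hy h
        have hby : b ∉ y := fun h => by simpa using hy h
        have h1 := h (insert a y) (Finset.insert_subset ha hyS)
          (by rw [Finset.card_insert_of_notMem hay, hyk])
        have h2 := h (insert b y) (Finset.insert_subset hb hyS)
          (by rw [Finset.card_insert_of_notMem hby, hyk])
        rw [sum_pairs_insert hay] at h1
        rw [sum_pairs_insert hby] at h2
        rw [Finset.sum_sub_distrib]
        linarith) (by simp [hca, hcb, hc])
    beta_reduce at this
    linarith
  have hconst : ∀ c ∈ S, ∀ a ∈ S, c ≠ a → t c a + t a c = t q r + t r q := by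
    intro c hc a ha hca
    by_cases h1 : c = q
    · subst h1
      by_cases h2 : a = r
      · rw [h2]
      · exact step c hc a ha r hr hca hqr h2
    · have h2 : t c a + t a c = t c q + t q c := by
        by_cases h2 : a = q
        · rw [h2]
        · exact step c hc a ha q hq hca h1 h2
      have h3 : t q c + t c q = t q r + t r q := by
        by_cases h3 : c = r
        · rw [h3]
        · exact step q hq c hc r hr (Ne.symm h1) hqr h3
      linarith
  -- The symmetrised function has one value on all pairs; summing over a single set shows that the
  -- value is zero.
  obtain ⟨x, hx, hxk⟩ := Finset.exists_subset_card_eq (show k + 2 ≤ S.card by omega)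
  have h1 := h x hx hxk
  have h2 : ∑ q ∈ x, ∑ r ∈ x.erase q, t q r = ∑ q ∈ x, ∑ r ∈ x.erase q, t r q := by
    refine Finset.sum_comm' ?_
    intro a b
    simp only [Finset.mem_erase]
    tauto
  have h3 : ∑ c ∈ x, ∑ a ∈ x.erase c, (t c a + t a c) = 0 := by
    simp only [Finset.sum_add_distrib]
    linarith
  rw [Finset.sum_congr rfl fun c hc => Finset.sum_congr rfl fun a ha =>
    hconst c (hx hc) a (hx (Finset.mem_of_mem_erase ha)) (Finset.ne_of_mem_erase ha).symm] at h3
  rw [Finset.sum_congr rfl fun c hc => show ∑ a ∈ x.erase c, (t q r + t r q) =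
    ((k : ℚ) + 1) * (t q r + t r q) by
      rw [Finset.sum_const, Finset.card_erase_of_mem hc, hxk, nsmul_eq_mul]; push_cast; ring] at h3
  rw [Finset.sum_const, hxk, nsmul_eq_mul, ← mul_assoc] at h3
  refine (mul_eq_zero.mp h3).resolve_left ?_
  positivity

end Parity

/-! ### The case `n = 2e`: four-term property, one-label graphs, stars -/

section Half

variable {n e : ℕ} {D : Finset (Fin n) → Finset (Fin n) → ℕ × ℕ}

/-- For `n = 2e ≥ 8`, symmetric functions of the label have the four-term property. -/
theorem Labelling.fourTerm (hL : Labelling n e D) (hn : n = 2 * e) (he : 4 ≤ e)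
    {φ : ℕ × ℕ → ℚ} (hφ : ∀ i, φ i.swap = φ i) {x : Finset (Fin n)} (hx : x.card = e) :
    FourTerm (fun x y => φ (D x y)) x := by
  obtain ⟨k, hk⟩ := hL.exists_centered φ
  set φ' : ℕ × ℕ → ℚ := fun i => (e * ((n : ℚ) - e)) * φ i - k with hφ'
  have hsym : ∀ i, φ' i.swap = φ' i := fun i => by simp only [hφ', hφ]
  obtain ⟨ψ, hψ, h1⟩ := hL.exists_rowAt_add_colAt (φ := φ') (ε := 1) (by norm_num)
    (by simpa using hsym)
  have hk' : ∀ x, x.card = e → nbrSum x (fun y => φ' (D x y)) = 0 := hk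
  have hne : (n : ℚ) - e = e := by rw [hn]; push_cast; ring
  -- Every line sum of `ψ` is `e` times that of `φ'`. The difference `eφ' - ψ` is therefore
  -- symmetric with zero line sums and vanishes on edges, so `φ'` is a term for the leaving point
  -- plus a term for the entering point.
  have hz : ZeroLines e (fun x y => (fun i => e * φ' i - ψ i) (D x y)) := by
    intro x hx
    constructor
    · intro a ha
      have h2 := rowAt_of_eq_add (f := fun x y => φ' (D x y)) (g := fun x y => ψ (D x y))
        (fun a ha b hb => h1 x a b hx ha hb) ha
      rw [hk' x hx, hx, hne] at h2
      simp only [rowAt, Finset.sum_sub_distrib, ← Finset.mul_sum] at h2 ⊢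
      linarith
    · intro b hb
      have h2 := colAt_of_eq_add (f := fun x y => φ' (D x y)) (g := fun x y => ψ (D x y))
        (fun a ha b hb => h1 x a b hx ha hb) hb
      rw [hk' x hx, hx] at h2
      simp only [colAt, Finset.sum_sub_distrib, ← Finset.mul_sum] at h2 ⊢
      linarith
  have key : ∀ a ∈ x, ∀ b ∉ x, e * φ' (D x (insert b (x.erase a))) =
      rowAt (fun x y => φ' (D x y)) x a + colAt (fun x y => φ' (D x y)) x b := by
    intro a ha b hb
    have h2 := hL.eq_zero_of_symm (φ := fun i => e * φ' i - ψ i)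
      (fun i => by simp only [hsym, hψ, one_mul]) hz (by omega) (by omega) (by omega) hx ha hb
    rw [← h1 x a b hx ha hb]
    linarith
  intro a ha a' ha' b hb b' hb'
  have e1 := key a ha b hb
  have e2 := key a' ha' b' hb'
  have e3 := key a ha b' hb'
  have e4 := key a' ha' b hb
  simp only [hφ', hne] at e1 e2 e3 e4
  have h0 : (e : ℚ) * (e * e) ≠ 0 := by
    have : (e : ℚ) ≠ 0 := by
      have : e ≠ 0 := by omega
      exact_mod_cast this
    positivity
  refine mul_left_cancel₀ h0 ?_
  linear_combination e1 + e2 - e3 - e4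

/-- Row plus column of the sign is skew on a single pair of labels, hence equal to `ν` times the
sign. Summing once more gives `(ν - e)` times a line sum equal to zero. For `ν = e` the sign would
itself be a row term plus a column term, hence pure at each set, which is excluded. -/
theorem Labelling.zeroLines_arcSign (hL : Labelling n e D) (hn : n = 2 * e) (he : 3 ≤ e)
    {i₀ : ℕ × ℕ} (h₀ : i₀.swap ≠ i₀)
    (h : ∀ x a b, x.card = e → a ∈ x → b ∉ x → arcSupp i₀ (D x (insert b (x.erase a))) = 1) :
    ZeroLines e (fun x y => arcSign i₀ (D x y)) := by
  obtain ⟨ψ, hψ, h1⟩ := hL.exists_rowAt_add_colAt (φ := arcSign i₀) (ε := -1) (by norm_num)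
    (fun i => by rw [arcSign_swap]; ring)
  have hk := hL.total_skew _ (arcSign_swap i₀)
  have hne : (n : ℚ) - e = e := by rw [hn]; push_cast; ring
  set ν := ψ i₀ with hν
  have hνs : ∀ x a b, x.card = e → a ∈ x → b ∉ x → ν * arcSign i₀ (D x (insert b (x.erase a))) =
      rowAt (fun x y => arcSign i₀ (D x y)) x a + colAt (fun x y => arcSign i₀ (D x y)) x b := by
    intro x a b hx ha hb
    rw [← h1 x a b hx ha hb, skew_of_supp (ψ := ψ) h₀ (fun i => by rw [hψ]; ring) (h x a b hx ha hb)]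
  by_cases hνe : ν = e
  · exfalso
    refine hL.false_of_pure he (by omega) (arcSign_swap i₀)
      (fun x a b hx ha hb => arcSign_of_supp h₀ (h x a b hx ha hb)) (fun x hx => ?_)
    refine FourTerm.rowsOnly_or_colsOnly ?_ (c := 1) (d := -1)
      (fun a ha b hb => arcSign_of_supp h₀ (h x a b hx ha hb))
    intro a ha a' ha' b hb b' hb'
    have e1 := hνs x a b hx ha hb
    have e2 := hνs x a' b' hx ha' hb'
    have e3 := hνs x a b' hx ha hb'
    have e4 := hνs x a' b hx ha' hb
    have h0 : ν ≠ 0 := by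
      rw [hνe]
      have : e ≠ 0 := by omega
      exact_mod_cast this
    refine mul_left_cancel₀ h0 ?_
    linear_combination e1 + e2 - e3 - e4
  · intro x hx
    constructor
    · intro a ha
      have h2 := rowAt_of_eq_add (f := fun x y => arcSign i₀ (D x y))
        (g := fun x y => ν * arcSign i₀ (D x y)) (fun a ha b hb => hνs x a b hx ha hb) ha
      rw [hk x hx, hx, hne] at h2
      simp only [rowAt, ← Finset.mul_sum] at h2 ⊢
      have h3 : (ν - e) * ∑ b ∈ xᶜ, arcSign i₀ (D x (insert b (x.erase a))) = 0 := by linarith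
      exact (mul_eq_zero.mp h3).resolve_left (sub_ne_zero.mpr hνe)
    · intro b hb
      have h2 := colAt_of_eq_add (f := fun x y => arcSign i₀ (D x y))
        (g := fun x y => ν * arcSign i₀ (D x y)) (fun a ha b hb => hνs x a b hx ha hb) hb
      rw [hk x hx, hx] at h2
      simp only [colAt, ← Finset.mul_sum] at h2 ⊢
      have h3 : (ν - e) * ∑ a ∈ x, arcSign i₀ (D x (insert b (x.erase a))) = 0 := by linarith
      exact (mul_eq_zero.mp h3).resolve_left (sub_ne_zero.mpr hνe)

/-- For `n = 2e` the edges do not all have one label up to reversal. -/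
theorem Labelling.false_of_arcSupp_eq_one (hL : Labelling n e D) (hn : n = 2 * e) (he : 3 ≤ e)
    {i₀ : ℕ × ℕ} (h₀ : i₀.swap ≠ i₀)
    (h : ∀ x a b, x.card = e → a ∈ x → b ∉ x → arcSupp i₀ (D x (insert b (x.erase a))) = 1) :
    False := by
  have hz := hL.zeroLines_arcSign hn he h₀ h
  obtain ⟨k, rfl⟩ : ∃ k, e = k + 3 := ⟨e - 3, by omega⟩
  set p : Fin n := ⟨0, by omega⟩ with hp
  -- One point `p` is fixed and the dictators of the pairs `q, p` are collected in a function `d`;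
  -- its value at `p` is irrelevant.
  have hdict : ∀ q : Fin n, ∃ d : Fin n, ∃ ε : ℚ, q ≠ p → d ≠ q ∧ d ≠ p ∧ (ε = 1 ∨ ε = -1) ∧
      ∀ u, u.card + 1 = k + 3 → q ∉ u → p ∉ u →
        arcSign i₀ (D (insert q u) (insert p u)) = if d ∈ u then ε else -ε := by
    intro q
    by_cases hq : q = p
    · exact ⟨q, 0, fun h => absurd hq h⟩
    · obtain ⟨d, hd1, hd2, ε, hε, hu⟩ := (hL.exists_dictator (arcSign_swap i₀) hz he (by omega)
        (fun x a b hx ha hb => arcSign_of_supp h₀ (h x a b hx ha hb)) hq).2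
      exact ⟨d, ε, fun _ => ⟨hd1, hd2, hε, hu⟩⟩
  choose d ε hdε using hdict
  have hS : (Finset.univ.erase p).card = 2 * k + 5 := by
    rw [Finset.card_erase_of_mem (Finset.mem_univ _), Finset.card_univ, Fintype.card_fin]
    omega
  -- The column sum at `p` is the sum over `q ∈ x` of `ε q` times `2[d q ∈ x \ q] - 1`. Spreading
  -- the -1 over the `k + 2` points of `x \ q` makes it a sum over ordered pairs in `x`.
  have hskew := fun (q r : Fin n) (hq : q ∈ Finset.univ.erase p) (hr : r ∈ Finset.univ.erase p)
      (hqr : q ≠ r) => skew_of_sum_pairs (S := Finset.univ.erase p) (k := k + 1) (by omega)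
    (t := fun q r => ε q * (2 * (if d q = r then 1 else 0) - 1 / ((k : ℚ) + 2))) (by
      intro x hx hxk
      have hpx : p ∉ x := fun h => by simpa using hx h
      have h1 := (hz x (by omega)).2 p hpx
      refine Eq.trans (Finset.sum_congr rfl fun q hq => ?_) h1
      have hqp : q ≠ p := fun h => hpx (h ▸ hq)
      obtain ⟨hd1, hd2, hε, hu⟩ := hdε q hqp
      have hc : (x.erase q).card = k + 2 := by rw [Finset.card_erase_of_mem hq, hxk]; rfl
      have h2 := hu (x.erase q) (by omega) (by simp) (by simp [hpx])
      rw [Finset.insert_erase hq] at h2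
      beta_reduce
      rw [h2, ← Finset.mul_sum, Finset.sum_sub_distrib, ← Finset.mul_sum, Finset.sum_const, hc,
        Finset.sum_ite_eq, nsmul_eq_mul]
      push_cast
      have : (k : ℚ) + 2 ≠ 0 := by positivity
      rw [mul_one_div_cancel this]
      split_ifs <;> ring) hq hr hqr
  -- Otherwise skewness for `q` and `d q` becomes `ε q * (2k + 3) = ε (d q)`, impossible for signs.
  -- So `d` is a fixed-point-free involution on the `2e - 1` points other than `p`, against parity.
  have hinv : ∀ q ∈ Finset.univ.erase p, d (d q) = q := by
    intro q hq
    have hqp : q ≠ p := Finset.ne_of_mem_erase hq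
    obtain ⟨hd1, hd2, hε, -⟩ := hdε q hqp
    obtain ⟨-, -, hε', -⟩ := hdε (d q) hd2
    by_contra hne
    have h1 := hskew q (d q) hq (by simp [hd2]) hd1.symm
    simp only [if_true, hne, if_false] at h1
    have h2 : (0 : ℚ) ≤ k := by positivity
    have h3 : (k : ℚ) + 2 ≠ 0 := by positivity
    have h4 : ε q * (2 * k + 3) = ε (d q) := by
      field_simp at h1
      linarith
    rcases hε with h | h <;> rcases hε' with h' | h' <;> rw [h, h'] at h4 <;> linarith
  have := even_card_of_involution (s := Finset.univ.erase p) (d := d)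
    (fun q hq => by simp [(hdε q (Finset.ne_of_mem_erase hq)).2.1])
    (fun q hq => (hdε q (Finset.ne_of_mem_erase hq)).1) hinv
  rw [hS] at this
  rw [Nat.even_iff] at this
  omega

/-- `δ` is the indicator of the exchanges that involve the point `c`. -/
def IsStar (e : ℕ) (D : Finset (Fin n) → Finset (Fin n) → ℕ × ℕ) (δ : ℕ × ℕ → ℚ) (c : Fin n) :
    Prop :=
  ∀ x a b, x.card = e → a ∈ x → b ∉ x →
    δ (D x (insert b (x.erase a))) = if a = c ∨ b = c then 1 else 0

/-- Row plus column of `δφ` is a function of the label. On an edge from `u ∪ {q}` to `u ∪ {p}` not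
involving `c`, its only surviving term is the exchange of `q` for `c`, so its value depends on `q`
alone; being skew on at least three points, it is zero. -/
theorem Labelling.star_eq_zero (hL : Labelling n e D) (hn : e + 3 ≤ n)
    {δ : ℕ × ℕ → ℚ} (hδ : ∀ i, δ i.swap = δ i) {c : Fin n} (hc : IsStar e D δ c)
    {φ : ℕ × ℕ → ℚ} (hφ : ∀ i, φ i.swap = -φ i) {x : Finset (Fin n)} {a b : Fin n}
    (hx : x.card = e) (ha : a ∈ x) (hb : b ∉ x) (hab : a = c ∨ b = c) :
    φ (D x (insert b (x.erase a))) = 0 := by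
  have hη : ∀ i, (fun i => δ i * φ i) i.swap = -1 * (fun i => δ i * φ i) i := by
    intro i
    beta_reduce
    rw [hδ, hφ]
    ring
  obtain ⟨ψ, hψ, h1⟩ := hL.exists_rowAt_add_colAt (φ := fun i => δ i * φ i) (ε := -1) (by norm_num) hη
  have key : ∀ u : Finset (Fin n), u.card + 1 = e → c ∉ u → ∀ q ∉ u, q ≠ c →
      φ (D (insert q u) (insert c u)) = 0 := by
    intro u hu hcu q hq hqc
    have h2 : ∀ q p, q ∉ u → p ∉ u → q ≠ c → p ≠ c → q ≠ p →
        ψ (D (insert q u) (insert p u)) = φ (D (insert q u) (insert c u)) := by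
      intro q p hq hp hqc hpc hqp
      have hx : (insert q u).card = e := by rw [Finset.card_insert_of_notMem hq, hu]
      have hcx : c ∉ insert q u := by simp [hqc.symm, hcu]
      have h3 := h1 (insert q u) q p hx (by simp) (by simp [hqp.symm, hp])
      have h4 : colAt (fun x y => δ (D x y) * φ (D x y)) (insert q u) p = 0 := by
        refine Finset.sum_eq_zero fun a ha => ?_
        have hac : a ≠ c := fun h => hcx (h ▸ ha)
        beta_reduce
        rw [hc _ a p hx ha (by simp [hqp.symm, hp])]
        simp [hac, hpc]
      have h5 : rowAt (fun x y => δ (D x y) * φ (D x y)) (insert q u) q =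
          φ (D (insert q u) (insert c u)) := by
        simp only [rowAt]
        rw [Finset.sum_eq_single c]
        · rw [hc _ q c hx (by simp) hcx, Finset.erase_insert hq]
          simp
        · intro b hb hbc
          rw [hc _ q b hx (by simp) (Finset.mem_compl.mp hb)]
          simp [hqc, hbc]
        · intro h
          exact absurd (Finset.mem_compl.mpr hcx) h
      rw [h4, h5, Finset.erase_insert hq, add_zero] at h3
      exact h3
    have hs : 3 ≤ (insert c u)ᶜ.card := by
      rw [Finset.card_compl, Fintype.card_fin, Finset.card_insert_of_notMem hcu]
      omega
    refine (eps_symm hs (Or.inr rfl) (f := fun q => φ (D (insert q u) (insert c u))) ?_).2 rfl q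
      (by simp [hqc, hq])
    intro q hq p hp hqp
    simp only [Finset.mem_compl, Finset.mem_insert, not_or] at hq hp
    rw [← h2 q p hq.2 hp.2 hq.1 hp.1 hqp, ← h2 p q hp.2 hq.2 hp.1 hq.1 hqp.symm, hL.swap, hψ]
  have hne : a ≠ b := fun h => hb (h ▸ ha)
  have hu : (x.erase a).card + 1 = e := by rw [Finset.card_erase_add_one ha, hx]
  rcases hab with rfl | rfl
  · have := key (x.erase a) hu (by simp) b (by simp [hb]) hne.symm
    rw [Finset.insert_erase ha] at this
    rw [hL.swap, hφ, this, neg_zero]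
  · have := key (x.erase a) hu (by simp [hb]) a (by simp) hne
    rwa [Finset.insert_erase ha] at this

/-- Both `φ` and its row-plus-column function vanish on edges involving `c`. The line of `c`
therefore sums to zero, and so does every line crossing it. The remaining lines are compared within
a clique of at least three sets, where skewness makes them vanish. -/
theorem Labelling.star_zeroLines (hL : Labelling n e D) (he : 2 ≤ e) (hn : e + 3 ≤ n)
    {δ : ℕ × ℕ → ℚ} (hδ : ∀ i, δ i.swap = δ i) {c : Fin n} (hc : IsStar e D δ c)
    {φ : ℕ × ℕ → ℚ} (hφ : ∀ i, φ i.swap = -φ i) : ZeroLines e (fun x y => φ (D x y)) := by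
  obtain ⟨ψ, hψ, h1⟩ := hL.exists_rowAt_add_colAt (φ := φ) (ε := -1) (by norm_num)
    (fun i => by rw [hφ]; ring)
  have hψ' : ∀ i, ψ i.swap = -ψ i := fun i => by rw [hψ]; ring
  have out : ∀ x, x.card = e → c ∉ x → colAt (fun x y => φ (D x y)) x c = 0 ∧
      ∀ a ∈ x, rowAt (fun x y => φ (D x y)) x a = 0 := by
    intro x hx hcx
    have h2 : colAt (fun x y => φ (D x y)) x c = 0 := Finset.sum_eq_zero fun a ha =>
      hL.star_eq_zero hn hδ hc hφ hx ha hcx (Or.inr rfl)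
    refine ⟨h2, fun a ha => ?_⟩
    have h3 := h1 x a c hx ha hcx
    rw [h2, hL.star_eq_zero hn hδ hc hψ' hx ha hcx (Or.inr rfl)] at h3
    linarith
  have inn : ∀ x, x.card = e → c ∈ x → rowAt (fun x y => φ (D x y)) x c = 0 ∧
      ∀ b ∉ x, colAt (fun x y => φ (D x y)) x b = 0 := by
    intro x hx hcx
    have h2 : rowAt (fun x y => φ (D x y)) x c = 0 := Finset.sum_eq_zero fun b hb =>
      hL.star_eq_zero hn hδ hc hφ hx hcx (Finset.mem_compl.mp hb) (Or.inl rfl)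
    refine ⟨h2, fun b hb => ?_⟩
    have h3 := h1 x c b hx hcx hb
    rw [h2, hL.star_eq_zero hn hδ hc hψ' hx hcx hb (Or.inl rfl)] at h3
    linarith
  intro x hx
  by_cases hcx : c ∈ x
  · refine ⟨fun a ha => ?_, (inn x hx hcx).2⟩
    by_cases hac : a = c
    · rw [hac]; exact (inn x hx hcx).1
    have hu : (x.erase a).card + 1 = e := by rw [Finset.card_erase_add_one ha, hx]
    have hcu : c ∈ x.erase a := by simp [Ne.symm hac, hcx]
    have hs : 3 ≤ (x.erase a)ᶜ.card := by
      rw [Finset.card_compl, Fintype.card_fin]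
      omega
    have key : ∀ q p, q ∉ x.erase a → p ∉ x.erase a → q ≠ p →
        rowAt (fun x y => φ (D x y)) (insert q (x.erase a)) q =
          ψ (D (insert q (x.erase a)) (insert p (x.erase a))) := by
      intro q p hq hp hqp
      have hxq : (insert q (x.erase a)).card = e := by rw [Finset.card_insert_of_notMem hq, hu]
      have hpq : p ∉ insert q (x.erase a) := by simp only [Finset.mem_insert]; tauto
      have h3 := h1 (insert q (x.erase a)) q p hxq (by simp) hpq
      rw [(inn _ hxq (Finset.mem_insert_of_mem hcu)).2 p hpq, Finset.erase_insert hq,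
        add_zero] at h3
      exact h3.symm
    have := (eps_symm hs (Or.inr rfl)
      (f := fun q => rowAt (fun x y => φ (D x y)) (insert q (x.erase a)) q) (by
        intro q hq p hp hqp
        rw [Finset.mem_compl] at hq hp
        rw [key q p hq hp hqp, key p q hp hq hqp.symm, hL.swap, hψ])).2 rfl a (by simp)
    beta_reduce at this
    rwa [Finset.insert_erase ha] at this
  · refine ⟨(out x hx hcx).2, fun b hb => ?_⟩
    by_cases hbc : b = c
    · rw [hbc]; exact (out x hx hcx).1
    have hw : (insert b x).card = e + 1 := by rw [Finset.card_insert_of_notMem hb, hx]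
    have hcw : c ∉ insert b x := by simp [Ne.symm hbc, hcx]
    have key : ∀ q p, q ∈ insert b x → p ∈ insert b x → q ≠ p →
        colAt (fun x y => φ (D x y)) ((insert b x).erase q) q =
          ψ (D ((insert b x).erase q) ((insert b x).erase p)) := by
      intro q p hq hp hqp
      have hxq : ((insert b x).erase q).card = e := by rw [Finset.card_erase_of_mem hq, hw]; rfl
      have hpq : p ∈ (insert b x).erase q := Finset.mem_erase.mpr ⟨hqp.symm, hp⟩
      have h3 := h1 ((insert b x).erase q) p q hxq hpq (by simp)
      rw [(out _ hxq (fun h => hcw (Finset.mem_of_mem_erase h))).2 p hpq,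
        Finset.erase_right_comm, Finset.insert_erase (Finset.mem_erase.mpr ⟨hqp, hq⟩),
        zero_add] at h3
      exact h3.symm
    have := (eps_symm (s := insert b x) (by omega) (Or.inr rfl)
      (f := fun q => colAt (fun x y => φ (D x y)) ((insert b x).erase q) q) (by
        intro q hq p hp hqp
        rw [key q p hq hp hqp, key p q hp hq hqp.symm, hL.swap, hψ])).2 rfl b (by simp)
    beta_reduce at this
    rwa [Finset.erase_insert hb] at this

end Half

end WDRD

namespace WDRD

/-! ### The case `n = 2e ≥ 8` with the distance-two identity -/

section HalfQuad

variable {n e : ℕ} {D : Finset (Fin n) → Finset (Fin n) → ℕ × ℕ}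

/-- The four-term property turns the distance-two identity into one about a four-cycle. -/
theorem Labelling.four_cycle (hL : Labelling n e D) (hQ : HasQuad n e D)
    {φ : ℕ × ℕ → ℚ} (hφ : ∀ i, φ i.swap = φ i)
    (hF : ∀ x, x.card = e → FourTerm (fun x y => φ (D x y)) x) {w : Finset (Fin n)}
    {q p r r' : Fin n} (hw : w.card + 2 = e) (hq : q ∉ w) (hp : p ∉ w) (hr : r ∉ w)
    (hr' : r' ∉ w) (hqp : q ≠ p) (hqr : q ≠ r) (hqr' : q ≠ r') (hpr : p ≠ r) (hpr' : p ≠ r')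
    (hrr : r ≠ r') :
    φ (D (insert q (insert r w)) (insert p (insert r w))) +
        φ (D (insert q (insert r w)) (insert q (insert r' w))) =
      φ (D (insert p (insert r w)) (insert p (insert r' w))) +
        φ (D (insert q (insert r' w)) (insert p (insert r' w))) := by
  have hsw : ∀ x y, φ (D y x) = φ (D x y) := fun x y => by rw [hL.swap, hφ]
  have h1 := hQ φ w q r p r' hw hq hr hp hr' hqr hpr' hqp hqr' hpr.symm hrr
  have four : ∀ s t a b, s ∉ w → t ∉ w → a ∉ w → b ∉ w → s ≠ t → a ≠ b → s ≠ a → s ≠ b →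
      t ≠ a → t ≠ b →
      φ (D (insert s (insert t w)) (insert a (insert t w))) +
        φ (D (insert s (insert t w)) (insert b (insert s w))) =
      φ (D (insert s (insert t w)) (insert b (insert t w))) +
        φ (D (insert s (insert t w)) (insert a (insert s w))) := by
    intro s t a b hs ht ha hb hst hab hsa hsb hta htb
    have hx : (insert s (insert t w)).card = e := by
      rw [Finset.card_insert_of_notMem (by simp [hst, hs]), Finset.card_insert_of_notMem ht, ← hw]
    have h2 := hF _ hx s (by simp) t (by simp) a (by simp [hsa.symm, hta.symm, ha])
      b (by simp [hsb.symm, htb.symm, hb])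
    have e1 : (insert s (insert t w)).erase s = insert t w :=
      Finset.erase_insert (by simp [hst, hs])
    have e2 : (insert s (insert t w)).erase t = insert s w := by
      rw [Finset.insert_comm]
      exact Finset.erase_insert (by simp [hst.symm, ht])
    rw [e1, e2] at h2
    exact h2
  have h2 := four q r p r' hq hr hp hr' hqr hpr' hqp hqr' hpr.symm hrr
  have h3 := four p r' q r hp hr' hq hr hpr' hqr hqp.symm hpr hqr'.symm hrr.symm
  simp only [hsw _ (insert p (insert r' w))] at h3
  rw [Finset.insert_comm q p, Finset.insert_comm r p, Finset.insert_comm r r'] at h1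
  rw [Finset.insert_comm r' q] at h2
  rw [Finset.insert_comm r p, Finset.insert_comm q p] at h3
  rw [Finset.insert_comm p q] at h1 h3
  rw [Finset.insert_comm q p] at h1 h3
  rw [Finset.insert_comm r r'] at h3
  linarith

theorem exists_avoid {n k : ℕ} (s : Finset (Fin n)) (h : k + s.card ≤ n) :
    ∃ w : Finset (Fin n), w.card = k ∧ Disjoint w s := by
  obtain ⟨w, hw, hwk⟩ := Finset.exists_subset_card_eq
    (show k ≤ sᶜ.card by rw [Finset.card_compl, Fintype.card_fin]; omega)
  exact ⟨w, hwk, Finset.disjoint_left.mpr fun z hz hzs => by simpa [hzs] using hw hz⟩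

/-- The value of a symmetric function of the label with the four-term property on an exchange
only depends on the exchanged points. -/
theorem Labelling.exists_pair_function (hL : Labelling n e D) (hQ : HasQuad n e D)
    (hn : n = 2 * e) (he : 1 ≤ e) {φ : ℕ × ℕ → ℚ} (hφ : ∀ i, φ i.swap = φ i)
    (hF : ∀ x, x.card = e → FourTerm (fun x y => φ (D x y)) x) :
    ∃ π : Fin n → Fin n → ℚ, ∀ q p, q ≠ p → ∀ u : Finset (Fin n), u.card + 1 = e → q ∉ u → p ∉ u →
      φ (D (insert q u) (insert p u)) = π q p := by
  have : ∀ q p : Fin n, ∃ κ : ℚ, q ≠ p → ∀ u : Finset (Fin n), u.card + 1 = e → q ∉ u → p ∉ u →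
      φ (D (insert q u) (insert p u)) = κ := by
    intro q p
    obtain ⟨u₀, hu₀, hd⟩ := exists_avoid (k := e - 1) ({q, p} : Finset (Fin n))
      (by have := Finset.card_le_two (a := q) (b := p); omega)
    rw [Finset.disjoint_right] at hd
    have hq₀ := hd (show q ∈ ({q, p} : Finset (Fin n)) by simp)
    have hp₀ := hd (show p ∈ ({q, p} : Finset (Fin n)) by simp)
    refine ⟨φ (D (insert q u₀) (insert p u₀)), fun hqp u hu hqu hpu => ?_⟩
    refine eq_of_exchange (G := (Finset.univ.erase q).erase p) (k := e - 1)
      (f := fun u => φ (D (insert q u) (insert p u))) ?_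
      (subset_erase_erase (Finset.subset_univ _) hqu hpu)
      (subset_erase_erase (Finset.subset_univ _) hq₀ hp₀) (by omega) hu₀
    intro w r r' hw hr hr' hrw hr'w hrr hwk
    simp only [Finset.mem_erase, Finset.mem_univ, and_true] at hr hr'
    have hqw : q ∉ w := fun h => by simpa using hw h
    have hpw : p ∉ w := fun h => by simpa using hw h
    -- Adding the four-cycle identities for `q, p` and for `p, q` cancels the edges that exchange
    -- `r` for `r'`; hence `r` may be replaced by `r'` without changing the value.
    have h1 := hL.four_cycle hQ hφ hF (w := w) (by omega) hqw hpw hrw hr'w hqp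
      (Ne.symm hr.2) (Ne.symm hr'.2) (Ne.symm hr.1) (Ne.symm hr'.1) hrr
    have h2 := hL.four_cycle hQ hφ hF (w := w) (by omega) hpw hqw hrw hr'w hqp.symm
      (Ne.symm hr.1) (Ne.symm hr'.1) (Ne.symm hr.2) (Ne.symm hr'.2) hrr
    have hsw : ∀ x y, φ (D y x) = φ (D x y) := fun x y => by rw [hL.swap, hφ]
    rw [hsw (insert q (insert r w)) (insert p (insert r w)),
      hsw (insert q (insert r' w)) (insert p (insert r' w))] at h2
    linarith
  choose π hπ using this
  exact ⟨π, hπ⟩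

/-- The support is a 0-1 function of the exchanged pair with the four-term property. A constant
leaves one label up to reversal, which is excluded. On a star the sign would vanish on its own
support. On the complement of a star the lines sum to zero, and at a set avoiding the centre the
other lines hold `e` or `e - 1` signs according to their direction, so both numbers would be even.
-/
theorem Labelling.false_of_half_quad (hL : Labelling n e D) (hQ : HasQuad n e D)
    (hn : n = 2 * e) (he : 4 ≤ e) {i₀ : ℕ × ℕ} (hi : HasLabel e D i₀) (h₀ : i₀.swap ≠ i₀) :
    False := by
  obtain ⟨π, hπ⟩ := hL.exists_pair_function hQ hn (by omega) (arcSupp_swap i₀)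
    (fun _ hx => hL.fourTerm hn he (arcSupp_swap i₀) hx)
  -- values on diagonal pairs are irrelevant
  set ρ : Fin n → Fin n → ℚ := fun a b => if a = b then 0 else π a b with hρ
  have hρ' : ∀ x a b, x.card = e → a ∈ x → b ∉ x →
      arcSupp i₀ (D x (insert b (x.erase a))) = ρ a b := by
    intro x a b hx ha hb
    have hab : a ≠ b := fun h => hb (h ▸ ha)
    have := hπ a b hab (x.erase a) (by rw [Finset.card_erase_add_one ha, hx]) (by simp)
      (by simp [hb])
    rw [Finset.insert_erase ha] at this
    simp only [hρ, hab, if_false, this]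
  have pick : ∀ s t : Finset (Fin n), s.card ≤ 2 → t.card ≤ 2 → Disjoint s t →
      ∃ x : Finset (Fin n), x.card = e ∧ s ⊆ x ∧ Disjoint x t := by
    intro s t hs ht hst
    obtain ⟨w, hw, hd⟩ := exists_avoid (k := e - s.card) (s ∪ t)
      (by have := Finset.card_union_le s t; omega)
    rw [Finset.disjoint_union_right] at hd
    refine ⟨s ∪ w, ?_, Finset.subset_union_left, ?_⟩
    · rw [Finset.card_union_of_disjoint hd.1.symm, hw]
      omega
    · rw [Finset.disjoint_union_left]
      exact ⟨hst, hd.2⟩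
  have h01 : ∀ a b, a ≠ b → ρ a b = 0 ∨ ρ a b = 1 := by
    intro a b hab
    obtain ⟨x, hx, hs, ht⟩ := pick {a} {b} (by simp) (by simp) (by simpa using hab)
    rw [← hρ' x a b hx (hs (by simp)) (by simpa using ht)]
    exact arcSupp_eq _ _
  have hsymm : ∀ a b, ρ a b = ρ b a := by
    intro a b
    by_cases hab : a = b
    · rw [hab]
    obtain ⟨x, hx, hs, ht⟩ := pick {a} {b} (by simp) (by simp) (by simpa using hab)
    have ha : a ∈ x := hs (by simp)
    have hb : b ∉ x := by simpa using ht
    rw [← hρ' x a b hx ha hb, ← hρ' (insert b (x.erase a)) b a ((card_exchange ha hb).trans hx)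
      (by simp) (by simp [hab]), Finset.erase_insert (by simp [hb]), Finset.insert_erase ha,
      hL.swap, arcSupp_swap]
  have h4 : ∀ a a' b b', a ≠ a' → b ≠ b' → a ≠ b → a ≠ b' → a' ≠ b → a' ≠ b' →
      ρ a b + ρ a' b' = ρ a b' + ρ a' b := by
    intro a a' b b' haa hbb hab hab' ha'b ha'b'
    obtain ⟨x, hx, hs, ht⟩ := pick {a, a'} {b, b'} Finset.card_le_two Finset.card_le_two
      (by simp [hab.symm, hab'.symm, ha'b.symm, ha'b'.symm])
    have ha : a ∈ x := hs (by simp)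
    have ha' : a' ∈ x := hs (by simp)
    rw [Finset.disjoint_right] at ht
    have hb : b ∉ x := ht (by simp)
    have hb' : b' ∉ x := ht (by simp)
    have := hL.fourTerm hn he (arcSupp_swap i₀) hx a ha a' ha' b hb b' hb'
    simp only [hρ' x _ _ hx ha hb, hρ' x _ _ hx ha hb', hρ' x _ _ hx ha' hb,
      hρ' x _ _ hx ha' hb'] at this
    exact this
  rcases star_of_four_term (by simp; omega) h01 hsymm h4 with ⟨κ, hκ⟩ | ⟨c, hc | hc⟩
  · refine hL.false_of_arcSupp_eq_one hn (by omega) h₀ fun x a b hx ha hb =>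
      arcSupp_eq_one_of_const hi (c := κ) (fun x a b hx ha hb => ?_) hx ha hb
    rw [hρ' x a b hx ha hb]
    exact hκ a b fun h => hb (h ▸ ha)
  · have hstar : IsStar e D (arcSupp i₀) c := by
      intro x a b hx ha hb
      rw [hρ' x a b hx ha hb]
      exact hc a b fun h => hb (h ▸ ha)
    obtain ⟨x, hx, hs, -⟩ := pick {c} ∅ (by simp) (by simp) (by simp)
    have hcx : c ∈ x := hs (by simp)
    obtain ⟨b, hb⟩ : xᶜ.Nonempty := Finset.card_pos.mp (by
      rw [Finset.card_compl, Fintype.card_fin]; omega)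
    rw [Finset.mem_compl] at hb
    have h1 := hL.star_eq_zero (by omega) (arcSupp_swap i₀) hstar (arcSign_swap i₀) hx hcx hb
      (Or.inl rfl)
    have h2 := hstar x c b hx hcx hb
    rw [if_pos (Or.inl rfl)] at h2
    rcases arcSign_of_supp h₀ h2 with h3 | h3 <;> rw [h3] at h1 <;> norm_num at h1
  · have hsupp : ∀ x a b, x.card = e → a ∈ x → b ∉ x →
        arcSupp i₀ (D x (insert b (x.erase a))) = if a = c ∨ b = c then 0 else 1 := by
      intro x a b hx ha hb
      rw [hρ' x a b hx ha hb]
      exact hc a b fun h => hb (h ▸ ha)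
    have hstar : IsStar e D (fun i => 1 - arcSupp i₀ i) c := by
      intro x a b hx ha hb
      beta_reduce
      rw [hsupp x a b hx ha hb]
      split_ifs <;> norm_num
    have hz := hL.star_zeroLines (by omega) (by omega) (fun i => by rw [arcSupp_swap]) hstar
      (arcSign_swap i₀)
    obtain ⟨x, hx, -, ht⟩ := pick ∅ {c} (by simp) (by simp) (by simp)
    have hcx : c ∉ x := by simpa using ht
    have hxc : xᶜ.card = e := by rw [Finset.card_compl, Fintype.card_fin]; omega
    obtain ⟨a, ha⟩ : x.Nonempty := Finset.card_pos.mp (by omega)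
    have hac : a ≠ c := fun h => hcx (h ▸ ha)
    obtain ⟨b, hb⟩ : (xᶜ.erase c).Nonempty := Finset.card_pos.mp (by
      rw [Finset.card_erase_of_mem (by simpa using hcx)]; omega)
    rw [Finset.mem_erase, Finset.mem_compl] at hb
    have h1 : Even x.card := by
      refine even_card_of_sum_eq_zero (f := fun a => arcSign i₀ (D x (insert b (x.erase a)))) ?_
        ((hz x hx).2 b hb.2)
      intro a ha
      refine arcSign_of_supp h₀ ?_
      rw [hsupp x a b hx ha hb.2, if_neg]
      rintro (h | h)
      · exact hcx (h ▸ ha)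
      · exact hb.1 h
    have h2 : Even (xᶜ.erase c).card := by
      have hrow := (hz x hx).1 a ha
      simp only [rowAt] at hrow
      rw [← Finset.add_sum_erase _ _ (show c ∈ xᶜ by simpa using hcx)] at hrow
      have h0 : arcSign i₀ (D x (insert c (x.erase a))) = 0 :=
        arcSign_of_not_supp (by rw [hsupp x a c hx ha hcx, if_pos (Or.inr rfl)])
      rw [h0, zero_add] at hrow
      refine even_card_of_sum_eq_zero (f := fun b => arcSign i₀ (D x (insert b (x.erase a)))) ?_
        hrow
      intro b hb
      rw [Finset.mem_erase, Finset.mem_compl] at hb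
      refine arcSign_of_supp h₀ ?_
      rw [hsupp x a b hx ha hb.2, if_neg]
      rintro (h | h)
      · exact hac h
      · exact hb.1 h
    rw [Finset.card_erase_of_mem (by simpa using hcx), hxc] at h2
    rw [hx] at h1
    rw [Nat.even_iff] at h1 h2
    omega

end HalfQuad

end WDRD

namespace WDRD

/-! ### Tournaments on five points -/

section Tournament

variable {α : Type*} [DecidableEq α]

/-- There is no regular tournament on five points whose square is constant off the diagonal. -/
theorem false_of_tournament {s : Finset α} (hs : s.card = 5) {m : α → α → ℚ}
    (h1 : ∀ q ∈ s, ∀ p ∈ s, q ≠ p → m q p = 1 ∨ m q p = -1)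
    (hsk : ∀ q ∈ s, ∀ p ∈ s, q ≠ p → m p q = -m q p)
    (h0 : ∀ q ∈ s, ∑ r ∈ s.erase q, m q r = 0) {c : ℚ}
    (hc : ∀ q ∈ s, ∀ p ∈ s, q ≠ p → ∑ r ∈ (s.erase q).erase p, m q r * m r p = c) : False := by
  obtain ⟨q, hq⟩ : s.Nonempty := Finset.card_pos.mp (by omega)
  have hcard : (s.erase q).card = 4 := by rw [Finset.card_erase_of_mem hq, hs]
  -- Sum the square over all `p ≠ q`. By regularity at `r`, the inner sum without `q` is `m q r`, so
  -- each of the four `r` contributes 1.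
  have hc1 : c = 1 := by
    have e1 : ∑ p ∈ s.erase q, ∑ r ∈ (s.erase q).erase p, m q r * m r p = 4 * c := by
      rw [Finset.sum_congr rfl fun p hp => hc q hq p (Finset.mem_of_mem_erase hp)
        (Finset.ne_of_mem_erase hp).symm, Finset.sum_const, hcard, nsmul_eq_mul]
      norm_num
    have e2 : ∑ p ∈ s.erase q, ∑ r ∈ (s.erase q).erase p, m q r * m r p =
        ∑ r ∈ s.erase q, ∑ p ∈ (s.erase q).erase r, m q r * m r p := by
      refine Finset.sum_comm' ?_
      intro a b
      simp only [Finset.mem_erase]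
      tauto
    have e3 : ∀ r ∈ s.erase q, ∑ p ∈ (s.erase q).erase r, m q r * m r p = 1 := by
      intro r hr
      have hrs := Finset.mem_of_mem_erase hr
      have hrq := Finset.ne_of_mem_erase hr
      rw [← Finset.mul_sum]
      have h2 := h0 r hrs
      rw [← Finset.add_sum_erase _ _ (show q ∈ s.erase r by simp [hrq.symm, hq]),
        Finset.erase_right_comm, hsk q hq r hrs hrq.symm] at h2
      have h3 : ∑ p ∈ (s.erase q).erase r, m r p = m q r := by linarith
      rw [h3]
      rcases h1 q hq r hrs hrq.symm with h | h <;> rw [h] <;> norm_num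
    rw [e2, Finset.sum_congr rfl e3, Finset.sum_const, hcard] at e1
    norm_num at e1
    linarith
  subst hc1
  obtain ⟨p, hp⟩ : (s.erase q).Nonempty := Finset.card_pos.mp (by omega)
  have hps := Finset.mem_of_mem_erase hp
  have hpq := Finset.ne_of_mem_erase hp
  have hcard3 : ((s.erase q).erase p).card = 3 := by rw [Finset.card_erase_of_mem hp, hcard]
  obtain ⟨r₁, r₂, r₃, h12, h13, h23, hr⟩ := Finset.card_eq_three.mp hcard3
  have mem : ∀ r ∈ (s.erase q).erase p, r ∈ s ∧ r ≠ q ∧ r ≠ p := by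
    intro r hr
    simp only [Finset.mem_erase] at hr
    exact ⟨hr.2.2, hr.2.1, hr.1⟩
  obtain ⟨a1, a2, a3⟩ := mem r₁ (by simp [hr])
  obtain ⟨b1, b2, b3⟩ := mem r₂ (by simp [hr])
  obtain ⟨c1, c2, c3⟩ := mem r₃ (by simp [hr])
  have sum3 : ∀ f : α → ℚ, ∑ r ∈ (s.erase q).erase p, f r = f r₁ + f r₂ + f r₃ := by
    intro f
    rw [hr, Finset.sum_insert (by simp [h12, h13]), Finset.sum_pair h23, add_assoc]
  have g1 := hc q hq p hps hpq.symm
  have g2 := h0 q hq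
  have g3 := h0 p hps
  rw [← Finset.add_sum_erase _ _ hp, sum3] at g2
  rw [← Finset.add_sum_erase _ _ (show q ∈ s.erase p by simp [hpq.symm, hq]),
    Finset.erase_right_comm, sum3, hsk q hq p hps hpq.symm, hsk r₁ a1 p hps a3,
    hsk r₂ b1 p hps b3, hsk r₃ c1 p hps c3] at g3
  rw [sum3] at g1
  have k1 := h1 q hq p hps hpq.symm
  have k2 := h1 q hq r₁ a1 a2.symm
  have k3 := h1 q hq r₂ b1 b2.symm
  have k4 := h1 q hq r₃ c1 c2.symm
  have k5 := h1 r₁ a1 p hps a3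
  have k6 := h1 r₂ b1 p hps b3
  have k7 := h1 r₃ c1 p hps c3
  -- Regularity at `q` and at `p` makes `x₁ + x₂ + x₃` and `y₁ + y₂ + y₃` both equal to `-z`. Two
  -- such sign vectors have scalar product 3 or -1, never 1.
  generalize m q p = z at *
  generalize m q r₁ = x₁ at *
  generalize m q r₂ = x₂ at *
  generalize m q r₃ = x₃ at *
  generalize m r₁ p = y₁ at *
  generalize m r₂ p = y₂ at *
  generalize m r₃ p = y₃ at *
  clear sum3 mem hr hsk h0 hc h1
  rcases k1 with rfl | rfl <;> rcases k2 with rfl | rfl <;> rcases k3 with rfl | rfl <;>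
    rcases k4 with rfl | rfl <;> try (exfalso; linarith)
  all_goals
    rcases k5 with rfl | rfl <;> rcases k6 with rfl | rfl <;> rcases k7 with rfl | rfl <;> linarith

end Tournament

/-! ### The folded graph of `J(8, 4)` -/

section FoldedFour

variable {D : Finset (Fin 8) → Finset (Fin 8) → ℕ × ℕ}

theorem compl_exchange {n : ℕ} {x : Finset (Fin n)} {a b : Fin n} (ha : a ∈ x) (hb : b ∉ x) :
    (insert b (x.erase a))ᶜ = insert a (xᶜ.erase b) := by
  have hab : a ≠ b := fun h => hb (h ▸ ha)
  ext z
  simp only [Finset.mem_compl, Finset.mem_insert, Finset.mem_erase]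
  by_cases h1 : z = a
  · subst h1; simp [hab]
  · by_cases h2 : z = b
    · subst h2; simp [h1]
    · simp [h1, h2]

/-- Passing to complements interchanges the leaving and the entering point. -/
theorem ColsOnly.compl {n : ℕ} {f : Finset (Fin n) → Finset (Fin n) → ℚ}
    (hf : ∀ x y, f xᶜ yᶜ = f x y) {x : Finset (Fin n)} (h : ColsOnly f x) : RowsOnly f xᶜ := by
  intro b hb a ha a' ha'
  simp only [Finset.mem_compl, not_not] at hb ha ha'
  rw [← compl_exchange ha hb, ← compl_exchange ha' hb, hf, hf]
  exact h b hb a ha a' ha'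

theorem RowsOnly.compl {n : ℕ} {f : Finset (Fin n) → Finset (Fin n) → ℚ}
    (hf : ∀ x y, f xᶜ yᶜ = f x y) {x : Finset (Fin n)} (h : RowsOnly f x) : ColsOnly f xᶜ := by
  intro a ha b hb b' hb'
  simp only [Finset.mem_compl, not_not] at hb ha hb'
  rw [← compl_exchange ha hb, ← compl_exchange ha hb', hf, hf]
  exact h a ha b hb b' hb'

/-- The points whose row is in the support of the label. -/
def activeRows (i₀ : ℕ × ℕ) (D : Finset (Fin 8) → Finset (Fin 8) → ℕ × ℕ) (x : Finset (Fin 8)) :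
    Finset (Fin 8) :=
  x.filter fun a => ∀ b ∈ xᶜ, arcSupp i₀ (D x (insert b (x.erase a))) = 1

variable {i₀ : ℕ × ℕ}

theorem activeRows_subset (x : Finset (Fin 8)) : activeRows i₀ D x ⊆ x :=
  Finset.filter_subset _ _

theorem card_compl_eight {x : Finset (Fin 8)} (hx : x.card = 4) : xᶜ.card = 4 := by
  rw [Finset.card_compl, Fintype.card_fin, hx]

theorem RowsOnly.arcSupp_eq {x : Finset (Fin 8)}
    (h : RowsOnly (fun x y => arcSupp i₀ (D x y)) x) {a b : Fin 8} (ha : a ∈ x) (hb : b ∉ x) :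
    arcSupp i₀ (D x (insert b (x.erase a))) = if a ∈ activeRows i₀ D x then 1 else 0 := by
  split_ifs with hR
  · exact (Finset.mem_filter.mp hR).2 b (Finset.mem_compl.mpr hb)
  · rcases WDRD.arcSupp_eq i₀ (D x (insert b (x.erase a))) with h1 | h1
    · exact h1
    · refine absurd (Finset.mem_filter.mpr ⟨ha, fun b' hb' => ?_⟩) hR
      rw [← h1]
      exact h a ha b' (Finset.mem_compl.mp hb') b hb

theorem RowsOnly.nbrSum_eq {x : Finset (Fin 8)} (hx : x.card = 4)
    (h : RowsOnly (fun x y => arcSupp i₀ (D x y)) x) :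
    nbrSum x (fun y => arcSupp i₀ (D x y)) = 4 * (activeRows i₀ D x).card := by
  have h1 : nbrSum x (fun y => arcSupp i₀ (D x y)) =
      ∑ a ∈ x, if a ∈ activeRows i₀ D x then (4 : ℚ) else 0 := by
    refine Finset.sum_congr rfl fun a ha => ?_
    rw [Finset.sum_congr rfl fun b hb => h.arcSupp_eq ha (Finset.mem_compl.mp hb),
      Finset.sum_const, card_compl_eight hx]
    split_ifs <;> norm_num
  rw [h1, Finset.sum_ite_mem, Finset.inter_eq_right.mpr (activeRows_subset x),
    Finset.sum_const, nsmul_eq_mul, mul_comm]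

theorem arcSign_row_inactive {x : Finset (Fin 8)}
    (h : RowsOnly (fun x y => arcSupp i₀ (D x y)) x) {a b : Fin 8} (ha : a ∈ x) (hb : b ∉ x)
    (hR : a ∉ activeRows i₀ D x) : arcSign i₀ (D x (insert b (x.erase a))) = 0 :=
  arcSign_of_not_supp (by rw [h.arcSupp_eq ha hb, if_neg hR])

/-- At every set, either the set or its complement has a support consisting of rows. -/
theorem Labelling.rowsOnly_or_compl (hL : Labelling 8 4 D) (hcompl : ∀ x y, D xᶜ yᶜ = D x y)
    {x : Finset (Fin 8)} (hx : x.card = 4) :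
    RowsOnly (fun x y => arcSupp i₀ (D x y)) x ∨
      RowsOnly (fun x y => arcSupp i₀ (D x y)) xᶜ := by
  rcases (hL.fourTerm rfl le_rfl (arcSupp_swap i₀) hx).rowsOnly_or_colsOnly (c := 0) (d := 1)
    (fun a _ b _ => arcSupp_eq _ _) with h | h
  · exact Or.inl h
  · exact Or.inr (h.compl fun x y => by rw [hcompl])

/-- The total of the support is four times the number of active rows, so this number is the same at
all sets of row type. It is positive since the label occurs, and 4 would put every edge into the
support, a case already excluded. If a set and its complement were both of row type, the support at
the set would be all or nothing. -/
theorem Labelling.exists_activeRows_card (hL : Labelling 8 4 D)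
    (hcompl : ∀ x y, D xᶜ yᶜ = D x y) (hi : HasLabel 4 D i₀) (h₀ : i₀.swap ≠ i₀) :
    ∃ i : ℕ, 0 < i ∧ i < 4 ∧ (∀ x, x.card = 4 → RowsOnly (fun x y => arcSupp i₀ (D x y)) x →
        (activeRows i₀ D x).card = i) ∧
      ∀ x, x.card = 4 → RowsOnly (fun x y => arcSupp i₀ (D x y)) x →
        ¬RowsOnly (fun x y => arcSupp i₀ (D x y)) xᶜ := by
  have hf : ∀ x y : Finset (Fin 8),
      (fun x y => arcSupp i₀ (D x y)) xᶜ yᶜ = (fun x y => arcSupp i₀ (D x y)) x y :=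
    fun x y => by beta_reduce; rw [hcompl]
  obtain ⟨k, hk⟩ := hL.total (arcSupp i₀)
  obtain ⟨x₀, a₀, b₀, hx₀, ha₀, hb₀, hD⟩ := hi
  obtain ⟨z, a, b, hz, ha, hb, hzr, hzD⟩ : ∃ z a b, z.card = 4 ∧ a ∈ z ∧ b ∉ z ∧
      RowsOnly (fun x y => arcSupp i₀ (D x y)) z ∧ D z (insert b (z.erase a)) = i₀ := by
    rcases hL.rowsOnly_or_compl (i₀ := i₀) hcompl hx₀ with h | h
    · exact ⟨x₀, a₀, b₀, hx₀, ha₀, hb₀, h, hD⟩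
    · refine ⟨x₀ᶜ, b₀, a₀, card_compl_eight hx₀, by simpa using hb₀, by simpa using ha₀, h, ?_⟩
      rw [← compl_exchange ha₀ hb₀, hcompl, hD]
  have hcard : ∀ x, x.card = 4 → RowsOnly (fun x y => arcSupp i₀ (D x y)) x →
      (activeRows i₀ D x).card = (activeRows i₀ D z).card := by
    intro x hx hr
    have h1 := hr.nbrSum_eq hx
    have h2 := hzr.nbrSum_eq hz
    rw [hk x hx] at h1
    rw [hk z hz, h1] at h2
    have h3 : ((activeRows i₀ D x).card : ℚ) = (activeRows i₀ D z).card := by linarith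
    exact_mod_cast h3
  have hpos : 0 < (activeRows i₀ D z).card := by
    rw [Finset.card_pos]
    refine ⟨a, ?_⟩
    by_contra h
    have := hzr.arcSupp_eq ha hb
    rw [if_neg h, hzD, arcSupp_self] at this
    norm_num at this
  have hlt : (activeRows i₀ D z).card < 4 := by
    by_contra h
    have hle := Finset.card_le_card (activeRows_subset (i₀ := i₀) (D := D) z)
    have h4 : (activeRows i₀ D z).card = 4 := by omega
    have one : ∀ x, x.card = 4 → RowsOnly (fun x y => arcSupp i₀ (D x y)) x →
        ∀ a ∈ x, ∀ b ∉ x, arcSupp i₀ (D x (insert b (x.erase a))) = 1 := by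
      intro x hx hr a ha b hb
      have h5 : activeRows i₀ D x = x := Finset.eq_of_subset_of_card_le (activeRows_subset x)
        (by rw [hcard x hx hr, h4, hx])
      rw [hr.arcSupp_eq ha hb, if_pos (by rw [h5]; exact ha)]
    refine hL.false_of_arcSupp_eq_one rfl (by norm_num) h₀ fun x a b hx ha hb => ?_
    rcases hL.rowsOnly_or_compl (i₀ := i₀) hcompl hx with h | h
    · exact one x hx h a ha b hb
    · have := one xᶜ (card_compl_eight hx) h b (by simpa using hb) a (by simpa using ha)
      rwa [← compl_exchange ha hb, hcompl] at this
  refine ⟨_, hpos, hlt, hcard, fun x hx hr hr' => ?_⟩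
  have hc : ColsOnly (fun x y => arcSupp i₀ (D x y)) x := by
    have := hr'.compl hf
    rwa [compl_compl] at this
  have h1 := hcard x hx hr
  obtain ⟨b, hb⟩ : xᶜ.Nonempty := Finset.card_pos.mp (by rw [card_compl_eight hx]; norm_num)
  rw [Finset.mem_compl] at hb
  obtain ⟨a, ha⟩ := Finset.card_pos.mp (h1 ▸ hpos)
  have hax := activeRows_subset x ha
  have hsub : x ⊆ activeRows i₀ D x := by
    intro a' ha'
    by_contra hn
    have h2 := hr.arcSupp_eq hax hb
    have h3 := hr.arcSupp_eq ha' hb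
    rw [if_pos ha] at h2
    rw [if_neg hn] at h3
    have h4 := hc b hb a hax a' ha'
    beta_reduce at h4
    rw [h2, h3] at h4
    norm_num at h4
  have := Finset.card_le_card hsub
  omega

/-- Let row plus column of the sign equal `ν` times the sign on the support, and let `i` be the
number of active rows. Summing again along lines gives `4 - ν` times a row sum zero and `ν - i`
times a column sum zero. If `ν = i`, rows vanish and the column sums divided by `i` form a pure skew
sign, which is impossible. So columns vanish, each holds `i` signs, and `i` is 2 by parity. Then
either `ν = 4` and the sign is constant along active rows, or the rows vanish too. -/
theorem Labelling.activeRows_lines (hL : Labelling 8 4 D)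
    (hcompl : ∀ x y, D xᶜ yᶜ = D x y) (hi : HasLabel 4 D i₀) (h₀ : i₀.swap ≠ i₀) :
    (∀ x, x.card = 4 → RowsOnly (fun x y => arcSupp i₀ (D x y)) x →
      (activeRows i₀ D x).card = 2) ∧
    ((∀ x, x.card = 4 → RowsOnly (fun x y => arcSupp i₀ (D x y)) x →
      ∀ a ∈ activeRows i₀ D x, ∀ b ∉ x, 4 * arcSign i₀ (D x (insert b (x.erase a))) =
        rowAt (fun x y => arcSign i₀ (D x y)) x a) ∨
     ∀ x, x.card = 4 → RowsOnly (fun x y => arcSupp i₀ (D x y)) x →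
      (∀ a ∈ x, rowAt (fun x y => arcSign i₀ (D x y)) x a = 0) ∧
        ∀ b ∉ x, colAt (fun x y => arcSign i₀ (D x y)) x b = 0) := by
  obtain ⟨ψ, hψ, h1⟩ := hL.exists_rowAt_add_colAt (φ := arcSign i₀) (ε := -1) (by norm_num)
    (fun i => by rw [arcSign_swap]; ring)
  have hψ' : ∀ i, ψ i.swap = -ψ i := fun i => by rw [hψ]; ring
  have hk := hL.total_skew _ (arcSign_swap i₀)
  obtain ⟨i, hpos, hlt, hcard, -⟩ := hL.exists_activeRows_card hcompl hi h₀
  have hi0 : (i : ℚ) ≠ 0 := by exact_mod_cast hpos.ne'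
  have hi4 : (4 : ℚ) - i ≠ 0 := by
    rw [sub_ne_zero]
    exact_mod_cast hlt.ne'
  set ν := ψ i₀ with hν
  have hact : ∀ x a b, RowsOnly (fun x y => arcSupp i₀ (D x y)) x → a ∈ activeRows i₀ D x →
      b ∉ x → arcSupp i₀ (D x (insert b (x.erase a))) = 1 := by
    intro x a b hr ha hb
    rw [hr.arcSupp_eq (activeRows_subset x ha) hb, if_pos ha]
  have hψs : ∀ x a b, RowsOnly (fun x y => arcSupp i₀ (D x y)) x → a ∈ activeRows i₀ D x →
      b ∉ x → ψ (D x (insert b (x.erase a))) = ν * arcSign i₀ (D x (insert b (x.erase a))) :=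
    fun x a b hr ha hb => skew_of_supp h₀ hψ' (hact x a b hr ha hb)
  have hinact : ∀ x, RowsOnly (fun x y => arcSupp i₀ (D x y)) x → ∀ a ∈ x,
      a ∉ activeRows i₀ D x → rowAt (fun x y => arcSign i₀ (D x y)) x a = 0 :=
    fun x hr a ha hR => Finset.sum_eq_zero fun b hb =>
      arcSign_row_inactive hr ha (Finset.mem_compl.mp hb) hR
  have hrow : ∀ x, x.card = 4 → RowsOnly (fun x y => arcSupp i₀ (D x y)) x → ∀ a ∈ x,
      (4 - ν) * rowAt (fun x y => arcSign i₀ (D x y)) x a = 0 := by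
    intro x hx hr a ha
    by_cases hR : a ∈ activeRows i₀ D x
    · have h2 := rowAt_of_eq_add (f := fun x y => arcSign i₀ (D x y))
        (g := fun x y => ψ (D x y)) (fun a ha b hb => h1 x a b hx ha hb) ha
      have h3 : rowAt (fun x y => ψ (D x y)) x a =
          ν * rowAt (fun x y => arcSign i₀ (D x y)) x a := by
        simp only [rowAt, Finset.mul_sum]
        exact Finset.sum_congr rfl fun b hb => hψs x a b hr hR (Finset.mem_compl.mp hb)
      rw [h3, hk x hx, hx] at h2
      push_cast at h2
      linarith
    · rw [hinact x hr a ha hR, mul_zero]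
  have hsumR : ∀ x, x.card = 4 → RowsOnly (fun x y => arcSupp i₀ (D x y)) x → ∀ b ∉ x,
      ∑ a ∈ activeRows i₀ D x, arcSign i₀ (D x (insert b (x.erase a))) =
        colAt (fun x y => arcSign i₀ (D x y)) x b := by
    intro x hx hr b hb
    exact Finset.sum_subset (activeRows_subset x) fun a ha hR => arcSign_row_inactive hr ha hb hR
  have hcol : ∀ x, x.card = 4 → RowsOnly (fun x y => arcSupp i₀ (D x y)) x → ∀ b ∉ x,
      (ν - i) * colAt (fun x y => arcSign i₀ (D x y)) x b = 0 := by
    intro x hx hr b hb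
    have h2 : ∑ a ∈ activeRows i₀ D x, ν * arcSign i₀ (D x (insert b (x.erase a))) =
        ∑ a ∈ activeRows i₀ D x, (rowAt (fun x y => arcSign i₀ (D x y)) x a +
          colAt (fun x y => arcSign i₀ (D x y)) x b) :=
      Finset.sum_congr rfl fun a ha => by
        rw [← hψs x a b hr ha hb, h1 x a b hx (activeRows_subset x ha) hb]
    have h3 : ∑ a ∈ activeRows i₀ D x, rowAt (fun x y => arcSign i₀ (D x y)) x a = 0 := by
      rw [Finset.sum_subset (activeRows_subset x) fun a ha hR => hinact x hr a ha hR]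
      exact hk x hx
    rw [← Finset.mul_sum, hsumR x hx hr b hb, Finset.sum_add_distrib, h3, Finset.sum_const,
      hcard x hx hr, nsmul_eq_mul] at h2
    linarith
  by_cases hνi : ν = i
  · exfalso
    have key : ∀ x, x.card = 4 → RowsOnly (fun x y => arcSupp i₀ (D x y)) x →
        ColsOnly (fun x y => (fun j => ψ j / i) (D x y)) x ∧
        ∀ a ∈ x, ∀ b ∉ x, ψ (D x (insert b (x.erase a))) / i = 1 ∨
          ψ (D x (insert b (x.erase a))) / i = -1 := by
      intro x hx hr
      have h2 : ∀ a ∈ x, ∀ b ∉ x, ψ (D x (insert b (x.erase a))) =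
          colAt (fun x y => arcSign i₀ (D x y)) x b := by
        intro a ha b hb
        have h3 := hrow x hx hr a ha
        rw [hνi] at h3
        rw [h1 x a b hx ha hb, (mul_eq_zero.mp h3).resolve_left hi4, zero_add]
      constructor
      · intro b hb a ha a' ha'
        beta_reduce
        rw [h2 a ha b hb, h2 a' ha' b hb]
      · intro a ha b hb
        obtain ⟨a₀, ha₀⟩ := Finset.card_pos.mp (show 0 < (activeRows i₀ D x).card by
          rw [hcard x hx hr]; exact hpos)
        rw [h2 a ha b hb, ← h2 a₀ (activeRows_subset x ha₀) b hb, hψs x a₀ b hr ha₀ hb, hνi,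
          mul_div_cancel_left₀ _ hi0]
        exact arcSign_of_supp h₀ (hact x a₀ b hr ha₀ hb)
    refine hL.false_of_pure (φ := fun j => ψ j / i) (by norm_num) (by norm_num)
      (fun j => by rw [hψ', neg_div]) (fun x a b hx ha hb => ?_) (fun x hx => ?_)
    · rcases hL.rowsOnly_or_compl (i₀ := i₀) hcompl hx with h | h
      · exact (key x hx h).2 a ha b hb
      · have := (key xᶜ (card_compl_eight hx) h).2 b (by simpa using hb) a (by simpa using ha)
        rwa [← compl_exchange ha hb, hcompl] at this
    · rcases hL.rowsOnly_or_compl (i₀ := i₀) hcompl hx with h | h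
      · exact Or.inr (key x hx h).1
      · have := (key xᶜ (card_compl_eight hx) h).1.compl fun x y => by rw [hcompl]
        rw [compl_compl] at this
        exact Or.inl this
  · have hcol0 : ∀ x, x.card = 4 → RowsOnly (fun x y => arcSupp i₀ (D x y)) x → ∀ b ∉ x,
        colAt (fun x y => arcSign i₀ (D x y)) x b = 0 := fun x hx hr b hb =>
      (mul_eq_zero.mp (hcol x hx hr b hb)).resolve_left (sub_ne_zero.mpr hνi)
    constructor
    · intro x hx hr
      obtain ⟨b, hb⟩ : xᶜ.Nonempty :=
        Finset.card_pos.mp (by rw [card_compl_eight hx]; norm_num)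
      rw [Finset.mem_compl] at hb
      have h2 : Even (activeRows i₀ D x).card := by
        refine even_card_of_sum_eq_zero
          (f := fun a => arcSign i₀ (D x (insert b (x.erase a))))
          (fun a ha => arcSign_of_supp h₀ (hact x a b hr ha hb)) ?_
        rw [hsumR x hx hr b hb, hcol0 x hx hr b hb]
      rw [hcard x hx hr] at h2 ⊢
      rw [Nat.even_iff] at h2
      omega
    · by_cases hν4 : ν = 4
      · left
        intro x hx hr a ha b hb
        rw [← hν4, ← hψs x a b hr ha hb, h1 x a b hx (activeRows_subset x ha) hb,
          hcol0 x hx hr b hb, add_zero]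
      · right
        intro x hx hr
        refine ⟨fun a ha => ?_, hcol0 x hx hr⟩
        exact (mul_eq_zero.mp (hrow x hx hr a ha)).resolve_left
          (sub_ne_zero.mpr (Ne.symm hν4))

/-- When only the rows of `a` and `a'` carry `φ`, the common neighbours that count are those in the
clique of `a` and a single one in row `a'`. -/
theorem triSum_rows {x : Finset (Fin 8)} {a a' b : Fin 8} (ha : a ∈ x) (ha' : a' ∈ x)
    (haa : a ≠ a') (hb : b ∉ x) {φ χ : ℕ × ℕ → ℚ}
    (hφ : ∀ c ∈ x, c ≠ a → c ≠ a' → φ (D x (insert b (x.erase c))) = 0) :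
    triSum D φ χ (x.erase a) a b =
      ∑ r ∈ (insert b x)ᶜ, φ (D x (insert r (x.erase a))) *
        χ (D (insert r (x.erase a)) (insert b (x.erase a))) +
      φ (D x (insert b (x.erase a'))) *
        χ (D (insert b (x.erase a')) (insert b (x.erase a))) := by
  have hw : insert a (insert b (x.erase a)) = insert b x := by
    rw [Finset.insert_comm, Finset.insert_erase ha]
  have her : ∀ c ∈ x, (insert b x).erase c = insert b (x.erase c) := fun c hc =>
    insert_erase_insert_ne fun h => hb (h ▸ hc)
  unfold triSum
  rw [hw, Finset.insert_erase ha]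
  congr 1
  rw [Finset.sum_eq_single a', her a' ha']
  · intro c hc hca
    have hc' := Finset.mem_of_mem_erase hc
    rw [her c hc', hφ c hc' (Finset.ne_of_mem_erase hc) hca, zero_mul]
  · intro h
    exact absurd (Finset.mem_erase.mpr ⟨haa.symm, ha'⟩) h

/-- The square `κ` of the support is the same at all edges of the support. It is at least 3 if a
neighbour along an active row keeps the row type, and equals 2 if the type flips; so all such
neighbours keep it or all flip it. Constant flipping is inconsistent on a triangle. Constant keeping
makes a clique of five sets lie in the support, and its signs give a forbidden tournament. -/
theorem Labelling.false_of_folded_four (hL : Labelling 8 4 D)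
    (hcompl : ∀ x y, D xᶜ yᶜ = D x y) (hi : HasLabel 4 D i₀) (h₀ : i₀.swap ≠ i₀) : False := by
  obtain ⟨i, -, -, -, hexcl⟩ := hL.exists_activeRows_card hcompl hi h₀
  obtain ⟨hcard, hlines⟩ := hL.activeRows_lines hcompl hi h₀
  have hsw : ∀ x y, arcSupp i₀ (D y x) = arcSupp i₀ (D x y) := fun x y => by
    rw [hL.swap, arcSupp_swap]
  have hskew : ∀ x y, arcSign i₀ (D y x) = -arcSign i₀ (D x y) := fun x y => by
    rw [hL.swap, arcSign_swap]
  have hact : ∀ x a b, RowsOnly (fun x y => arcSupp i₀ (D x y)) x → a ∈ activeRows i₀ D x →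
      b ∉ x → arcSupp i₀ (D x (insert b (x.erase a))) = 1 := by
    intro x a b hr ha hb
    rw [hr.arcSupp_eq (activeRows_subset x ha) hb, if_pos ha]
  have hpair : ∀ x, x.card = 4 → RowsOnly (fun x y => arcSupp i₀ (D x y)) x →
      ∀ a ∈ activeRows i₀ D x, ∃ a' ∈ activeRows i₀ D x, a ≠ a' ∧
        ∀ c ∈ x, c ≠ a → c ≠ a' → c ∉ activeRows i₀ D x := by
    intro x hx hr a ha
    obtain ⟨a', ha'⟩ := Finset.card_eq_one.mp (show ((activeRows i₀ D x).erase a).card = 1 by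
      rw [Finset.card_erase_of_mem ha, hcard x hx hr])
    have h1 : a' ∈ (activeRows i₀ D x).erase a := by simp [ha']
    refine ⟨a', Finset.mem_of_mem_erase h1, (Finset.ne_of_mem_erase h1).symm, ?_⟩
    intro c _ hca hca' hc
    have : c ∈ (activeRows i₀ D x).erase a := by simp [hca, hc]
    rw [ha', Finset.mem_singleton] at this
    exact hca' this
  -- the squares of the support and of the sign are constant on the support
  have hconst : ∀ φ : ℕ × ℕ → ℚ, (∀ u q p, triSum D φ φ u p q = triSum D φ φ u q p) →
      ∃ κ, ∀ x a b, x.card = 4 → a ∈ x → b ∉ x →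
        arcSupp i₀ (D x (insert b (x.erase a))) = 1 → triSum D φ φ (x.erase a) a b = κ := by
    intro φ hφ
    obtain ⟨g, hg⟩ := hL.triangle φ φ
    refine ⟨g i₀, fun x a b hx ha hb hs => ?_⟩
    have hab : a ≠ b := fun h => hb (h ▸ ha)
    have hu : (x.erase a).card + 1 = 4 := by rw [Finset.card_erase_add_one ha, hx]
    have h1 : D x (insert b (x.erase a)) = i₀ ∨ D x (insert b (x.erase a)) = i₀.swap := by
      by_contra hn
      simp [arcSupp, hn] at hs
    have h2 := hg (x.erase a) a b hu (by simp) (by simp [hb]) hab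
    rcases h1 with h1 | h1
    · rw [h2, Finset.insert_erase ha, h1]
    · have h3 := hg (x.erase a) b a hu (by simp [hb]) (by simp) hab.symm
      rw [← hφ, h3, Finset.insert_erase ha, hL.swap, h1, Prod.swap_swap]
  obtain ⟨κ, hκ⟩ := hconst (arcSupp i₀) (fun u q p => by
    rw [triSum_swap hL.swap]
    simp only [arcSupp_swap])
  obtain ⟨μ, hμ⟩ := hconst (arcSign i₀) (fun u q p => by
    rw [triSum_swap hL.swap]
    simp only [arcSign_swap, triSum, neg_mul_neg])
  have hcomplw : ∀ (x : Finset (Fin 8)) a b, a ∈ x → b ∉ x →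
      (insert b x)ᶜ = (insert b (x.erase a))ᶜ.erase a := by
    intro x a b ha hb
    have hab : a ≠ b := fun h => hb (h ▸ ha)
    rw [← Finset.compl_insert, Finset.insert_comm, Finset.insert_erase ha]
  have hcard3 : ∀ (x : Finset (Fin 8)) b, x.card = 4 → b ∉ x → (insert b x)ᶜ.card = 3 := by
    intro x b hx hb
    rw [Finset.card_compl, Fintype.card_fin, Finset.card_insert_of_notMem hb, hx]
  -- the square of the support along an active row
  have hsq : ∀ x, x.card = 4 → RowsOnly (fun x y => arcSupp i₀ (D x y)) x →
      ∀ a ∈ activeRows i₀ D x, ∀ a' ∈ activeRows i₀ D x, a ≠ a' →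
      (∀ c ∈ x, c ≠ a → c ≠ a' → c ∉ activeRows i₀ D x) → ∀ b ∉ x,
      κ = ∑ r ∈ (insert b x)ᶜ,
        arcSupp i₀ (D (insert b (x.erase a)) (insert r (x.erase a))) +
        arcSupp i₀ (D (insert b (x.erase a)) (insert b (x.erase a'))) := by
    intro x hx hr a ha a' ha' haa hc b hb
    have hax := activeRows_subset x ha
    have ha'x := activeRows_subset x ha'
    rw [← hκ x a b hx hax hb (hact x a b hr ha hb), triSum_rows hax ha'x haa hb
      (fun c hcx h1 h2 => by rw [hr.arcSupp_eq hcx hb, if_neg (hc c hcx h1 h2)]),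
      hact x a' b hr ha' hb, one_mul, hsw]
    congr 1
    refine Finset.sum_congr rfl fun r hr' => ?_
    rw [Finset.mem_compl, Finset.mem_insert, not_or] at hr'
    rw [hact x a r hr ha hr'.2, one_mul, hsw]
  have hrows : ∀ x, x.card = 4 → RowsOnly (fun x y => arcSupp i₀ (D x y)) x →
      ∀ a ∈ activeRows i₀ D x, ∀ b ∉ x,
      RowsOnly (fun x y => arcSupp i₀ (D x y)) (insert b (x.erase a)) → 3 ≤ κ := by
    intro x hx hr a ha b hb hy
    obtain ⟨a', ha', haa, hc⟩ := hpair x hx hr a ha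
    have hax := activeRows_subset x ha
    have hab : a ≠ b := fun h => hb (h ▸ hax)
    rw [hsq x hx hr a ha a' ha' haa hc b hb]
    have h1 : ∀ r ∈ (insert b x)ᶜ,
        arcSupp i₀ (D (insert b (x.erase a)) (insert r (x.erase a))) = 1 := by
      intro r hr'
      rw [Finset.mem_compl, Finset.mem_insert, not_or] at hr'
      have h2 := hy b (by simp) r (by simp [hr'.1, hr'.2]) a (by simp [hab])
      rw [Finset.erase_insert (by simp [hb]), Finset.insert_erase hax] at h2
      beta_reduce at h2
      rw [h2, hsw, hact x a b hr ha hb]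
    rw [Finset.sum_congr rfl h1, Finset.sum_const, hcard3 x b hx hb]
    have := arcSupp_eq i₀ (D (insert b (x.erase a)) (insert b (x.erase a')))
    rcases this with h | h <;> rw [h] <;> norm_num
  have hcols : ∀ x, x.card = 4 → RowsOnly (fun x y => arcSupp i₀ (D x y)) x →
      ∀ a ∈ activeRows i₀ D x, ∀ b ∉ x,
      RowsOnly (fun x y => arcSupp i₀ (D x y)) (insert b (x.erase a))ᶜ → κ = 2 := by
    intro x hx hr a ha b hb hy
    obtain ⟨a', ha', haa, hc⟩ := hpair x hx hr a ha
    have hax := activeRows_subset x ha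
    have ha'x := activeRows_subset x ha'
    have hab : a ≠ b := fun h => hb (h ▸ hax)
    have hy4 : (insert b (x.erase a))ᶜ.card = 4 :=
      card_compl_eight ((card_exchange hax hb).trans hx)
    have hby : b ∉ (insert b (x.erase a))ᶜ := by simp
    have hval : ∀ r ∈ (insert b (x.erase a))ᶜ, ∀ c ∈ insert b (x.erase a),
        arcSupp i₀ (D (insert b (x.erase a)) (insert r ((insert b (x.erase a)).erase c))) =
        if r ∈ activeRows i₀ D (insert b (x.erase a))ᶜ then 1 else 0 := by
      intro r hr' c hc'
      rw [← hcompl, compl_exchange hc' (Finset.mem_compl.mp hr')]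
      exact hy.arcSupp_eq hr' (by rwa [Finset.mem_compl, not_not])
    have hay : a ∈ (insert b (x.erase a))ᶜ := by simp [hab]
    have haR : a ∈ activeRows i₀ D (insert b (x.erase a))ᶜ := by
      by_contra hn
      have h2 := hval a hay b (by simp)
      rw [if_neg hn, Finset.erase_insert (by simp [hb]), Finset.insert_erase hax, hsw,
        hact x a b hr ha hb] at h2
      norm_num at h2
    have h1 : arcSupp i₀ (D (insert b (x.erase a)) (insert b (x.erase a'))) = 1 := by
      have h2 := hval a hay a' (by simp [haa.symm, ha'x])
      rw [if_pos haR, insert_erase_insert_ne (fun h : a' = b => hb (h ▸ ha'x)), Finset.insert_comm,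
        Finset.erase_right_comm, Finset.insert_erase (by simp [haa, hax])] at h2
      exact h2
    have h2 : ∑ r ∈ (insert b x)ᶜ,
        arcSupp i₀ (D (insert b (x.erase a)) (insert r (x.erase a))) = 1 := by
      have h3 : ∀ r ∈ (insert b x)ᶜ,
          arcSupp i₀ (D (insert b (x.erase a)) (insert r (x.erase a))) =
          if r ∈ activeRows i₀ D (insert b (x.erase a))ᶜ then 1 else 0 := by
        intro r hr'
        have hr'' : r ∈ (insert b (x.erase a))ᶜ := by
          rw [hcomplw x a b hax hb] at hr'
          exact Finset.mem_of_mem_erase hr'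
        have h4 := hval r hr'' b (by simp)
        rwa [Finset.erase_insert (by simp [hb])] at h4
      rw [Finset.sum_congr rfl h3, Finset.sum_ite_mem, Finset.sum_const, nsmul_eq_mul, mul_one,
        hcomplw x a b hax hb, Finset.erase_inter,
        Finset.inter_eq_right.mpr (activeRows_subset _), Finset.card_erase_of_mem haR,
        hcard _ hy4 hy]
      norm_num
    rw [hsq x hx hr a ha a' ha' haa hc b hb, h1, h2]
    norm_num
  -- a set with row support
  obtain ⟨x, hx, hr⟩ : ∃ x : Finset (Fin 8), x.card = 4 ∧
      RowsOnly (fun x y => arcSupp i₀ (D x y)) x := by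
    obtain ⟨x, -, -, hx, -⟩ := hi
    rcases hL.rowsOnly_or_compl (i₀ := i₀) hcompl hx with h | h
    · exact ⟨x, hx, h⟩
    · exact ⟨xᶜ, card_compl_eight hx, h⟩
  obtain ⟨a, ha⟩ := Finset.card_pos.mp (show 0 < (activeRows i₀ D x).card by
    rw [hcard x hx hr]; norm_num)
  obtain ⟨a', ha', haa, hc⟩ := hpair x hx hr a ha
  have hax := activeRows_subset x ha
  have ha'x := activeRows_subset x ha'
  obtain ⟨b, hb⟩ : xᶜ.Nonempty := Finset.card_pos.mp (by rw [card_compl_eight hx]; norm_num)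
  rw [Finset.mem_compl] at hb
  have hab : a ≠ b := fun h => hb (h ▸ hax)
  by_cases hκ2 : κ = 2
  · -- neighbours along active rows never have row support
    have hflip : ∀ x, x.card = 4 → RowsOnly (fun x y => arcSupp i₀ (D x y)) x →
        ∀ a ∈ activeRows i₀ D x, ∀ b ∉ x,
        RowsOnly (fun x y => arcSupp i₀ (D x y)) (insert b (x.erase a))ᶜ := by
      intro x hx hr a ha b hb
      refine (hL.rowsOnly_or_compl (i₀ := i₀) hcompl
        ((card_exchange (activeRows_subset x ha) hb).trans hx)).resolve_left fun h => ?_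
      have := hrows x hx hr a ha b hb h
      linarith
    have hy := hflip x hx hr a ha b hb
    have hz := hflip x hx hr a' ha' b hb
    have hy4 : (insert b (x.erase a))ᶜ.card = 4 :=
      card_compl_eight ((card_exchange hax hb).trans hx)
    have hz4 : (insert b (x.erase a')).card = 4 := (card_exchange ha'x hb).trans hx
    have hay : a ∈ (insert b (x.erase a))ᶜ := by simp [hab]
    have ha'b : a' ≠ b := fun h => hb (h ▸ ha'x)
    have haR : a ∈ activeRows i₀ D (insert b (x.erase a))ᶜ := by
      by_contra hn
      have h2 := hy.arcSupp_eq hay (b := b) (by simp)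
      rw [if_neg hn, ← compl_exchange (by simp) (by simpa using hay), hcompl,
        Finset.erase_insert (by simp [hb]), Finset.insert_erase hax, hsw,
        hact x a b hr ha hb] at h2
      norm_num at h2
    -- The set `x - a' + b` is reached from `x` by one flip and through `x - a + b` by two, so it
    -- and its complement would both be of row type.
    have h3 := hflip _ hy4 hy a haR a' (by simp [haa.symm, ha'x])
    rw [← compl_exchange (by simp [haa.symm, ha'x]) (by simp [hab]), compl_compl,
      insert_erase_insert_ne ha'b, Finset.insert_comm,
      Finset.erase_right_comm, Finset.insert_erase (by simp [haa, hax])] at h3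
    exact hexcl _ hz4 h3 hz
  · have hkeep : ∀ x, x.card = 4 → RowsOnly (fun x y => arcSupp i₀ (D x y)) x →
        ∀ a ∈ activeRows i₀ D x, ∀ b ∉ x,
        RowsOnly (fun x y => arcSupp i₀ (D x y)) (insert b (x.erase a)) := by
      intro x hx hr a ha b hb
      refine (hL.rowsOnly_or_compl (i₀ := i₀) hcompl
        ((card_exchange (activeRows_subset x ha) hb).trans hx)).resolve_right fun h => ?_
      exact hκ2 (hcols x hx hr a ha b hb h)
    -- the clique through the active point `a`
    have hcl : ∀ q ∉ x.erase a, (insert q (x.erase a)).card = 4 ∧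
        RowsOnly (fun x y => arcSupp i₀ (D x y)) (insert q (x.erase a)) ∧
        q ∈ activeRows i₀ D (insert q (x.erase a)) := by
      intro q hq
      by_cases hqa : q = a
      · subst hqa
        rw [Finset.insert_erase hax]
        exact ⟨hx, hr, ha⟩
      · have hqx : q ∉ x := fun h => hq (Finset.mem_erase.mpr ⟨hqa, h⟩)
        refine ⟨(card_exchange hax hqx).trans hx, hkeep x hx hr a ha q hqx, ?_⟩
        by_contra hn
        have h2 := (hkeep x hx hr a ha q hqx).arcSupp_eq (a := q) (b := a) (by simp)
          (by simp [Ne.symm hqa])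
        rw [if_neg hn, Finset.erase_insert hq, Finset.insert_erase hax, hsw,
          hact x a q hr ha hqx] at h2
        norm_num at h2
    have hcsupp : ∀ q ∉ x.erase a, ∀ p ∉ x.erase a, q ≠ p →
        arcSupp i₀ (D (insert q (x.erase a)) (insert p (x.erase a))) = 1 := by
      intro q hq p hp hqp
      have h2 := hact _ q p (hcl q hq).2.1 (hcl q hq).2.2
        (by rw [Finset.mem_insert]; exact fun h => h.elim (fun h => hqp h.symm) hp)
      rwa [Finset.erase_insert hq] at h2
    have hu5 : (x.erase a)ᶜ.card = 5 := by
      rw [Finset.card_compl, Fintype.card_fin, Finset.card_erase_of_mem hax, hx]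
    rcases hlines with h4 | hz
    -- A sign constant along active rows depends, within the clique, on its first set only; skewness
    -- on three sets makes it zero.
    · have h5 := (eps_symm (s := (x.erase a)ᶜ) (by omega) (Or.inr rfl)
        (f := fun q => rowAt (fun x y => arcSign i₀ (D x y)) (insert q (x.erase a)) q) (by
          intro q hq p hp hqp
          rw [Finset.mem_compl] at hq hp
          have e1 := h4 _ (hcl q hq).1 (hcl q hq).2.1 q (hcl q hq).2.2 p
            (by rw [Finset.mem_insert]; exact fun h => h.elim (fun h => hqp h.symm) hp)
          have e2 := h4 _ (hcl p hp).1 (hcl p hp).2.1 p (hcl p hp).2.2 q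
            (by rw [Finset.mem_insert]; exact fun h => h.elim hqp hq)
          rw [Finset.erase_insert hq] at e1
          rw [Finset.erase_insert hp, hskew] at e2
          rw [← e1, ← e2]
          ring)).2 rfl a (by simp)
      beta_reduce at h5
      have e1 := h4 x hx hr a ha b hb
      rw [Finset.insert_erase hax] at h5
      rw [h5] at e1
      rcases arcSign_of_supp h₀ (hact x a b hr ha hb) with h | h <;> rw [h] at e1 <;>
        norm_num at e1
    -- Three common neighbours lie in the clique, so the remaining one contributes `κ - 3` to the
    -- square of the support. It contributes the same to the square `μ` of the sign, which leaves a
    -- constant square inside the clique.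
    · refine false_of_tournament (s := (x.erase a)ᶜ) hu5
        (m := fun q p => arcSign i₀ (D (insert q (x.erase a)) (insert p (x.erase a))))
        (c := μ - (κ - 3)) ?_ ?_ ?_ ?_
      · intro q hq p hp hqp
        rw [Finset.mem_compl] at hq hp
        exact arcSign_of_supp h₀ (hcsupp q hq p hp hqp)
      · intro q _ p _ _
        exact hskew _ _
      · intro q hq
        rw [Finset.mem_compl] at hq
        have h2 := (hz _ (hcl q hq).1 (hcl q hq).2.1).1 q (by simp)
        simp only [rowAt, Finset.erase_insert hq, Finset.compl_insert] at h2
        exact h2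
      · intro q hq p hp hqp
        rw [Finset.mem_compl] at hq hp
        obtain ⟨hy4, hy, hqR⟩ := hcl q hq
        set y := insert q (x.erase a) with hydef
        have hyq : y.erase q = x.erase a := Finset.erase_insert hq
        have hqy : q ∈ y := by simp [hydef]
        have hpy : p ∉ y := by
          rw [hydef, Finset.mem_insert]
          exact fun h => h.elim (fun h => hqp h.symm) hp
        obtain ⟨q', hq'R, hqq', hcc⟩ := hpair y hy4 hy q hqR
        have hq'y := activeRows_subset y hq'R
        have hpq' : q' ≠ p := fun h => hpy (h ▸ hq'y)
        have hPP := hsq y hy4 hy q hqR q' hq'R hqq' hcc p hpy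
        have hSS := hμ y q p hy4 hqy hpy (hact y q p hy hqR hpy)
        rw [triSum_rows hqy hq'y hqq' hpy
          (fun c hcx h1 h2 => arcSign_row_inactive hy hcx hpy (hcc c hcx h1 h2))] at hSS
        have hset : (insert p y)ᶜ = ((x.erase a)ᶜ.erase q).erase p := by
          rw [hydef, Finset.compl_insert, Finset.compl_insert]
        have hone : ∀ r ∈ (insert p y)ᶜ,
            arcSupp i₀ (D (insert p (y.erase q)) (insert r (y.erase q))) = 1 := by
          intro r hr'
          rw [hset] at hr'
          simp only [Finset.mem_erase, Finset.mem_compl] at hr'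
          rw [hyq]
          refine hcsupp p hp r ?_ (Ne.symm hr'.1)
          rw [Finset.mem_erase]
          exact hr'.2.2
        rw [Finset.sum_congr rfl hone, Finset.sum_const, hcard3 y p hy4 hpy] at hPP
        have hzy := hcl p hp
        -- the remaining common neighbour contributes the same to both squares
        have hT : arcSign i₀ (D y (insert p (y.erase q'))) *
            arcSign i₀ (D (insert p (y.erase q')) (insert p (y.erase q))) =
            arcSupp i₀ (D (insert p (y.erase q)) (insert p (y.erase q'))) := by
          have c1 := (hz y hy4 hy).2 p hpy
          have sum2 : ∀ (z : Finset (Fin 8)) (s t : Fin 8), z.card = 4 →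
              RowsOnly (fun x y => arcSupp i₀ (D x y)) z → s ∈ activeRows i₀ D z →
              t ∈ activeRows i₀ D z → s ≠ t → ∀ r ∉ z,
              arcSign i₀ (D z (insert r (z.erase s))) +
                arcSign i₀ (D z (insert r (z.erase t))) = 0 := by
            intro z s t hz4 hzr hs ht hst r hrz
            have h2 := (hz z hz4 hzr).2 r hrz
            unfold colAt at h2
            rw [← Finset.sum_subset (activeRows_subset (i₀ := i₀) (D := D) z)
              (fun c hcz hcR => arcSign_row_inactive hzr hcz hrz hcR)] at h2
            have h3 : activeRows i₀ D z = {s, t} := by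
              symm
              refine Finset.eq_of_subset_of_card_le ?_ ?_
              · intro c hc
                rcases Finset.mem_insert.mp hc with rfl | hc
                · exact hs
                · rwa [Finset.mem_singleton.mp hc]
              · rw [hcard z hz4 hzr, Finset.card_pair hst]
            rw [h3, Finset.sum_pair hst] at h2
            exact h2
          have s1 := sum2 y q q' hy4 hy hqR hq'R hqq' p hpy
          have hz'def : insert p (y.erase q) = insert p (x.erase a) := by rw [hyq]
          rw [hz'def]
          have hqz : q ∉ insert p (x.erase a) := by
            rw [Finset.mem_insert]; exact fun h => h.elim hqp hq
          have hq'u : q' ∈ x.erase a := by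
            rw [← hyq]; exact Finset.mem_erase.mpr ⟨hqq'.symm, hq'y⟩
          have hezq : insert q ((insert p (x.erase a)).erase q') = insert p (y.erase q') := by
            rw [insert_erase_insert_ne hpq', Finset.insert_comm, hydef,
              insert_erase_insert_ne hqq'.symm]
          by_cases hR : q' ∈ activeRows i₀ D (insert p (x.erase a))
          · have s2 := sum2 _ p q' hzy.1 hzy.2.1 hzy.2.2 hR hpq'.symm q hqz
            have h6 := hact _ q' q hzy.2.1 hR hqz
            rw [Finset.erase_insert hp, ← hydef, hezq, hskew y] at s2
            rw [hyq] at s1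
            rw [hezq] at h6
            rw [h6, hskew (insert p (x.erase a))]
            have h7 := arcSign_of_supp h₀ (hcsupp q hq p hp hqp)
            rw [← hydef] at h7
            have e1 : arcSign i₀ (D y (insert p (y.erase q'))) =
              -arcSign i₀ (D y (insert p (x.erase a))) := by linarith
            have e2 : arcSign i₀ (D (insert p (x.erase a)) (insert p (y.erase q'))) =
              arcSign i₀ (D y (insert p (x.erase a))) := by linarith
            rw [e1, e2]
            rcases h7 with h7 | h7 <;> rw [h7] <;> norm_num
          · have h6 := hzy.2.1.arcSupp_eq (a := q') (b := q) (by simp [hq'u]) hqz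
            rw [if_neg hR, hezq] at h6
            rw [h6, hskew (insert p (x.erase a)), arcSign_of_not_supp h6]
            norm_num
        rw [hT] at hSS
        rw [← hset]
        simp only [hyq] at hSS hPP
        norm_num at hPP
        linarith

end FoldedFour

end WDRD

namespace WDRD

/-! ### Oriented triples on six points -/

section SixPoints

/-- There is no way to put every ordered pair of six points into a unique cyclically oriented
triple such that no triple occurs with both orientations. -/
theorem false_of_oriented_triples {R : Fin 6 → Fin 6 → Fin 6 → Prop}
    (cyc : ∀ {a b c}, R a b c → R b c a) (anti : ∀ {a b c}, R a b c → ¬R b a c)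
    (ne : ∀ {a b c}, R a b c → a ≠ b) (ex : ∀ a b, a ≠ b → ∃ c, R a b c)
    (uniq : ∀ {a b c d}, R a b c → R a b d → c = d) : False := by
  have ne' : ∀ {a b c}, R a b c → a ≠ b ∧ b ≠ c ∧ a ≠ c := fun h =>
    ⟨ne h, ne (cyc h), (ne (cyc (cyc h))).symm⟩
  have inj : ∀ {q a b c}, R q a c → R q b c → a = b := fun h h' => uniq (cyc (cyc h)) (cyc (cyc h'))
  obtain ⟨q, p₀, hq0⟩ : ∃ q p₀ : Fin 6, q ≠ p₀ := ⟨0, 1, by decide⟩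
  obtain ⟨p₁, h01⟩ := ex q p₀ hq0
  obtain ⟨p₂, h12⟩ := ex q p₁ (ne' h01).2.2
  obtain ⟨p₃, h23⟩ := ex q p₂ (ne' h12).2.2
  obtain ⟨p₄, h34⟩ := ex q p₃ (ne' h23).2.2
  have two : ∀ {a b c}, R q a b → R q b c → a ≠ c := by
    rintro a b c h h' rfl
    exact anti h (cyc (cyc h'))
  have d01 := (ne' h01).2.1
  have d12 := (ne' h12).2.1
  have d23 := (ne' h23).2.1
  have d34 := (ne' h34).2.1
  have d02 := two h01 h12
  have d13 := two h12 h23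
  have d24 := two h23 h34
  have q1 := (ne' h01).2.2
  have q2 := (ne' h12).2.2
  have q3 := (ne' h23).2.2
  have q4 := (ne' h34).2.2
  -- Sending `p` to the third point of the triple through `q, p` permutes the five other points
  -- without fixed points or 2-cycles. A 3-cycle would leave two points forming a 2-cycle; hence the
  -- permutation is a single pentagon.
  have d03 : p₀ ≠ p₃ := by
    rintro rfl
    have hs : ({q, p₀, p₁, p₂} : Finset (Fin 6))ᶜ.card = 2 := by
      rw [Finset.card_compl, Finset.card_insert_of_notMem (by simp [hq0, q1, q2]),
        Finset.card_insert_of_notMem (by simp [d01, d02]), Finset.card_pair d12]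
      rfl
    obtain ⟨x, y, hxy, hs⟩ := Finset.card_eq_two.mp hs
    have key : ∀ z, z ∉ ({q, p₀, p₁, p₂} : Finset (Fin 6)) → ∃ w, R q z w ∧
        w ∈ ({q, p₀, p₁, p₂} : Finset (Fin 6))ᶜ ∧ w ≠ z := by
      intro z hz
      simp only [Finset.mem_insert, Finset.mem_singleton, not_or] at hz
      obtain ⟨w, hw⟩ := ex q z (Ne.symm hz.1)
      refine ⟨w, hw, ?_, (ne' hw).2.1.symm⟩
      simp only [Finset.mem_compl, Finset.mem_insert, Finset.mem_singleton, not_or]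
      refine ⟨(ne' hw).2.2.symm, ?_, ?_, ?_⟩ <;> rintro rfl
      · exact hz.2.2.2 (inj hw h23)
      · exact hz.2.1 (inj hw h01)
      · exact hz.2.2.1 (inj hw h12)
    have hx : x ∉ ({q, p₀, p₁, p₂} : Finset (Fin 6)) := by
      rw [← Finset.mem_compl, hs]; simp
    have hy : y ∉ ({q, p₀, p₁, p₂} : Finset (Fin 6)) := by
      rw [← Finset.mem_compl, hs]; simp
    obtain ⟨w, hw, hw1, hw2⟩ := key x hx
    obtain ⟨v, hv, hv1, hv2⟩ := key y hy
    rw [hs] at hw1 hv1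
    simp only [Finset.mem_insert, Finset.mem_singleton] at hw1 hv1
    obtain rfl := hw1.resolve_left hw2
    obtain rfl := hv1.resolve_right hv2
    exact two hw hv rfl
  have d14 : p₁ ≠ p₄ := by
    rintro rfl
    exact d03 (inj h01 h34)
  have d04 : p₀ ≠ p₄ := by
    rintro rfl
    have hs : ({q, p₀, p₁, p₂, p₃} : Finset (Fin 6))ᶜ.card = 1 := by
      rw [Finset.card_compl, Finset.card_insert_of_notMem (by simp [hq0, q1, q2, q3]),
        Finset.card_insert_of_notMem (by simp [d01, d02, d03]),
        Finset.card_insert_of_notMem (by simp [d12, d13]), Finset.card_pair d23]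
      rfl
    obtain ⟨x, hs⟩ := Finset.card_eq_one.mp hs
    have hx : x ∉ ({q, p₀, p₁, p₂, p₃} : Finset (Fin 6)) := by
      rw [← Finset.mem_compl, hs]; simp
    simp only [Finset.mem_insert, Finset.mem_singleton, not_or] at hx
    obtain ⟨w, hw⟩ := ex q x (Ne.symm hx.1)
    have : w ∈ ({q, p₀, p₁, p₂, p₃} : Finset (Fin 6))ᶜ := by
      simp only [Finset.mem_compl, Finset.mem_insert, Finset.mem_singleton, not_or]
      refine ⟨(ne' hw).2.2.symm, ?_, ?_, ?_, ?_⟩ <;> rintro rfl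
      · exact hx.2.2.2.2 (inj hw h34)
      · exact hx.2.1 (inj hw h01)
      · exact hx.2.2.1 (inj hw h12)
      · exact hx.2.2.2.1 (inj hw h23)
    rw [hs, Finset.mem_singleton] at this
    exact (ne' hw).2.1 this.symm
  have cover : ∀ z, z = q ∨ z = p₀ ∨ z = p₁ ∨ z = p₂ ∨ z = p₃ ∨ z = p₄ := by
    intro z
    have hs : ({q, p₀, p₁, p₂, p₃, p₄} : Finset (Fin 6)) = Finset.univ := by
      refine (Finset.card_eq_iff_eq_univ _).mp ?_
      rw [Finset.card_insert_of_notMem (by simp [hq0, q1, q2, q3, q4]),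
        Finset.card_insert_of_notMem (by simp [d01, d02, d03, d04]),
        Finset.card_insert_of_notMem (by simp [d12, d13, d14]),
        Finset.card_insert_of_notMem (by simp [d23, d24]), Finset.card_pair d34]
      rfl
    have := Finset.mem_univ z
    rw [← hs] at this
    simpa using this
  have h40 : R q p₄ p₀ := by
    obtain ⟨w, hw⟩ := ex q p₄ q4
    rcases cover w with rfl | rfl | rfl | rfl | rfl | rfl
    · exact absurd rfl (ne' hw).2.2
    · exact hw
    · exact absurd (inj hw h01) d04.symm
    · exact absurd (inj hw h12) d14.symm
    · exact absurd (inj hw h23) d24.symm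
    · exact absurd rfl (ne' hw).2.1
  -- in a pentagon, two points at distance two are completed by the point between them
  have mid : ∀ a b c d e, R q a b → R q b c → R q c d → R q e a → d ≠ e →
      (∀ z, z = q ∨ z = a ∨ z = b ∨ z = c ∨ z = d ∨ z = e) → R a c b := by
    intro a b c d e hab hbc hcd hea hde hcov
    obtain ⟨w, hw⟩ := ex a c (two hab hbc)
    rcases hcov w with rfl | rfl | rfl | rfl | rfl | rfl
    · exact absurd (uniq hab (cyc (cyc hw))) (ne' hbc).2.1
    · exact absurd rfl (ne' hw).2.2
    · exact hw
    · exact absurd rfl (ne' hw).2.1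
    · exact absurd (uniq (cyc hcd) (cyc hw)) (ne hab)
    · exact absurd (uniq (cyc hea) (cyc (cyc hw))) (ne' hbc).2.2
  have m0 := mid p₀ p₁ p₂ p₃ p₄ h01 h12 h23 h40 d34 cover
  have m4 := mid p₄ p₀ p₁ p₂ p₃ h40 h01 h12 h34 d23 (fun z => by have := cover z; tauto)
  have m1 := mid p₁ p₂ p₃ p₄ p₀ h12 h23 h34 h01 d04.symm (fun z => by have := cover z; tauto)
  -- The triples found so far rule out each of the six points as the completion of `p₀, p₃`.
  obtain ⟨w, hw⟩ := ex p₀ p₃ d03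
  rcases cover w with rfl | rfl | rfl | rfl | rfl | rfl
  · exact d13 (uniq h01 (cyc (cyc hw)))
  · exact (ne' hw).2.2 rfl
  · exact d34 (uniq (cyc (cyc hw)) (cyc m4))
  · exact d01 (uniq (cyc hw) (cyc m1))
  · exact (ne' hw).2.1 rfl
  · exact q3 (uniq (cyc h40) (cyc (cyc hw)))

/-- Writing six distinct points as the values of a permutation turns all distinctness and complement
conditions into decidable facts about the indices. -/
theorem exists_perm_of_nodup {a b c d e f : Fin 6} (h : [a, b, c, d, e, f].Nodup) :
    ∃ p : Equiv.Perm (Fin 6), p 0 = a ∧ p 1 = b ∧ p 2 = c ∧ p 3 = d ∧ p 4 = e ∧ p 5 = f :=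
  ⟨Equiv.ofBijective [a, b, c, d, e, f].get
    (Finite.injective_iff_bijective.mp (List.nodup_iff_injective_get.mp h)),
    rfl, rfl, rfl, rfl, rfl, rfl⟩

theorem compl_perm (p : Equiv.Perm (Fin 6)) :
    ({p 0, p 1, p 2} : Finset (Fin 6))ᶜ = {p 3, p 4, p 5} := by
  ext z
  obtain ⟨i, rfl⟩ := p.surjective z
  simp only [Finset.mem_compl, Finset.mem_insert, Finset.mem_singleton,
    EmbeddingLike.apply_eq_iff_eq]
  revert i
  decide

theorem card_perm (p : Equiv.Perm (Fin 6)) : ({p 0, p 1, p 2} : Finset (Fin 6)).card = 3 := by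
  rw [Finset.card_eq_three]
  exact ⟨_, _, _, by simp, by simp, by simp, rfl⟩

theorem exists_perm_of_exchange {x : Finset (Fin 6)} {a b : Fin 6} (hx : x.card = 3) (ha : a ∈ x)
    (hb : b ∉ x) : ∃ p : Equiv.Perm (Fin 6), x = {p 0, p 1, p 2} ∧ p 0 = a ∧ p 3 = b := by
  obtain ⟨c, d, hcd, h1⟩ := Finset.card_eq_two.mp
    (show (x.erase a).card = 2 by rw [Finset.card_erase_of_mem ha, hx])
  obtain ⟨e, f, hef, h2⟩ := Finset.card_eq_two.mp (show (xᶜ.erase b).card = 2 by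
    rw [Finset.card_erase_of_mem (Finset.mem_compl.mpr hb), Finset.card_compl, hx]; rfl)
  have hc : c ∈ x.erase a := by simp [h1]
  have hd : d ∈ x.erase a := by simp [h1]
  have he : e ∈ xᶜ.erase b := by simp [h2]
  have hf : f ∈ xᶜ.erase b := by simp [h2]
  simp only [Finset.mem_erase, Finset.mem_compl] at hc hd he hf
  have out : ∀ {y z : Fin 6}, y ∈ x → z ∉ x → y ≠ z := fun hy hz h => hz (h ▸ hy)
  obtain ⟨p, p0, p1, p2, p3, -, -⟩ := exists_perm_of_nodup (a := a) (b := c) (c := d) (d := b)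
    (e := e) (f := f) (by
      simp [hc.1.symm, hd.1.symm, out ha hb, out ha he.2, out ha hf.2, hcd, out hc.2 hb,
        out hc.2 he.2, out hc.2 hf.2, out hd.2 hb, out hd.2 he.2, out hd.2 hf.2, he.1.symm,
        hf.1.symm, hef])
  refine ⟨p, ?_, p0, p3⟩
  rw [p0, p1, p2, ← h1, Finset.insert_erase ha]

theorem exists_perm_pair {a b : Fin 6} (hab : a ≠ b) :
    ∃ p : Equiv.Perm (Fin 6), p 0 = a ∧ p 1 = b := by
  refine ⟨Equiv.swap (Equiv.swap 0 a 1) b * Equiv.swap 0 a, ?_, by simp⟩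
  rw [Equiv.Perm.mul_apply, Equiv.swap_apply_left]
  refine Equiv.swap_apply_of_ne_of_ne ?_ hab
  intro h
  have := (Equiv.swap 0 a).injective ((Equiv.swap_apply_left 0 a).trans h)
  simp at this

theorem exists_perm_triple {a b c : Fin 6} (hab : a ≠ b) (hac : a ≠ c) (hbc : b ≠ c) :
    ∃ p : Equiv.Perm (Fin 6), p 0 = a ∧ p 1 = b ∧ p 2 = c := by
  have hs : ({a, b, c} : Finset (Fin 6)).card = 3 :=
    Finset.card_eq_three.mpr ⟨a, b, c, hab, hac, hbc, rfl⟩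
  obtain ⟨d, e, f, hde, hdf, hef, h2⟩ := Finset.card_eq_three.mp
    (show ({a, b, c} : Finset (Fin 6))ᶜ.card = 3 by rw [Finset.card_compl, hs]; rfl)
  have hd : d ∈ ({a, b, c} : Finset (Fin 6))ᶜ := by simp [h2]
  have he : e ∈ ({a, b, c} : Finset (Fin 6))ᶜ := by simp [h2]
  have hf : f ∈ ({a, b, c} : Finset (Fin 6))ᶜ := by simp [h2]
  simp only [Finset.mem_compl, Finset.mem_insert, Finset.mem_singleton, not_or] at hd he hf
  obtain ⟨p, p0, p1, p2, -⟩ := exists_perm_of_nodup (a := a) (b := b) (c := c) (d := d)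
    (e := e) (f := f) (by
      simp [hab, hac, hbc, Ne.symm hd.1, Ne.symm hd.2.1, Ne.symm hd.2.2, Ne.symm he.1,
        Ne.symm he.2.1, Ne.symm he.2.2, Ne.symm hf.1, Ne.symm hf.2.1, Ne.symm hf.2.2, hde, hdf, hef])
  exact ⟨p, p0, p1, p2⟩

theorem sum_triple {i j k : Fin 6} (h1 : i ≠ j) (h2 : i ≠ k) (h3 : j ≠ k) (f : Fin 6 → ℚ) :
    ∑ z ∈ {i, j, k}, f z = f i + f j + f k := by
  rw [Finset.sum_insert (by simp [h1, h2]), Finset.sum_pair h3, add_assoc]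

theorem colAt_perm (f : Finset (Fin 6) → Finset (Fin 6) → ℚ) (p : Equiv.Perm (Fin 6)) :
    colAt f {p 0, p 1, p 2} (p 3) = f {p 0, p 1, p 2} {p 3, p 1, p 2} +
      f {p 1, p 0, p 2} {p 3, p 0, p 2} + f {p 2, p 0, p 1} {p 3, p 0, p 1} := by
  have e1 : ({p 0, p 1, p 2} : Finset (Fin 6)) = {p 1, p 0, p 2} := Finset.insert_comm _ _ _
  have e2 : ({p 0, p 1, p 2} : Finset (Fin 6)) = {p 2, p 0, p 1} := by
    rw [Finset.pair_comm, Finset.insert_comm]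
  unfold colAt
  rw [sum_triple (by simp) (by simp) (by simp), Finset.erase_insert (by simp)]
  congr 1
  · rw [e1, Finset.erase_insert (by simp)]
  · rw [e2, Finset.erase_insert (by simp)]

end SixPoints

end WDRD

namespace WDRD

/-! ### Weights on six points and lines of symmetric functions on `J(6, 3)` -/

section SixThree

/-- Two 3-sets differing by the exchange of `a` and `b` give `(α a - α b)(α c + α d - α e - α f) =
0` for the other four points. If `α a ≠ α b`, the other four values agree by permuting the roles,
and the same argument shows that one of `α a`, `α b` equals them. -/
theorem exists_center_of_sum_sq {α : Fin 6 → ℚ} {k : ℚ}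
    (h : ∀ x : Finset (Fin 6), x.card = 3 → ∑ a ∈ x, ∑ b ∈ xᶜ, (α a + α b) ^ 2 = k) :
    ∃ c t, ∀ a, a ≠ c → α a = t := by
  have h' : ∀ a b c d e f : Fin 6, [a, b, c, d, e, f].Nodup →
      ((α a + α d) ^ 2 + (α a + α e) ^ 2 + (α a + α f) ^ 2) +
      ((α b + α d) ^ 2 + (α b + α e) ^ 2 + (α b + α f) ^ 2) +
      ((α c + α d) ^ 2 + (α c + α e) ^ 2 + (α c + α f) ^ 2) = k := by
    intro a b c d e f hn
    obtain ⟨p, rfl, rfl, rfl, rfl, rfl, rfl⟩ := exists_perm_of_nodup hn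
    rw [← h _ (card_perm p), compl_perm, sum_triple (by simp) (by simp) (by simp),
      sum_triple (by simp) (by simp) (by simp), sum_triple (by simp) (by simp) (by simp),
      sum_triple (by simp) (by simp) (by simp)]
  have key : ∀ a b c d e f : Fin 6, [a, b, c, d, e, f].Nodup → α a ≠ α b →
      α c + α d = α e + α f := by
    intro a b c d e f hn hab
    obtain ⟨p, rfl, rfl, rfl, rfl, rfl, rfl⟩ := exists_perm_of_nodup hn
    have h1 := h' (p 0) (p 2) (p 3) (p 1) (p 4) (p 5) (by simp)
    have h2 := h' (p 1) (p 2) (p 3) (p 0) (p 4) (p 5) (by simp)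
    refine mul_left_cancel₀ (sub_ne_zero.mpr hab) ?_
    linear_combination (h2 - h1) / 2
  have rest : ∀ p : Equiv.Perm (Fin 6), α (p 0) ≠ α (p 1) →
      α (p 3) = α (p 2) ∧ α (p 4) = α (p 2) ∧ α (p 5) = α (p 2) := by
    intro p hp
    have h1 := key (p 0) (p 1) (p 2) (p 3) (p 4) (p 5) (by simp) hp
    have h2 := key (p 0) (p 1) (p 2) (p 4) (p 3) (p 5) (by simp) hp
    have h3 := key (p 0) (p 1) (p 2) (p 5) (p 3) (p 4) (by simp) hp
    exact ⟨by linarith, by linarith, by linarith⟩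
  by_cases hc : ∀ a b, α a = α b
  · exact ⟨0, α 0, fun a _ => hc a 0⟩
  push Not at hc
  obtain ⟨a, b, hab⟩ := hc
  obtain ⟨p, rfl, rfl⟩ := exists_perm_pair (fun h : a = b => hab (h ▸ rfl))
  obtain ⟨r3, r4, r5⟩ := rest p hab
  by_cases h0 : α (p 0) = α (p 2)
  · refine ⟨p 1, α (p 2), fun z hz => ?_⟩
    obtain ⟨i, rfl⟩ := p.surjective z
    fin_cases i
    exacts [h0, absurd rfl hz, rfl, r3, r4, r5]
  · have h1 := key (p 0) (p 2) (p 1) (p 3) (p 4) (p 5) (by simp) h0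
    refine ⟨p 0, α (p 2), fun z hz => ?_⟩
    obtain ⟨i, rfl⟩ := p.surjective z
    fin_cases i
    exacts [absurd rfl hz, show α (p 1) = _ by linarith, rfl, r3, r4, r5]

/-- The three values on the points 0, 1, 2 determine the weight of 0; the identity then propagates
the decomposition to all pairs. -/
theorem exists_weight {π : Fin 6 → Fin 6 → ℚ} (hs : ∀ a b, a ≠ b → π b a = π a b)
    (h4 : ∀ a a' b b', a ≠ a' → b ≠ b' → a ≠ b → a ≠ b' → a' ≠ b → a' ≠ b' →
      π a b + π a' b' = π a b' + π a' b) : ∃ α : Fin 6 → ℚ, ∀ a b, a ≠ b → π a b = α a + α b := by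
  set c := (π 0 1 + π 0 2 - π 1 2) / 2 with hc
  refine ⟨fun a => if a = 0 then c else π 0 a - c, ?_⟩
  have h0 : ∀ b, b ≠ 0 → π 0 b = c + (π 0 b - c) := fun b _ => by ring
  have h1 : ∀ b, b ≠ 0 → b ≠ 1 → π 1 b = (π 0 1 - c) + (π 0 b - c) := by
    intro b hb0 hb1
    by_cases hb2 : b = 2
    · rw [hb2, hc]; ring
    have := h4 1 0 b 2 (by decide) hb2 (Ne.symm hb1) (by decide) (Ne.symm hb0) (by decide)
    rw [hc]
    linarith
  intro a b hab
  by_cases ha : a = 0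
  · have hb : b ≠ 0 := fun h => hab (ha.trans h.symm)
    simp only [ha, if_true, hb, if_false]
    ring
  by_cases hb : b = 0
  · simp only [ha, if_false, hb, if_true]
    rw [hs 0 a (Ne.symm ha)]
    ring
  simp only [ha, hb, if_false]
  by_cases ha1 : a = 1
  · rw [ha1, h1 b hb (fun h => hab (ha1.trans h.symm))]
  by_cases hb1 : b = 1
  · rw [hb1, hs 1 a (Ne.symm ha1), h1 a ha ha1]
    ring
  have h2 := h4 a 0 b 1 ha hb1 hab ha1 (Ne.symm hb) (by decide)
  rw [hs 1 a (Ne.symm ha1), h1 a ha ha1] at h2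
  linarith

variable {D : Finset (Fin 6) → Finset (Fin 6) → ℕ × ℕ}

/-- For `J(6, 3)`, the line sums of a symmetric function of the label are those of a star. -/
theorem Labelling.exists_star_lines (hL : Labelling 6 3 D) (hQ : HasQuad 6 3 D)
    {φ : ℕ × ℕ → ℚ} (hφ : ∀ i, φ i.swap = φ i) :
    ∃ ψ : ℕ × ℕ → ℚ, (∀ i, ψ i.swap = ψ i) ∧ (∀ x a b, x.card = 3 → a ∈ x → b ∉ x →
      ψ (D x (insert b (x.erase a))) =
        rowAt (fun x y => φ (D x y)) x a + colAt (fun x y => φ (D x y)) x b) ∧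
      ∃ c s t, ∀ x a b, x.card = 3 → a ∈ x → b ∉ x →
        ψ (D x (insert b (x.erase a))) = if a = c ∨ b = c then s else t := by
  obtain ⟨ψ, hψ, h1⟩ := hL.exists_rowAt_add_colAt (φ := φ) (ε := 1) (by norm_num)
    (by simpa using hφ)
  replace hψ : ∀ i, ψ i.swap = ψ i := by simpa using hψ
  refine ⟨ψ, hψ, h1, ?_⟩
  -- As a row term plus a column term, `ψ` has the four-term property directly. The eigenvalue
  -- comparison that gives it for `φ` itself needs `n ≥ 7` when `e = 3`.
  have hF : ∀ x, x.card = 3 → FourTerm (fun x y => ψ (D x y)) x := by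
    intro x hx a ha a' ha' b hb b' hb'
    beta_reduce
    rw [h1 x a b hx ha hb, h1 x a' b' hx ha' hb', h1 x a b' hx ha hb', h1 x a' b hx ha' hb]
    ring
  obtain ⟨π, hπ⟩ := hL.exists_pair_function hQ rfl (by norm_num) hψ hF
  have hπ' : ∀ x a b, x.card = 3 → a ∈ x → b ∉ x → ψ (D x (insert b (x.erase a))) = π a b := by
    intro x a b hx ha hb
    have := hπ a b (fun h => hb (h ▸ ha)) (x.erase a)
      (by rw [Finset.card_erase_add_one ha, hx]) (by simp) (by simp [hb])
    rwa [Finset.insert_erase ha] at this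
  obtain ⟨α, hα⟩ := exists_weight (π := π) (by
      intro a b hab
      obtain ⟨p, rfl, rfl⟩ := exists_perm_pair hab
      rw [← hπ (p 0) (p 1) (by simp) {p 2, p 3} (by rw [Finset.card_pair (by simp)]) (by simp)
        (by simp), hL.swap, hψ,
        hπ (p 1) (p 0) (by simp) {p 2, p 3} (by rw [Finset.card_pair (by simp)]) (by simp)
        (by simp)]) (by
      intro a a' b b' haa hbb hab hab' ha'b ha'b'
      obtain ⟨w, hw, hd⟩ := exists_avoid (k := 1) ({a, a', b, b'} : Finset (Fin 6))
        (by have := Finset.card_le_four (a := a) (b := a') (c := b) (d := b'); omega)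
      rw [Finset.disjoint_right] at hd
      have hx : (insert a (insert a' w)).card = 3 := by
        rw [Finset.card_insert_of_notMem (by simp [haa, hd]),
          Finset.card_insert_of_notMem (by simp [hd]), hw]
      have hb : b ∉ insert a (insert a' w) := by simp [hab.symm, ha'b.symm, hd]
      have hb' : b' ∉ insert a (insert a' w) := by simp [hab'.symm, ha'b'.symm, hd]
      have := hF _ hx a (by simp) a' (by simp) b hb b' hb'
      beta_reduce at this
      rwa [hπ' _ _ _ hx (by simp) hb, hπ' _ _ _ hx (by simp) hb', hπ' _ _ _ hx (by simp) hb',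
        hπ' _ _ _ hx (by simp) hb] at this)
  -- That the sum of squares is the same at all sets confines the weights to one exceptional point.
  obtain ⟨k, hk⟩ := hL.total (fun i => ψ i ^ 2)
  obtain ⟨c, t, hc⟩ := exists_center_of_sum_sq (α := α) (k := k) (by
    intro x hx
    rw [← hk x hx]
    refine Finset.sum_congr rfl fun a ha => Finset.sum_congr rfl fun b hb => ?_
    rw [Finset.mem_compl] at hb
    beta_reduce
    rw [hπ' x a b hx ha hb, hα a b (fun h => hb (h ▸ ha))])
  refine ⟨c, α c + t, t + t, fun x a b hx ha hb => ?_⟩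
  have hab : a ≠ b := fun h => hb (h ▸ ha)
  rw [hπ' x a b hx ha hb, hα a b hab]
  by_cases hac : a = c
  · rw [if_pos (Or.inl hac), hac, hc b (fun h => hab (hac.trans h.symm))]
  by_cases hbc : b = c
  · rw [if_pos (Or.inr hbc), hbc, hc a hac, add_comm]
  · rw [if_neg (by tauto), hc a hac, hc b hbc]

end SixThree

end WDRD

namespace WDRD

/-! ### The support of a label on `J(6, 3)` -/

section SixThree

theorem rowAt_six (f : Finset (Fin 6) → Finset (Fin 6) → ℚ) {x : Finset (Fin 6)}
    {p : Equiv.Perm (Fin 6)} (hx : x = {p 0, p 1, p 2}) (a : Fin 6) :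
    rowAt f x a = f x (insert (p 3) (x.erase a)) + f x (insert (p 4) (x.erase a)) +
      f x (insert (p 5) (x.erase a)) := by
  unfold rowAt
  rw [hx, compl_perm, sum_triple (by simp) (by simp) (by simp)]

theorem colAt_six (f : Finset (Fin 6) → Finset (Fin 6) → ℚ) {x : Finset (Fin 6)}
    {p : Equiv.Perm (Fin 6)} (hx : x = {p 0, p 1, p 2}) (b : Fin 6) :
    colAt f x b = f x (insert b (x.erase (p 0))) + f x (insert b (x.erase (p 1))) +
      f x (insert b (x.erase (p 2))) := by
  unfold colAt
  conv_lhs => rw [hx]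
  rw [sum_triple (by simp) (by simp) (by simp), ← hx]

variable {D : Finset (Fin 6) → Finset (Fin 6) → ℕ × ℕ} {i₀ : ℕ × ℕ}

theorem Labelling.nbrSum_arcSupp_ne {n e : ℕ} {D : Finset (Fin n) → Finset (Fin n) → ℕ × ℕ}
    (hL : Labelling n e D) (hi : HasLabel e D i₀)
    {x : Finset (Fin n)} (hx : x.card = e) : nbrSum x (fun y => arcSupp i₀ (D x y)) ≠ 0 := by
  obtain ⟨k, hk⟩ := hL.total (arcSupp i₀)
  obtain ⟨y, a, b, hy, ha, hb, h⟩ := hi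
  rw [hk x hx, ← hk y hy]
  intro h0
  have hnn : ∀ z, 0 ≤ arcSupp i₀ z := fun z => by
    rcases arcSupp_eq i₀ z with h | h <;> rw [h]
    norm_num
  unfold nbrSum at h0
  rw [Finset.sum_eq_zero_iff_of_nonneg (fun a _ => Finset.sum_nonneg fun b _ => hnn _)] at h0
  have h1 := (Finset.sum_eq_zero_iff_of_nonneg (fun b _ => hnn _)).mp (h0 a ha) b
    (Finset.mem_compl.mpr hb)
  rw [h, arcSupp_self] at h1
  norm_num at h1

theorem mem_perm {x : Finset (Fin 6)} {p : Equiv.Perm (Fin 6)} (hx : x = {p 0, p 1, p 2}) :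
    (p 0 ∈ x ∧ p 1 ∈ x ∧ p 2 ∈ x) ∧ p 3 ∉ x ∧ p 4 ∉ x ∧ p 5 ∉ x := by
  rw [hx]
  simp

/-- Otherwise the line function of the support is, after scaling, a star at some `c`, and all signs
have zero line sums and vanish on edges involving `c`. At a set containing `c` the other two entries
of each column are then opposite signs or both zero, so the line condition makes the support
constant along a row of three. Three signs cannot sum to zero, so the support is empty there. -/
theorem Labelling.exists_arcSupp_lines (hL : Labelling 6 3 D) (hQ : HasQuad 6 3 D)
    (hi : HasLabel 3 D i₀) (h₀ : i₀.swap ≠ i₀) : ∃ ρ, ∀ x a b, x.card = 3 → a ∈ x → b ∉ x →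
      rowAt (fun x y => arcSupp i₀ (D x y)) x a +
        colAt (fun x y => arcSupp i₀ (D x y)) x b = ρ := by
  obtain ⟨ψ, hψ, h1, c, s, t, h2⟩ := hL.exists_star_lines hQ (arcSupp_swap i₀)
  by_cases hst : s = t
  · refine ⟨t, fun x a b hx ha hb => ?_⟩
    rw [← h1 x a b hx ha hb, h2 x a b hx ha hb, hst, ite_self]
  exfalso
  have hst' : s - t ≠ 0 := sub_ne_zero.mpr hst
  have hδ : ∀ i, (fun i => (ψ i - t) / (s - t)) i.swap = (fun i => (ψ i - t) / (s - t)) i :=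
    fun i => by simp only [hψ]
  have hstar : IsStar 3 D (fun i => (ψ i - t) / (s - t)) c := by
    intro x a b hx ha hb
    beta_reduce
    rw [h2 x a b hx ha hb]
    split_ifs
    · exact div_self hst'
    · rw [sub_self, zero_div]
  have hz := hL.star_zeroLines (by norm_num) (by norm_num) hδ hstar (arcSign_swap i₀)
  obtain ⟨c', hc'⟩ : ∃ c', c ≠ c' := by
    by_cases h : c = 0
    · exact ⟨1, by rw [h]; decide⟩
    · exact ⟨0, h⟩
  obtain ⟨p, rfl, -⟩ := exists_perm_pair hc'
  obtain ⟨x, hxp⟩ : ∃ x : Finset (Fin 6), x = {p 0, p 1, p 2} := ⟨_, rfl⟩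
  have hx : x.card = 3 := by rw [hxp, card_perm]
  obtain ⟨⟨m0, m1, m2⟩, m3, m4, m5⟩ := mem_perm hxp
  have hcol : ∀ b, b ∉ x → arcSupp i₀ (D x (insert b (x.erase (p 0)))) = 0 ∧
      arcSupp i₀ (D x (insert b (x.erase (p 2)))) =
        arcSupp i₀ (D x (insert b (x.erase (p 1)))) := by
    intro b hb
    have e0 := hL.star_eq_zero (by norm_num) hδ hstar (arcSign_swap i₀) hx m0 hb (Or.inl rfl)
    have e1 := (hz x hx).2 b hb
    rw [colAt_six _ hxp, e0] at e1
    refine ⟨by rw [← arcSign_mul_self h₀, e0, mul_zero], ?_⟩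
    rw [← arcSign_mul_self h₀, ← arcSign_mul_self h₀,
      show arcSign i₀ (D x (insert b (x.erase (p 2)))) =
        -arcSign i₀ (D x (insert b (x.erase (p 1)))) by linarith]
    ring
  have hline : ∀ b, b ∉ x → rowAt (fun x y => arcSupp i₀ (D x y)) x (p 1) +
      2 * arcSupp i₀ (D x (insert b (x.erase (p 1)))) = t := by
    intro b hb
    have e1 := h1 x (p 1) b hx m1 hb
    have hb0 : b ≠ p 0 := fun h => hb (h ▸ m0)
    rw [h2 x (p 1) b hx m1 hb, if_neg (by simp [hb0]), colAt_six _ hxp, (hcol b hb).1,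
      (hcol b hb).2] at e1
    linarith
  have l3 := hline _ m3
  have l4 := hline _ m4
  have l5 := hline _ m5
  have hrow := (hz x hx).1 (p 1) m1
  rw [rowAt_six _ hxp] at hrow
  have h0 : arcSupp i₀ (D x (insert (p 3) (x.erase (p 1)))) = 0 := by
    refine (arcSupp_eq _ _).resolve_right fun h => ?_
    have s3 := arcSign_of_supp h₀ h
    have s4 := arcSign_of_supp h₀ (i := D x (insert (p 4) (x.erase (p 1)))) (by linarith)
    have s5 := arcSign_of_supp h₀ (i := D x (insert (p 5) (x.erase (p 1)))) (by linarith)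
    rcases s3 with s3 | s3 <;> rcases s4 with s4 | s4 <;> rcases s5 with s5 | s5 <;>
      rw [s3, s4, s5] at hrow <;> norm_num at hrow
  refine hL.nbrSum_arcSupp_ne hi hx ?_
  have hcz : ∀ b, b ∉ x → arcSupp i₀ (D x (insert b (x.erase (p 1)))) = 0 → 
      colAt (fun x y => arcSupp i₀ (D x y)) x b = 0 := by
    intro b hb h
    rw [colAt_six _ hxp, (hcol b hb).1, (hcol b hb).2, h]
    norm_num
  have e := nbrSum_eq_sum_colAt (fun x y => arcSupp i₀ (D x y)) x
  beta_reduce at e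
  rw [e, hxp, compl_perm, ← hxp, sum_triple (by simp) (by simp) (by simp), hcz _ m3 h0,
    hcz _ m4 (by linarith), hcz _ m5 (by linarith)]
  norm_num

/-- Support and sign agree modulo 2; since the sign has total zero, the support has even total at
each set. -/
theorem exists_int_arcSupp (h₀ : i₀.swap ≠ i₀) (i : ℕ × ℕ) :
    ∃ m : ℤ, arcSupp i₀ i = 2 * (m : ℚ) - arcSign i₀ i := by
  rcases arcSupp_eq i₀ i with h | h
  · exact ⟨0, by rw [h, arcSign_of_not_supp h]; norm_num⟩
  · rcases arcSign_of_supp h₀ h with h' | h'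
    · exact ⟨1, by rw [h, h']; norm_num⟩
    · exact ⟨0, by rw [h, h']; norm_num⟩

/-- Since row plus column is constant, all row sums are equal and all column sums are equal, and in
a 3 × 3 array the two coincide. Three times this number is the total, which is even and nonzero; an
entry count between 0 and 3 must then be 2. -/
theorem Labelling.arcSupp_lines (hL : Labelling 6 3 D) (hQ : HasQuad 6 3 D)
    (hi : HasLabel 3 D i₀) (h₀ : i₀.swap ≠ i₀) {x : Finset (Fin 6)} (hx : x.card = 3) :
    (∀ a ∈ x, rowAt (fun x y => arcSupp i₀ (D x y)) x a = 2) ∧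
      ∀ b ∉ x, colAt (fun x y => arcSupp i₀ (D x y)) x b = 2 := by
  obtain ⟨ρ, hρ⟩ := hL.exists_arcSupp_lines hQ hi h₀
  have hne := hL.nbrSum_arcSupp_ne hi hx
  have hsum := hL.total_skew _ (arcSign_swap i₀) x hx
  have er := nbrSum_eq_sum_rowAt (fun x y => arcSupp i₀ (D x y)) x
  have ec := nbrSum_eq_sum_colAt (fun x y => arcSupp i₀ (D x y)) x
  have es := nbrSum_eq_sum_rowAt (fun x y => arcSign i₀ (D x y)) x
  beta_reduce at er ec es
  obtain ⟨a₀, ha₀⟩ : x.Nonempty := Finset.card_pos.mp (by omega)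
  obtain ⟨b₀, hb₀⟩ : xᶜ.Nonempty := Finset.card_pos.mp (by
    rw [Finset.card_compl, hx, Fintype.card_fin]; norm_num)
  rw [Finset.mem_compl] at hb₀
  obtain ⟨p, hxp, h0, -⟩ := exists_perm_of_exchange hx ha₀ hb₀
  obtain ⟨⟨m0, m1, m2⟩, m3, m4, m5⟩ := mem_perm hxp
  rw [show ∑ a ∈ x, rowAt (fun x y => arcSupp i₀ (D x y)) x a =
    ∑ a ∈ {p 0, p 1, p 2}, rowAt (fun x y => arcSupp i₀ (D x y)) x a by rw [← hxp],
    sum_triple (by simp) (by simp) (by simp)] at er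
  rw [show ∑ a ∈ x, rowAt (fun x y => arcSign i₀ (D x y)) x a =
    ∑ a ∈ {p 0, p 1, p 2}, rowAt (fun x y => arcSign i₀ (D x y)) x a by rw [← hxp],
    sum_triple (by simp) (by simp) (by simp)] at es
  rw [show xᶜ = {p 3, p 4, p 5} by rw [hxp, compl_perm],
    sum_triple (by simp) (by simp) (by simp)] at ec
  have r0 := hρ x _ _ hx m0 m3
  have r1 := hρ x _ _ hx m1 m3
  have r2 := hρ x _ _ hx m2 m3
  have c4 := hρ x _ _ hx m0 m4
  have c5 := hρ x _ _ hx m0 m5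
  have key : rowAt (fun x y => arcSupp i₀ (D x y)) x (p 0) = 2 := by
    obtain ⟨M, hM⟩ : ∃ M : ℤ, nbrSum x (fun y => arcSupp i₀ (D x y)) = 2 * (M : ℚ) := by
      choose m hm using exists_int_arcSupp (i₀ := i₀) h₀
      refine ⟨∑ a ∈ x, ∑ b ∈ xᶜ, m (D x (insert b (x.erase a))), ?_⟩
      have : nbrSum x (fun y => arcSupp i₀ (D x y)) = nbrSum x (fun y => 2 * (m (D x y) : ℚ)) -
          nbrSum x (fun y => arcSign i₀ (D x y)) := by
        unfold nbrSum
        simp only [← Finset.sum_sub_distrib, ← hm]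
      rw [this, hsum, sub_zero]
      unfold nbrSum
      push_cast
      simp only [Finset.mul_sum]
    have hR : 3 * rowAt (fun x y => arcSupp i₀ (D x y)) x (p 0) = 2 * (M : ℚ) := by linarith
    have hRne : rowAt (fun x y => arcSupp i₀ (D x y)) x (p 0) ≠ 0 := by
      intro h
      rw [h] at hR
      exact hne (by linarith)
    rw [rowAt_six _ hxp] at hR hRne ⊢
    rcases arcSupp_eq i₀ (D x (insert (p 3) (x.erase (p 0)))) with e3 | e3 <;>
    rcases arcSupp_eq i₀ (D x (insert (p 4) (x.erase (p 0)))) with e4 | e4 <;>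
    rcases arcSupp_eq i₀ (D x (insert (p 5) (x.erase (p 0)))) with e5 | e5 <;>
    rw [e3, e4, e5] at hR hRne ⊢ <;>
    first
    | (norm_num; done)
    | (exfalso; apply hRne; norm_num; done)
    | (have h5 : (3 : ℤ) = 2 * M := by exact_mod_cast (by linarith : (3 : ℚ) = 2 * M)
       omega)
    | (have h5 : (9 : ℤ) = 2 * M := by exact_mod_cast (by linarith : (9 : ℚ) = 2 * M)
       omega)
  have key' : colAt (fun x y => arcSupp i₀ (D x y)) x (p 3) = 2 := by linarith
  refine ⟨fun a ha => ?_, fun b hb => ?_⟩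
  · have := hρ x a _ hx ha m3
    linarith
  · have := hρ x _ b hx m0 hb
    linarith

theorem lines_eq_zero_of_diagonal {s : Fin 3 → Fin 3 → ℚ} (h0 : ∀ i, s i i = 0)
    (h1 : ∀ i j, i ≠ j → s i j = 1 ∨ s i j = -1) (hs : ∑ i, ∑ j, s i j = 0) {ν : ℚ}
    (hν : ∀ i j, i ≠ j → ∑ k, s i k + ∑ k, s k j = ν * s i j) :
    (∀ i, ∑ j, s i j = 0) ∧ ∀ j, ∑ i, s i j = 0 := by
  have a01 := h1 0 1 (by decide)
  have a02 := h1 0 2 (by decide)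
  have a10 := h1 1 0 (by decide)
  have a12 := h1 1 2 (by decide)
  have a20 := h1 2 0 (by decide)
  have a21 := h1 2 1 (by decide)
  have n01 := hν 0 1 (by decide)
  have n02 := hν 0 2 (by decide)
  have n10 := hν 1 0 (by decide)
  have n12 := hν 1 2 (by decide)
  have n20 := hν 2 0 (by decide)
  have n21 := hν 2 1 (by decide)
  simp only [Fin.sum_univ_three, h0] at hs n01 n02 n10 n12 n20 n21
  have key : s 0 1 + s 0 2 = 0 ∧ s 1 0 + s 1 2 = 0 ∧ s 2 0 + s 2 1 = 0 ∧
      s 1 0 + s 2 0 = 0 ∧ s 0 1 + s 2 1 = 0 ∧ s 0 2 + s 1 2 = 0 := by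
    generalize s 0 1 = x01 at *
    generalize s 0 2 = x02 at *
    generalize s 1 0 = x10 at *
    generalize s 1 2 = x12 at *
    generalize s 2 0 = x20 at *
    generalize s 2 1 = x21 at *
    clear h0 h1 hν
    rcases a01 with rfl | rfl <;> rcases a02 with rfl | rfl <;> rcases a10 with rfl | rfl <;>
    rcases a12 with rfl | rfl <;> rcases a20 with rfl | rfl <;> rcases a21 with rfl | rfl <;>
    first
    | (exfalso; linarith)
    | norm_num
  obtain ⟨k1, k2, k3, k4, k5, k6⟩ := key
  refine ⟨fun i => ?_, fun i => ?_⟩ <;> rw [Fin.sum_univ_three] <;> fin_cases i <;>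
    simp only [Fin.zero_eta, Fin.mk_one, Fin.reduceFinMk, h0] <;> linarith

/-- With two nonzero entries on each line, the zeros form a permutation matrix; a permutation of the
columns moves them to the diagonal, where finitely many sign patterns remain. -/
theorem lines_eq_zero {s : Fin 3 → Fin 3 → ℚ}
    (h1 : ∀ i j, s i j = 0 ∨ s i j = 1 ∨ s i j = -1) (hr : ∀ i, ∑ j, s i j * s i j = 2)
    (hc : ∀ j, ∑ i, s i j * s i j = 2) (hs : ∑ i, ∑ j, s i j = 0) {ν : ℚ}
    (hν : ∀ i j, s i j ≠ 0 → ∑ k, s i k + ∑ k, s k j = ν * s i j) :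
    (∀ i, ∑ j, s i j = 0) ∧ ∀ j, ∑ i, s i j = 0 := by
  have hsq : ∀ i j, s i j ≠ 0 → s i j * s i j = 1 := by
    intro i j h
    rcases (h1 i j).resolve_left h with h | h <;> rw [h] <;> norm_num
  have hz : ∀ f : Fin 3 → ℚ, (∀ i, f i ≠ 0 → f i * f i = 1) → ∑ i, f i * f i = 2 →
      ∃ i, f i = 0 ∧ ∀ j, f j = 0 → j = i := by
    intro f hf h
    have hcard : ((Finset.univ.filter fun i => f i ≠ 0).card : ℚ) = 2 := by
      rw [← h, Finset.card_eq_sum_ones, Finset.sum_filter]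
      push_cast
      refine Finset.sum_congr rfl fun i _ => ?_
      split_ifs with hi
      · rw [hf i hi]
      · rw [not_not.mp hi, mul_zero]
    have h3 := Finset.card_filter_add_card_filter_not (s := (Finset.univ : Finset (Fin 3)))
      (fun i => f i ≠ 0)
    have hcard' : (Finset.univ.filter fun i => f i ≠ 0).card = 2 := by exact_mod_cast hcard
    rw [hcard', Finset.card_univ, Fintype.card_fin] at h3
    obtain ⟨i, hi⟩ := Finset.card_eq_one.mp
      (show (Finset.univ.filter fun i => ¬f i ≠ 0).card = 1 by omega)
    refine ⟨i, ?_, fun j hj => ?_⟩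
    · have : i ∈ Finset.univ.filter fun i => ¬f i ≠ 0 := by
        rw [hi]; exact Finset.mem_singleton_self i
      simpa using this
    · have : j ∈ Finset.univ.filter fun i => ¬f i ≠ 0 := by simp [hj]
      rw [hi] at this
      simpa using this
  choose τ hτ hτ' using fun i => hz (s i) (hsq i) (hr i)
  have hinj : Function.Injective τ := by
    intro i i' h
    obtain ⟨k, -, hk⟩ := hz (fun i => s i (τ i')) (fun i => hsq i _) (hc _)
    rw [hk i (by rw [← h]; exact hτ i), hk i' (hτ i')]
  obtain ⟨σ, hσ⟩ : ∃ σ : Equiv.Perm (Fin 3), ∀ i, σ i = τ i :=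
    ⟨Equiv.ofBijective τ (Finite.injective_iff_bijective.mp hinj), fun _ => rfl⟩
  have hrow : ∀ i, ∑ j, s i (σ j) = ∑ j, s i j := fun i => Equiv.sum_comp σ (s i)
  have key := lines_eq_zero_of_diagonal (s := fun i j => s i (σ j)) (ν := ν)
    (fun i => by rw [hσ, hτ]) (fun i j hij => (h1 i (σ j)).resolve_left fun h => ?_) ?_ ?_
  · refine ⟨fun i => by rw [← hrow, key.1], fun j => ?_⟩
    have := key.2 (σ.symm j)
    simpa using this
  · have := hτ' i _ h
    rw [← hσ] at this
    exact hij (σ.injective this).symm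
  · simp only [hrow, hs]
  · intro i j hij
    rw [hrow]
    refine hν i (σ j) fun h => ?_
    have := hτ' i _ h
    rw [← hσ] at this
    exact hij (σ.injective this).symm

end SixThree

end WDRD

namespace WDRD

/-! ### The contradiction for `J(6, 3)` -/

section SixThree

variable {D : Finset (Fin 6) → Finset (Fin 6) → ℕ × ℕ} {i₀ : ℕ × ℕ}

theorem Labelling.zeroLines_arcSign_six (hL : Labelling 6 3 D) (hQ : HasQuad 6 3 D)
    (hi : HasLabel 3 D i₀) (h₀ : i₀.swap ≠ i₀) :
    ZeroLines 3 (fun x y => arcSign i₀ (D x y)) := by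
  obtain ⟨ψ, hψ, h1⟩ := hL.exists_rowAt_add_colAt (φ := arcSign i₀) (ε := -1) (by norm_num)
    (fun i => by rw [arcSign_swap]; ring)
  replace hψ : ∀ i, ψ i.swap = -ψ i := fun i => by rw [hψ]; ring
  intro x hx
  obtain ⟨hPr, hPc⟩ := hL.arcSupp_lines hQ hi h₀ hx
  obtain ⟨a₀, ha₀⟩ : x.Nonempty := Finset.card_pos.mp (by omega)
  obtain ⟨b₀, hb₀⟩ : xᶜ.Nonempty := Finset.card_pos.mp (by
    rw [Finset.card_compl, hx, Fintype.card_fin]; norm_num)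
  rw [Finset.mem_compl] at hb₀
  obtain ⟨p, hxp, -, -⟩ := exists_perm_of_exchange hx ha₀ hb₀
  obtain ⟨⟨m0, m1, m2⟩, m3, m4, m5⟩ := mem_perm hxp
  set A : Fin 3 → Fin 6 := ![p 0, p 1, p 2] with hA
  set B : Fin 3 → Fin 6 := ![p 3, p 4, p 5] with hB
  have hAx : ∀ i, A i ∈ x := by
    intro i
    fin_cases i
    exacts [m0, m1, m2]
  have hBx : ∀ i, B i ∉ x := by
    intro i
    fin_cases i
    exacts [m3, m4, m5]
  have hrow : ∀ (f : Finset (Fin 6) → Finset (Fin 6) → ℚ) a,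
      rowAt f x a = ∑ j, f x (insert (B j) (x.erase a)) := by
    intro f a
    rw [rowAt_six f hxp, Fin.sum_univ_three]
    rfl
  have hcol : ∀ (f : Finset (Fin 6) → Finset (Fin 6) → ℚ) b,
      colAt f x b = ∑ i, f x (insert b (x.erase (A i))) := by
    intro f b
    rw [colAt_six f hxp, Fin.sum_univ_three]
    rfl
  have hsum : ∀ (f : Finset (Fin 6) → Finset (Fin 6) → ℚ),
      nbrSum x (f x) = ∑ i, rowAt f x (A i) := by
    intro f
    rw [nbrSum_eq_sum_rowAt, Fin.sum_univ_three,
      show ∑ a ∈ x, rowAt f x a = ∑ a ∈ {p 0, p 1, p 2}, rowAt f x a by rw [← hxp],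
      sum_triple (by simp) (by simp) (by simp)]
    rfl
  have key := lines_eq_zero (s := fun i j => arcSign i₀ (D x (insert (B j) (x.erase (A i)))))
    (ν := ψ i₀) ?_ ?_ ?_ ?_ ?_
  · refine ⟨fun a ha => ?_, fun b hb => ?_⟩
    · obtain ⟨i, rfl⟩ : ∃ i, A i = a := by
        rw [hxp] at ha
        simp only [Finset.mem_insert, Finset.mem_singleton] at ha
        rcases ha with rfl | rfl | rfl
        exacts [⟨0, rfl⟩, ⟨1, rfl⟩, ⟨2, rfl⟩]
      rw [hrow]
      exact key.1 i
    · obtain ⟨j, rfl⟩ : ∃ j, B j = b := by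
        rw [← Finset.mem_compl, hxp, compl_perm] at hb
        simp only [Finset.mem_insert, Finset.mem_singleton] at hb
        rcases hb with rfl | rfl | rfl
        exacts [⟨0, rfl⟩, ⟨1, rfl⟩, ⟨2, rfl⟩]
      rw [hcol]
      exact key.2 j
  · intro i j
    rcases arcSupp_eq i₀ (D x (insert (B j) (x.erase (A i)))) with h | h
    · exact Or.inl (arcSign_of_not_supp h)
    · exact Or.inr (arcSign_of_supp h₀ h)
  · intro i
    have := hPr (A i) (hAx i)
    rw [hrow] at this
    simpa only [arcSign_mul_self h₀] using this
  · intro j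
    have := hPc (B j) (hBx j)
    rw [hcol] at this
    simpa only [arcSign_mul_self h₀] using this
  · have := hL.total_skew _ (arcSign_swap i₀) x hx
    have h2 := hsum (fun x y => arcSign i₀ (D x y))
    beta_reduce at h2
    rw [this] at h2
    simpa only [hrow] using h2.symm
  · intro i j hij
    have h2 := h1 x (A i) (B j) hx (hAx i) (hBx j)
    have h3 : arcSupp i₀ (D x (insert (B j) (x.erase (A i)))) = 1 :=
      (arcSupp_eq _ _).resolve_left fun h => hij (arcSign_of_not_supp h)
    rw [skew_of_supp h₀ hψ h3, hrow, hcol] at h2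
    exact h2.symm

theorem exchangeSum_perm (σ : Finset (Fin 6) → ℚ) (p : Equiv.Perm (Fin 6)) :
    exchangeSum ((Finset.univ.erase (p 1)).erase (p 0)) σ {p 2, p 3} =
      σ {p 4, p 3} + σ {p 5, p 3} + (σ {p 4, p 2} + σ {p 5, p 2}) := by
  have h1 : ((Finset.univ.erase (p 1)).erase (p 0)) \ {p 2, p 3} = {p 4, p 5} := by
    ext z
    obtain ⟨i, rfl⟩ := p.surjective z
    simp only [Finset.mem_sdiff, Finset.mem_erase, Finset.mem_univ, Finset.mem_insert,
      Finset.mem_singleton, ne_eq, EmbeddingLike.apply_eq_iff_eq]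
    revert i
    decide
  unfold exchangeSum
  rw [h1, Finset.sum_pair (by simp), Finset.sum_pair (by simp), Finset.sum_pair (by simp),
    Finset.erase_insert (by simp), Finset.pair_comm (p 2) (p 3), Finset.erase_insert (by simp)]

theorem isEigen_perm {σ : Finset (Fin 6) → ℚ} {c : ℚ} {p : Equiv.Perm (Fin 6)}
    (h : IsEigen ((Finset.univ.erase (p 1)).erase (p 0)) 2 c σ) :
    σ {p 4, p 3} + σ {p 5, p 3} + (σ {p 4, p 2} + σ {p 5, p 2}) = c * σ {p 2, p 3} := by
  rw [← exchangeSum_perm]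
  exact h _ (by intro z; simp only [Finset.mem_insert, Finset.mem_singleton]; rintro (rfl | rfl) <;> simp)
    (Finset.card_pair (by simp))

/-- A function on the pairs from four points, in the eigenspaces that occur for `J(6, 3)`. -/
theorem six_eigen {q r : Fin 6} {c : ℚ} {σ : Finset (Fin 6) → ℚ}
    (h : IsEigen ((Finset.univ.erase r).erase q) 2 c σ) {a b d e : Fin 6}
    (hn : [q, r, a, b, d, e].Nodup) :
    σ {a, d} + σ {a, e} + σ {b, d} + σ {b, e} = c * σ {a, b} := by
  obtain ⟨p, rfl, rfl, rfl, rfl, rfl, rfl⟩ := exists_perm_of_nodup hn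
  have := isEigen_perm h
  rw [Finset.pair_comm (p 4) (p 3), Finset.pair_comm (p 5) (p 3), Finset.pair_comm (p 4) (p 2),
    Finset.pair_comm (p 5) (p 2)] at this
  linarith

/-- For fixed `q, p` the signs and the support live on the six pairs of four points, with
eigenvalues 0 and -2. Hence complementary pairs carry opposite signs and two of the three
complementary couples are nonzero. Such a function is `t c + t d` with values `1, -1, 0, 0` of `t`
on the four points. The line sums make `t` alternating in its three arguments, so the triples with
`t = 1` form a forbidden orientation. -/
theorem Labelling.false_of_six_three (hL : Labelling 6 3 D) (hQ : HasQuad 6 3 D)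
    (hi : HasLabel 3 D i₀) (h₀ : i₀.swap ≠ i₀) : False := by
  have hz := hL.zeroLines_arcSign_six hQ hi h₀
  have hskew : ∀ x y, arcSign i₀ (D y x) = -arcSign i₀ (D x y) := fun x y => by
    rw [hL.swap, arcSign_swap]
  set F : Fin 6 → Fin 6 → Fin 6 → Fin 6 → ℚ :=
    fun q p r r' => arcSign i₀ (D {q, r, r'} {p, r, r'}) with hF
  have hFs : ∀ q p r r', F q p r' r = F q p r r' := fun q p r r' => by
    simp only [hF, Finset.pair_comm r r']
  have hFk : ∀ q p r r', F p q r r' = -F q p r r' := fun q p r r' => hskew _ _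
  have hF1 : ∀ q p r r', F q p r r' = 0 ∨ F q p r r' = 1 ∨ F q p r r' = -1 := by
    intro q p r r'
    rcases arcSupp_eq i₀ (D {q, r, r'} {p, r, r'}) with h | h
    · exact Or.inl (arcSign_of_not_supp h)
    · exact Or.inr (arcSign_of_supp h₀ h)
  -- complementary pairs carry opposite signs
  have hcompl : ∀ q p a b c d, [q, p, a, b, c, d].Nodup → F q p c d = -F q p a b := by
    intro q p a b c d hn
    obtain ⟨g, rfl, rfl, rfl, rfl, rfl, rfl⟩ := exists_perm_of_nodup hn
    have h := hL.isEigen_skew (q := g 0) (p := g 1) (arcSign_swap i₀) hz (by simp) (k := 1) (j := 1)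
      rfl rfl
    have e1 := six_eigen h (a := g 2) (b := g 3) (d := g 4) (e := g 5) (by simp)
    have e2 := six_eigen h (a := g 2) (b := g 4) (d := g 3) (e := g 5) (by simp)
    have e3 := six_eigen h (a := g 2) (b := g 5) (d := g 3) (e := g 4) (by simp)
    rw [Finset.pair_comm (g 4) (g 3)] at e2
    rw [Finset.pair_comm (g 5) (g 3), Finset.pair_comm (g 5) (g 4)] at e3
    simp only [hF]
    norm_num at e1 e2 e3
    linarith
  -- exactly two of the three complementary pairs of pairs carry signs
  have htwo : ∀ q p a b c d, [q, p, a, b, c, d].Nodup →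
      F q p a b * F q p a b + F q p a c * F q p a c + F q p a d * F q p a d = 2 := by
    intro q p a b c d hn
    have hc := hcompl q p
    obtain ⟨g, rfl, rfl, rfl, rfl, rfl, rfl⟩ := exists_perm_of_nodup hn
    -- Each line of three entries meets the support twice, so this multiple of the centred support
    -- has zero line sums.
    have hz' : ZeroLines 3 (fun x y => (fun i => 3 * arcSupp i₀ i - 2) (D x y)) := by
      intro x hx
      obtain ⟨hr, hc⟩ := hL.arcSupp_lines hQ hi h₀ hx
      constructor
      · intro a ha
        have := hr a ha
        simp only [rowAt, Finset.sum_sub_distrib, ← Finset.mul_sum, Finset.sum_const,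
          Finset.card_compl, hx, Fintype.card_fin] at this ⊢
        rw [this]
        norm_num
      · intro b hb
        have := hc b hb
        simp only [colAt, Finset.sum_sub_distrib, ← Finset.mul_sum, Finset.sum_const, hx] at this ⊢
        rw [this]
        norm_num
    have h := hL.isEigen_symm (q := g 0) (p := g 1) (φ := fun i => 3 * arcSupp i₀ i - 2)
      (fun i => by simp only [arcSupp_swap]) hz' (by simp) (k := 1) (j := 1) rfl rfl
    have e1 := six_eigen h (a := g 2) (b := g 3) (d := g 4) (e := g 5) (by simp)
    have hP : ∀ r r', arcSupp i₀ (D {g 0, r, r'} {g 1, r, r'}) =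
        F (g 0) (g 1) r r' * F (g 0) (g 1) r r' := fun r r' => (arcSign_mul_self h₀).symm
    simp only [hP] at e1
    rw [hc (g 2) (g 5) (g 3) (g 4) (by simp), hc (g 2) (g 4) (g 3) (g 5) (by simp)] at e1
    norm_num at e1
    linarith
  -- column sums
  have hcolF : ∀ q a b c d e, [a, b, c, q, d, e].Nodup → F a q b c + F b q a c + F c q a b = 0 := by
    intro q a b c d e hn
    obtain ⟨g, rfl, rfl, rfl, rfl, rfl, rfl⟩ := exists_perm_of_nodup hn
    have := (hz _ (card_perm g)).2 (g 3) (by simp)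
    rwa [colAt_perm] at this
  set t : Fin 6 → Fin 6 → Fin 6 → ℚ := fun q p r => (∑ z ∈ {q, p, r}ᶜ, F q p r z) / 2 with ht
  have ht3 : ∀ a b c d e f, [a, b, c, d, e, f].Nodup →
      t a b c = (F a b c d + F a b c e + F a b c f) / 2 := by
    intro a b c d e f hn
    obtain ⟨g, rfl, rfl, rfl, rfl, rfl, rfl⟩ := exists_perm_of_nodup hn
    simp only [ht]
    rw [compl_perm, sum_triple (by simp) (by simp) (by simp)]
  have hFt : ∀ a b c d e f, [a, b, c, d, e, f].Nodup → F a b c d = t a b c + t a b d := by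
    intro a b c d e f hn
    obtain ⟨g, rfl, rfl, rfl, rfl, rfl, rfl⟩ := exists_perm_of_nodup hn
    rw [ht3 _ _ _ (g 3) (g 4) (g 5) (by simp), ht3 _ _ (g 3) (g 2) (g 4) (g 5) (by simp), hFs,
      hcompl (g 0) (g 1) (g 2) (g 5) (g 3) (g 4) (by simp),
      hcompl (g 0) (g 1) (g 2) (g 4) (g 3) (g 5) (by simp)]
    ring
  have htk : ∀ a b c, t b a c = -t a b c := by
    intro a b c
    simp only [ht, hFk a b, Finset.insert_comm b a, Finset.sum_neg_distrib, neg_div]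
  -- With the middle argument fixed, the column sums say that the symmetrisation of `t` sums to zero
  -- over the three pairs of every triple from five points; the ten equations force it to vanish.
  have hts : ∀ a b c, a ≠ b → a ≠ c → b ≠ c → t c b a = -t a b c := by
    intro a b c hab hac hbc
    obtain ⟨g, rfl, rfl, rfl⟩ := exists_perm_triple hab hac hbc
    have key : ∀ i j k l m, [g i, g j, g k, g 1, g l, g m].Nodup →
        (t (g i) (g 1) (g j) + t (g i) (g 1) (g k)) + (t (g j) (g 1) (g i) + t (g j) (g 1) (g k)) +
          (t (g k) (g 1) (g i) + t (g k) (g 1) (g j)) = 0 := by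
      intro i j k l m hn
      have h := hcolF _ _ _ _ _ _ hn
      simp only [List.nodup_cons, List.mem_cons, not_or, List.not_mem_nil, not_false_eq_true,
        EmbeddingLike.apply_eq_iff_eq, List.nodup_nil, and_true] at hn
      rw [hFt (g i) (g 1) (g j) (g k) (g l) (g m) (by simp; grind),
        hFt (g j) (g 1) (g i) (g k) (g l) (g m) (by simp; grind),
        hFt (g k) (g 1) (g i) (g j) (g l) (g m) (by simp; grind)] at h
      exact h
    have k1 := key 0 2 3 4 5 (by simp)
    have k2 := key 0 2 4 3 5 (by simp)
    have k3 := key 0 2 5 3 4 (by simp)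
    have k4 := key 0 3 4 2 5 (by simp)
    have k5 := key 0 3 5 2 4 (by simp)
    have k6 := key 0 4 5 2 3 (by simp)
    have k7 := key 2 3 4 0 5 (by simp)
    have k8 := key 2 3 5 0 4 (by simp)
    have k9 := key 2 4 5 0 3 (by simp)
    have k10 := key 3 4 5 0 2 (by simp)
    linarith
  refine false_of_oriented_triples (R := fun a b c => a ≠ b ∧ a ≠ c ∧ b ≠ c ∧ t a b c = 1)
    ?_ ?_ ?_ ?_ ?_
  · rintro a b c ⟨h1, h2, h3, h⟩
    refine ⟨h3, h1.symm, h2.symm, ?_⟩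
    have e1 := hts a b c h1 h2 h3
    have e2 := htk b c a
    linarith
  · rintro a b c ⟨h1, h2, h3, h⟩ ⟨-, -, -, h'⟩
    have := htk a b c
    linarith
  · rintro a b c ⟨h, -⟩
    exact h
  · intro a b hab
    obtain ⟨g, rfl, rfl⟩ := exists_perm_pair hab
    have t2 := ht3 (g 0) (g 1) (g 2) (g 3) (g 4) (g 5) (by simp)
    have f3 := hFt (g 0) (g 1) (g 2) (g 3) (g 4) (g 5) (by simp)
    have f4 := hFt (g 0) (g 1) (g 2) (g 4) (g 3) (g 5) (by simp)
    have f5 := hFt (g 0) (g 1) (g 2) (g 5) (g 3) (g 4) (by simp)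
    have hsq := htwo (g 0) (g 1) (g 2) (g 3) (g 4) (g 5) (by simp)
    have : t (g 0) (g 1) (g 2) = 1 ∨ t (g 0) (g 1) (g 3) = 1 ∨ t (g 0) (g 1) (g 4) = 1 ∨
        t (g 0) (g 1) (g 5) = 1 := by
      rcases hF1 (g 0) (g 1) (g 2) (g 3) with e3 | e3 | e3 <;>
      rcases hF1 (g 0) (g 1) (g 2) (g 4) with e4 | e4 | e4 <;>
      rcases hF1 (g 0) (g 1) (g 2) (g 5) with e5 | e5 | e5 <;>
      rw [e3, e4, e5] at t2 hsq <;> rw [e3] at f3 <;> rw [e4] at f4 <;> rw [e5] at f5 <;>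
      first
      | (exfalso; linarith)
      | exact Or.inl (by linarith)
      | exact Or.inr (Or.inl (by linarith))
      | exact Or.inr (Or.inr (Or.inl (by linarith)))
      | exact Or.inr (Or.inr (Or.inr (by linarith)))
    rcases this with h | h | h | h
    exacts [⟨g 2, by simp, by simp, by simp, h⟩, ⟨g 3, by simp, by simp, by simp, h⟩,
      ⟨g 4, by simp, by simp, by simp, h⟩, ⟨g 5, by simp, by simp, by simp, h⟩]
  · rintro a b c d ⟨h1, h2, h3, h⟩ ⟨-, h2', h3', h'⟩
    by_contra hcd
    obtain ⟨e, f, hef, hs⟩ := Finset.card_eq_two.mp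
      (show ({a, b, c, d} : Finset (Fin 6))ᶜ.card = 2 by
        rw [Finset.card_compl, Finset.card_insert_of_notMem (by simp [h1, h2, h2']),
          Finset.card_insert_of_notMem (by simp [h3, h3']), Finset.card_pair hcd]
        rfl)
    have he : e ∈ ({a, b, c, d} : Finset (Fin 6))ᶜ := by simp [hs]
    have hf : f ∈ ({a, b, c, d} : Finset (Fin 6))ᶜ := by simp [hs]
    simp only [Finset.mem_compl, Finset.mem_insert, Finset.mem_singleton, not_or] at he hf
    have h5 := hFt a b c d e f (by
      simp [h1, h2, h2', h3, h3', hcd, hef, Ne.symm he.1, Ne.symm he.2.1, Ne.symm he.2.2.1,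
        Ne.symm he.2.2.2, Ne.symm hf.1, Ne.symm hf.2.1, Ne.symm hf.2.2.1, Ne.symm hf.2.2.2])
    rw [h, h'] at h5
    rcases hF1 a b c d with h6 | h6 | h6 <;> rw [h6] at h5 <;> norm_num at h5

end SixThree

end WDRD

namespace WDRD

/-! ### The graphs `J(n, 2)`, `n ≥ 5`: the square of the sign matrix -/

section Pairs

variable {V : Type*} {n : ℕ} {Γ : Digraph V} {i₀ : ℕ × ℕ} {P : Fin n → Fin n → V}

/-- The vertices are the pairs of points, the underlying graph is `J(n, 2)`, and `i₀` and its
reverse are the only edge labels, with vanishing line sums. -/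
structure PairModel [Fintype V] (Γ : Digraph V) (i₀ : ℕ × ℕ) (P : Fin n → Fin n → V) : Prop where
  comm : ∀ a b, P b a = P a b
  surj : ∀ v, ∃ a b, a ≠ b ∧ P a b = v
  adj : ∀ {a b c}, a ≠ b → a ≠ c → b ≠ c → Γ.toSimpleGraphInclusive.Adj (P a b) (P a c)
  far : ∀ {a b c d}, a ≠ b → c ≠ d → a ≠ c → a ≠ d → b ≠ c → b ≠ d →
    P a b ≠ P c d ∧ ¬Γ.toSimpleGraphInclusive.Adj (P a b) (P c d)
  sum : ∀ (φ : ℕ × ℕ → ℚ) (f : V → ℚ) {q r}, q ≠ r →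
    ∑ v, onEdge φ (twoWayDist Γ (P q r) v) * f v = ∑ b ∈ ({q, r} : Finset (Fin n))ᶜ,
      (φ (twoWayDist Γ (P q r) (P q b)) * f (P q b) +
        φ (twoWayDist Γ (P q r) (P r b)) * f (P r b))
  supp : ∀ {a b c}, a ≠ b → a ≠ c → b ≠ c → arcSupp i₀ (twoWayDist Γ (P a b) (P a c)) = 1
  alt : ∀ {a b c}, a ≠ b → a ≠ c → b ≠ c → arcSign i₀ (twoWayDist Γ (P b a) (P b c)) =
    -arcSign i₀ (twoWayDist Γ (P a b) (P a c))
  row : ∀ {a b}, a ≠ b →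
    ∑ c ∈ ({a, b} : Finset (Fin n))ᶜ, arcSign i₀ (twoWayDist Γ (P a b) (P a c)) = 0

/-- The sign of the edge between the pairs `{a, b}` and `{a, c}`. -/
noncomputable def triSign (Γ : Digraph V) (i₀ : ℕ × ℕ) (P : Fin n → Fin n → V) (a b c : Fin n) : ℚ :=
  arcSign i₀ (twoWayDist Γ (P a b) (P a c))

/-- The signed adjacency matrix. -/
noncomputable def signMat (Γ : Digraph V) (i₀ : ℕ × ℕ) (v w : V) : ℚ :=
  onEdge (arcSign i₀) (twoWayDist Γ v w)

/-- The square of the signed adjacency matrix. -/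
noncomputable def signSq [Fintype V] (Γ : Digraph V) (i₀ : ℕ × ℕ) (v w : V) : ℚ :=
  ∑ z, signMat Γ i₀ v z * signMat Γ i₀ z w

theorem signMat_swap (v w : V) : signMat Γ i₀ w v = -signMat Γ i₀ v w := by
  unfold signMat onEdge
  rw [twoWayDist_swap]
  simp only [isEdgeLabel_swap, arcSign_swap]
  split_ifs <;> simp

theorem signSq_swap [Fintype V] (v w : V) : signSq Γ i₀ w v = signSq Γ i₀ v w := by
  unfold signSq
  refine Finset.sum_congr rfl fun z _ => ?_
  rw [signMat_swap z w, signMat_swap v z]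
  ring

theorem sum_compl_pair {q r p : Fin n} (hp : p ≠ q ∧ p ≠ r) (f : Fin n → ℚ) :
    ∑ b ∈ ({q, r} : Finset (Fin n))ᶜ, f b = f p + ∑ b ∈ ({p, q, r} : Finset (Fin n))ᶜ, f b := by
  rw [Finset.compl_insert (a := p), Finset.add_sum_erase]
  simp [hp.1, hp.2]

theorem card_compl_pair {q r : Fin n} (h : q ≠ r) :
    ((({q, r} : Finset (Fin n))ᶜ.card : ℕ) : ℚ) = (n : ℚ) - 2 := by
  have h1 := Finset.card_compl_add_card ({q, r} : Finset (Fin n))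
  rw [Finset.card_pair h, Fintype.card_fin] at h1
  have : (((({q, r} : Finset (Fin n))ᶜ.card + 2 : ℕ)) : ℚ) = n := by rw [h1]
  push_cast at this
  linarith

theorem card_compl_triple {p q r : Fin n} (hp : p ≠ q ∧ p ≠ r) (h : q ≠ r) :
    ((({p, q, r} : Finset (Fin n))ᶜ.card : ℕ) : ℚ) = (n : ℚ) - 3 := by
  have h1 := sum_compl_pair hp (fun _ => 1)
  simp only [Finset.sum_const, nsmul_eq_mul, mul_one] at h1
  rw [card_compl_pair h] at h1
  linarith

theorem triSign_skew (a b c : Fin n) : triSign Γ i₀ P a c b = -triSign Γ i₀ P a b c := by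
  unfold triSign
  rw [twoWayDist_swap, arcSign_swap]

theorem signMat_self (hl : Loopless Γ) (hs : StronglyConnected Γ) (v : V) :
    signMat Γ i₀ v v = 0 :=
  Cover.onEdge_not_adj hl hs (fun h => h.ne rfl)

variable [Fintype V]

namespace PairModel

/-- Interchanging the last two arguments reverses an edge; interchanging the first two uses that a
column has just two entries with sum zero. So `triSign` is alternating. -/
theorem orders (H : PairModel Γ i₀ P) {a b c : Fin n} (hab : a ≠ b) (hac : a ≠ c) (hbc : b ≠ c) :
    triSign Γ i₀ P b a c = -triSign Γ i₀ P a b c ∧ triSign Γ i₀ P b c a = triSign Γ i₀ P a b c ∧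
      triSign Γ i₀ P c a b = triSign Γ i₀ P a b c ∧
      triSign Γ i₀ P c b a = -triSign Γ i₀ P a b c := by
  have h1 : triSign Γ i₀ P b a c = -triSign Γ i₀ P a b c := H.alt hab hac hbc
  have h2 : triSign Γ i₀ P c a b = -triSign Γ i₀ P a c b := H.alt hac hab hbc.symm
  have h3 := triSign_skew (Γ := Γ) (i₀ := i₀) (P := P) a b c
  have h4 := triSign_skew (Γ := Γ) (i₀ := i₀) (P := P) b a c
  have h5 := triSign_skew (Γ := Γ) (i₀ := i₀) (P := P) c a b
  refine ⟨h1, by linarith, by linarith, by linarith⟩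

theorem sign (H : PairModel Γ i₀ P) (h₀ : i₀.swap ≠ i₀) {a b c : Fin n} (hab : a ≠ b)
    (hac : a ≠ c) (hbc : b ≠ c) : triSign Γ i₀ P a b c = 1 ∨ triSign Γ i₀ P a b c = -1 :=
  arcSign_of_supp h₀ (H.supp hab hac hbc)

theorem sq (H : PairModel Γ i₀ P) (h₀ : i₀.swap ≠ i₀) {a b c : Fin n} (hab : a ≠ b)
    (hac : a ≠ c) (hbc : b ≠ c) : triSign Γ i₀ P a b c * triSign Γ i₀ P a b c = 1 := by
  rcases H.sign h₀ hab hac hbc with h | h <;> rw [h] <;> norm_num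

theorem signMat_near (H : PairModel Γ i₀ P) (hl : Loopless Γ) (hs : StronglyConnected Γ)
    {a b c : Fin n} (hab : a ≠ b) (hac : a ≠ c) (hbc : b ≠ c) :
    signMat Γ i₀ (P a b) (P a c) = triSign Γ i₀ P a b c :=
  Cover.onEdge_adj hl hs (H.adj hab hac hbc)

theorem signMat_far (H : PairModel Γ i₀ P) (hl : Loopless Γ) (hs : StronglyConnected Γ)
    {a b c d : Fin n} (hab : a ≠ b) (hcd : c ≠ d) (hac : a ≠ c) (had : a ≠ d) (hbc : b ≠ c)
    (hbd : b ≠ d) : signMat Γ i₀ (P a b) (P c d) = 0 :=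
  Cover.onEdge_not_adj hl hs (H.far hab hcd hac had hbc hbd).2

theorem sum_signMat (H : PairModel Γ i₀ P) (f : V → ℚ) {q r : Fin n} (hqr : q ≠ r) :
    ∑ v, signMat Γ i₀ (P q r) v * f v =
      ∑ b ∈ ({q, r} : Finset (Fin n))ᶜ, triSign Γ i₀ P q r b * (f (P q b) - f (P r b)) := by
  unfold signMat
  rw [H.sum _ _ hqr]
  refine Finset.sum_congr rfl fun b hb => ?_
  simp only [Finset.mem_compl, Finset.mem_insert, Finset.mem_singleton, not_or] at hb
  have h1 := (H.orders hqr (Ne.symm hb.1) (Ne.symm hb.2)).1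
  unfold triSign at h1 ⊢
  rw [H.comm q r] at h1
  rw [h1]
  ring

theorem sum_adj (H : PairModel Γ i₀ P) (f : V → ℚ) {q r : Fin n} (hqr : q ≠ r) :
    ∑ v, onEdge 1 (twoWayDist Γ (P q r) v) * f v =
      ∑ b ∈ ({q, r} : Finset (Fin n))ᶜ, (f (P q b) + f (P r b)) := by
  rw [H.sum _ _ hqr]
  simp

/-- Two distinct pairs meet in a point or are disjoint. -/
theorem classify (H : PairModel Γ i₀ P) {a b : Fin n} (hab : a ≠ b) (v : V) :
    v = P a b ∨ (∃ c, c ≠ a ∧ c ≠ b ∧ (v = P a c ∨ v = P b c)) ∨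
      ∃ c d, c ≠ d ∧ c ≠ a ∧ c ≠ b ∧ d ≠ a ∧ d ≠ b ∧ v = P c d := by
  obtain ⟨c, d, hcd, rfl⟩ := H.surj v
  by_cases hca : c = a
  · subst hca
    by_cases hdb : d = b
    · exact Or.inl (by rw [hdb])
    · exact Or.inr (Or.inl ⟨d, hcd.symm, hdb, Or.inl rfl⟩)
  by_cases hcb : c = b
  · subst hcb
    by_cases hda : d = a
    · exact Or.inl (by rw [hda, H.comm])
    · exact Or.inr (Or.inl ⟨d, hda, hcd.symm, Or.inr rfl⟩)
  by_cases hda : d = a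
  · subst hda
    exact Or.inr (Or.inl ⟨c, hca, hcb, Or.inl (H.comm _ _)⟩)
  by_cases hdb : d = b
  · subst hdb
    exact Or.inr (Or.inl ⟨c, hca, hcb, Or.inr (H.comm _ _)⟩)
  · exact Or.inr (Or.inr ⟨c, d, hcd, hca, hcb, hda, hdb, rfl⟩)

/-- The sign matrix lies in the eigenspace of `A` for -2: the signs over each clique of pairs
through a point sum to zero, and alternation cancels the terms between disjoint pairs. -/
theorem sum_adj_signMat (H : PairModel Γ i₀ P) (hl : Loopless Γ) (hs : StronglyConnected Γ)
    (v w : V) : ∑ z, onEdge 1 (twoWayDist Γ v z) * signMat Γ i₀ z w = -2 * signMat Γ i₀ v w := by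
  obtain ⟨q, r, hqr, rfl⟩ := H.surj v
  rw [H.sum_adj _ hqr]
  have edge : ∀ q r p, q ≠ r → p ≠ q → p ≠ r →
      ∑ b ∈ ({q, r} : Finset (Fin n))ᶜ, (signMat Γ i₀ (P q b) (P q p) +
        signMat Γ i₀ (P r b) (P q p)) = -2 * signMat Γ i₀ (P q r) (P q p) := by
    intro q r p hqr hpq hpr
    rw [sum_compl_pair ⟨hpq, hpr⟩, signMat_self hl hs, H.signMat_near hl hs hqr hpq.symm hpr.symm,
      ← H.comm r p, ← H.comm q p, H.signMat_near hl hs hpr hpq hqr.symm,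
      H.comm q p]
    have h1 : ∑ b ∈ ({p, q, r} : Finset (Fin n))ᶜ, (signMat Γ i₀ (P q b) (P q p) +
        signMat Γ i₀ (P r b) (P q p)) =
        ∑ b ∈ ({p, q, r} : Finset (Fin n))ᶜ, -triSign Γ i₀ P q p b := by
      refine Finset.sum_congr rfl fun b hb => ?_
      simp only [Finset.mem_compl, Finset.mem_insert, Finset.mem_singleton, not_or] at hb
      rw [H.signMat_near hl hs (Ne.symm hb.2.1) hpq.symm hb.1, triSign_skew,
        H.signMat_far hl hs (Ne.symm hb.2.2) hpq.symm hqr.symm hpr.symm hb.2.1 hb.1, add_zero]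
    have h2 := H.row hpq.symm
    rw [sum_compl_pair (p := r) ⟨hqr.symm, hpr.symm⟩] at h2
    have h3 : ({r, q, p} : Finset (Fin n)) = {p, q, r} := by
      ext z; simp only [Finset.mem_insert, Finset.mem_singleton]; tauto
    rw [h3] at h2
    rw [h1, Finset.sum_neg_distrib]
    have h4 := (H.orders hpq hpr hqr)
    have h5 := triSign_skew (Γ := Γ) (i₀ := i₀) (P := P) q p r
    have h6 := triSign_skew (Γ := Γ) (i₀ := i₀) (P := P) p q r
    change triSign Γ i₀ P q p r + ∑ c ∈ _, triSign Γ i₀ P q p c = 0 at h2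
    linarith
  rcases H.classify hqr w with rfl | ⟨p, hpq, hpr, rfl | rfl⟩ | ⟨c, d, hcd, hcq, hcr, hdq, hdr, rfl⟩
  · rw [signMat_self hl hs, mul_zero]
    refine Finset.sum_eq_zero fun b hb => ?_
    simp only [Finset.mem_compl, Finset.mem_insert, Finset.mem_singleton, not_or] at hb
    rw [H.signMat_near hl hs (Ne.symm hb.1) hqr hb.2, ← H.comm q r,
      H.signMat_near hl hs (Ne.symm hb.2) hqr.symm hb.1]
    have := H.orders hqr (Ne.symm hb.1) (Ne.symm hb.2)
    have h5 := triSign_skew (Γ := Γ) (i₀ := i₀) (P := P) q r b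
    have h6 := triSign_skew (Γ := Γ) (i₀ := i₀) (P := P) r q b
    linarith
  · exact edge q r p hqr hpq hpr
  · have := edge r q p hqr.symm hpr hpq
    rw [H.comm q r, Finset.pair_comm] at this
    rw [← this]
    exact Finset.sum_congr rfl fun b _ => add_comm _ _
  · rw [H.signMat_far hl hs hqr hcd hcq.symm hdq.symm hcr.symm hdr.symm, mul_zero,
      sum_compl_pair ⟨hcq, hcr⟩, Finset.sum_eq_single_of_mem d (by simp [hcd.symm, hdq, hdr])]
    · rw [← H.comm q c, ← H.comm r c, ← H.comm q d, ← H.comm r d,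
        H.signMat_near hl hs hcq hcd hdq.symm, H.signMat_near hl hs hcr hcd hdr.symm,
        ← H.comm c d, H.signMat_near hl hs hdq hcd.symm hcq.symm,
        H.signMat_near hl hs hdr hcd.symm hcr.symm]
      have h1 := (H.orders hcd hcq hdq)
      have h2 := (H.orders hcd hcr hdr)
      have h5 := triSign_skew (Γ := Γ) (i₀ := i₀) (P := P) c d q
      have h6 := triSign_skew (Γ := Γ) (i₀ := i₀) (P := P) d c q
      have h7 := triSign_skew (Γ := Γ) (i₀ := i₀) (P := P) c d r
      have h8 := triSign_skew (Γ := Γ) (i₀ := i₀) (P := P) d c r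
      linarith
    · intro b hb hbd
      simp only [Finset.mem_compl, Finset.mem_insert, Finset.mem_singleton, not_or] at hb
      rw [H.signMat_far hl hs (Ne.symm hb.2.1) hcd hcq.symm hdq.symm hb.1 hbd,
        H.signMat_far hl hs (Ne.symm hb.2.2) hcd hcr.symm hdr.symm hb.1 hbd, add_zero]

theorem sum_adj_signSq (H : PairModel Γ i₀ P) (hl : Loopless Γ) (hs : StronglyConnected Γ)
    (v w : V) : ∑ z, onEdge 1 (twoWayDist Γ v z) * signSq Γ i₀ z w = -2 * signSq Γ i₀ v w := by
  unfold signSq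
  simp only [Finset.mul_sum]
  rw [Finset.sum_comm]
  refine Finset.sum_congr rfl fun z _ => ?_
  simp only [← mul_assoc, ← Finset.sum_mul]
  rw [H.sum_adj_signMat hl hs]

theorem signSq_self (H : PairModel Γ i₀ P) (hl : Loopless Γ) (hs : StronglyConnected Γ)
    (h₀ : i₀.swap ≠ i₀) (v : V) : signSq Γ i₀ v v = -2 * ((n : ℚ) - 2) := by
  obtain ⟨q, r, hqr, rfl⟩ := H.surj v
  unfold signSq
  rw [H.sum_signMat _ hqr, ← card_compl_pair hqr, Finset.sum_congr rfl (g := fun _ => -2)]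
  · rw [Finset.sum_const, nsmul_eq_mul, mul_comm]
  · intro b hb
    simp only [Finset.mem_compl, Finset.mem_insert, Finset.mem_singleton, not_or] at hb
    rw [H.signMat_near hl hs (Ne.symm hb.1) hqr hb.2, ← H.comm q r,
      H.signMat_near hl hs (Ne.symm hb.2) hqr.symm hb.1]
    have h1 := H.orders hqr (Ne.symm hb.1) (Ne.symm hb.2)
    have h5 := triSign_skew (Γ := Γ) (i₀ := i₀) (P := P) q r b
    have h6 := triSign_skew (Γ := Γ) (i₀ := i₀) (P := P) r q b
    have h7 := H.sq h₀ hqr (Ne.symm hb.1) (Ne.symm hb.2)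
    rw [h5, h6, h1.1]
    linear_combination -2 * h7

theorem signSq_far (H : PairModel Γ i₀ P) (hl : Loopless Γ) (hs : StronglyConnected Γ)
    {a b c d : Fin n} (hab : a ≠ b) (hcd : c ≠ d) (hac : a ≠ c) (had : a ≠ d) (hbc : b ≠ c)
    (hbd : b ≠ d) : signSq Γ i₀ (P a b) (P c d) =
      (triSign Γ i₀ P b c d - triSign Γ i₀ P a c d) *
        (triSign Γ i₀ P a b c - triSign Γ i₀ P a b d) := by
  unfold signSq
  rw [H.sum_signMat _ hab, sum_compl_pair ⟨hac.symm, hbc.symm⟩,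
    Finset.sum_eq_single_of_mem d (by simp [hcd.symm, had.symm, hbd.symm])]
  · rw [← H.comm a c, ← H.comm b c, ← H.comm a d, ← H.comm b d,
      H.signMat_near hl hs hac.symm hcd had, H.signMat_near hl hs hbc.symm hcd hbd,
      ← H.comm c d, H.signMat_near hl hs had.symm hcd.symm hac,
      H.signMat_near hl hs hbd.symm hcd.symm hbc, (H.orders hac had hcd).1,
      (H.orders hbc hbd hcd).1, (H.orders hac had hcd).2.2.1, (H.orders hbc hbd hcd).2.2.1]
    ring
  · intro e he hed
    simp only [Finset.mem_compl, Finset.mem_insert, Finset.mem_singleton, not_or] at he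
    rw [H.signMat_far hl hs (Ne.symm he.2.1) hcd hac had he.1 hed,
      H.signMat_far hl hs (Ne.symm he.2.2) hcd hbc hbd he.1 hed, sub_zero, mul_zero]

end PairModel

end Pairs

end WDRD

namespace WDRD

section Pairs

variable {V : Type*} [Fintype V] {n : ℕ} {Γ : Digraph V} {i₀ : ℕ × ℕ} {P : Fin n → Fin n → V}

namespace PairModel

/-- Signs give arcs, and hence paths of length two between disjoint pairs. -/
theorem dist_two (H : PairModel Γ i₀ P) (hl : Loopless Γ) (hs : StronglyConnected Γ)
    (h₀ : i₀.swap ≠ i₀) (h1 : i₀.1 = 1) {a b c d : Fin n} (hab : a ≠ b) (hcd : c ≠ d)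
    (hac : a ≠ c) (had : a ≠ d) (hbc : b ≠ c) (hbd : b ≠ d)
    (h : triSign Γ i₀ P a b c = 1 ∧ triSign Γ i₀ P a c d = -1) :
    dist Γ (P a b) (P c d) = 2 := by
  have arc : ∀ {a b c}, a ≠ b → a ≠ c → b ≠ c → triSign Γ i₀ P a b c = 1 →
      Γ.Adj (P a b) (P a c) := by
    intro a b c hab hac hbc h
    have h2 : twoWayDist Γ (P a b) (P a c) = i₀ := by
      have h3 := H.supp hab hac hbc
      by_contra hn
      have h4 : twoWayDist Γ (P a b) (P a c) = i₀.swap := by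
        by_contra hn'
        simp [arcSupp, hn, hn'] at h3
      rw [triSign, h4] at h
      simp only [arcSign, if_neg h₀, if_true] at h
      norm_num at h
    refine (dist_eq_one_iff hl hs).mp ?_
    rw [← h1, ← h2]
    rfl
  have hfar := H.far hab hcd hac had hbc hbd
  refine dist_eq_two hl hs (arc hab hac hbc h.1) ?_ hfar.1 fun h' => hfar.2 ?_
  · rw [← H.comm a c]
    refine arc hac.symm hcd had ?_
    rw [(H.orders hac had hcd).1, h.2, neg_neg]
  · exact (isEdgeLabel_iff hl hs).mp (Or.inl ((dist_eq_one_iff hl hs).mpr h'))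

/-- In each direction four paths of length two are possible between `{a, b}` and `{c, d}`. The
excluded sign pattern, called a block below, is the one that admits none of them; every other
pattern admits a path both ways. -/
theorem twoWayDist_far (H : PairModel Γ i₀ P) (hl : Loopless Γ) (hs : StronglyConnected Γ)
    (h₀ : i₀.swap ≠ i₀) (h1 : i₀.1 = 1) {a b c d : Fin n} (hab : a ≠ b) (hcd : c ≠ d)
    (hac : a ≠ c) (had : a ≠ d) (hbc : b ≠ c) (hbd : b ≠ d)
    (h : ¬(triSign Γ i₀ P a c d = triSign Γ i₀ P a b c ∧
      triSign Γ i₀ P a b d = -triSign Γ i₀ P a b c ∧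
      triSign Γ i₀ P b c d = -triSign Γ i₀ P a b c)) :
    twoWayDist Γ (P a b) (P c d) = (2, 2) := by
  have p1 := H.dist_two hl hs h₀ h1 hab hcd hac had hbc hbd
  have p2 := H.dist_two hl hs h₀ h1 hab hcd.symm had hac hbd hbc
  have p3 := H.dist_two hl hs h₀ h1 hab.symm hcd hbc hbd hac had
  have p4 := H.dist_two hl hs h₀ h1 hab.symm hcd.symm hbd hbc had hac
  have q1 := H.dist_two hl hs h₀ h1 hcd hab hac.symm hbc.symm had.symm hbd.symm
  have q2 := H.dist_two hl hs h₀ h1 hcd hab.symm hbc.symm hac.symm hbd.symm had.symm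
  have q3 := H.dist_two hl hs h₀ h1 hcd.symm hab had.symm hbd.symm hac.symm hbc.symm
  have q4 := H.dist_two hl hs h₀ h1 hcd.symm hab.symm hbd.symm had.symm hbc.symm hac.symm
  rw [H.comm c d] at p2 q3
  rw [H.comm a b] at p3 q2
  rw [H.comm a b, H.comm c d] at p4 q4
  obtain ⟨a1, a2, a3, a4⟩ := H.orders hab hac hbc
  obtain ⟨b1, b2, b3, b4⟩ := H.orders hab had hbd
  obtain ⟨c1, c2, c3, c4⟩ := H.orders hac had hcd
  obtain ⟨d1, d2, d3, d4⟩ := H.orders hbc hbd hcd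
  have c5 := triSign_skew (Γ := Γ) (i₀ := i₀) (P := P) a c d
  have d5 := triSign_skew (Γ := Γ) (i₀ := i₀) (P := P) b c d
  have c6 := triSign_skew (Γ := Γ) (i₀ := i₀) (P := P) c a d
  have c7 := triSign_skew (Γ := Γ) (i₀ := i₀) (P := P) d a c
  rw [c5] at p2
  rw [a1] at p3
  rw [b1, d5] at p4
  rw [c2, a3] at q1
  rw [d2, a4] at q2
  rw [c4, b3] at q3
  rw [d4, b4] at q4
  rcases H.sign h₀ hab hac hbc with e4 | e4 <;> rcases H.sign h₀ hab had hbd with e3 | e3 <;>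
  rcases H.sign h₀ hac had hcd with e2 | e2 <;> rcases H.sign h₀ hbc hbd hcd with e1 | e1 <;>
  rw [e1, e2, e3, e4] at h <;> norm_num at h <;>
  (rw [twoWayDist, Prod.mk.injEq]
   rw [e2, e4] at p1
   rw [e2, e3] at p2
   rw [e1, e4] at p3
   rw [e1, e3] at p4
   rw [e2, e4] at q1
   rw [e1, e4] at q2
   rw [e2, e3] at q3
   rw [e1, e3] at q4
   norm_num at p1 p2 p3 p4 q1 q2 q3 q4
   refine ⟨?_, ?_⟩ <;> assumption)

/-- Disjoint pairs either form a block or are at two-way distance `(2, 2)`. -/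
theorem signSq_far_cases (H : PairModel Γ i₀ P) (hl : Loopless Γ) (h : IsWeaklyDistanceRegular Γ)
    (h₀ : i₀.swap ≠ i₀) (h1 : i₀.1 = 1) {a b c d : Fin n} (hab : a ≠ b) (hcd : c ≠ d)
    (hac : a ≠ c) (had : a ≠ d) (hbc : b ≠ c) (hbd : b ≠ d) :
    (signSq Γ i₀ (P a b) (P c d) = -4 ∧ triSign Γ i₀ P a c d = triSign Γ i₀ P a b c) ∨
      (signSq Γ i₀ (P a b) (P c d) = 0 ∧ twoWayDist Γ (P a b) (P c d) = (2, 2)) := by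
  have hs := h.stronglyConnected
  obtain ⟨k, hk⟩ := exists_conv h (onEdge (arcSign i₀)) (onEdge (arcSign i₀))
  change ∀ v w, signSq Γ i₀ v w = _ at hk
  have w1 := H.signSq_far hl hs hab hcd hac had hbc hbd
  have w2 := H.signSq_far hl hs hac hbd hab had hbc.symm hcd
  have w3 := H.signSq_far hl hs had hbc hab hac hbd.symm hcd.symm
  have t1 := H.twoWayDist_far hl hs h₀ h1 hab hcd hac had hbc hbd
  have t2 := H.twoWayDist_far hl hs h₀ h1 hac hbd hab had hbc.symm hcd
  have t3 := H.twoWayDist_far hl hs h₀ h1 had hbc hab hac hbd.symm hcd.symm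
  rw [triSign_skew a b c, (H.orders hbc hbd hcd).1] at w2 t2
  rw [triSign_skew a b d, triSign_skew a c d, (H.orders hbc hbd hcd).2.2.1] at w3 t3
  have hτ : ∀ v w, twoWayDist Γ v w = (2, 2) → signSq Γ i₀ v w = k (2, 2) := fun v w e => by
    rw [hk, e]
  by_cases hb : triSign Γ i₀ P a c d = triSign Γ i₀ P a b c ∧
      triSign Γ i₀ P a b d = -triSign Γ i₀ P a b c ∧
      triSign Γ i₀ P b c d = -triSign Γ i₀ P a b c
  · refine Or.inl ⟨?_, hb.1⟩
    rw [w1, hb.1, hb.2.1, hb.2.2]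
    linear_combination -4 * H.sq h₀ hab hac hbc
  · refine Or.inr ⟨?_, t1 hb⟩
    -- If one splitting of four points into pairs is not a block, neither are the other two. All
    -- three then have the same entry of `S ^ 2`, and comparing the three product formulas leaves
    -- only zero.
    have e1 := hτ _ _ (t1 hb)
    have e2 := hτ _ _ (t2 fun h' => hb ⟨by linarith [h'.1, h'.2.1, h'.2.2],
      by linarith [h'.1, h'.2.1, h'.2.2], by linarith [h'.1, h'.2.1, h'.2.2]⟩)
    have e3 := hτ _ _ (t3 fun h' => hb ⟨by linarith [h'.1, h'.2.1, h'.2.2],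
      by linarith [h'.1, h'.2.1, h'.2.2], by linarith [h'.1, h'.2.1, h'.2.2]⟩)
    rw [w1] at e1 ⊢
    rw [w2, ← e1] at e2
    rw [w3, ← e1] at e3
    clear w1 w2 w3 t1 t2 t3 hτ e1
    rcases H.sign h₀ hab hac hbc with e4 | e4 <;> rcases H.sign h₀ hab had hbd with e3' | e3' <;>
    rcases H.sign h₀ hac had hcd with e2' | e2' <;>
    rcases H.sign h₀ hbc hbd hcd with e1' | e1' <;>
    rw [e4, e3', e2', e1'] at e2 e3 hb ⊢ <;>
    first
    | (norm_num; done)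
    | (exfalso; norm_num at e2; done)
    | (exfalso; norm_num at e3; done)
    | (exfalso; norm_num at hb; done)

/-- `S ^ 2` is symmetric, so it takes one value on all edges; the diagonal of `A S² = -2 S²`
identifies it. -/
theorem signSq_near (H : PairModel Γ i₀ P) (hl : Loopless Γ) (h : IsWeaklyDistanceRegular Γ)
    (h₀ : i₀.swap ≠ i₀) (hn : 5 ≤ n) {a b c : Fin n} (hab : a ≠ b) (hac : a ≠ c) (hbc : b ≠ c) :
    signSq Γ i₀ (P a b) (P a c) = 2 := by
  have hs := h.stronglyConnected
  obtain ⟨k, hk⟩ := exists_conv h (onEdge (arcSign i₀)) (onEdge (arcSign i₀))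
  change ∀ v w, signSq Γ i₀ v w = _ at hk
  have hρ : ∀ {a b c}, a ≠ b → a ≠ c → b ≠ c → signSq Γ i₀ (P a b) (P a c) = k i₀ := by
    intro a b c hab hac hbc
    have h3 := H.supp hab hac hbc
    by_cases h4 : twoWayDist Γ (P a b) (P a c) = i₀
    · rw [hk, h4]
    · have h5 : twoWayDist Γ (P a b) (P a c) = i₀.swap := by
        by_contra hn'
        simp [arcSupp, h4, hn'] at h3
      rw [← signSq_swap, hk, twoWayDist_swap, h5, Prod.swap_swap]
  have h1 := H.sum_adj_signSq hl hs (P a b) (P a b)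
  rw [H.sum_adj _ hab, H.signSq_self hl hs h₀,
    Finset.sum_congr rfl (g := fun _ => k i₀ + k i₀)] at h1
  · rw [Finset.sum_const, nsmul_eq_mul, card_compl_pair hab] at h1
    have h5 : (5 : ℚ) ≤ n := by exact_mod_cast hn
    have h6 : ((n : ℚ) - 2) ≠ 0 := by linarith
    rw [hρ hab hac hbc]
    have h7 : ((n : ℚ) - 2) * (k i₀ - 2) = 0 := by linear_combination h1 / 2
    have := (mul_eq_zero.mp h7).resolve_left h6
    linarith
  · intro e he
    simp only [Finset.mem_compl, Finset.mem_insert, Finset.mem_singleton, not_or] at he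
    rw [hρ (Ne.symm he.1) hab he.2, ← H.comm a b, hρ (Ne.symm he.2) hab.symm he.1]

/-- Every triple of points lies in exactly one block. -/
theorem sum_signSq_far (H : PairModel Γ i₀ P) (hl : Loopless Γ) (h : IsWeaklyDistanceRegular Γ)
    (h₀ : i₀.swap ≠ i₀) (hn : 5 ≤ n) {q r p : Fin n} (hqr : q ≠ r) (hqp : q ≠ p) (hrp : r ≠ p) :
    ∑ b ∈ ({p, r, q} : Finset (Fin n))ᶜ, signSq Γ i₀ (P q b) (P r p) = -4 := by
  have hs := h.stronglyConnected
  -- The equation `A S² = -2 S²` is read at an edge; the known diagonal and edge entries leave -4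
  -- for the disjoint pairs.
  have h1 := H.sum_adj_signSq hl hs (P r q) (P r p)
  rw [H.sum_adj _ hqr.symm, H.signSq_near hl h h₀ hn hqr.symm hrp hqp,
    sum_compl_pair ⟨hrp.symm, hqp.symm⟩, H.signSq_self hl hs h₀, Finset.sum_add_distrib,
    ← H.comm q p, ← H.comm r p, H.signSq_near hl h h₀ hn hqp.symm hrp.symm hqr,
    Finset.sum_congr rfl (g := fun _ => (2 : ℚ)), Finset.sum_const, nsmul_eq_mul,
    card_compl_triple ⟨hrp.symm, hqp.symm⟩ hqr.symm] at h1
  · rw [H.comm r p] at h1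
    linarith
  · intro b hb
    simp only [Finset.mem_compl, Finset.mem_insert, Finset.mem_singleton, not_or] at hb
    rw [H.comm r p, H.signSq_near hl h h₀ hn (Ne.symm hb.2.1) hrp hb.1]

theorem block_unique (H : PairModel Γ i₀ P) (hl : Loopless Γ) (h : IsWeaklyDistanceRegular Γ)
    (h₀ : i₀.swap ≠ i₀) (h1 : i₀.1 = 1) (hn : 5 ≤ n) {a b c d e : Fin n} (hab : a ≠ b)
    (hcd : c ≠ d) (hac : a ≠ c) (had : a ≠ d) (hbc : b ≠ c) (hbd : b ≠ d)
    (hb : signSq Γ i₀ (P a b) (P c d) = -4) (hea : e ≠ a) (heb : e ≠ b) (hec : e ≠ c)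
    (hed : e ≠ d) :
    signSq Γ i₀ (P a e) (P c d) = 0 ∧ twoWayDist Γ (P a e) (P c d) = (2, 2) := by
  refine (H.signSq_far_cases hl h h₀ h1 hea.symm hcd hac had hec hed).resolve_left ?_
  rintro ⟨he, -⟩
  have h2 := H.sum_signSq_far hl h h₀ hn hac had hcd
  have h3 : ({b, e} : Finset (Fin n)) ⊆ ({d, c, a} : Finset (Fin n))ᶜ := by
    intro z hz
    simp only [Finset.mem_insert, Finset.mem_singleton] at hz
    rcases hz with rfl | rfl
    · simp [hbd, hbc, hab.symm]
    · simp [hed, hec, hea]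
  have h4 := Finset.sum_le_sum_of_subset_of_nonneg (f := fun z => -signSq Γ i₀ (P a z) (P c d)) h3 (by
    intro z hz _
    simp only [Finset.mem_compl, Finset.mem_insert, Finset.mem_singleton, not_or] at hz
    rcases H.signSq_far_cases hl h h₀ h1 (Ne.symm hz.2.2) hcd hac had hz.2.1 hz.1 with
      ⟨h5, -⟩ | ⟨h5, -⟩ <;> rw [h5] <;> norm_num)
  simp only [Finset.sum_neg_distrib] at h4
  rw [h2, Finset.sum_pair heb.symm, hb, he] at h4
  norm_num at h4

/-- Let `X` be the part of `S ^ 2` on disjoint pairs. On edges, and at two-way distance `(2, 2)`,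
the product `S X` agrees with `-4 S`, so at a block `S² X` equals `-4 * (-4) = 16`. But in `S² X`
all terms are nonnegative and the diagonal one alone is `8(n - 2) ≥ 24`. -/
theorem false_of_five_le (H : PairModel Γ i₀ P) (hl : Loopless Γ)
    (hc : IsCommutativeWeaklyDistanceRegular Γ) (h₀ : i₀.swap ≠ i₀) (h1 : i₀.1 = 1)
    (hn : 5 ≤ n) : False := by
  have h := hc.toIsWeaklyDistanceRegular
  have hs := h.stronglyConnected
  obtain ⟨k, hk⟩ := exists_conv h (onEdge (arcSign i₀)) (onEdge (arcSign i₀))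
  change ∀ v w, signSq Γ i₀ v w = _ at hk
  set X : ℕ × ℕ → ℚ := fun i => if IsEdgeLabel i ∨ i = (0, 0) then 0 else k i with hX
  have hXadj : ∀ {v w}, Γ.toSimpleGraphInclusive.Adj v w → X (twoWayDist Γ v w) = 0 := by
    intro v w hvw
    rw [hX]
    exact if_pos (Or.inl ((isEdgeLabel_iff hl hs).mpr hvw))
  have h00 : ∀ v w, twoWayDist Γ v w = (0, 0) ↔ v = w := by
    intro v w
    constructor
    · intro h'
      exact (dist_eq_zero_iff hs).mp (congrArg Prod.fst h')
    · rintro rfl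
      rw [twoWayDist, (dist_eq_zero_iff hs).mpr rfl]
  have hXself : ∀ v, X (twoWayDist Γ v v) = 0 := fun v => if_pos (Or.inr ((h00 v v).mpr rfl))
  have hXfar : ∀ {a b c d}, a ≠ b → c ≠ d → a ≠ c → a ≠ d → b ≠ c → b ≠ d →
      X (twoWayDist Γ (P a b) (P c d)) = signSq Γ i₀ (P a b) (P c d) := by
    intro a b c d hab hcd hac had hbc hbd
    obtain ⟨h2, h3⟩ := H.far hab hcd hac had hbc hbd
    rw [hk]
    refine if_neg ?_
    rintro (h' | h')
    · exact h3 ((isEdgeLabel_iff hl hs).mp h')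
    · exact h2 ((h00 _ _).mp h')
  have hXswap : ∀ v w, X (twoWayDist Γ w v) = X (twoWayDist Γ v w) := by
    intro v w
    simp only [hX, ← hk, signSq_swap v w]
    congr 1
    rw [twoWayDist_swap Γ v w, isEdgeLabel_swap]
    simp [Prod.ext_iff, and_comm]
  have hXle : ∀ v w, X (twoWayDist Γ v w) ≤ 0 := by
    intro v w
    obtain ⟨a, b, hab, rfl⟩ := H.surj v
    rcases H.classify hab w with rfl | ⟨c, hca, hcb, rfl | rfl⟩ | ⟨c, d, hcd, hca, hcb, hda, hdb, rfl⟩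
    · rw [hXself]
    · rw [hXadj (H.adj hab hca.symm hcb.symm)]
    · rw [← H.comm a b, hXadj (H.adj hab.symm hcb.symm hca.symm)]
    · rw [hXfar hab hcd hca.symm hda.symm hcb.symm hdb.symm]
      rcases H.signSq_far_cases hl h h₀ h1 hab hcd hca.symm hda.symm hcb.symm hdb.symm with
        ⟨h5, -⟩ | ⟨h5, -⟩ <;> rw [h5]
      norm_num
  obtain ⟨l, hl'⟩ := exists_conv h (onEdge (arcSign i₀)) X
  change ∀ v w, ∑ z, signMat Γ i₀ v z * _ = _ at hl'
  -- By commutativity `S X` is skew, while the label `(2, 2)` is its own reverse.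
  have hlzero : l (2, 2) = 0 ∨ ∀ v w, twoWayDist Γ v w ≠ (2, 2) := by
    by_cases h' : ∀ v w, twoWayDist Γ v w ≠ (2, 2)
    · exact Or.inr h'
    · left
      push Not at h'
      obtain ⟨v, w, hvw⟩ := h'
      have e1 := hl' v w
      have e2 := hl' w v
      rw [twoWayDist_swap Γ v w, hvw] at e2
      rw [hvw] at e1
      have e3 := conv_comm hc (onEdge (arcSign i₀)) X v w
      change ∑ z, signMat Γ i₀ v z * _ = ∑ z, _ * signMat Γ i₀ z w at e3
      have e4 : ∑ z, signMat Γ i₀ w z * X (twoWayDist Γ z v) =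
          -∑ z, X (twoWayDist Γ v z) * signMat Γ i₀ z w := by
        rw [← Finset.sum_neg_distrib]
        refine Finset.sum_congr rfl fun z _ => ?_
        rw [signMat_swap z w, hXswap v z]
        ring
      rw [e4, ← e3, e1] at e2
      simp only [Prod.swap_prod_mk] at e2
      linarith
  have hSX22 : ∀ v w, twoWayDist Γ v w = (2, 2) →
      ∑ z, signMat Γ i₀ v z * X (twoWayDist Γ z w) = 0 := by
    intro v w hvw
    rw [hl', hvw]
    exact hlzero.resolve_right fun h' => h' v w hvw
  have hSXedge : ∀ {r q p}, r ≠ q → r ≠ p → q ≠ p →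
      ∑ z, signMat Γ i₀ (P r q) z * X (twoWayDist Γ z (P r p)) =
        -4 * signMat Γ i₀ (P r q) (P r p) := by
    intro r q p hrq hrp hqp
    rw [H.sum_signMat _ hrq, sum_compl_pair ⟨hrp.symm, hqp.symm⟩, hXself, ← H.comm q p,
      ← H.comm r p, hXadj (H.adj hqp.symm hrp.symm hrq.symm), sub_zero, mul_zero, zero_add,
      H.comm r p, H.signMat_near hl hs hrq hrp hqp, ← H.sum_signSq_far hl h h₀ hn hrq.symm hqp hrp,
      Finset.sum_mul]
    refine Finset.sum_congr rfl fun b hb => ?_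
    simp only [Finset.mem_compl, Finset.mem_insert, Finset.mem_singleton, not_or] at hb
    rw [hXadj (H.adj (Ne.symm hb.2.1) hrp hb.1),
      hXfar (Ne.symm hb.2.2) hrp hrq.symm hqp hb.2.1 hb.1]
    rcases H.signSq_far_cases hl h h₀ h1 (Ne.symm hb.2.2) hrp hrq.symm hqp hb.2.1 hb.1 with
      ⟨h5, h6⟩ | ⟨h5, -⟩
    · rw [h5, ← (H.orders hrq (Ne.symm hb.2.1) (Ne.symm hb.2.2)).2.1.symm.symm, ← h6,
        (H.orders hrq hrp hqp).1]
      ring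
    · rw [h5]
      ring
  -- a block
  obtain ⟨a, c, d, hac, had, hcd⟩ : ∃ a c d : Fin n, a ≠ c ∧ a ≠ d ∧ c ≠ d :=
    ⟨⟨0, by omega⟩, ⟨1, by omega⟩, ⟨2, by omega⟩, by simp, by simp, by simp⟩
  obtain ⟨b, hbd, hbc, hba, hb⟩ : ∃ b, b ≠ d ∧ b ≠ c ∧ b ≠ a ∧
      signSq Γ i₀ (P a b) (P c d) = -4 := by
    by_contra hno
    push Not at hno
    have h2 := H.sum_signSq_far hl h h₀ hn hac had hcd
    rw [Finset.sum_eq_zero] at h2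
    · norm_num at h2
    · intro b hb
      simp only [Finset.mem_compl, Finset.mem_insert, Finset.mem_singleton, not_or] at hb
      rcases H.signSq_far_cases hl h h₀ h1 (Ne.symm hb.2.2) hcd hac had hb.2.1 hb.1 with
        ⟨h5, -⟩ | ⟨h5, -⟩
      · exact absurd h5 (hno b hb.1 hb.2.1 hb.2.2)
      · exact h5
  have hside : ∀ {a b}, a ≠ b → a ≠ c → a ≠ d → b ≠ c → b ≠ d →
      signSq Γ i₀ (P a b) (P c d) = -4 → ∀ e, e ≠ a → e ≠ b →
      ∑ z, signMat Γ i₀ (P a e) z * X (twoWayDist Γ z (P c d)) =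
        -4 * signMat Γ i₀ (P a e) (P c d) ∧ X (twoWayDist Γ (P a e) (P c d)) = 0 := by
    intro a b hab hac had hbc hbd hb e hea heb
    by_cases hec : e = c
    · subst hec
      rw [← H.comm a e]
      exact ⟨hSXedge hac.symm hcd had, hXadj (H.adj hac.symm hcd had)⟩
    by_cases hed : e = d
    · subst hed
      rw [← H.comm a e, ← H.comm c e]
      exact ⟨hSXedge had.symm hcd.symm hac, hXadj (H.adj had.symm hcd.symm hac)⟩
    obtain ⟨h5, h6⟩ := H.block_unique hl h h₀ h1 hn hab hcd hac had hbc hbd hb hea heb hec hed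
    rw [hSX22 _ _ h6, H.signMat_far hl hs hea.symm hcd hac had hec hed,
      hXfar hea.symm hcd hac had hec hed, h5]
    norm_num
  have hb' : signSq Γ i₀ (P b a) (P c d) = -4 := by rw [H.comm a b, hb]
  have ha := hside hba.symm hac had hbc hbd hb
  have hbb := hside hba hbc hbd hac had hb'
  -- Every neighbour `{a, e}` or `{b, e}` of `{a, b}` is adjacent to `{c, d}` or at two-way distance
  -- `(2, 2)` from it, since a triple lies in only one block.
  have e1 : ∑ z, signMat Γ i₀ (P a b) z * ∑ w, signMat Γ i₀ z w * X (twoWayDist Γ w (P c d)) =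
      16 := by
    have e2 : ∑ z, signMat Γ i₀ (P a b) z * (-4 * signMat Γ i₀ z (P c d)) = 16 := by
      have : signSq Γ i₀ (P a b) (P c d) * -4 = 16 := by rw [hb]; norm_num
      rw [← this, signSq, Finset.sum_mul]
      refine Finset.sum_congr rfl fun z _ => by ring
    rw [← e2, H.sum_signMat _ hba.symm, H.sum_signMat _ hba.symm]
    refine Finset.sum_congr rfl fun e he => ?_
    simp only [Finset.mem_compl, Finset.mem_insert, Finset.mem_singleton, not_or] at he
    rw [(ha e he.1 he.2).1, (hbb e he.2 he.1).1]
  have e2 : ∑ w, signSq Γ i₀ (P a b) w * X (twoWayDist Γ w (P c d)) = 16 := by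
    rw [← e1]
    unfold signSq
    simp only [Finset.sum_mul, Finset.mul_sum]
    rw [Finset.sum_comm]
    simp only [mul_assoc]
  have e3 : signSq Γ i₀ (P a b) (P a b) * X (twoWayDist Γ (P a b) (P c d)) ≤ 16 := by
    rw [← e2]
    refine Finset.single_le_sum (f := fun w => signSq Γ i₀ (P a b) w * X (twoWayDist Γ w (P c d)))
      (fun w _ => ?_) (Finset.mem_univ _)
    rcases H.classify hba.symm w with rfl | ⟨e, hea, heb, rfl | rfl⟩ |
      ⟨e, f, hef, hea, heb, hfa, hfb, rfl⟩
    · refine mul_nonneg_of_nonpos_of_nonpos ?_ (hXle _ _)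
      rw [H.signSq_self hl hs h₀]
      have h5 : (5 : ℚ) ≤ n := by exact_mod_cast hn
      linarith
    · rw [(ha e hea heb).2, mul_zero]
    · rw [(hbb e heb hea).2, mul_zero]
    · refine mul_nonneg_of_nonpos_of_nonpos ?_ (hXle _ _)
      rw [← hXfar hba.symm hef hea.symm hfa.symm heb.symm hfb.symm]
      exact hXle _ _
  rw [H.signSq_self hl hs h₀, hXfar hba.symm hcd hac had hbc hbd, hb] at e3
  have h5 : (5 : ℚ) ≤ n := by exact_mod_cast hn
  linarith

end PairModel

end Pairs

end WDRD

namespace WDRD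

/-! ### From `J(n, 2)` to the pair model -/

section Pairs

variable {V : Type*} [Fintype V] {n : ℕ} {Γ : Digraph V} {i₀ : ℕ × ℕ}

theorem erase_pair_left {a b : Fin n} (h : a ≠ b) : ({a, b} : Finset (Fin n)).erase a = {b} :=
  Finset.erase_insert (by simpa using h)

theorem erase_pair_right {a b : Fin n} (h : a ≠ b) : ({a, b} : Finset (Fin n)).erase b = {a} := by
  rw [Finset.pair_comm, erase_pair_left h.symm]

theorem Cover.pairModel (hl : Loopless Γ) (h : IsCommutativeWeaklyDistanceRegular Γ) {d : ℕ}
    {π : Finset (Fin n) → V} (hc : Cover Γ.toSimpleGraphInclusive n 2 d π) (hd : 3 ≤ d)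
    (hinj : ∀ x y, x.card = 2 → y.card = 2 → π x = π y → x = y) (hn : 5 ≤ n)
    (hi : HasLabel 2 (fun x y => twoWayDist Γ (π x) (π y)) i₀) :
    PairModel Γ i₀ (fun a b => π {a, b}) := by
  have hs := h.stronglyConnected
  have hL := hc.labelling hl h (by omega)
  have hQ := hc.hasQuad hl h hd
  have hz := hL.zeroLines hQ (by norm_num) (by omega) (φ := arcSign i₀) (Or.inr rfl)
    (fun i => by rw [arcSign_swap]; ring) (hL.total_skew _ (arcSign_swap i₀))
  refine ⟨?_, ?_, ?_, ?_, ?_, ?_, ?_, ?_⟩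
  · intro a b
    rw [Finset.pair_comm]
  · intro v
    obtain ⟨x, hx, rfl⟩ := hc.surj v
    obtain ⟨a, b, hab, rfl⟩ := Finset.card_eq_two.mp hx
    exact ⟨a, b, hab, rfl⟩
  · intro a b c hab hac hbc
    have := hc.adj_insert (u := {a}) (q := b) (p := c) (by simp) (by simpa using hab.symm)
      (by simpa using hac.symm) hbc
    rwa [Finset.pair_comm b a, Finset.pair_comm c a] at this
  · intro a b c d' hab hcd hac had hbc hbd
    have hdis : ({a, b} : Finset (Fin n)) ∩ {c, d'} = ∅ := by
      ext z
      simp only [Finset.mem_inter, Finset.mem_insert, Finset.mem_singleton, Finset.notMem_empty,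
        iff_false, not_and, not_or]
      rintro (rfl | rfl)
      · exact ⟨hac, had⟩
      · exact ⟨hbc, hbd⟩
    refine ⟨fun h' => ?_, fun h' => ?_⟩
    · have := hinj _ _ (Finset.card_pair hab) (Finset.card_pair hcd) h'
      rw [this, Finset.inter_self] at hdis
      simp at hdis
    · have := hc.near _ _ (Finset.card_pair hab) (Finset.card_pair hcd) (by omega) h'
      rw [hdis] at this
      simp at this
  · intro φ f q r hqr
    rw [hc.sum_nbr hl hs φ f (Finset.card_pair hqr)]
    unfold nbrSum
    rw [Finset.sum_comm]
    refine Finset.sum_congr rfl fun b _ => ?_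
    rw [Finset.sum_pair hqr, erase_pair_left hqr, erase_pair_right hqr, add_comm,
      Finset.pair_comm b, Finset.pair_comm b]
  · intro a b c hab hac hbc
    have := hL.arcSupp_eq_one hQ (by norm_num) (by omega) hi (x := {a, b}) (a := b) (b := c)
      (Finset.card_pair hab) (by simp) (by simp [hac.symm, hbc.symm])
    rwa [erase_pair_right hab, Finset.pair_comm c a] at this
  · intro a b c hab hac hbc
    have := (hz {a, b} (Finset.card_pair hab)).2 c (by simp [hac.symm, hbc.symm])
    simp only [colAt] at this
    rw [Finset.sum_pair hab, erase_pair_left hab, erase_pair_right hab, Finset.pair_comm c,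
      Finset.pair_comm c] at this
    rw [Finset.pair_comm b a]
    linarith
  · intro a b hab
    have := (hz {a, b} (Finset.card_pair hab)).1 b (by simp)
    simp only [rowAt] at this
    rw [erase_pair_right hab] at this
    rw [← this]
    refine Finset.sum_congr rfl fun c _ => ?_
    rw [Finset.pair_comm c]

end Pairs

/-! ### Orientations of the octahedron -/

section Octahedron

/-- An orientation of the octahedron that is invariant under the antipodal map. -/
def octArc (a a' b b' c c' : Bool) : Fin 6 → Fin 6 → Bool :=
  ![![false, a, b, false, a', b'], ![!a, false, c, !a', false, c'],
    ![!b, !c, false, !b', !c', false], ![false, a', b', false, a, b],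
    ![!a', false, c', !a, false, c], ![!b', !c', false, !b, !c, false]]

/-- The skew matrix on the octahedron, invariant under the antipodal map, with given entries. -/
def octSign (α α' β β' γ γ' : ℚ) : Fin 6 → Fin 6 → ℚ :=
  ![![0, α, β, 0, α', β'], ![-α, 0, γ, -α', 0, γ'],
    ![-β, -γ, 0, -β', -γ', 0], ![0, α', β', 0, α, β],
    ![-α', 0, γ', -α, 0, γ], ![-β', -γ', 0, -β, -γ, 0]]

theorem octSign_eq_one (a a' b b' c c' : Bool) (i j : Fin 6) :
    octSign (if a then 1 else -1) (if a' then 1 else -1) (if b then 1 else -1)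
      (if b' then 1 else -1) (if c then 1 else -1) (if c' then 1 else -1) i j = 1 ↔
    octArc a a' b b' c c' i j = true := by
  have h1 : ∀ s : Bool, ((if s then 1 else -1 : ℚ) = 1 ↔ s = true) := by decide
  have h2 : ∀ s : Bool, (-(if s then 1 else -1 : ℚ) = 1 ↔ (!s) = true) := by decide
  fin_cases i <;> fin_cases j <;>
    first | exact h1 _ | exact h2 _ | simp [octSign, octArc]

theorem octSign_sq_add {α α' β β' γ γ' : ℚ} (hβ : β ^ 2 + β' ^ 2 = α ^ 2 + α' ^ 2)
    (hγ : γ ^ 2 + γ' ^ 2 = α ^ 2 + α' ^ 2) {i j : Fin 6} (h1 : j ≠ i) (h2 : j ≠ i + 3) :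
    octSign α α' β β' γ γ' i j ^ 2 + octSign α α' β β' γ γ' i (j + 3) ^ 2 = α ^ 2 + α' ^ 2 := by
  fin_cases i <;> fin_cases j <;>
    first
    | exact absurd rfl h1
    | exact absurd rfl h2
    | (simp [octSign]; done)
    | (simp [octSign]; linarith)

theorem octArc_alternating (a b c : Bool) : ∃ g : Equiv.Perm (Fin 6), ∀ i j,
    octArc a (!a) b (!b) c (!c) (g i) (g j) = true ↔ j - i = 1 ∨ j - i = 2 := by
  -- Swapping antipodes 1, 4 negates `a` and `c`, swapping 2, 5 negates `b` and `c`; both preserve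
  -- the parity of the three signs. They make the signs equal, and the map `i ↦ -i` reverses the
  -- orientation when the parity is wrong.
  refine ⟨(if a = (a ^^ b ^^ c) then 1 else Equiv.swap 1 4) *
    (if b = (a ^^ b ^^ c) then 1 else Equiv.swap 2 5) *
    (if (a ^^ b ^^ c) then 1 else Equiv.swap 1 5 * Equiv.swap 2 4), ?_⟩
  revert a b c
  decide

theorem octArc_cyclic (a : Bool) : ∃ g : Equiv.Perm (Fin 6), ∀ i j,
    octArc a a (!a) (!a) a a (g i) (g j) = true ↔ j - i = 1 ∨ j - i = 4 := by
  refine ⟨if a then 1 else Equiv.swap 1 5 * Equiv.swap 2 4, ?_⟩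
  revert a
  decide

variable {V : Type*} [Fintype V] {Γ : Digraph V}

set_option maxHeartbeats 800000 in
/-- A commutative weakly distance-regular digraph on the octahedron is an antipodal orientation,
with equal in- and out-degrees. -/
theorem exists_octArc (hl : Loopless Γ) (h : IsCommutativeWeaklyDistanceRegular Γ)
    (e : Fin 6 ≃ V)
    (he : ∀ i j, Γ.toSimpleGraphInclusive.Adj (e i) (e j) ↔ j ≠ i ∧ j ≠ i + 3) :
    ∃ a a' b b' c c' : Bool, (∀ i j, Γ.Adj (e i) (e j) ↔ octArc a a' b b' c c' i j = true) ∧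
      ((a' = !a ∧ b' = !b ∧ c' = !c) ∨ (a' = a ∧ b = !a ∧ b' = !a ∧ c = a ∧ c' = a)) := by
  have hw := h.toIsWeaklyDistanceRegular
  have hs := h.stronglyConnected
  set τ : ℕ × ℕ → ℚ := fun i => (if i.1 = 1 then 1 else 0) - if i.2 = 1 then 1 else 0 with hτ
  set T : Fin 6 → Fin 6 → ℚ := fun i j => τ (twoWayDist Γ (e i) (e j)) with hT
  have hτs : ∀ i, τ i.swap = -τ i := fun i => by simp [hτ]
  have hskew : ∀ i j, T j i = -T i j := fun i j => by
    simp only [hT]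
    rw [twoWayDist_swap, hτs]
  have hnadj : ∀ i j, ¬(j ≠ i ∧ j ≠ i + 3) → ¬Γ.Adj (e i) (e j) ∧ ¬Γ.Adj (e j) (e i) := by
    intro i j hij
    have h1 := mt (he i j).mp hij
    rw [← isEdgeLabel_iff hl hs] at h1
    simp only [IsEdgeLabel, twoWayDist, dist_eq_one_iff hl hs, not_or] at h1
    exact h1
  have hTval : ∀ i j, T i j = (if dist Γ (e i) (e j) = 1 then 1 else 0) -
      if dist Γ (e j) (e i) = 1 then 1 else 0 := fun i j => rfl
  have hT0 : ∀ i j, ¬(j ≠ i ∧ j ≠ i + 3) → T i j = 0 := by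
    intro i j hij
    rw [hTval, if_neg (mt (dist_eq_one_iff hl hs).mp (hnadj i j hij).1),
      if_neg (mt (dist_eq_one_iff hl hs).mp (hnadj i j hij).2), sub_zero]
  -- the antipodal relation
  set N : ℕ × ℕ → ℚ := fun i => if IsEdgeLabel i ∨ i = (0, 0) then 0 else 1 with hN
  have hthree : ∀ i : Fin 6, i + 3 ≠ i := by decide
  have hNval : ∀ i j, N (twoWayDist Γ (e i) (e j)) = if j = i + 3 then 1 else 0 := by
    intro i j
    have h1 : twoWayDist Γ (e i) (e j) = (0, 0) ↔ j = i := by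
      rw [twoWayDist, Prod.mk.injEq, dist_eq_zero_iff hs, dist_eq_zero_iff hs,
        e.injective.eq_iff, e.injective.eq_iff]
      exact ⟨fun h => h.2, fun h => ⟨h.symm, h⟩⟩
    simp only [hN, isEdgeLabel_iff hl hs, he, h1]
    by_cases hj : j = i + 3
    · rw [if_pos hj, if_neg]
      rintro (h | h)
      · exact h.2 hj
      · exact hthree i (hj.symm.trans h)
    · rw [if_neg hj, if_pos]
      by_cases hji : j = i
      · exact Or.inr hji
      · exact Or.inl ⟨hji, hj⟩
  have hsumV : ∀ f : V → ℚ, ∑ v, f v = ∑ i, f (e i) := fun f => (Equiv.sum_comp e f).symm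
  have hleft : ∀ i j, ∑ v, N (twoWayDist Γ (e i) v) * τ (twoWayDist Γ v (e j)) = T (i + 3) j := by
    intro i j
    rw [hsumV]
    simp only [hNval, ite_mul, one_mul, zero_mul, Finset.sum_ite_eq',
      Finset.mem_univ, if_true]
    rfl
  have hright : ∀ i j, ∑ v, τ (twoWayDist Γ (e i) v) * N (twoWayDist Γ v (e j)) = T i (j + 3) := by
    intro i j
    rw [hsumV]
    have h1 : ∀ k, j = k + 3 ↔ k = j + 3 := by
      revert j; decide
    simp only [hNval, h1, mul_ite, mul_one, mul_zero, Finset.sum_ite_eq',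
      Finset.mem_univ, if_true]
    rfl
  -- The antipodal relation is a relation of the scheme, and commuting with it makes the signed arcs
  -- invariant under the antipodal map.
  have hanti : ∀ i j, T (i + 3) j = T i (j + 3) := by
    intro i j
    rw [← hleft, ← hright, conv_comm h]
  obtain ⟨g, hg⟩ := exists_conv hw N τ
  -- An edge with `T = 0` has arcs both ways, so its label is symmetric; `T i (j + 3)` is a function
  -- of this label, yet changes sign under reversal.
  have hzero : ∀ i j, j ≠ i → j ≠ i + 3 → T i j = 0 → T i (j + 3) = 0 := by
    intro i j h1 h2 h3
    have h4 := (isEdgeLabel_iff hl hs).mpr ((he i j).mpr ⟨h1, h2⟩)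
    have h5 : twoWayDist Γ (e j) (e i) = twoWayDist Γ (e i) (e j) := by
      rw [hTval] at h3
      simp only [IsEdgeLabel, twoWayDist] at h4
      simp only [twoWayDist]
      rcases h4 with h4 | h4
      · rw [if_pos h4] at h3
        have : dist Γ (e j) (e i) = 1 := by
          by_contra hn
          rw [if_neg hn] at h3
          norm_num at h3
        rw [h4, this]
      · rw [if_pos h4] at h3
        have : dist Γ (e i) (e j) = 1 := by
          by_contra hn
          rw [if_neg hn] at h3
          norm_num at h3
        rw [h4, this]
    have h6 := hg (e i) (e j)
    have h7 := hg (e j) (e i)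
    rw [hleft] at h6 h7
    rw [h5, ← h6, hanti j i, hanti i j, hskew] at h7
    rw [hanti] at h7
    linarith
  have hsign : ∀ i j, T i j = 0 ∨ T i j = 1 ∨ T i j = -1 := by
    intro i j
    rw [hTval]
    split_ifs <;> norm_num
  have hrow : ∀ i, ∑ j, T i j = 0 := fun i => by
    rw [← rowSum_eq_zero hw τ hτs (e i), hsumV]
  obtain ⟨k, hk⟩ := exists_rowSum hw (fun i => τ i ^ 2)
  have hsq : ∀ i, ∑ j, T i j ^ 2 = k := fun i => by
    rw [← hk (e i), hsumV]
  have hdiag : ∀ i, T i i = 0 := fun i => hT0 i i (by simp)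
  have hopp : ∀ i, T i (i + 3) = 0 := fun i => hT0 i (i + 3) (by simp)
  have hanti' : ∀ i j, T (i + 3) (j + 3) = T i j := fun i j => by
    rw [hanti, add_assoc]
    congr 1
    revert j
    decide
  have h31 : T 3 1 = T 0 4 := hanti 0 1
  have h34 : T 3 4 = T 0 1 := hanti' 0 1
  have h32 : T 3 2 = T 0 5 := hanti 0 2
  have h35 : T 3 5 = T 0 2 := hanti' 0 2
  have h42 : T 4 2 = T 1 5 := hanti 1 2
  have h45 : T 4 5 = T 1 2 := hanti' 1 2
  have htab : ∀ i j, T i j = octSign (T 0 1) (T 0 4) (T 0 2) (T 0 5) (T 1 2) (T 1 5) i j := by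
    intro i j
    fin_cases i <;> fin_cases j <;>
      simp only [octSign, Fin.mk_one, Fin.zero_eta, Fin.reduceFinMk, Matrix.cons_val]
    all_goals first
      | exact hdiag _
      | exact hopp _
      | exact hskew _ _
      | assumption
      | (rw [hskew]; congr 1)
  have hrow' : ∀ i, ∑ j, octSign (T 0 1) (T 0 4) (T 0 2) (T 0 5) (T 1 2) (T 1 5) i j = 0 :=
    fun i => (Finset.sum_congr rfl fun j _ => (htab i j).symm).trans (hrow i)
  have hsq' : ∀ i, ∑ j, octSign (T 0 1) (T 0 4) (T 0 2) (T 0 5) (T 1 2) (T 1 5) i j ^ 2 = k :=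
    fun i => (Finset.sum_congr rfl fun j _ => by rw [htab i j]).trans (hsq i)
  have hr0 := hrow' 0
  have hr1 := hrow' 1
  have hr2 := hrow' 2
  have hs0 := hsq' 0
  have hs1 := hsq' 1
  have hs2 := hsq' 2
  simp only [Fin.sum_univ_six, octSign, Matrix.cons_val] at hr0 hr1 hr2 hs0 hs1 hs2
  have hpair : ∀ i j, j ≠ i → j ≠ i + 3 →
      T i j ^ 2 + T i (j + 3) ^ 2 = T 0 1 ^ 2 + T 0 4 ^ 2 := by
    intro i j h1 h2
    rw [htab i j, htab i (j + 3)]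
    exact octSign_sq_add (by linarith) (by linarith) h1 h2
  -- The number of one-way edges from a vertex to an antipodal pair is constant, so one two-way edge
  -- would make all edges two-way.
  have hne : ∀ i j, j ≠ i → j ≠ i + 3 → T i j ≠ 0 := by
    intro i j h1 h2 h0
    have h3 := hpair i j h1 h2
    rw [hzero i j h1 h2 h0, h0] at h3
    have hall : ∀ i j, T i j = 0 := by
      intro i' j'
      by_cases hij : j' ≠ i' ∧ j' ≠ i' + 3
      · have h4 := hpair i' j' hij.1 hij.2
        have h5 : T i' j' ^ 2 = 0 :=
          le_antisymm (by linarith [sq_nonneg (T i' (j' + 3))]) (sq_nonneg _)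
        exact pow_eq_zero_iff two_ne_zero |>.mp h5
      · exact hT0 i' j' hij
    obtain ⟨x, y, hxy, hyx⟩ := exists_nonsymmetric_arc hw
    have h5 := hall (e.symm x) (e.symm y)
    rw [hTval, e.apply_symm_apply, e.apply_symm_apply, if_pos ((dist_eq_one_iff hl hs).mpr hxy),
      if_neg (mt (dist_eq_one_iff hl hs).mp hyx)] at h5
    norm_num at h5
  have hadj : ∀ i j, Γ.Adj (e i) (e j) ↔ T i j = 1 := by
    intro i j
    by_cases hij : j ≠ i ∧ j ≠ i + 3
    · have := hne i j hij.1 hij.2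
      rw [hTval] at this ⊢
      rw [← dist_eq_one_iff hl hs]
      by_cases h1 : dist Γ (e i) (e j) = 1 <;> by_cases h2 : dist Γ (e j) (e i) = 1 <;>
        first | (norm_num [h1, h2] at this; done) | norm_num [h1, h2]
    · rw [hT0 i j hij]
      simp [(hnadj i j hij).1]
  have hbool : ∀ i j, T i j ≠ 0 → ∃ a : Bool, T i j = if a then 1 else -1 := by
    intro i j h0
    rcases hsign i j with h1 | h1 | h1
    · exact absurd h1 h0
    · exact ⟨true, by simp [h1]⟩
    · exact ⟨false, by simp [h1]⟩
  obtain ⟨a, ha⟩ := hbool 0 1 (hne 0 1 (by decide) (by decide))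
  obtain ⟨a', ha'⟩ := hbool 0 4 (hne 0 4 (by decide) (by decide))
  obtain ⟨b, hb⟩ := hbool 0 2 (hne 0 2 (by decide) (by decide))
  obtain ⟨b', hb'⟩ := hbool 0 5 (hne 0 5 (by decide) (by decide))
  obtain ⟨c, hc⟩ := hbool 1 2 (hne 1 2 (by decide) (by decide))
  obtain ⟨c', hc'⟩ := hbool 1 5 (hne 1 5 (by decide) (by decide))
  refine ⟨a, a', b, b', c, c', fun i j => ?_, ?_⟩
  · rw [hadj, htab, ha, ha', hb, hb', hc, hc', octSign_eq_one]
  · have h1 : T 0 1 + T 0 4 = T 1 2 + T 1 5 := by linarith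
    have h2 : T 0 1 + T 0 4 + (T 0 2 + T 0 5) = 0 := by linarith
    rw [ha, ha', hc, hc'] at h1
    rw [ha, ha', hb, hb'] at h2
    clear * - h1 h2
    cases a <;> cases a' <;> cases b <;> cases b' <;> cases c <;> cases c' <;>
      first | (norm_num at h1; done) | (norm_num at h2; done) | simp

end Octahedron

end WDRD

namespace WDRD

section Octahedron

/-- The vertices of `J(4, 2)`, opposite ones differing by `3`. -/
def octPair (i : Fin 6) : {s : Finset (Fin 4) // s.card = 2} :=
  ![⟨{0, 1}, rfl⟩, ⟨{0, 2}, rfl⟩, ⟨{0, 3}, rfl⟩, ⟨{2, 3}, rfl⟩, ⟨{1, 3}, rfl⟩, ⟨{1, 2}, rfl⟩] i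

theorem octPair_bijective : Function.Bijective octPair := by
  refine ⟨?_, ?_⟩
  · unfold Function.Injective
    decide
  · unfold Function.Surjective
    decide

/-- `octPair` as an equivalence. -/
noncomputable def octEquiv : Fin 6 ≃ {s : Finset (Fin 4) // s.card = 2} :=
  Equiv.ofBijective octPair octPair_bijective

theorem octEquiv_adj (i j : Fin 6) :
    (johnsonGraph 4 2).Adj (octEquiv i) (octEquiv j) ↔ j ≠ i ∧ j ≠ i + 3 := by
  change ((octPair i).1 ∩ (octPair j).1).card + 1 = 2 ↔ _
  revert i j
  decide

variable {V : Type*} {Γ : Digraph V}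

theorem digraphIso_cayley (g : Fin 6 ≃ V) (s t : ZMod 6)
    (h : ∀ i j, Γ.Adj (g i) (g j) ↔ j - i = s ∨ j - i = t) :
    DigraphIso Γ (cayleyDigraph ({s, t} : Set (ZMod 6))) := by
  refine ⟨RelIso.symm ⟨g, ?_⟩⟩
  intro i j
  exact h i j

/-- The digraphs with underlying graph `J(4, 2)`. -/
theorem cayley_of_johnson_four_two [Fintype V] (hl : Loopless Γ)
    (h : IsCommutativeWeaklyDistanceRegular Γ)
    (φ : Γ.toSimpleGraphInclusive ≃g johnsonGraph 4 2) :
    DigraphIso Γ (cayleyDigraph ({1, 2} : Set (ZMod 6))) ∨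
      DigraphIso Γ (cayleyDigraph ({1, 4} : Set (ZMod 6))) := by
  obtain ⟨a, a', b, b', c, c', hadj, ⟨rfl, rfl, rfl⟩ | ⟨rfl, rfl, rfl, rfl, rfl⟩⟩ :=
    exists_octArc hl h (octEquiv.trans φ.symm.toEquiv)
      (fun i j => (φ.symm.map_adj_iff).trans (octEquiv_adj i j))
  · obtain ⟨g, hg⟩ := octArc_alternating a b c
    exact Or.inl (digraphIso_cayley (g.trans (octEquiv.trans φ.symm.toEquiv)) 1 2
      fun i j => (hadj _ _).trans (hg i j))
  · obtain ⟨g, hg⟩ := octArc_cyclic _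
    exact Or.inr (digraphIso_cayley (g.trans (octEquiv.trans φ.symm.toEquiv)) 1 4
      fun i j => (hadj _ _).trans (hg i j))

theorem johnson_four_two_of_cayley {s t : ZMod 6}
    (hst : ∀ i j : Fin 6, (i ≠ j ∧ ((j - i = s ∨ j - i = t) ∨ i - j = s ∨ i - j = t)) ↔
      j ≠ i ∧ j ≠ i + 3)
    (h : DigraphIso Γ (cayleyDigraph ({s, t} : Set (ZMod 6)))) :
    HasJohnsonUnderlyingGraph Γ := by
  obtain ⟨r⟩ := h
  refine ⟨4, 2, le_rfl, le_rfl, ⟨⟨r.toEquiv.trans octEquiv, ?_⟩⟩⟩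
  intro x y
  refine (octEquiv_adj (r x) (r y)).trans ((hst (r x) (r y)).symm.trans ?_)
  refine and_congr (r.injective.ne_iff) (or_congr ?_ ?_)
  · exact r.map_rel_iff
  · exact r.map_rel_iff

end Octahedron

/-! ### Exchanges and intersections -/

section Exchange

variable {n e : ℕ}

theorem inter_exchange {x : Finset (Fin n)} {a b : Fin n} (hb : b ∉ x) :
    x ∩ insert b (x.erase a) = x.erase a := by
  rw [Finset.inter_insert_of_notMem hb, Finset.inter_eq_right]
  exact Finset.erase_subset _ _

theorem card_inter_exchange {x : Finset (Fin n)} {a b : Fin n} (ha : a ∈ x) (hb : b ∉ x) :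
    (x ∩ insert b (x.erase a)).card + 1 = x.card := by
  rw [inter_exchange hb, Finset.card_erase_add_one ha]

theorem exists_exchange {x y : Finset (Fin n)} (hx : x.card = e) (hy : y.card = e)
    (h : (x ∩ y).card + 1 = e) : ∃ a ∈ x, ∃ b ∉ x, insert b (x.erase a) = y := by
  have h1 := Finset.card_sdiff_add_card_inter x y
  have h2 := Finset.card_sdiff_add_card_inter y x
  rw [Finset.inter_comm] at h2
  obtain ⟨a, ha⟩ := Finset.card_eq_one.mp (show (x \ y).card = 1 by omega)
  obtain ⟨b, hb⟩ := Finset.card_eq_one.mp (show (y \ x).card = 1 by omega)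
  have ha' : ∀ z, (z ∈ x ∧ z ∉ y) ↔ z = a := fun z => by
    rw [← Finset.mem_sdiff, ha, Finset.mem_singleton]
  have hb' : ∀ z, (z ∈ y ∧ z ∉ x) ↔ z = b := fun z => by
    rw [← Finset.mem_sdiff, hb, Finset.mem_singleton]
  refine ⟨a, ((ha' a).mpr rfl).1, b, ((hb' b).mpr rfl).2, ?_⟩
  ext z
  rw [Finset.mem_insert, Finset.mem_erase, ne_eq, ← ha', ← hb']
  tauto

theorem exchange_injective {x : Finset (Fin n)} {a b a' b' : Fin n} (ha : a ∈ x) (hb : b ∉ x)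
    (h : insert b (x.erase a) = insert b' (x.erase a')) : a = a' ∧ b = b' := by
  have h1 : b ∈ insert b' (x.erase a') := h ▸ Finset.mem_insert_self _ _
  have h2 : a ∉ insert b (x.erase a) := by
    simp only [Finset.mem_insert, Finset.mem_erase, ne_eq, not_true, false_and, or_false]
    rintro rfl
    exact hb ha
  rw [h] at h2
  simp only [Finset.mem_insert, Finset.mem_erase, not_or, not_and] at h1 h2
  refine ⟨?_, h1.resolve_right fun h => hb h.2⟩
  by_contra hne
  exact h2.2 hne ha

theorem sideSign_compl (p q : Fin n) (x : Finset (Fin n)) :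
    sideSign p q xᶜ = sideSign p q x := by
  simp [sideSign, not_iff_not]

end Exchange

/-! ### Johnson and folded Johnson graphs as local quotients -/

section Covers

variable {V : Type*} {Γ : Digraph V} {n e d : ℕ}

theorem Cover.hasLabel {π : Finset (Fin n) → V} (hc : Cover Γ.toSimpleGraphInclusive n e d π)
    {v w : V} (h : Γ.toSimpleGraphInclusive.Adj v w) :
    HasLabel e (fun x y => twoWayDist Γ (π x) (π y)) (twoWayDist Γ v w) := by
  obtain ⟨x, hx, rfl⟩ := hc.surj v
  obtain ⟨a, ha, b, hb, rfl⟩ := hc.lift x w hx h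
  exact ⟨x, a, b, hx, ha, hb, rfl⟩

theorem exists_nonsymmetric_label (hl : Loopless Γ) (h : IsWeaklyDistanceRegular Γ) :
    ∃ v w, Γ.toSimpleGraphInclusive.Adj v w ∧ (twoWayDist Γ v w).1 = 1 ∧
      (twoWayDist Γ v w).swap ≠ twoWayDist Γ v w := by
  obtain ⟨x, y, hxy, hyx⟩ := exists_nonsymmetric_arc h
  have hs := h.stronglyConnected
  have h1 : dist Γ x y = 1 := (dist_eq_one_iff hl hs).mpr hxy
  have h2 : dist Γ y x ≠ 1 := mt (dist_eq_one_iff hl hs).mp hyx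
  refine ⟨x, y, (isEdgeLabel_iff hl hs).mp (Or.inl h1), h1, fun h3 => h2 ?_⟩
  exact (congrArg Prod.fst h3).trans h1

theorem johnson_cover [Nonempty V] {A : SimpleGraph V} (φ : A ≃g johnsonGraph n e) (d : ℕ) :
    ∃ π : Finset (Fin n) → V, Cover A n e d π ∧
      ∀ x y, x.card = e → y.card = e → π x = π y → x = y := by
  classical
  set π : Finset (Fin n) → V := fun x =>
    if h : x.card = e then φ.symm ⟨x, h⟩ else Classical.arbitrary V with hπ
  have hval : ∀ x (h : x.card = e), π x = φ.symm ⟨x, h⟩ := fun x h => dif_pos h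
  have hinj : ∀ x y, x.card = e → y.card = e → π x = π y → x = y := by
    intro x y hx hy h
    rw [hval x hx, hval y hy] at h
    exact congrArg Subtype.val (φ.symm.injective h)
  have hadj : ∀ x y, x.card = e → y.card = e →
      (A.Adj (π x) (π y) ↔ (x ∩ y).card + 1 = e) := by
    intro x y hx hy
    rw [hval x hx, hval y hy]
    exact φ.symm.map_adj_iff
  have hsurj : ∀ v, ∃ x, x.card = e ∧ π x = v := fun v =>
    ⟨(φ v).1, (φ v).2, by rw [hval _ (φ v).2]; exact φ.symm_apply_apply v⟩
  refine ⟨π, ⟨?_, ?_, ?_, ?_, ?_, hsurj⟩, hinj⟩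
  · intro x a b hx ha hb
    rw [hadj x _ hx ((card_exchange ha hb).trans hx), card_inter_exchange ha hb, hx]
  · intro x v hx h
    obtain ⟨y, hy, rfl⟩ := hsurj v
    obtain ⟨a, ha, b, hb, rfl⟩ := exists_exchange hx hy ((hadj x y hx hy).mp h)
    exact ⟨a, ha, b, hb, rfl⟩
  · intro x a b a' b' hx ha hb ha' hb' h
    exact exchange_injective ha hb (hinj _ _ ((card_exchange ha hb).trans hx)
      ((card_exchange ha' hb').trans hx) h)
  · intro x y hx hy _ h
    exact (hadj x y hx hy).mp h
  · intro p q
    refine ⟨fun v => sideSign p q (φ v).1, fun x hx => ?_⟩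
    beta_reduce
    rw [hval x hx, φ.apply_symm_apply]

theorem card_compl_half {x : Finset (Fin (2 * e))} (hx : x.card = e) : xᶜ.card = e := by
  rw [Finset.card_compl, Fintype.card_fin]
  omega

theorem card_inter_compl {x y : Finset (Fin n)} (hx : x.card = e) :
    (x ∩ yᶜ).card + (x ∩ y).card = e := by
  rw [← Finset.sdiff_eq_inter_compl, Finset.card_sdiff_add_card_inter, hx]

theorem eq_or_eq_compl_of_pair_eq {x y : Finset (Fin n)}
    (h : ({x, xᶜ} : Finset (Finset (Fin n))) = {y, yᶜ}) : x = y ∨ x = yᶜ := by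
  have : x ∈ ({y, yᶜ} : Finset (Finset (Fin n))) := h ▸ Finset.mem_insert_self _ _
  simpa using this

/-- The partition of a `2e`-set given by one of its parts. -/
def halfPartition (x : Finset (Fin (2 * e))) (hx : x.card = e) : HalfPartition e :=
  ⟨{x, xᶜ}, x, hx, rfl⟩

theorem exists_eq_halfPartition (P : HalfPartition e) : ∃ x hx, P = halfPartition x hx := by
  obtain ⟨P, x, hx, rfl⟩ := P
  exact ⟨x, hx, rfl⟩

theorem halfPartition_adj {x y : Finset (Fin (2 * e))} (hx : x.card = e) (hy : y.card = e) :
    (foldedJohnsonGraph e).Adj (halfPartition x hx) (halfPartition y hy) ↔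
      (x ≠ y ∧ x ≠ yᶜ) ∧ ((x ∩ y).card = 1 ∨ (x ∩ y).card + 1 = e) := by
  have hne : halfPartition x hx ≠ halfPartition y hy ↔ x ≠ y ∧ x ≠ yᶜ := by
    rw [← not_or, not_iff_not]
    refine ⟨fun h => eq_or_eq_compl_of_pair_eq (congrArg Subtype.val h), ?_⟩
    rintro (rfl | rfl)
    · rfl
    · refine Subtype.ext ?_
      change ({yᶜ, yᶜᶜ} : Finset (Finset (Fin (2 * e)))) = {y, yᶜ}
      rw [compl_compl, Finset.pair_comm]
  have hx' := card_compl_half hx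
  have hy' := card_compl_half hy
  have h1 := card_inter_compl (y := y) hx
  have h2 := card_inter_compl (y := x) hy
  have h3 := card_inter_compl (y := y) hx'
  have h4 := card_inter_compl (y := x) hy'
  rw [Finset.inter_comm y xᶜ, Finset.inter_comm y x] at h2
  rw [Finset.inter_comm yᶜ xᶜ, Finset.inter_comm yᶜ x] at h4
  refine and_congr hne ⟨?_, ?_⟩
  · rintro ⟨x', hxm, y', hym, h5, -, -, -⟩
    change x' ∈ ({x, xᶜ} : Finset (Finset (Fin (2 * e)))) at hxm
    change y' ∈ ({y, yᶜ} : Finset (Finset (Fin (2 * e)))) at hym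
    simp only [Finset.mem_insert, Finset.mem_singleton] at hxm hym
    rcases hxm with rfl | rfl <;> rcases hym with rfl | rfl <;> omega
  · rintro (h5 | h5)
    · refine ⟨x, Finset.mem_insert_self _ _, y, Finset.mem_insert_self _ _, h5, ?_, ?_, ?_⟩
      · rw [Finset.sdiff_eq_inter_compl]; omega
      · omega
      · rw [Finset.sdiff_eq_inter_compl, Finset.inter_comm]; omega
    · refine ⟨x, Finset.mem_insert_self _ _, yᶜ, by simp [halfPartition], by omega, ?_, ?_, ?_⟩
      · rw [Finset.sdiff_eq_inter_compl, compl_compl]; omega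
      · rw [compl_compl]; omega
      · rw [Finset.sdiff_eq_inter_compl, Finset.inter_comm]; omega

/-- Parts of two distinct partitions meet in between 1 and `e - 1` points, and for `e ≤ 3` only the
two extreme values are possible. -/
theorem foldedJohnsonGraph_eq_top (he : e ≤ 3) : foldedJohnsonGraph e = ⊤ := by
  ext P Q
  rw [SimpleGraph.top_adj]
  refine ⟨fun h => h.ne, fun h => ?_⟩
  obtain ⟨x, hx, rfl⟩ := exists_eq_halfPartition P
  obtain ⟨y, hy, rfl⟩ := exists_eq_halfPartition Q
  have h1 : x ≠ y := by
    rintro rfl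
    exact h rfl
  have h2 : x ≠ yᶜ := by
    rintro rfl
    refine h (Subtype.ext ?_)
    change ({yᶜ, yᶜᶜ} : Finset (Finset (Fin (2 * e)))) = {y, yᶜ}
    rw [compl_compl, Finset.pair_comm]
  rw [halfPartition_adj]
  refine ⟨⟨h1, h2⟩, ?_⟩
  have h3 := card_inter_compl (y := y) hx
  have h4 : (x ∩ y).card ≠ e := fun h4 => h1 (Finset.eq_of_subset_of_card_le
    (Finset.inter_eq_left.mp (Finset.eq_of_subset_of_card_le Finset.inter_subset_left
      (by omega))) (by omega))
  have h5 : (x ∩ yᶜ).card ≠ e := fun h5 => h2 (Finset.eq_of_subset_of_card_le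
    (Finset.inter_eq_left.mp (Finset.eq_of_subset_of_card_le Finset.inter_subset_left
      (by omega))) (by rw [card_compl_half hy]; omega))
  omega

theorem four_le_of_two_le_diam (h : 2 ≤ (foldedJohnsonGraph e).diam) : 4 ≤ e := by
  by_contra he
  have : Nontrivial (HalfPartition e) := SimpleGraph.nontrivial_of_diam_ne_zero
    (G := foldedJohnsonGraph e) (by omega)
  rw [foldedJohnsonGraph_eq_top (by omega), SimpleGraph.diam_top] at h
  omega

/-- Adjacent partitions have parts meeting in `e - 1` points or in 1 point. The second kind is an
adjacency through the complement, which does not occur between sets at distance at most `e - 2` in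
`J(2e, e)`. -/
theorem folded_cover [Nonempty V] {A : SimpleGraph V} (φ : A ≃g foldedJohnsonGraph e)
    (he : 4 ≤ e) (hd : d + 2 ≤ e) :
    ∃ π : Finset (Fin (2 * e)) → V, Cover A (2 * e) e d π ∧ ∀ x, π xᶜ = π x := by
  classical
  set π : Finset (Fin (2 * e)) → V := fun x =>
    if h : x.card = e then φ.symm (halfPartition x h) else Classical.arbitrary V with hπ
  have hval : ∀ x (h : x.card = e), π x = φ.symm (halfPartition x h) := fun x h => dif_pos h
  have hinj : ∀ x y, x.card = e → y.card = e → π x = π y → x = y ∨ x = yᶜ := by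
    intro x y hx hy h
    rw [hval x hx, hval y hy] at h
    exact eq_or_eq_compl_of_pair_eq (congrArg Subtype.val (φ.symm.injective h))
  have hcompl : ∀ x, π xᶜ = π x := by
    intro x
    by_cases hx : x.card = e
    · rw [hval x hx, hval _ (card_compl_half hx)]
      congr 1
      refine Subtype.ext ?_
      change ({xᶜ, xᶜᶜ} : Finset (Finset (Fin (2 * e)))) = {x, xᶜ}
      rw [compl_compl, Finset.pair_comm]
    · have hx' : ¬xᶜ.card = e := fun h => hx (by simpa using card_compl_half h)
      simp only [hπ]
      rw [dif_neg hx, dif_neg hx']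
  have hadj : ∀ x y, x.card = e → y.card = e →
      (A.Adj (π x) (π y) ↔ (x ∩ y).card = 1 ∨ (x ∩ y).card + 1 = e) := by
    intro x y hx hy
    rw [hval x hx, hval y hy, φ.symm.map_adj_iff, halfPartition_adj, and_iff_right_iff_imp]
    intro h
    constructor
    · rintro rfl
      rw [Finset.inter_self] at h
      omega
    · rintro rfl
      rw [Finset.inter_comm, Finset.inter_compl, Finset.card_empty] at h
      omega
  have hsurj : ∀ v, ∃ x, x.card = e ∧ π x = v := fun v => by
    obtain ⟨x, hx, h⟩ := exists_eq_halfPartition (φ v)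
    exact ⟨x, hx, by rw [hval x hx, ← h, φ.symm_apply_apply]⟩
  refine ⟨π, ⟨?_, ?_, ?_, ?_, ?_, hsurj⟩, hcompl⟩
  · intro x a b hx ha hb
    rw [hadj x _ hx ((card_exchange ha hb).trans hx), card_inter_exchange ha hb]
    exact Or.inr hx
  · intro x v hx h
    obtain ⟨y, hy, rfl⟩ := hsurj v
    rcases (hadj x y hx hy).mp h with h | h
    · have h1 := card_inter_compl (y := y) hx
      obtain ⟨a, ha, b, hb, hab⟩ := exists_exchange hx (card_compl_half hy) (by omega)
      exact ⟨a, ha, b, hb, by rw [hab, hcompl]⟩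
    · obtain ⟨a, ha, b, hb, hab⟩ := exists_exchange hx hy h
      exact ⟨a, ha, b, hb, by rw [hab]⟩
  · intro x a b a' b' hx ha hb ha' hb' h
    rcases hinj _ _ ((card_exchange ha hb).trans hx) ((card_exchange ha' hb').trans hx) h
      with h | h
    · exact exchange_injective ha hb h
    · obtain ⟨c, hc⟩ : ((x.erase a).erase a').Nonempty := by
        rw [← Finset.card_pos]
        have h1 := Finset.pred_card_le_card_erase (s := x) (a := a)
        have h2 := Finset.pred_card_le_card_erase (s := x.erase a) (a := a')
        omega
      simp only [Finset.mem_erase] at hc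
      have h1 : c ∈ insert b (x.erase a) := by simp [hc]
      rw [h] at h1
      simp [hc] at h1
  · intro x y hx hy hxy h
    have := (hadj x y hx hy).mp h
    omega
  · intro p q
    choose y hy hy' using fun P : HalfPartition e => exists_eq_halfPartition P
    refine ⟨fun v => sideSign p q (y (φ v)), fun x hx => ?_⟩
    beta_reduce
    rw [hval x hx, φ.apply_symm_apply]
    rcases eq_or_eq_compl_of_pair_eq (congrArg Subtype.val (hy' (halfPartition x hx)))
      with h | h
    · rw [← h]
    · exact (sideSign_compl _ _ _).symm.trans (congrArg (sideSign p q) h.symm)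

end Covers

/-! ### Assembling the cases -/

section Classification

variable {V : Type*} [Fintype V] [Nonempty V] {Γ : Digraph V}

/-- A Johnson graph underlies a commutative weakly distance-regular digraph only if it is the
octahedron. -/
theorem johnson_params (hl : Loopless Γ) (h : IsCommutativeWeaklyDistanceRegular Γ) {n e : ℕ}
    (he : 2 ≤ e) (hn : 2 * e ≤ n) (φ : Γ.toSimpleGraphInclusive ≃g johnsonGraph n e) :
    n = 4 ∧ e = 2 := by
  obtain ⟨π, hc, hinj⟩ := johnson_cover φ 3
  obtain ⟨v, w, hvw, h1, h₀⟩ := exists_nonsymmetric_label hl h.toIsWeaklyDistanceRegular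
  have hi := hc.hasLabel hvw
  have hL := hc.labelling hl h (by norm_num)
  have hQ := hc.hasQuad hl h le_rfl
  by_contra hne
  rcases hn.lt_or_eq with hlt | rfl
  · rcases he.lt_or_eq with he3 | rfl
    · exact hL.false_of_lt hQ he3 hlt hi h₀
    · exact (hc.pairModel hl h le_rfl hinj hlt hi).false_of_five_le hl h h₀ h1 hlt
  · have he3 : 3 ≤ e := by omega
    rcases he3.lt_or_eq with he4 | rfl
    · exact hL.false_of_half_quad hQ rfl he4 hi h₀
    · exact Labelling.false_of_six_three hL hQ hi h₀

/-- A folded Johnson graph of diameter at least two underlies no commutative weakly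
distance-regular digraph. -/
theorem not_hasFoldedJohnsonUnderlyingGraph (hl : Loopless Γ)
    (h : IsCommutativeWeaklyDistanceRegular Γ) : ¬HasFoldedJohnsonUnderlyingGraph Γ := by
  rintro ⟨e, -, hdiam, ⟨φ⟩⟩
  have he := four_le_of_two_le_diam hdiam
  obtain ⟨v, w, hvw, h1, h₀⟩ := exists_nonsymmetric_label hl h.toIsWeaklyDistanceRegular
  -- For `e ≥ 5` folding is invisible up to distance three, so the distance-two identity holds; for
  -- `e = 4` only distance two is faithful.
  rcases he.lt_or_eq with he5 | rfl
  · obtain ⟨π, hc, -⟩ := folded_cover φ he (d := 3) he5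
    exact (hc.labelling hl h (by norm_num)).false_of_half_quad (hc.hasQuad hl h le_rfl) rfl he
      (hc.hasLabel hvw) h₀
  · obtain ⟨π, hc, hcompl⟩ := folded_cover φ he (d := 2) le_rfl
    exact Labelling.false_of_folded_four (hc.labelling hl h le_rfl)
      (fun x y => by rw [hcompl, hcompl]) (hc.hasLabel hvw) h₀

end Classification

end WDRD

theorem theorem1p1 {V : Type*} [Finite V] [Nonempty V] (Γ : Digraph V)
    (hloop : WDRD.Loopless Γ) (hΓ : WDRD.IsCommutativeWeaklyDistanceRegular Γ) :
    ((WDRD.HasJohnsonUnderlyingGraph Γ ∨ WDRD.HasFoldedJohnsonUnderlyingGraph Γ) ↔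
      (WDRD.DigraphIso Γ (WDRD.cayleyDigraph ({1, 2} : Set (ZMod 6))) ∨
        WDRD.DigraphIso Γ (WDRD.cayleyDigraph ({1, 4} : Set (ZMod 6))))) ∧
    ¬ WDRD.HasFoldedJohnsonUnderlyingGraph Γ := by
  have := Fintype.ofFinite V
  have hfold := WDRD.not_hasFoldedJohnsonUnderlyingGraph hloop hΓ
  refine ⟨⟨?_, ?_⟩, hfold⟩
  · rintro (⟨n, e, he, hn, ⟨φ⟩⟩ | h)
    · obtain ⟨rfl, rfl⟩ := WDRD.johnson_params hloop hΓ he hn φ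
      exact WDRD.cayley_of_johnson_four_two hloop hΓ φ
    · exact absurd h hfold
  · rintro (h | h)
    · exact Or.inl (WDRD.johnson_four_two_of_cayley (by decide) h)
    · exact Or.inl (WDRD.johnson_four_two_of_cayley (by decide) h)
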